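/- **Setting.** Let $d\ge1$, $m_0\ge1$, $\beta>0$, $\kappa>0$, $N\in\mathbb N_{\ge1}$, $t_N>0$, $\alpha\in\mathbb R$, and let $\mathcal V\in C^\infty_c(\mathbb R^d;\mathbb R)$ be even, with $\hat{\mathcal V}(k)=\int e^{-ik\cdot x}\mathcal V(x)\,dx$, $M(v)=(\beta/2\pi)^{d/2}e^{-\beta|v|^2/2}$, $d^*k=(2\pi)^{-d}dk$, and $$C^{\mathcal V}_s:=\int_{\mathbb R^d}\langle k\rangle^s|k|^{1-s}\hat{\mathcal V}(k)^2\,dk\in[0,\infty],\qquad \langle k\rangle=(1+|k|^2)^{1/2}.$$ Write $[m]=\{0,\dots,m\}$. For fixed momenta $k_{[m]}=(k_0,\dots,k_m)\in(\mathbb R^d)^{m+1}$ with $\sum_jk_j=0$, let $\langle\cdot,\cdot\rangle_k$, $\|\cdot\|_k$ be the scalar product and norm of $L^2((\mathbb R^d)^{m+1};\mathbb C)$ in the velocities $v_{[m]}$; test functions are elements of $C^\infty_c((\mathbb R^d)^{m+1};\mathbb C)$ and $\nabla^\ell=\nabla^\ell_{v_{[m]}}$ is the full tensor of velocity derivatives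 of order $\ell$. For $0\le j\le m$ let $$(\hat S^{m+1,-}_{j,m+1}g)\big((k_{[m]\setminus\{j\}},k_j-k',k'),v_{[m+1]}\big)=-\tfrac1{\sqrt{m+1}}\sqrt M(v_{m+1})\hat{\mathcal V}(k')\,k'\cdot\nabla_{v_j}g(k_{[m]},v_{[m]}),$$ $$(\hat S^{m,+}_{j,m+1}f)(k_{[m]},v_{[m]})=\sqrt{m+1}\iint\sqrt M(v_{m+1})\hat{\mathcal V}(k')\,k'\cdot\nabla_{v_j}f\big((k_{[m]\setminus\{j\}},k_j-k',k'),v_{[m+1]}\big)\,d^*k'\,dv_{m+1}.$$ The renormalized propagators $W_m$ ($1\le m\le m_0$) and renormalized hat operators $B_m$ ($0\le m\le m_0$) are defined at fixed momenta by $B_{m_0}=0$ and, descending in $m$, $$W_m=\Big(\tfrac{1+i\alpha}{t_N}+i\sum_{l=0}^mk_l\cdot v_l-\tfrac\kappa N\triangle_{v_{[m]}}+\tfrac1NB_m\Big)^{-1},\qquad B_m=\sum_{j=0}^m\hat S^{m,+}_{j,m+1}\,W_{m+1}\,\hat S^{m+1,-}_{j,m+1}\quad(m<m_0).$$ For $\xi\in(\mathbb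 R^d)^{m+1}$ let $(\tau_\xi g)(v)=g(v+\xi)$ and $T_\xi[X]=\tau_\xi X\tau_{-\xi}$. For $\xi\in(\mathbb C^d)^{m+1}$ put $\lambda(\xi)=\frac1{t_N}+\mathrm{Re}\big(i\sum_jk_j\cdot\xi_j\big)$. **Statement.** There are constants $K$ and $C_\ell$ ($\ell\ge0$) depending only on $d,\beta,m_0$ (and $\ell$) such that the following holds whenever $\kappa\ge K\,C_0^{\mathcal V}$, where $C_0^{\mathcal V}=\int|k|\hat{\mathcal V}(k)^2dk$, uniformly in $\mathcal V,\kappa,N,t_N,\alpha$ and the momenta. (0) For $1\le m\le m_0$ the operator $W_m$ is well defined and bounded on $L^2((\mathbb R^d)^{m+1})$. (1) Let $0\le m<m_0$, and put $c_{m,s}=C_s^{\mathcal V}$ if $m\ge1$ and $c_{0,s}=C_0^{\mathcal V}$. For all test functions $g,h$, the distribution $B_mg$ is a smooth function, and for all $\ell\ge0$ (the second and the last bound being for tensor norms and tensor scalar products, the third one for each component of $\nabla^\ell$) $$|\langle h,B_mg\rangle_k|\le C_0\,C_0^{\mathcal V}\|\nabla h\|_k\|\nabla g\|_k,\qquad \|\nabla^\ell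 B_mg\|_k\le C_\ell\sum_{s=0}^{\ell+1}c_{m,s}\langle k_{[m]}\rangle^s\|\nabla^{\ell+2-s}g\|_k,$$ $$|\langle h,\nabla^\ell B_mg\rangle_k|\le C_\ell\|\nabla h\|_k\sum_{s=0}^{\ell}c_{m,s}\langle k_{[m]}\rangle^s\|\nabla^{\ell+1-s}g\|_k,$$ $$\mathrm{Re}\,\langle\nabla^\ell g,\nabla^\ell B_mg\rangle_k\ge-C_\ell\|\nabla^{\ell+1}g\|_k\sum_{s=1}^{\ell}c_{m,s}\langle k_{[m]}\rangle^s\|\nabla^{\ell+1-s}g\|_k .$$ (2) Let $1\le m\le m_0$, $\sum_jk_j=0$, and let $\nu_0,\dots,\nu_m\in\mathbb S^{d-1}$ satisfy $\sum_jk_j\cdot\nu_j>0$. Let $S$ be the set of $\xi\in\prod_{j=0}^m\big(\mathbb R^d-i[0,\tfrac m{m_0}]\nu_j\big)$ with $\lambda(\xi)>0$; it is the full product of strips if $k_j\cdot\nu_j\ge0$ for all $j$. For every test function $g$ and every $v\in(\mathbb R^d)^{m+1}$, the map $\xi\mapsto T_\xi[W_m]g(v)$, defined for real $\xi$ through the continuous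 representative, extends holomorphically to $S$ (i.e. is holomorphic at each point of $S$). For $\xi\in S$ the extension, still denoted by $T_\xi[W_m]g$, is smooth in $v$ and satisfies for all $\ell\ge0$ $$\|T_\xi[W_m]g\|_k\le C_0\,\lambda(\xi)^{-1}\|g\|_k,\qquad \|\nabla^\ell T_\xi[W_m]g\|_k\le C_\ell\sum_{s=0}^\ell\langle k_{[m]}\rangle^s\big(1+\lambda(\xi)^{-s-1}\big)\|\nabla^{\ell-s}g\|_k .$$ -/

import Mathlib

open MeasureTheory Complex
open scoped ContDiff ENNReal NNReal

noncomputable section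

namespace RenormalizedPropagator

/-- The one-particle velocity (or momentum) space `ℝ^d`. -/
abbrev E (d : ℕ) := EuclideanSpace ℝ (Fin d)

/-- `(ℝ^d)^{m+1}`: velocities `v_{[m]}` or momenta `k_{[m]}` of the particles `0, …, m`. -/
abbrev Vel (d m : ℕ) := Fin (m + 1) → E d

/-- `(ℂ^d)^{m+1}`. -/
abbrev CVel (d m : ℕ) := Fin (m + 1) → EuclideanSpace ℂ (Fin d)

/-- The fibre Hilbert space `L²((ℝ^d)^{m+1})` at fixed momenta. -/
abbrev L2 (d m : ℕ) := Lp ℂ 2 (volume : Measure (Vel d m))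

/-- `C_c^∞(ℝ^n; ℂ)` in the velocity variables. -/
def IsTest {d m : ℕ} (φ : Vel d m → ℂ) : Prop :=
  ContDiff ℝ ∞ φ ∧ HasCompactSupport φ

/-- Interaction potentials: real, even, `C_c^∞(ℝ^d)`. -/
def IsPotential {d : ℕ} (V : E d → ℝ) : Prop :=
  ContDiff ℝ ∞ V ∧ HasCompactSupport V ∧ ∀ x, V (-x) = V x

/-- The Fourier transform `∫ e^{-i k·x} V(x) dx`. -/
def fourierV {d : ℕ} (V : E d → ℝ) (k : E d) : ℂ :=
  ∫ x, cexp (-(I * ((inner ℝ k x : ℝ) : ℂ))) * (V x : ℂ)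

/-- `C_s^V = ∫ ⟨k⟩^s |k|^{1-s} V̂(k)² dk`, with values in `[0, ∞]`. In particular
`C_0^V = ∫ |k| V̂(k)² dk`. -/
def normV {d : ℕ} (V : E d → ℝ) (s : ℕ) : ℝ≥0∞ :=
  ∫⁻ k : E d, ENNReal.ofReal
    (Real.sqrt (1 + ‖k‖ ^ 2) ^ s * ‖k‖ ^ (1 - (s : ℝ)) * ‖fourierV V k‖ ^ 2)

/-- The Maxwellian `M(v) = (β/2π)^{d/2} e^{-β|v|²/2}`. -/
def maxwellian {d : ℕ} (β : ℝ) (v : E d) : ℝ :=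
  (β / (2 * Real.pi)) ^ ((d : ℝ) / 2) * Real.exp (-(β / 2) * ‖v‖ ^ 2)

/-- The parameters of the model: inverse temperature, interaction potential, diffusion constant,
particle number, timescale `t_N`, Laplace variable. -/
structure Params (d : ℕ) where
  beta : ℝ
  pot : E d → ℝ
  kappa : ℝ
  N : ℕ
  tN : ℝ
  alpha : ℝ

/-- The coordinate vector of `(ℝ^d)^{m+1}` for the component `i` of the particle `j`. -/
def coordVec {d m : ℕ} (c : Fin (m + 1) × Fin d) : Vel d m :=
  Pi.single c.1 (EuclideanSpace.single c.2 (1 : ℝ))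

/-- The component `∂_{I 0} ⋯ ∂_{I (ℓ-1)} f` of the tensor `∇_{v_{[m]}}^ℓ f`. -/
def partialD {d m ℓ : ℕ} (I : Fin ℓ → Fin (m + 1) × Fin d) (f : Vel d m → ℂ) (v : Vel d m) : ℂ :=
  iteratedFDeriv ℝ ℓ f v (fun a => coordVec (I a))

/-- The first-order derivatives `∂_{v_{j,i}} f`, i.e. `i`-th component of `∇_{v_j} f`. -/
def grad {d m : ℕ} (f : Vel d m → ℂ) (j : Fin (m + 1)) (i : Fin d) (v : Vel d m) : ℂ :=
  fderiv ℝ f v (coordVec (j, i))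

/-- `‖∇_{v_{[m]}}^ℓ f‖_k`: the `L²` norm (in `[0, ∞]`) of the tensor of derivatives of order `ℓ`,
at fixed momenta. -/
def derivNorm {d m : ℕ} (ℓ : ℕ) (f : Vel d m → ℂ) : ℝ≥0∞ :=
  (∑ I : Fin ℓ → Fin (m + 1) × Fin d, eLpNorm (partialD I f) 2 volume ^ 2) ^ (1 / 2 : ℝ)

/-- The pairing `⟨f, g⟩_k = ∫ conj(f) g dv_{[m]}`. -/
def pairing {d m : ℕ} (f g : Vel d m → ℂ) : ℂ :=
  ∫ v, starRingEnd ℂ (f v) * g v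

/-- The bracket `⟨k_{[m]}⟩ = (1 + |k_{[m]}|²)^{1/2}`. -/
def bracket {d m : ℕ} (k : Vel d m) : ℝ :=
  Real.sqrt (1 + ∑ j, ‖k j‖ ^ 2)

/-- `h ∈ H¹`, with weak velocity gradient `D`. -/
def HasWeakGrad {d m : ℕ} (h : Vel d m → ℂ) (D : Fin (m + 1) → Fin d → Vel d m → ℂ) : Prop :=
  MemLp h 2 volume ∧ ∀ j i, MemLp (D j i) 2 volume ∧
    ∀ φ : Vel d m → ℂ, IsTest φ → ∫ v, grad φ j i v * h v = -∫ v, φ v * D j i v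

open Classical in
/-- The class in `L²` of a square-integrable function (and `0` otherwise). -/
def toL2 {d m : ℕ} (f : Vel d m → ℂ) : L2 d m :=
  if hf : MemLp f 2 volume then hf.toLp f else 0

/-- The momenta `(k_0, …, k_j - k', …, k_m, k')` of the particles `0, …, m+1`. -/
def splitMom {d m : ℕ} (k : Vel d m) (j : Fin (m + 1)) (k' : E d) : Vel d (m + 1) :=
  Fin.snoc (α := fun _ => E d) (Function.update k j (k j - k')) k'

/-- The operator `Ŝ^{m+1,-}_{j,m+1}` applied to `g` with `∇_{v_j} g = G`, at fixed `k_{[m]}`: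
the value at momenta `splitMom k j k'` and velocities `w = (v_{[m]}, v_{m+1})`, namely
`-(m+1)^{-1/2} √M(v_{m+1}) V̂(k') k'·∇_{v_j} g(k_{[m]}, v_{[m]})`. -/
def opMinus {d m : ℕ} (p : Params d) (k' : E d) (G : Fin d → Vel d m → ℂ)
    (w : Vel d (m + 1)) : ℂ :=
  -((Real.sqrt (m + 1) : ℝ) : ℂ)⁻¹ * ((Real.sqrt (maxwellian p.beta (w (Fin.last _))) : ℝ) : ℂ) *
    fourierV p.pot k' * ∑ i, (k' i : ℂ) * G i (fun l => w l.castSucc)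

/-- The operator `Ŝ^{m,+}_{j,m+1}`,
`f ↦ (m+1)^{1/2} ∫∫ √M(v_{m+1}) V̂(k') k'·∇_{v_j} f(splitMom k j k', v_{[m+1]}) d^*k' dv_{m+1}`,
with `d^*k' = (2π)^{-d} dk'` and with the derivative `∇_{v_j}` taken in the distributional sense:
the value of this distribution on a test function `φ` (conjugated), for the function `f` given as
the family of its restrictions `f k'` to the momenta `splitMom k j k'`. -/
def opPlus {d m : ℕ} (p : Params d) (j : Fin (m + 1)) (f : E d → Vel d (m + 1) → ℂ)
    (φ : Vel d m → ℂ) : ℂ :=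
  -((Real.sqrt (m + 1) : ℝ) : ℂ) * ((((2 * Real.pi) ^ d : ℝ) : ℂ)⁻¹ *
    ∫ k' : E d, ∫ w : Vel d (m + 1),
      starRingEnd ℂ (∑ i, (k' i : ℂ) * grad φ j i (fun l => w l.castSucc)) *
        (((Real.sqrt (maxwellian p.beta (w (Fin.last _))) : ℝ) : ℂ) *
          fourierV p.pot k' * f k' w))

/-- The hat operator `∑_j Ŝ^{m,+}_{j,m+1} W Ŝ^{m+1,-}_{j,m+1}` at fixed momenta `k`, for a
propagator `W` on `m+2` particles, applied to a function with (weak) velocity gradient `D`, as a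
distribution. -/
def hatOp {d m : ℕ} (p : Params d) (W : Vel d (m + 1) → (L2 d (m + 1) →L[ℂ] L2 d (m + 1)))
    (k : Vel d m) (D : Fin (m + 1) → Fin d → Vel d m → ℂ) (φ : Vel d m → ℂ) : ℂ :=
  ∑ j, opPlus p j (fun k' => W (splitMom k j k') (toL2 (opMinus p k' (D j)))) φ

/-- `h ∈ H¹` solves `((1+iα)/t_N + i ∑ k_l·v_l - (κ/N) Δ_{v_{[m]}} + (1/N) B) h = g` in the sense
of distributions. -/
def SolvesResolventEq {d m : ℕ} (p : Params d) (k : Vel d m)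
    (B : (Fin (m + 1) → Fin d → Vel d m → ℂ) → (Vel d m → ℂ) → ℂ)
    (g h : L2 d m) : Prop :=
  ∃ D : Fin (m + 1) → Fin d → Vel d m → ℂ, HasWeakGrad h D ∧
    ∀ φ : Vel d m → ℂ, IsTest φ →
      (1 + I * (p.alpha : ℂ)) / (p.tN : ℂ) * pairing φ h
        + pairing φ (fun v => I * ((∑ l, inner ℝ (k l) (v l) : ℝ) : ℂ) * h v)
        + (p.kappa : ℂ) / (p.N : ℂ) * ∑ j, ∑ i, pairing (grad φ j i) (D j i)
        + 1 / (p.N : ℂ) * B D φ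
      = pairing φ g

/-- `W` is the bounded inverse on `L²` of
`(1+iα)/t_N + i ∑ k_l·v_l - (κ/N) Δ_{v_{[m]}} + (1/N) B`. -/
def IsResolvent {d m : ℕ} (p : Params d) (k : Vel d m)
    (B : (Fin (m + 1) → Fin d → Vel d m → ℂ) → (Vel d m → ℂ) → ℂ)
    (W : L2 d m →L[ℂ] L2 d m) : Prop :=
  ∀ g : L2 d m, SolvesResolventEq p k B g (W g) ∧
    ∀ h : L2 d m, SolvesResolventEq p k B g h → h = W g

open Classical in
/-- The bounded inverse (and `0` if it does not exist). -/
def resolventOf {d m : ℕ} (p : Params d) (k : Vel d m)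
    (B : (Fin (m + 1) → Fin d → Vel d m → ℂ) → (Vel d m → ℂ) → ℂ) :
    L2 d m →L[ℂ] L2 d m :=
  if hW : ∃ W, IsResolvent p k B W then hW.choose else 0

/-- The iterative renormalization: `renormIter p n m k` is the propagator on `m+1` particles with
momenta `k` when up to `n` further particles can be created. -/
def renormIter {d : ℕ} (p : Params d) :
    (n m : ℕ) → Vel d m → (L2 d m →L[ℂ] L2 d m)
  | 0, _, k => resolventOf p k (fun _ _ => 0)
  | n + 1, m, k => resolventOf p k (hatOp p (renormIter p n (m + 1)) k)

/-- The renormalized propagator on `L²(𝔻̂^{m+1})`, `m ≤ m₀`, at fixed momenta. -/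
def renormProp {d : ℕ} (p : Params d) (m₀ m : ℕ) (k : Vel d m) : L2 d m →L[ℂ] L2 d m :=
  renormIter p (m₀ - m) m k

/-- The renormalized hat operator on `L²(𝔻̂^{m+1})` at fixed momenta, as a distribution: it is built
from the renormalized propagator on `m+2` particles, and it vanishes for `m ≥ m₀`. -/
def renormHat {d : ℕ} (p : Params d) (m₀ m : ℕ) (k : Vel d m)
    (D : Fin (m + 1) → Fin d → Vel d m → ℂ) (φ : Vel d m → ℂ) : ℂ :=
  if m < m₀ then hatOp p (renormProp p m₀ (m + 1)) k D φ else 0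

/-- The translation `(τ_ξ g)(v) = g(v + ξ)`. -/
def tau {d m : ℕ} (ξ : Vel d m) : L2 d m →L[ℂ] L2 d m :=
  (Lp.compMeasurePreservingₗᵢ ℂ (fun v : Vel d m => v + ξ)
    (measurePreserving_add_right volume ξ)).toContinuousLinearMap

/-- The conjugation `T_ξ[X] = τ_ξ X τ_{-ξ}`. -/
def conjT {d m : ℕ} (ξ : Vel d m) (X : L2 d m →L[ℂ] L2 d m) : L2 d m →L[ℂ] L2 d m :=
  tau ξ ∘L X ∘L tau (-ξ)

/-- The inclusion `(ℝ^d)^{m+1} ⊆ (ℂ^d)^{m+1}`. -/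
def toCVel {d m : ℕ} (ξ : Vel d m) : CVel d m :=
  fun j => WithLp.toLp 2 (fun i => ((ξ j i : ℝ) : ℂ))

/-- `1/t_N + Re(i k_{[m]}·ξ_{[m]})`. -/
def rate {d m : ℕ} (tN : ℝ) (k : Vel d m) (ξ : CVel d m) : ℝ :=
  1 / tN + (I * ∑ j, ∑ i, (k j i : ℂ) * ξ j i).re

/-- The product of the strips `ℝ^d - i[0, m/m₀] ν_j`, `0 ≤ j ≤ m`. -/
def strip {d m : ℕ} (m₀ : ℕ) (ν : Vel d m) : Set (CVel d m) :=
  {ξ | ∃ (a : Vel d m) (t : Fin (m + 1) → ℝ),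
    (∀ j, t j ∈ Set.Icc (0 : ℝ) ((m : ℝ) / (m₀ : ℝ))) ∧
    ∀ j i, ξ j i = (a j i : ℂ) - I * (t j : ℂ) * (ν j i : ℂ)}

/-- The part of the strip where the resolvent rate `1/t_N + Re(i k·ξ)` is positive. -/
def admissible {d m : ℕ} (m₀ : ℕ) (tN : ℝ) (k ν : Vel d m) : Set (CVel d m) :=
  {ξ | ξ ∈ strip m₀ ν ∧ 0 < rate tN k ξ}

end RenormalizedPropagator

end

noncomputable section

namespace RenormalizedPropagator

/-! ### Holomorphic functions of several variables -/

section SeveralVariables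

set_option linter.unusedSectionVars false

open Metric Filter Topology

variable {E F : Type} [NormedAddCommGroup E] [NormedSpace ℂ E] [NormedAddCommGroup F]
  [NormedSpace ℂ F]

/-! Conjugation with the translation by ξ turns i k·v into i k·(v+ξ) and shifts the Maxwellian of an
emitted particle; both make sense for complex ξ. The whole recursion is therefore run for families
depending on ξ (`iterFam`), and W_m is the value at ξ = 0. The energy balance bounds the deformed
propagator by λ(ξ)⁻¹, where λ is `rate`.

The crux is the emission of a momentum q by particle j. The velocity of the emitted particle may be
translated by any η, at the price of a shifted Gaussian. For η = ξ_j - i q/|q| (`emit`) the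
propagator with one more particle has rate λ(ξ) + |q| (`rate_emit`), hence norm at most 1/|q|. This
absorbs one of the two factors |q| coming from the two operators q·∇, and the q-integral becomes a
multiple of ∫|q| V̂² = C_0. So B_m = -∇·b∇ with an operator b on gradients of norm at most const·C_0
on the whole domain of deformations (`PropFam.norm_hatFam_le`), and κ ≥ K C_0 leaves half of the
diffusion for coercivity. Each emission enlarges imaginary parts by at most 1, so the domains |Im
ξ_j| < m+1, λ > 0 (`deform`) are compatible with the recursion. At ξ = 0 the shift of the emitted
velocity is immaterial, because a holomorphic function invariant under real translations is constant
(`PropFam.partOp_zero`). This identifies b with the hat operator of the statement and gives Re b ≥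
0.

The multiplication by k·v is unbounded, so propagators are constructed from a weak formulation on
H¹. The energy identity for weak solutions (`IsSol.energy`) is proved by mollification and cut-off;
it gives uniqueness, and by duality existence (`exists_solOp`). Holomorphy in ξ follows from a
resolvent identity. Strong continuity of the adjoints in momenta and deformation
(`tendsto_solOp_adjoint`) is carried through the recursion to make the integrals over q meaningful.

Velocity derivatives are controlled by the covariance X_{ξ+a} = τ_a X_ξ τ_{-a}: it implies [∂_v,
X_ξ] = ∂_ξ X_ξ, so that a derivative either falls on g or becomes a ξ-derivative, which Cauchy's
estimates bound. For the propagator a radius of order λ/(⟨k⟩(1+λ)) yields ⟨k⟩^s (1+λ^{-s-1}). For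
the emission of q, near ξ = 0, a radius of order |q|/(⟨k⟩⟨q⟩) yields ⟨k⟩^s ⟨q⟩^s |q|^{1-s}, which
integrates to C_s. For m = 0 the momentum vanishes, the radius can be fixed, and C_0 suffices.

Pointwise values come from `rep`: the value of a smooth vector at a is a fixed L² functional of one
mixed derivative of its orbit under translations. Holomorphy of operators thus passes to pointwise
values, and joint holomorphy gives analyticity. -/

theorem norm_fderiv_le_of_ball {f : E → F} {x : E} {R M : ℝ} (hR : 0 < R)
    (hf : DifferentiableOn ℂ f (ball x R)) (hM : ∀ y ∈ ball x R, ‖f y‖ ≤ M) :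
    ‖fderiv ℂ f x‖ ≤ 2 * M / R := by
  have hM0 : 0 ≤ M := (norm_nonneg _).trans (hM x (mem_ball_self hR))
  refine ContinuousLinearMap.opNorm_le_bound _ (by positivity) fun v => ?_
  rcases eq_or_ne v 0 with rfl | hv
  · simp
  have hv' : 0 < ‖v‖ := norm_pos_iff.2 hv
  -- Half the largest admissible radius on the complex line through x, so that the closed disc still
  -- lies in the ball.
  set r := R / (2 * ‖v‖) with hr
  have hr0 : 0 < r := by positivity
  have hmem : ∀ z : ℂ, ‖z‖ < 2 * r → x + z • v ∈ ball x R := by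
    intro z hz
    rw [mem_ball, dist_eq_norm, add_sub_cancel_left, norm_smul]
    calc ‖z‖ * ‖v‖ < 2 * r * ‖v‖ := by gcongr
      _ = R := by rw [hr]; field_simp
  have hd : ∀ z : ℂ, ‖z‖ < 2 * r → DifferentiableAt ℂ (fun z : ℂ => f (x + z • v)) z := by
    intro z hz
    have h1 := (hf _ (hmem z hz)).differentiableAt (isOpen_ball.mem_nhds (hmem z hz))
    exact h1.comp z (by fun_prop)
  have h1 : ‖deriv (fun z : ℂ => f (x + z • v)) 0‖ ≤ M / r := by
    refine Complex.norm_deriv_le_of_forall_mem_sphere_norm_le hr0 ?_ ?_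
    · refine DifferentiableOn.diffContOnCl fun z hz => (hd z ?_).differentiableWithinAt
      rw [closure_ball _ hr0.ne', mem_closedBall_zero_iff] at hz
      linarith
    · intro z hz
      rw [mem_sphere_zero_iff_norm] at hz
      exact hM _ (hmem z (by linarith))
  have h2 : deriv (fun z : ℂ => f (x + z • v)) 0 = fderiv ℂ f x v := by
    have h3 : HasDerivAt (fun z : ℂ => x + z • v) v 0 := by
      simpa using ((hasDerivAt_id (0 : ℂ)).smul_const v).const_add x
    have h4 : HasFDerivAt f (fderiv ℂ f x) (x + (0 : ℂ) • v) := by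
      simpa using ((hf x (mem_ball_self hR)).differentiableAt
        (isOpen_ball.mem_nhds (mem_ball_self hR))).hasFDerivAt
    exact (h4.comp_hasDerivAt (0 : ℂ) h3).deriv
  rw [← h2]
  refine h1.trans (le_of_eq ?_)
  rw [hr]; field_simp

theorem ball_subset_ball_of_mem {x y : E} {R r : ℝ} (hy : y ∈ ball x (R - r)) :
    ball y r ⊆ ball x R :=
  ball_subset_ball' (by rw [mem_ball] at hy; linarith)

theorem norm_sub_le_of_ball {f : E → F} {x : E} {R M : ℝ} (hR : 0 < R)
    (hf : DifferentiableOn ℂ f (ball x R)) (hM : ∀ y ∈ ball x R, ‖f y‖ ≤ M)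
    {y z : E} (hy : y ∈ ball x (R / 2)) (hz : z ∈ ball x (R / 2)) :
    ‖f z - f y‖ ≤ 4 * M / R * ‖z - y‖ := by
  let _ : NormedSpace ℝ E := NormedSpace.restrictScalars ℝ ℂ E
  have hsub : ∀ w ∈ ball x (R / 2), ball w (R / 2) ⊆ ball x R := fun w hw =>
    ball_subset_ball_of_mem (by rwa [show R - R / 2 = R / 2 by ring])
  refine Convex.norm_image_sub_le_of_norm_fderiv_le (𝕜 := ℂ) (s := ball x (R / 2)) ?_ ?_
    (convex_ball x (R / 2)) hy hz
  · intro w hw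
    have := hsub w hw (mem_ball_self (by positivity))
    exact (hf w this).differentiableAt (isOpen_ball.mem_nhds this)
  · intro w hw
    refine (norm_fderiv_le_of_ball (by positivity) (hf.mono (hsub w hw))
      fun y hy => hM y (hsub w hw hy)).trans (le_of_eq ?_)
    field_simp; ring

/-- The Cauchy estimate is applied to the increment z ↦ f(z + (y - x)) - f(z), which is already of
size 4M/R · ‖y - x‖. This avoids second derivatives. -/
theorem norm_fderiv_sub_le_of_ball {f : E → F} {x : E} {R M : ℝ} (hR : 0 < R)
    (hf : DifferentiableOn ℂ f (ball x R)) (hM : ∀ y ∈ ball x R, ‖f y‖ ≤ M)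
    {y : E} (hy : y ∈ ball x (R / 4)) :
    ‖fderiv ℂ f y - fderiv ℂ f x‖ ≤ 32 * M / R ^ 2 * ‖y - x‖ := by
  have hmem : ∀ z ∈ ball x (R / 4), z + (y - x) ∈ ball x (R / 2) := by
    intro z hz
    rw [mem_ball, dist_eq_norm] at *
    calc ‖z + (y - x) - x‖ = ‖(z - x) + (y - x)‖ := by congr 1; abel
      _ ≤ ‖z - x‖ + ‖y - x‖ := norm_add_le _ _
      _ < R / 2 := by linarith
  have hd : ∀ z ∈ ball x (R / 2), DifferentiableAt ℂ f z := fun z hz =>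
    (hf z (ball_subset_ball (by linarith) hz)).differentiableAt
      (isOpen_ball.mem_nhds (ball_subset_ball (by linarith) hz))
  have hd' : ∀ z ∈ ball x (R / 4), DifferentiableAt ℂ (fun z => f (z + (y - x))) z := fun z hz =>
    (hd _ (hmem z hz)).comp z (by fun_prop)
  have h1 := norm_fderiv_le_of_ball (f := fun z => f (z + (y - x)) - f z) (x := x) (R := R / 4)
    (M := 4 * M / R * ‖y - x‖) (by positivity)
    (fun z hz => ((hd' z hz).sub (hd z
      (ball_subset_ball (by linarith) hz))).differentiableWithinAt)
    (fun z hz => by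
      simpa using norm_sub_le_of_ball hR hf hM (ball_subset_ball (by linarith) hz) (hmem z hz))
  have hx : x ∈ ball x (R / 4) := mem_ball_self (by positivity)
  have h2 : fderiv ℂ (fun z => f (z + (y - x)) - f z) x = fderiv ℂ f y - fderiv ℂ f x := by
    rw [fderiv_fun_sub (hd' x hx) (hd x (ball_subset_ball (by linarith) hx)),
      fderiv_comp_add_right, add_sub_cancel]
  rw [h2] at h1
  refine h1.trans (le_of_eq ?_)
  field_simp; ring

theorem norm_taylor_one_le_of_ball {f : E → F} {x : E} {R M : ℝ} (hR : 0 < R)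
    (hf : DifferentiableOn ℂ f (ball x R)) (hM : ∀ y ∈ ball x R, ‖f y‖ ≤ M)
    {h : E} (hh : ‖h‖ < R / 4) :
    ‖f (x + h) - f x - fderiv ℂ f x h‖ ≤ 32 * M / R ^ 2 * ‖h‖ ^ 2 := by
  let _ : NormedSpace ℝ E := NormedSpace.restrictScalars ℝ ℂ E
  have hM0 : 0 ≤ M := (norm_nonneg _).trans (hM x (mem_ball_self hR))
  have hsub : closedBall x ‖h‖ ⊆ ball x (R / 4) := closedBall_subset_ball hh
  have h1 := Convex.norm_image_sub_le_of_norm_fderiv_le' (𝕜 := ℂ) (s := closedBall x ‖h‖)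
    (f := f) (φ := fderiv ℂ f x) (C := 32 * M / R ^ 2 * ‖h‖) (x := x) (y := x + h)
    (fun w hw => by
      have : w ∈ ball x R := ball_subset_ball (by linarith) (hsub hw)
      exact (hf w this).differentiableAt (isOpen_ball.mem_nhds this))
    (fun w hw => (norm_fderiv_sub_le_of_ball hR hf hM (hsub hw)).trans (by
      rw [mem_closedBall, dist_eq_norm] at hw
      gcongr))
    (convex_closedBall x ‖h‖) (mem_closedBall_self (norm_nonneg _))
    (by simp)
  rw [add_sub_cancel_left] at h1
  exact h1.trans (le_of_eq (by ring))

variable [FiniteDimensional ℂ E]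

theorem aestronglyMeasurable_clm_of_apply {α : Type} [MeasurableSpace α] {μ : Measure α}
    {L : α → E →L[ℂ] F} (h : ∀ v, AEStronglyMeasurable (fun a => L a v) μ) :
    AEStronglyMeasurable L μ := by
  let b := Module.finBasis ℂ E
  have : L = fun a => ∑ i, ((LinearMap.toContinuousLinearMap (b.coord i)).smulRightL ℂ E F) (L a (b i)) := by
    funext a
    ext v
    conv_lhs => rw [← b.sum_repr v, map_sum]
    simp
  rw [this]
  refine Finset.aestronglyMeasurable_fun_sum _ fun i _ => ?_
  exact (ContinuousLinearMap.continuous _).comp_aestronglyMeasurable (h _)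

/-- A directional derivative is a sequential limit of difference quotients along scalars tending to
0, each of which is measurable. -/
theorem aestronglyMeasurable_fderiv_apply {α : Type} [MeasurableSpace α] {μ : Measure α}
    {f : E → α → F} {x : E} {R : ℝ} (hR : 0 < R)
    (hmeas : ∀ y ∈ ball x R, AEStronglyMeasurable (f y) μ)
    (hf : ∀ a, DifferentiableOn ℂ (fun y => f y a) (ball x R)) (v : E) :
    AEStronglyMeasurable (fun a => fderiv ℂ (fun y => f y a) x v) μ := by
  obtain ⟨ε, hε, hεv⟩ : ∃ ε : ℝ, 0 < ε ∧ ε * ‖v‖ < R := by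
    refine ⟨R / (2 * (‖v‖ + 1)), by positivity, ?_⟩
    rw [div_mul_eq_mul_div, div_lt_iff₀ (by positivity)]
    nlinarith [norm_nonneg v]
  let t : ℕ → ℂ := fun n => ((ε / (n + 1) : ℝ) : ℂ)
  have ht0 : ∀ n, t n ≠ 0 := fun n => by
    simp only [t, ne_eq, ofReal_eq_zero]; positivity
  have htl : Tendsto t atTop (𝓝[≠] 0) := by
    refine tendsto_nhdsWithin_iff.2 ⟨?_, Eventually.of_forall ht0⟩
    have h := tendsto_one_div_add_atTop_nhds_zero_nat (𝕜 := ℝ)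
    have h2 : Tendsto (fun n : ℕ => ε / ((n : ℝ) + 1)) atTop (𝓝 0) := by
      simpa [div_eq_mul_inv] using h.const_mul ε
    exact (Complex.continuous_ofReal.tendsto 0).comp h2
  refine aestronglyMeasurable_of_tendsto_ae atTop
    (f := fun n a => (t n)⁻¹ • (f (x + t n • v) a - f x a)) (fun n => ?_) (ae_of_all _ fun a => ?_)
  · refine ((hmeas _ ?_).sub (hmeas _ (mem_ball_self hR))).const_smul _
    rw [mem_ball, dist_eq_norm, add_sub_cancel_left, norm_smul, Complex.norm_real,
      Real.norm_of_nonneg (by positivity)]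
    refine lt_of_le_of_lt ?_ hεv
    gcongr
    exact div_le_self hε.le (by linarith [(Nat.cast_nonneg n : (0 : ℝ) ≤ n)])
  · have h1 : HasFDerivAt (fun y => f y a) (fderiv ℂ (fun y => f y a) x) x :=
      ((hf a x (mem_ball_self hR)).differentiableAt
        (isOpen_ball.mem_nhds (mem_ball_self hR))).hasFDerivAt
    have h2 := (h1.hasLineDerivAt v).tendsto_slope_zero
    exact h2.comp htl

variable [CompleteSpace F]

/-- Cauchy's estimate turns a bound on the integrand into a bound on its derivative on the half
ball, so only the integrand has to be dominated. -/
theorem hasFDerivAt_integral_of_holomorphic {α : Type} [MeasurableSpace α] {μ : Measure α}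
    {f : E → α → F} {x : E} {R : ℝ} (hR : 0 < R)
    (hmeas : ∀ y ∈ ball x R, AEStronglyMeasurable (f y) μ)
    (hf : ∀ a, DifferentiableOn ℂ (fun y => f y a) (ball x R))
    {bound : α → ℝ} (hb : Integrable bound μ) (hM : ∀ y ∈ ball x R, ∀ a, ‖f y a‖ ≤ bound a) :
    Integrable (fun a => fderiv ℂ (fun y => f y a) x) μ ∧
    HasFDerivAt (fun y => ∫ a, f y a ∂μ) (∫ a, fderiv ℂ (fun y => f y a) x ∂μ) x := by
  have hsub : ∀ w ∈ ball x (R / 2), ball w (R / 2) ⊆ ball x R := fun w hw =>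
    ball_subset_ball_of_mem (by rwa [show R - R / 2 = R / 2 by ring])
  have hmem : ball x (R / 2) ∈ 𝓝 x := isOpen_ball.mem_nhds (mem_ball_self (by positivity))
  have hm := aestronglyMeasurable_clm_of_apply
    (aestronglyMeasurable_fderiv_apply hR hmeas hf)
  have hbd : ∀ a, ∀ y ∈ ball x (R / 2), ‖fderiv ℂ (fun y => f y a) y‖ ≤ 4 / R * bound a := by
    intro a y hy
    refine (norm_fderiv_le_of_ball (by positivity) ((hf a).mono (hsub y hy))
      fun z hz => hM z (hsub y hy hz) a).trans (le_of_eq ?_)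
    field_simp; ring
  refine ⟨(hb.const_mul (4 / R)).mono' hm (ae_of_all _ fun a =>
    hbd a x (mem_ball_self (by positivity))), ?_⟩
  let _ : NormedSpace ℝ E := NormedSpace.restrictScalars ℝ ℂ E
  refine hasFDerivAt_integral_of_dominated_of_fderiv_le (𝕜 := ℂ) (bound := fun a => 4 / R * bound a)
    (F' := fun y a => fderiv ℂ (fun y => f y a) y) hmem
    ?_ (hb.mono' (hmeas x (mem_ball_self hR)) (ae_of_all _ fun a => hM x (mem_ball_self hR) a))
    hm (ae_of_all _ fun a y hy => hbd a y hy) (hb.const_mul _) (ae_of_all _ fun a y hy => ?_)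
  · filter_upwards [hmem] with y hy
    exact hmeas y (ball_subset_ball (by linarith) hy)
  · have : y ∈ ball x R := ball_subset_ball (by linarith) hy
    exact ((hf a y this).differentiableAt (isOpen_ball.mem_nhds this)).hasFDerivAt

/-- Cauchy's formula on the complex line in direction v writes the derivative as an average of
values of f over a circle. Such an average may be differentiated under the integral. -/
theorem differentiableAt_fderiv_apply_of_ball {f : E → F} {x : E} {R M : ℝ} (hR : 0 < R)
    (hf : DifferentiableOn ℂ f (ball x R)) (hM : ∀ y ∈ ball x R, ‖f y‖ ≤ M) (v : E) :
    DifferentiableAt ℂ (fun y => fderiv ℂ f y v) x := by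
  obtain ⟨r, hr, hrv⟩ : ∃ r : ℝ, 0 < r ∧ r * ‖v‖ < R / 2 := by
    refine ⟨R / (4 * (‖v‖ + 1)), by positivity, ?_⟩
    rw [div_mul_eq_mul_div, div_lt_iff₀ (by positivity)]
    nlinarith [norm_nonneg v]
  have hmem : ∀ y ∈ ball x (R / 2), ∀ z : ℂ, ‖z‖ ≤ r → y + z • v ∈ ball x R := by
    intro y hy z hz
    rw [mem_ball, dist_eq_norm] at *
    calc ‖y + z • v - x‖ = ‖(y - x) + z • v‖ := by congr 1; abel
      _ ≤ ‖y - x‖ + ‖z‖ * ‖v‖ := by rw [← norm_smul]; exact norm_add_le _ _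
      _ ≤ ‖y - x‖ + r * ‖v‖ := by gcongr
      _ < R := by linarith
  have hdx : ∀ y ∈ ball x R, DifferentiableAt ℂ f y := fun y hy =>
    (hf y hy).differentiableAt (isOpen_ball.mem_nhds hy)
  let c : ℝ → ℂ := fun θ => circleMap 0 r θ
  have hc : ∀ θ, ‖c θ‖ = r := fun θ => by simp [c, abs_of_pos hr]
  have hcont : Continuous c := continuous_circleMap 0 r
  let G : E → ℝ → F := fun y θ => (2 * Real.pi : ℂ)⁻¹ • (c θ)⁻¹ • f (y + c θ • v)
  have hc0 : ∀ θ, c θ ≠ 0 := fun θ => by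
    rw [← norm_pos_iff, hc]; exact hr
  have key : ∀ y ∈ ball x (R / 2), fderiv ℂ f y v = ∫ θ in Set.Ioc 0 (2 * Real.pi), G y θ := by
    intro y hy
    have hd : DifferentiableOn ℂ (fun z : ℂ => f (y + z • v)) (closedBall 0 r) := fun z hz =>
      ((hdx _ (hmem y hy z (by simpa using hz))).comp z (by fun_prop)).differentiableWithinAt
    have h1 := DiffContOnCl.circleIntegral_one_div_sub_center_pow_smul (f := fun z : ℂ => f (y + z • v))
      hr 1 (DifferentiableOn.diffContOnCl (by rwa [closure_ball _ hr.ne']))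
    have h2 : deriv (fun z : ℂ => f (y + z • v)) 0 = fderiv ℂ f y v := by
      have h3 : HasDerivAt (fun z : ℂ => y + z • v) v 0 := by
        simpa using ((hasDerivAt_id (0 : ℂ)).smul_const v).const_add y
      have h4 : HasFDerivAt f (fderiv ℂ f y) (y + (0 : ℂ) • v) := by
        simpa using (hdx y (ball_subset_ball (by linarith) hy)).hasFDerivAt
      exact (h4.comp_hasDerivAt (0 : ℂ) h3).deriv
    rw [iteratedDeriv_one, h2, circleIntegral,
      intervalIntegral.integral_of_le Real.two_pi_pos.le] at h1
    have h5 : fderiv ℂ f y v = (2 * Real.pi * I : ℂ)⁻¹ • ((2 * Real.pi * I / (1).factorial : ℂ) • fderiv ℂ f y v) := by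
      rw [smul_smul, Nat.factorial_one, Nat.cast_one, div_one, inv_mul_cancel₀ (by simp), one_smul]
    rw [h5, ← h1, ← integral_smul]
    congr 1
    funext θ
    simp only [G, deriv_circleMap, smul_smul, sub_zero]
    congr 1
    change _ * (c θ * I * _) = _
    have := hc0 θ
    have hpi : (Real.pi : ℂ) ≠ 0 := by simp [Real.pi_ne_zero]
    change (2 * (Real.pi : ℂ) * I)⁻¹ * (c θ * I * (1 / c θ ^ (1 + 1))) = _
    field_simp [I_ne_zero]
  have hfc : ContinuousOn f (ball x R) := hf.continuousOn
  have h := (hasFDerivAt_integral_of_holomorphic (μ := volume.restrict (Set.Ioc 0 (2 * Real.pi)))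
    (f := G) (x := x) (R := R / 2) (by positivity) (fun y hy => ?_) (fun θ y hy => ?_)
    (bound := fun _ => (2 * Real.pi)⁻¹ * (r⁻¹ * M)) (integrable_const _) (fun y hy θ => ?_)).2
  · refine h.differentiableAt.congr_of_eventuallyEq ?_
    filter_upwards [isOpen_ball.mem_nhds (mem_ball_self (x := x) (half_pos hR))] with y hy
    exact key y hy
  · refine Continuous.aestronglyMeasurable ?_
    refine continuous_const.smul ((hcont.inv₀ hc0).smul ?_)
    exact hfc.comp_continuous (by fun_prop) fun θ => hmem y hy _ (hc θ).le
  · refine DifferentiableAt.differentiableWithinAt ?_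
    refine DifferentiableAt.const_smul (DifferentiableAt.const_smul ?_ _) _
    exact (hdx _ (hmem y hy _ (hc θ).le)).comp y (by fun_prop)
  · simp only [G, norm_smul, norm_inv, hc, norm_mul, Complex.norm_real, Complex.norm_ofNat,
      Real.norm_of_nonneg Real.pi_pos.le]
    gcongr
    exact hM _ (hmem y hy _ (hc θ).le)

theorem exists_ball_bound {f : E → F} {U : Set E} (hU : IsOpen U) (hf : ContinuousOn f U) {x : E}
    (hx : x ∈ U) : ∃ R M : ℝ, 0 < R ∧ ball x R ⊆ U ∧ ∀ y ∈ ball x R, ‖f y‖ ≤ M := by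
  have h1 : ∀ᶠ y in 𝓝 x, ‖f y‖ < ‖f x‖ + 1 :=
    (hf.continuousAt (hU.mem_nhds hx)).norm.eventually (gt_mem_nhds (by linarith))
  obtain ⟨R, hR, h⟩ := Metric.eventually_nhds_iff_ball.1 (h1.and (hU.mem_nhds hx))
  exact ⟨R, _, hR, fun y hy => (h y hy).2, fun y hy => (h y hy).1.le⟩

theorem differentiableOn_fderiv {f : E → F} {U : Set E} (hU : IsOpen U)
    (hf : DifferentiableOn ℂ f U) : DifferentiableOn ℂ (fderiv ℂ f) U := by
  intro x hx
  refine DifferentiableAt.differentiableWithinAt ?_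
  obtain ⟨R, M, hR, hsub, hM⟩ := exists_ball_bound hU hf.continuousOn hx
  have h := differentiableAt_fderiv_apply_of_ball hR (hf.mono hsub) hM
  let b := Module.finBasis ℂ E
  have : fderiv ℂ f = fun y => ∑ i, ((LinearMap.toContinuousLinearMap (b.coord i)).smulRightL ℂ E F)
      (fderiv ℂ f y (b i)) := by
    funext a
    ext v
    conv_lhs => rw [← b.sum_repr v, map_sum]
    simp
  rw [this]
  refine DifferentiableAt.fun_sum fun i _ => ?_
  exact (ContinuousLinearMap.differentiableAt _).comp x (h (b i))

theorem contDiffOn_of_differentiableOn_complex {f : E → F} {U : Set E} (hU : IsOpen U)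
    (hf : DifferentiableOn ℂ f U) (n : ℕ) : ContDiffOn ℂ n f U := by
  induction n generalizing F with
  | zero => exact contDiffOn_zero.2 hf.continuousOn
  | succ n ih =>
    have := (contDiffOn_succ_iff_fderiv_of_isOpen (n := (n : WithTop ℕ∞)) hU).2
      ⟨hf, by simp, ih (differentiableOn_fderiv hU hf)⟩
    exact_mod_cast this

/-- Iterated first-order Cauchy estimates with the radius divided evenly among the n derivatives;
each costs 2n/R. -/
theorem norm_iteratedFDeriv_le_of_ball (n : ℕ) {f : E → F} {x : E} {R M : ℝ} (hR : 0 < R)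
    (hf : DifferentiableOn ℂ f (ball x R)) (hM : ∀ y ∈ ball x R, ‖f y‖ ≤ M) :
    ‖iteratedFDeriv ℂ n f x‖ ≤ M * (2 * n / R) ^ n := by
  induction n generalizing F R M with
  | zero => simpa using hM x (mem_ball_self hR)
  | succ n ih =>
    have hM0 : 0 ≤ M := (norm_nonneg _).trans (hM x (mem_ball_self hR))
    rw [← norm_iteratedFDeriv_fderiv]
    have hbd : ∀ r, 0 < r → ∀ y ∈ ball x (R - r), ‖fderiv ℂ f y‖ ≤ 2 * M / r := fun r hr y hy =>
      norm_fderiv_le_of_ball hr (hf.mono (ball_subset_ball_of_mem hy))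
        fun z hz => hM z (ball_subset_ball_of_mem hy hz)
    rcases Nat.eq_zero_or_pos n with rfl | hn
    · have := norm_fderiv_le_of_ball hR hf hM
      simp only [norm_iteratedFDeriv_zero]
      refine this.trans (le_of_eq ?_)
      simp; ring
    have hn' : (0 : ℝ) < n := by exact_mod_cast hn
    have hlt : R / (n + 1) < R := div_lt_self hR (by linarith)
    -- The first derivative uses the fraction 1/(n+1) of the radius and leaves Rn/(n+1) for the
    -- other n. For n = 0 nothing would be left, hence the separate case.
    have h := ih (R := R - R / (n + 1)) (f := fderiv ℂ f) (M := 2 * M / (R / (n + 1))) (by linarith)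
      ((differentiableOn_fderiv isOpen_ball hf).mono (ball_subset_ball (by
        have : 0 < R / ((n : ℝ) + 1) := by positivity
        linarith)))
      (hbd _ (by positivity))
    refine h.trans (le_of_eq ?_)
    have e1 : R - R / ((n : ℝ) + 1) = R * n / (n + 1) := by field_simp; ring
    rw [e1, pow_succ]
    have e2 : 2 * (n : ℝ) / (R * n / (n + 1)) = 2 * ((n + 1 : ℕ) : ℝ) / R := by
      push_cast; field_simp
    rw [e2]
    push_cast
    field_simp

theorem iteratedDeriv_comp_line {f : E → F} {x y : E} {R : ℝ}
    (hf : DifferentiableOn ℂ f (ball x R)) (hR : 0 < R) (n : ℕ) :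
    iteratedDeriv n (fun z : ℂ => f (x + z • y)) 0 = iteratedFDeriv ℂ n f x fun _ => y := by
  let g : ℂ →L[ℂ] E := ContinuousLinearMap.toSpanSingleton ℂ y
  have h0 : DifferentiableOn ℂ (fun w => f (x + w)) (ball 0 R) := by
    intro w hw
    have hw' : x + w ∈ ball x R := by simpa using hw
    exact (((hf _ hw').differentiableAt (isOpen_ball.mem_nhds hw')).comp w
      (by fun_prop)).differentiableWithinAt
  have hpre : IsOpen (g ⁻¹' ball 0 R) := isOpen_ball.preimage g.continuous
  have h := g.iteratedFDerivWithin_comp_right (n := n)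
    (contDiffOn_of_differentiableOn_complex isOpen_ball h0 n)
    isOpen_ball.uniqueDiffOn hpre.uniqueDiffOn (x := 0) (by simpa using hR) (i := n) le_rfl
  rw [iteratedFDerivWithin_of_isOpen n hpre (by simpa using hR),
    iteratedFDerivWithin_of_isOpen n isOpen_ball (by simpa using hR)] at h
  have e : (fun z : ℂ => f (x + z • y)) = (fun w => f (x + w)) ∘ g := by
    funext z; simp [g]
  rw [iteratedDeriv_eq_iteratedFDeriv, e, h, iteratedFDeriv_comp_add_left]
  simp [g]

/-- The estimate (2n/R)^n / n! of the Taylor coefficients makes the series converge on a small ball.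
Its sum is f by the one-variable theorem on the complex line through x and x + y. -/
theorem analyticAt_of_ball {f : E → F} {x : E} {R M : ℝ} (hR : 0 < R)
    (hf : DifferentiableOn ℂ f (ball x R)) (hM : ∀ y ∈ ball x R, ‖f y‖ ≤ M) :
    AnalyticAt ℂ f x := by
  have hM0 : 0 ≤ M := (norm_nonneg _).trans (hM x (mem_ball_self hR))
  let p : FormalMultilinearSeries ℂ E F := fun n =>
    ((n.factorial : ℂ)⁻¹) • iteratedFDeriv ℂ n f x
  -- With this radius the n-th term is at most M (n^n/n!) 4^{-n}, and n^n/n! ≤ e^n ≤ 4^n.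
  let r : ℝ≥0 := ⟨R / 8, by positivity⟩
  refine ⟨p, r, ⟨p.le_radius_of_bound M fun n => ?_, ?_, fun {y} hy => ?_⟩⟩
  · have h1 := norm_iteratedFDeriv_le_of_ball n hR hf hM
    have h2 := Real.pow_div_factorial_le_exp n (Nat.cast_nonneg n) n
    have h3 : Real.exp n ≤ 4 ^ n := by
      rw [← Real.exp_one_pow]
      gcongr
      linarith [Real.exp_one_lt_d9]
    simp only [p, norm_smul, norm_inv, Complex.norm_natCast]
    change _ * (R / 8) ^ n ≤ M
    calc ((n.factorial : ℝ)⁻¹ * ‖iteratedFDeriv ℂ n f x‖) * (R / 8) ^ n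
        ≤ ((n.factorial : ℝ)⁻¹ * (M * (2 * n / R) ^ n)) * (R / 8) ^ n := by gcongr
      _ = M * ((n : ℝ) ^ n / n.factorial) * ((2 / R) ^ n * (R / 8) ^ n) := by
        rw [mul_div_right_comm 2 (n : ℝ) R, mul_pow]; ring
      _ = M * ((n : ℝ) ^ n / n.factorial) * (1 / 4) ^ n := by
        rw [← mul_pow]; congr 2; field_simp; norm_num
      _ ≤ M * 4 ^ n * (1 / 4) ^ n := by gcongr; exact h2.trans h3
      _ = M := by rw [mul_assoc, ← mul_pow]; norm_num
  · exact ENNReal.coe_pos.2 (by change (0 : ℝ) < R / 8; positivity)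
  · have hy' : ‖y‖ < R / 8 := by
      rw [Metric.eball_coe, mem_ball_zero_iff] at hy
      exact hy
    have hd : DifferentiableOn ℂ (fun z : ℂ => f (x + z • y)) (ball 0 2) := by
      intro z hz
      rw [mem_ball_zero_iff] at hz
      have : x + z • y ∈ ball x R := by
        rw [mem_ball, dist_eq_norm, add_sub_cancel_left, norm_smul]
        nlinarith [norm_nonneg y, norm_nonneg z]
      exact (((hf _ this).differentiableAt (isOpen_ball.mem_nhds this)).comp z
        (by fun_prop)).differentiableWithinAt
    have h := Complex.hasSum_taylorSeries_on_ball hd (z := 1) (by simp)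
    simpa [iteratedDeriv_comp_line hf hR, p] using h

/-- A holomorphic function of several variables is analytic. -/
theorem analyticOnNhd_of_differentiableOn_complex {f : E → F} {U : Set E} (hU : IsOpen U)
    (hf : DifferentiableOn ℂ f U) : AnalyticOnNhd ℂ f U := by
  intro x hx
  obtain ⟨R, M, hR, hsub, hM⟩ := exists_ball_bound hU hf.continuousOn hx
  exact analyticAt_of_ball hR (hf.mono hsub) hM

/-! ### Weak holomorphy and local boundedness imply holomorphy in operator norm. -/

section Weak

variable {H H' : Type} [NormedAddCommGroup H] [InnerProductSpace ℂ H]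
  [NormedAddCommGroup H'] [InnerProductSpace ℂ H'] [CompleteSpace H']

theorem opNorm_le_of_inner {A : H →L[ℂ] H'} {M : ℝ} (hM : 0 ≤ M)
    (h : ∀ x y, ‖inner ℂ y (A x)‖ ≤ M * ‖x‖ * ‖y‖) : ‖A‖ ≤ M := by
  refine A.opNorm_le_bound hM fun x => ?_
  have h1 := h x (A x)
  rw [inner_self_eq_norm_sq_to_K] at h1
  rcases (norm_nonneg (A x)).eq_or_lt with h0 | h0
  · rw [← h0]; positivity
  · refine le_of_mul_le_mul_right ?_ h0
    simpa [sq] using h1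

/-- A locally bounded weakly holomorphic family of operators is holomorphic in norm. -/
theorem differentiableAt_of_weakly_of_ball {A : E → H →L[ℂ] H'} {x : E} {R M : ℝ} (hR : 0 < R)
    (hw : ∀ f g, DifferentiableOn ℂ (fun z => inner ℂ g (A z f)) (ball x R))
    (hM : ∀ z ∈ ball x R, ‖A z‖ ≤ M) : DifferentiableAt ℂ A x := by
  have hM0 : 0 ≤ M := (norm_nonneg _).trans (hM x (mem_ball_self hR))
  set C := 32 * M / R ^ 2 with hC
  have hC0 : 0 ≤ C := by positivity
  -- The second-order Taylor error of each matrix element is bounded by the product of the norms of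
  -- the two vectors. This uniformity turns weak estimates into norm estimates.
  have htay : ∀ f g (h : E), ‖h‖ < R / 4 →
      ‖inner ℂ g ((A (x + h) - A x) f) - fderiv ℂ (fun z => inner ℂ g (A z f)) x h‖
        ≤ C * ‖h‖ ^ 2 * ‖f‖ * ‖g‖ := by
    intro f g h hh
    have := norm_taylor_one_le_of_ball (M := M * ‖f‖ * ‖g‖) hR (hw f g) (fun z hz => by
      refine (norm_inner_le_norm _ _).trans ?_
      rw [mul_comm]
      gcongr
      exact ((A z).le_opNorm f).trans (by gcongr; exact hM z hz)) hh
    simp only [sub_apply, inner_sub_right]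
    refine this.trans (le_of_eq ?_)
    rw [hC]; ring
  let t : ℕ → ℂ := fun n => (((n : ℝ) + 1)⁻¹ : ℝ)
  have htn : ∀ n, ‖t n‖ = ((n : ℝ) + 1)⁻¹ := fun n => by
    simp only [t, Complex.norm_real]; exact Real.norm_of_nonneg (by positivity)
  have ht0 : ∀ n, t n ≠ 0 := fun n => by rw [← norm_pos_iff, htn]; positivity
  have htl : Tendsto (fun n : ℕ => ((n : ℝ) + 1)⁻¹) atTop (𝓝 0) := by
    simpa using tendsto_one_div_add_atTop_nhds_zero_nat (𝕜 := ℝ)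
  let S : E → ℕ → H →L[ℂ] H' := fun h n => (t n)⁻¹ • (A (x + t n • h) - A x)
  have hsm : ∀ h : E, ∀ᶠ n in atTop, ‖t n • h‖ < R / 4 := by
    intro h
    have : Tendsto (fun n : ℕ => ((n : ℝ) + 1)⁻¹ * ‖h‖) atTop (𝓝 (0 * ‖h‖)) := htl.mul_const _
    rw [zero_mul] at this
    filter_upwards [this.eventually (gt_mem_nhds (show 0 < R / 4 by positivity))] with n hn
    rwa [norm_smul, htn]
  have hS : ∀ h f g n, ‖t n • h‖ < R / 4 →
      ‖inner ℂ g (S h n f) - fderiv ℂ (fun z => inner ℂ g (A z f)) x h‖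
        ≤ C * ‖h‖ ^ 2 * ((n : ℝ) + 1)⁻¹ * ‖f‖ * ‖g‖ := by
    intro h f g n hn
    have h1 := htay f g _ hn
    have h2 : inner ℂ g (S h n f) - fderiv ℂ (fun z => inner ℂ g (A z f)) x h =
        (t n)⁻¹ * (inner ℂ g ((A (x + t n • h) - A x) f)
          - fderiv ℂ (fun z => inner ℂ g (A z f)) x (t n • h)) := by
      simp only [S, smul_apply, inner_smul_right, map_smul, smul_eq_mul]
      rw [mul_sub, inv_mul_cancel_left₀ (ht0 n)]
    rw [h2, norm_mul, norm_inv, htn, inv_inv]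
    calc ((n : ℝ) + 1) * _ ≤ ((n : ℝ) + 1) * (C * ‖t n • h‖ ^ 2 * ‖f‖ * ‖g‖) := by gcongr
      _ = _ := by
        rw [norm_smul, htn]; field_simp
  -- Two difference quotients approximate the same weak derivative with uniform errors, so they form
  -- a Cauchy sequence in operator norm; the limit represents the weak derivative.
  have hSc : ∀ h, ∃ B : H →L[ℂ] H', Tendsto (S h) atTop (𝓝 B) := by
    intro h
    obtain ⟨N, hN⟩ := eventually_atTop.1 (hsm h)
    have hc : CauchySeq fun n => S h (n + N) := by
      refine cauchySeq_of_le_tendsto_0' (fun n => 2 * (C * ‖h‖ ^ 2 * (((n + N : ℕ) : ℝ) + 1)⁻¹))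
        (fun n k hnk => ?_) ?_
      · rw [dist_eq_norm]
        refine opNorm_le_of_inner (by positivity) fun f g => ?_
        have h1 := hS h f g (n + N) (hN _ (by omega))
        have h2 := hS h f g (k + N) (hN _ (by omega))
        have h3 : (((k + N : ℕ) : ℝ) + 1)⁻¹ ≤ (((n + N : ℕ) : ℝ) + 1)⁻¹ := by gcongr
        have h4 : C * ‖h‖ ^ 2 * (((k + N : ℕ) : ℝ) + 1)⁻¹ * ‖f‖ * ‖g‖ ≤
            C * ‖h‖ ^ 2 * (((n + N : ℕ) : ℝ) + 1)⁻¹ * ‖f‖ * ‖g‖ := by gcongr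
        rw [sub_apply, inner_sub_right]
        calc _ ≤ _ := norm_sub_le_norm_sub_add_norm_sub _
                (fderiv ℂ (fun z => inner ℂ g (A z f)) x h) _
          _ ≤ _ := by rw [norm_sub_rev _ (inner ℂ g (S h (k + N) f))]; linarith
      · have := (tendsto_add_atTop_iff_nat N).2 htl
        simpa using (this.const_mul (C * ‖h‖ ^ 2)).const_mul 2
    obtain ⟨B, hB⟩ := cauchySeq_tendsto_of_complete hc
    exact ⟨B, (tendsto_add_atTop_iff_nat N).1 hB⟩
  choose B hB using hSc
  have hBw : ∀ h f g, inner ℂ g (B h f) = fderiv ℂ (fun z => inner ℂ g (A z f)) x h := by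
    intro h f g
    have h1 : Tendsto (fun n => inner ℂ g (S h n f)) atTop (𝓝 (inner ℂ g (B h f))) := by
      have : Continuous fun T : H →L[ℂ] H' => inner ℂ g (T f) := by fun_prop
      exact (this.tendsto _).comp (hB h)
    refine tendsto_nhds_unique h1 (tendsto_iff_norm_sub_tendsto_zero.2 ?_)
    refine squeeze_zero' (Eventually.of_forall fun _ => norm_nonneg _)
      ((hsm h).mono fun n hn => hS h f g n hn) ?_
    simpa using ((htl.const_mul (C * ‖h‖ ^ 2)).mul_const ‖f‖).mul_const ‖g‖
  let L : E →ₗ[ℂ] (H →L[ℂ] H') :=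
    { toFun := B
      map_add' := fun a b => by
        ext f
        refine ext_inner_left ℂ fun g => ?_
        simp [hBw, inner_add_right]
      map_smul' := fun c a => by
        ext f
        refine ext_inner_left ℂ fun g => ?_
        simp [hBw, inner_smul_right] }
  have hfin : HasFDerivAt A (LinearMap.toContinuousLinearMap L) x := by
    refine HasFDerivAt.of_isLittleO ?_
    have hO : (fun y => A y - A x - LinearMap.toContinuousLinearMap L (y - x)) =O[𝓝 x]
        fun y => ‖y - x‖ ^ 2 := by
      refine Asymptotics.IsBigO.of_bound C ?_
      filter_upwards [ball_mem_nhds x (show 0 < R / 4 by positivity)] with y hy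
      rw [mem_ball, dist_eq_norm] at hy
      rw [Real.norm_of_nonneg (by positivity)]
      refine opNorm_le_of_inner (by positivity) fun f g => ?_
      have := htay f g (y - x) hy
      rw [add_sub_cancel] at this
      rw [sub_apply, inner_sub_right]
      change ‖_ - inner ℂ g (B (y - x) f)‖ ≤ _
      rwa [hBw]
    refine hO.trans_isLittleO ?_
    have : (fun y : E => ‖y - x‖ ^ 2) =o[𝓝 x] fun y => ‖y - x‖ ^ 1 :=
      (Asymptotics.isLittleO_pow_pow (𝕜 := ℝ) one_lt_two).comp_tendsto (by
        have : Continuous fun y : E => ‖y - x‖ := by fun_prop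
        simpa using this.tendsto x)
    simpa using this
  exact hfin.differentiableAt

end Weak

/-! ### Differentiation of holomorphic integrals with respect to parameters. -/

section ParametricIntegrals

variable {α : Type} [MeasurableSpace α]

/-- Families of holomorphic functions with a locally uniform integrable bound. -/
structure DominatedHolomorphic (μ : Measure α) (U : Set E) (f : E → α → F) : Prop where
  meas : ∀ z ∈ U, AEStronglyMeasurable (f z) μ
  hol : ∀ a, DifferentiableOn ℂ (fun z => f z a) U
  dom : ∀ z ∈ U, ∃ R, 0 < R ∧ ball z R ⊆ U ∧ ∃ bound : α → ℝ, Integrable bound μ ∧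
    ∀ w ∈ ball z R, ∀ a, ‖f w a‖ ≤ bound a

variable {μ : Measure α} {U : Set E} {f : E → α → F}

theorem DominatedHolomorphic.hasFDerivAt (hf : DominatedHolomorphic μ U f) {z : E} (hz : z ∈ U) :
    Integrable (fun a => fderiv ℂ (fun y => f y a) z) μ ∧
    HasFDerivAt (fun y => ∫ a, f y a ∂μ) (∫ a, fderiv ℂ (fun y => f y a) z ∂μ) z := by
  obtain ⟨R, hR, hsub, bound, hb, hM⟩ := hf.dom z hz
  exact hasFDerivAt_integral_of_holomorphic hR (fun y hy => hf.meas y (hsub hy))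
    (fun a => (hf.hol a).mono hsub) hb hM

theorem DominatedHolomorphic.fderiv_apply (hU : IsOpen U) (hf : DominatedHolomorphic μ U f)
    (v : E) : DominatedHolomorphic μ U fun z a => fderiv ℂ (fun y => f y a) z v where
  meas z hz := by
    obtain ⟨R, hR, hsub, -⟩ := hf.dom z hz
    exact aestronglyMeasurable_fderiv_apply hR (fun y hy => hf.meas y (hsub hy))
      (fun a => (hf.hol a).mono hsub) v
  hol a := (differentiableOn_fderiv hU (hf.hol a)).clm_apply (differentiableOn_const v)
  dom z hz := by
    obtain ⟨R, hR, hsub, bound, hb, hM⟩ := hf.dom z hz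
    have hs : ∀ w ∈ ball z (R / 2), ball w (R / 2) ⊆ ball z R := fun w hw =>
      ball_subset_ball_of_mem (by rwa [show R - R / 2 = R / 2 by ring])
    refine ⟨R / 2, by positivity, (ball_subset_ball (by linarith)).trans hsub,
      fun a => 2 * bound a / (R / 2) * ‖v‖, ((hb.const_mul 2).div_const _).mul_const _,
      fun w hw a => ?_⟩
    refine (ContinuousLinearMap.le_opNorm _ _).trans
      (mul_le_mul_of_nonneg_right ?_ (norm_nonneg v))
    exact norm_fderiv_le_of_ball (by positivity) ((hf.hol a).mono ((hs w hw).trans hsub))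
      fun y hy => hM y (hs w hw hy) a

theorem DominatedHolomorphic.differentiableOn_integral (hf : DominatedHolomorphic μ U f) :
    DifferentiableOn ℂ (fun y => ∫ a, f y a ∂μ) U := fun _ hz =>
  (hf.hasFDerivAt hz).2.differentiableAt.differentiableWithinAt

theorem iteratedFDeriv_succ_apply_eq {g : E → F} {U : Set E} (hU : IsOpen U)
    (hg : DifferentiableOn ℂ g U) {z : E} (hz : z ∈ U) (n : ℕ) (v : Fin (n + 1) → E) :
    iteratedFDeriv ℂ (n + 1) g z v =
      iteratedFDeriv ℂ n (fun y => fderiv ℂ g y (v (Fin.last n))) z (Fin.init v) := by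
  rw [iteratedFDeriv_succ_apply_right]
  have hc : ContDiffAt ℂ n (fderiv ℂ g) z :=
    (contDiffOn_of_differentiableOn_complex hU (differentiableOn_fderiv hU hg) n).contDiffAt
      (hU.mem_nhds hz)
  have := (ContinuousLinearMap.apply ℂ F (v (Fin.last n))).iteratedFDeriv_comp_left hc le_rfl
  change _ = iteratedFDeriv ℂ n ((ContinuousLinearMap.apply ℂ F (v (Fin.last n))) ∘ fderiv ℂ g) z _
  rw [this]
  rfl

/-- Domination is inherited by directional derivatives (`DominatedHolomorphic.fderiv_apply`), so one
derivative at a time may be moved under the integral. -/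
theorem DominatedHolomorphic.iteratedFDeriv_integral (hU : IsOpen U)
    (hf : DominatedHolomorphic μ U f) {z : E} (hz : z ∈ U) (n : ℕ) (v : Fin n → E) :
    iteratedFDeriv ℂ n (fun y => ∫ a, f y a ∂μ) z v =
      ∫ a, iteratedFDeriv ℂ n (fun y => f y a) z v ∂μ := by
  induction n generalizing f with
  | zero => simp
  | succ n ih =>
    rw [iteratedFDeriv_succ_apply_eq hU hf.differentiableOn_integral hz]
    have h1 : Set.EqOn (fun y => fderiv ℂ (fun y => ∫ a, f y a ∂μ) y (v (Fin.last n)))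
        (fun y => ∫ a, fderiv ℂ (fun y => f y a) y (v (Fin.last n)) ∂μ) U := by
      intro y hy
      have h := hf.hasFDerivAt hy
      simp only [h.2.fderiv]
      exact ContinuousLinearMap.integral_apply h.1 _
    rw [(h1.eventuallyEq_of_mem (hU.mem_nhds hz)).iteratedFDeriv ℂ n |>.eq_of_nhds,
      ih (hf.fderiv_apply hU _)]
    refine integral_congr_ae (ae_of_all _ fun a => ?_)
    exact (iteratedFDeriv_succ_apply_eq hU (hf.hol a) hz n v).symm

end ParametricIntegrals

end SeveralVariables

end RenormalizedPropagator

end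

noncomputable section

namespace RenormalizedPropagator

/-! ### Test functions and translations -/

open Filter Topology

variable {d m : ℕ}

theorem isTest_grad {φ : Vel d m → ℂ} (h : IsTest φ) (j : Fin (m + 1)) (i : Fin d) :
    IsTest (grad φ j i) :=
  ⟨(h.1.fderiv_right (m := ∞) (by simp)).clm_apply contDiff_const, h.2.fderiv_apply ℝ _⟩

theorem IsTest.add {φ ψ : Vel d m → ℂ} (h : IsTest φ) (h' : IsTest ψ) : IsTest (φ + ψ) :=
  ⟨h.1.add h'.1, h.2.add h'.2⟩

theorem IsTest.smul {φ : Vel d m → ℂ} (c : ℂ) (h : IsTest φ) : IsTest (c • φ) :=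
  ⟨h.1.const_smul c, h.2.smul_left (f := fun _ => c)⟩

theorem isTest_zero : IsTest (0 : Vel d m → ℂ) := ⟨contDiff_const, HasCompactSupport.zero⟩

theorem IsTest.mul_left {φ ψ : Vel d m → ℂ} (h : ContDiff ℝ ∞ ψ) (h' : IsTest φ) :
    IsTest fun v => ψ v * φ v :=
  ⟨h.mul h'.1, h'.2.mul_left⟩

theorem IsTest.conj {φ : Vel d m → ℂ} (h : IsTest φ) : IsTest fun v => starRingEnd ℂ (φ v) :=
  ⟨Complex.conjCLE.contDiff.comp h.1, h.2.comp_left (map_zero _)⟩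

theorem IsTest.translate {φ : Vel d m → ℂ} (h : IsTest φ) (a : Vel d m) :
    IsTest fun v => φ (v + a) :=
  ⟨h.1.comp (contDiff_id.add contDiff_const), h.2.comp_homeomorph (Homeomorph.addRight a)⟩

theorem IsTest.memLp {φ : Vel d m → ℂ} (h : IsTest φ) (p : ℝ≥0∞) : MemLp φ p volume :=
  h.1.continuous.memLp_of_hasCompactSupport h.2

theorem grad_translate (φ : Vel d m → ℂ) (a : Vel d m) (j : Fin (m + 1)) (i : Fin d)
    (v : Vel d m) : grad (fun v => φ (v + a)) j i v = grad φ j i (v + a) := by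
  simp only [grad, fderiv_comp_add_right]

theorem grad_conj {φ : Vel d m → ℂ} (h : IsTest φ) (j : Fin (m + 1)) (i : Fin d) (v : Vel d m) :
    grad (fun v => starRingEnd ℂ (φ v)) j i v = starRingEnd ℂ (grad φ j i v) := by
  have h1 : HasFDerivAt φ (fderiv ℝ φ v) v :=
    (h.1.differentiable (by simp)).differentiableAt.hasFDerivAt
  have := (Complex.conjCLE.toContinuousLinearMap.hasFDerivAt (x := φ v)).comp v h1
  change fderiv ℝ (Complex.conjCLE.toContinuousLinearMap ∘ φ) v _ = _
  rw [this.fderiv]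
  rfl

theorem coe_toL2 {f : Vel d m → ℂ} (h : MemLp f 2 volume) : toL2 f =ᵐ[volume] f := by
  rw [toL2, dif_pos h]; exact h.coeFn_toLp

theorem toL2_congr {f g : Vel d m → ℂ} (h : f =ᵐ[volume] g) : toL2 f = toL2 g := by
  by_cases hf : MemLp f 2 volume
  · have hg := hf.ae_eq h
    exact Lp.ext ((coe_toL2 hf).trans (h.trans (coe_toL2 hg).symm))
  · have hg : ¬ MemLp g 2 volume := fun hg => hf (hg.ae_eq h.symm)
    rw [toL2, toL2, dif_neg hf, dif_neg hg]

theorem toL2_coe (f : L2 d m) : toL2 (f : Vel d m → ℂ) = f :=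
  Lp.ext (coe_toL2 (Lp.memLp f))

theorem toL2_add {f g : Vel d m → ℂ} (hf : MemLp f 2 volume) (hg : MemLp g 2 volume) :
    toL2 (f + g) = toL2 f + toL2 g := by
  refine Lp.ext ((coe_toL2 (hf.add hg)).trans ?_)
  filter_upwards [Lp.coeFn_add (toL2 f) (toL2 g), coe_toL2 hf, coe_toL2 hg] with v h1 h2 h3
  rw [h1, Pi.add_apply, Pi.add_apply, h2, h3]

theorem toL2_smul {f : Vel d m → ℂ} (c : ℂ) (hf : MemLp f 2 volume) :
    toL2 (c • f) = c • toL2 f := by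
  refine Lp.ext ((coe_toL2 (hf.const_smul c)).trans ?_)
  filter_upwards [Lp.coeFn_smul c (toL2 f), coe_toL2 hf] with v h1 h2
  rw [h1, Pi.smul_apply, Pi.smul_apply, h2]

theorem toL2_sub {f g : Vel d m → ℂ} (hf : MemLp f 2 volume) (hg : MemLp g 2 volume) :
    toL2 (f - g) = toL2 f - toL2 g := by
  have := toL2_add hf (hg.const_smul (-1 : ℂ))
  rw [toL2_smul _ hg] at this
  simpa [sub_eq_add_neg] using this

theorem toL2_zero : toL2 (0 : Vel d m → ℂ) = 0 := by
  simpa using toL2_smul (0 : ℂ) (MemLp.zero (α := Vel d m) (ε := ℂ) (p := 2))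

theorem enorm_toL2 {f : Vel d m → ℂ} (h : MemLp f 2 volume) :
    ‖toL2 f‖ₑ = eLpNorm f 2 volume := by
  rw [toL2, dif_pos h]; exact Lp.enorm_toLp h

theorem inner_toL2 {f g : Vel d m → ℂ} (hf : MemLp f 2 volume) (hg : MemLp g 2 volume) :
    inner ℂ (toL2 f) (toL2 g) = pairing f g := by
  rw [L2.inner_def, pairing]
  refine integral_congr_ae ?_
  filter_upwards [coe_toL2 hf, coe_toL2 hg] with v h1 h2
  rw [h1, h2, RCLike.inner_apply, mul_comm]

theorem inner_toL2_coe {f : Vel d m → ℂ} (hf : MemLp f 2 volume) (g : L2 d m) :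
    inner ℂ (toL2 f) g = pairing f g := by
  conv_lhs => rw [← toL2_coe g]
  exact inner_toL2 hf (Lp.memLp g)

theorem coe_tau (a : Vel d m) (f : L2 d m) : tau a f =ᵐ[volume] fun v => f (v + a) :=
  Lp.coeFn_compMeasurePreserving f (measurePreserving_add_right volume a)

theorem tau_toL2 (a : Vel d m) {f : Vel d m → ℂ} (hf : MemLp f 2 volume) :
    tau a (toL2 f) = toL2 fun v => f (v + a) := by
  have hmp := measurePreserving_add_right (volume : Measure (Vel d m)) a
  refine Lp.ext ((coe_tau a _).trans ?_)
  have h1 := hmp.quasiMeasurePreserving.ae (coe_toL2 hf)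
  filter_upwards [h1, coe_toL2 (hf.comp_measurePreserving hmp)] with v h2 h3
  rw [h2]; exact h3.symm

theorem tau_tau (a b : Vel d m) (f : L2 d m) : tau a (tau b f) = tau (a + b) f := by
  have h := tau_toL2 b (Lp.memLp f)
  have h2 := tau_toL2 (a + b) (Lp.memLp f)
  rw [toL2_coe] at h h2
  have h3 := tau_toL2 a
    ((Lp.memLp f).comp_measurePreserving (measurePreserving_add_right volume b))
  simp only [Function.comp_def] at h3
  rw [h, h2, h3]
  congr 1
  funext v
  rw [add_assoc]

theorem tau_zero (f : L2 d m) : tau 0 f = f := by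
  refine Lp.ext ((coe_tau 0 f).trans ?_)
  simp

theorem norm_tau (a : Vel d m) (f : L2 d m) : ‖tau a f‖ = ‖f‖ :=
  LinearIsometry.norm_map _ f

theorem inner_tau_tau (a : Vel d m) (f g : L2 d m) : inner ℂ (tau a f) (tau a g) = inner ℂ f g :=
  LinearIsometry.inner_map_map _ f g

theorem inner_tau_left (a : Vel d m) (f g : L2 d m) :
    inner ℂ (tau a f) g = inner ℂ f (tau (-a) g) := by
  rw [← inner_tau_tau a f, tau_tau, add_neg_cancel, tau_zero]

/-- Addition of a constant as a continuous map. -/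
def addConst (a : Vel d m) : C(Vel d m, Vel d m) := ⟨fun v => v + a, by fun_prop⟩

theorem continuous_addConst : Continuous (addConst : Vel d m → C(Vel d m, Vel d m)) := by
  refine ContinuousMap.continuous_of_continuous_uncurry _ ?_
  change Continuous fun x : Vel d m × Vel d m => x.2 + x.1
  fun_prop

theorem measurePreserving_addConst (a : Vel d m) :
    MeasurePreserving (addConst a) (volume : Measure (Vel d m)) volume :=
  measurePreserving_add_right volume a

theorem continuous_addConst_fst : Continuous fun x : Vel d m × L2 d m => addConst x.1 :=
  continuous_addConst.comp continuous_fst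

theorem continuous_compMeasurePreserving_addConst : Continuous fun x : Vel d m × L2 d m =>
    Lp.compMeasurePreserving (addConst x.1) (measurePreserving_addConst x.1) x.2 := by
  have h := Lp.compMeasurePreserving_continuous (p := 2) (volume : Measure (Vel d m))
    (volume : Measure (Vel d m)) ℂ (by simp)
  exact h.comp (f := fun x : Vel d m × L2 d m => (x.2,
    (⟨addConst x.1, measurePreserving_addConst x.1⟩ :
      {g : C(Vel d m, Vel d m) // MeasurePreserving g volume volume})))
    (continuous_snd.prodMk (continuous_addConst_fst.subtype_mk _))

theorem continuous_tau_prod : Continuous fun x : Vel d m × L2 d m => tau x.1 x.2 :=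
  continuous_compMeasurePreserving_addConst

theorem continuous_tau (f : L2 d m) : Continuous fun a => tau a f := by
  have h : Continuous fun a : Vel d m => (a, f) := continuous_id.prodMk continuous_const
  simpa only [Function.comp_def] using continuous_tau_prod.comp h

theorem coordVec_apply (c : Fin (m + 1) × Fin d) (j : Fin (m + 1)) (i : Fin d) :
    (coordVec c : Vel d m) j i = if (j, i) = c then 1 else 0 := by
  obtain ⟨j', i'⟩ := c
  by_cases hj : j = j'
  · subst hj; simp [coordVec, Prod.ext_iff]
  · simp [coordVec, hj, Prod.ext_iff]

theorem sum_coordVec (v : Vel d m) : v = ∑ c : Fin (m + 1) × Fin d, v c.1 c.2 • coordVec c := by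
  funext j
  ext i
  simp [Finset.sum_apply, coordVec_apply]

theorem fderiv_eq_sum_grad (φ : Vel d m → ℂ) (v h : Vel d m) :
    fderiv ℝ φ v h = ∑ c : Fin (m + 1) × Fin d, h c.1 c.2 • grad φ c.1 c.2 v := by
  conv_lhs => rw [sum_coordVec h]
  simp [grad]

theorem norm_toL2_le_of_bounded {f : Vel d m → ℂ} (hf : MemLp f 2 volume) {K : Set (Vel d m)}
    (hs : Function.support f ⊆ K) {C : ℝ} (hC : 0 ≤ C) (hb : ∀ v, ‖f v‖ ≤ C)
    (hK : volume K ≠ ⊤) :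
    ‖toL2 f‖ ≤ (volume K ^ (2⁻¹ : ℝ)).toReal * C := by
  have h1 : ‖toL2 f‖ₑ ≤ volume K ^ (2⁻¹ : ℝ) * ENNReal.ofReal C := by
    rw [enorm_toL2 hf, ← eLpNorm_restrict_eq_of_support_subset hs]
    refine (eLpNorm_le_of_ae_bound (ae_of_all _ hb)).trans (le_of_eq ?_)
    simp
  have h2 : volume K ^ (2⁻¹ : ℝ) * ENNReal.ofReal C ≠ ⊤ :=
    ENNReal.mul_ne_top (by simp [hK]) (by simp)
  have := ENNReal.toReal_mono h2 h1
  rwa [toReal_enorm, ENNReal.toReal_mul, ENNReal.toReal_ofReal hC] at this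

theorem IsTest.toL2_fderiv {φ : Vel d m → ℂ} (h : IsTest φ) (b : Vel d m) :
    MemLp (fun w => fderiv ℝ φ w b) 2 volume ∧ toL2 (fun w => fderiv ℝ φ w b) =
      ∑ c : Fin (m + 1) × Fin d, b c.1 c.2 • toL2 (grad φ c.1 c.2) := by
  classical
  have hmem : ∀ c : Fin (m + 1) × Fin d,
      MemLp (((b c.1 c.2 : ℝ) : ℂ) • grad φ c.1 c.2) 2 volume :=
    fun c => ((isTest_grad h c.1 c.2).memLp 2).const_smul _
  have hsum : ∀ s : Finset (Fin (m + 1) × Fin d),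
      MemLp (∑ c ∈ s, ((b c.1 c.2 : ℝ) : ℂ) • grad φ c.1 c.2) 2 volume ∧
      toL2 (∑ c ∈ s, ((b c.1 c.2 : ℝ) : ℂ) • grad φ c.1 c.2) =
        ∑ c ∈ s, b c.1 c.2 • toL2 (grad φ c.1 c.2) := by
    intro s
    induction s using Finset.induction_on with
    | empty => exact ⟨by simp, by simpa using toL2_zero⟩
    | insert c s hc ih =>
      rw [Finset.sum_insert hc, Finset.sum_insert hc, toL2_add (hmem c) ih.1, ih.2,
        toL2_smul _ ((isTest_grad h c.1 c.2).memLp 2), Complex.coe_smul]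
      exact ⟨(hmem c).add ih.1, rfl⟩
  have he : (fun w => fderiv ℝ φ w b) =
      ∑ c : Fin (m + 1) × Fin d, ((b c.1 c.2 : ℝ) : ℂ) • grad φ c.1 c.2 := by
    funext w
    simp only [fderiv_eq_sum_grad, Finset.sum_apply, Pi.smul_apply, Complex.coe_smul]
  rw [he]
  exact hsum _

/-- The pointwise Taylor error is quadratic because the gradient is Lipschitz, and it is supported
in a fixed compact set; together this gives a quadratic L² bound. -/
theorem IsTest.norm_taylor_le {φ : Vel d m → ℂ} (h : IsTest φ) :
    ∃ C : ℝ, ∀ b : Vel d m, ‖b‖ < 1 →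
      ‖tau b (toL2 φ) - toL2 φ - ∑ c : Fin (m + 1) × Fin d, b c.1 c.2 • toL2 (grad φ c.1 c.2)‖ ≤
        C * ‖b‖ ^ 2 := by
  obtain ⟨C, hC⟩ := (h.1.fderiv_right (m := 1) (by norm_cast)).lipschitzWith_of_hasCompactSupport
    (h.2.fderiv ℝ) one_ne_zero
  -- Since ‖b‖ < 1, the unit thickening contains the supports of both φ and its translate by b.
  set K := Metric.cthickening 1 (tsupport φ) with hK
  have hKc : IsCompact K := IsCompact.cthickening h.2
  have hest : ∀ w b : Vel d m, ‖φ (w + b) - φ w - fderiv ℝ φ w b‖ ≤ C * ‖b‖ ^ 2 := by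
    intro w b
    have h1 := Convex.norm_image_sub_le_of_norm_fderiv_le' (𝕜 := ℝ) (s := Metric.closedBall w ‖b‖)
      (f := φ) (φ := fderiv ℝ φ w) (C := C * ‖b‖) (x := w) (y := w + b)
      (fun x _ => (h.1.differentiable (by simp)).differentiableAt)
      (fun x hx => (hC.norm_sub_le x w).trans (by
        rw [Metric.mem_closedBall, dist_eq_norm] at hx
        gcongr))
      (convex_closedBall _ _) (by simp) (by simp)
    rw [add_sub_cancel_left] at h1
    exact h1.trans (le_of_eq (by ring))
  refine ⟨(volume K ^ (2⁻¹ : ℝ)).toReal * C, fun b hb => ?_⟩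
  have hm0 := (h.translate b).memLp 2
  have hm1 := h.toL2_fderiv b
  rw [← hm1.2, tau_toL2 b (h.memLp 2), ← toL2_sub hm0 (h.memLp 2),
    ← toL2_sub (hm0.sub (h.memLp 2)) hm1.1, mul_assoc]
  refine norm_toL2_le_of_bounded ((hm0.sub (h.memLp 2)).sub hm1.1) ?_ (by positivity)
    (fun w => hest w b) hKc.measure_ne_top
  intro w hw
  by_contra hwK
  apply hw
  have h0 : w ∉ tsupport φ := fun h => hwK (Metric.self_subset_cthickening _ h)
  have h1 : w + b ∉ tsupport φ := fun h => hwK (Metric.mem_cthickening_of_dist_le w _ _ _ h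
    (by rw [dist_eq_norm, sub_add_cancel_left, norm_neg]; exact hb.le))
  have h2 : fderiv ℝ φ w = 0 := by
    have := (notMem_tsupport_iff_eventuallyEq.1 h0).fderiv_eq (𝕜 := ℝ)
    rw [this]; exact fderiv_const_apply 0
  simp [image_eq_zero_of_notMem_tsupport h0, image_eq_zero_of_notMem_tsupport h1, h2]

/-- The differential at `a` of the translates of a test function. -/
def dTau (φ : Vel d m → ℂ) (a : Vel d m) : Vel d m →L[ℝ] L2 d m :=
  ∑ c : Fin (m + 1) × Fin d,
    ContinuousLinearMap.smulRightL ℝ (Vel d m) (L2 d m)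
      ((EuclideanSpace.proj c.2 : E d →L[ℝ] ℝ).comp (ContinuousLinearMap.proj c.1))
      (tau a (toL2 (grad φ c.1 c.2)))

theorem dTau_apply (φ : Vel d m → ℂ) (a b : Vel d m) : dTau φ a b =
    tau a (∑ c : Fin (m + 1) × Fin d, b c.1 c.2 • toL2 (grad φ c.1 c.2)) := by
  rw [dTau, sum_apply, map_sum (tau a)]
  refine Finset.sum_congr rfl fun c _ => ?_
  rw [(tau a).map_smul_of_tower]
  rfl

theorem IsTest.hasFDerivAt_tau {φ : Vel d m → ℂ} (h : IsTest φ) (a : Vel d m) :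
    HasFDerivAt (fun a => tau a (toL2 φ)) (dTau φ a) a := by
  obtain ⟨C, hC⟩ := h.norm_taylor_le
  refine HasFDerivAt.of_isLittleO ?_
  have hO : (fun b => tau b (toL2 φ) - tau a (toL2 φ) - dTau φ a (b - a)) =O[𝓝 a]
      fun b => ‖b - a‖ ^ 2 := by
    refine Asymptotics.IsBigO.of_bound C ?_
    filter_upwards [Metric.ball_mem_nhds a one_pos] with b hb
    rw [Metric.mem_ball, dist_eq_norm] at hb
    rw [Real.norm_of_nonneg (by positivity)]
    -- The group law and the isometry of translations reduce differentiability at a to the Taylor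
    -- bound at 0.
    have h1 : tau b (toL2 φ) = tau a (tau (b - a) (toL2 φ)) := by
      rw [tau_tau, add_sub_cancel]
    rw [h1, dTau_apply, ← map_sub (tau a), ← map_sub (tau a), norm_tau]
    exact hC _ hb
  refine hO.trans_isLittleO ?_
  have : (fun y : Vel d m => ‖y - a‖ ^ 2) =o[𝓝 a] fun y => ‖y - a‖ ^ 1 :=
    (Asymptotics.isLittleO_pow_pow (𝕜 := ℝ) one_lt_two).comp_tendsto (by
      have : Continuous fun y : Vel d m => ‖y - a‖ := by fun_prop
      simpa using this.tendsto a)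
  simpa using this

theorem IsTest.fderiv_tau {φ : Vel d m → ℂ} (h : IsTest φ) (a : Vel d m)
    (c : Fin (m + 1) × Fin d) : fderiv ℝ (fun a => tau a (toL2 φ)) a (coordVec c) =
      tau a (toL2 (grad φ c.1 c.2)) := by
  rw [(h.hasFDerivAt_tau a).fderiv, dTau_apply]
  simp [coordVec_apply, ite_smul]

/-- Test functions are smooth vectors for the translations. -/
theorem IsTest.contDiff_tau {φ : Vel d m → ℂ} (h : IsTest φ) :
    ContDiff ℝ ∞ fun a => tau a (toL2 φ) := by
  refine contDiff_infty.2 fun n => ?_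
  induction n generalizing φ with
  | zero => exact contDiff_zero.2 (continuous_tau _)
  | succ n ih =>
    have := (contDiff_succ_iff_fderiv (𝕜 := ℝ) (n := (n : WithTop ℕ∞))
      (f := fun a => tau a (toL2 φ))).2 ⟨fun a => (h.hasFDerivAt_tau a).differentiableAt, by simp, by
        rw [show fderiv ℝ (fun a => tau a (toL2 φ)) = _ from
          funext fun a => (h.hasFDerivAt_tau a).fderiv]
        unfold dTau
        refine ContDiff.sum fun c _ => ?_
        exact (ContinuousLinearMap.smulRightL ℝ (Vel d m) (L2 d m) _).contDiff.comp
          (ih (isTest_grad h c.1 c.2))⟩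
    exact_mod_cast this

end RenormalizedPropagator

end

noncomputable section

namespace RenormalizedPropagator

/-! ### Pointwise evaluation of smooth vectors -/

open Filter Topology

variable {d m : ℕ}

/-- The differential operator `∏ (1 - ∂_c)`, over a list of directions. -/
def dirOp {V G : Type} [NormedAddCommGroup V] [NormedSpace ℝ V] [NormedAddCommGroup G]
    [NormedSpace ℝ G] : List V → (V → G) → V → G
  | [], Φ => Φ
  | c :: l, Φ => dirOp l fun a => Φ a - fderiv ℝ Φ a c

/-- The transposed differential operator `∏ (1 + ∂_c)`. -/
def dirOpT {V G : Type} [NormedAddCommGroup V] [NormedSpace ℝ V] [NormedAddCommGroup G]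
    [NormedSpace ℝ G] : List V → (V → G) → V → G
  | [], Φ => Φ
  | c :: l, Φ => fun a => dirOpT l Φ a + fderiv ℝ (dirOpT l Φ) a c

/-! ### Products of the first-order operators 1 - ∂_c and their transposes. -/

section DirOp

variable {V G : Type} [NormedAddCommGroup V] [NormedSpace ℝ V] [NormedAddCommGroup G]
  [NormedSpace ℝ G]

theorem contDiff_fderiv_apply {Φ : V → G} (h : ContDiff ℝ ∞ Φ) (c : V) :
    ContDiff ℝ ∞ fun a => fderiv ℝ Φ a c :=
  (h.fderiv_right (m := ∞) (by simp)).clm_apply contDiff_const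

theorem contDiff_dirOp (l : List V) {Φ : V → G} (h : ContDiff ℝ ∞ Φ) :
    ContDiff ℝ ∞ (dirOp l Φ) := by
  induction l generalizing Φ with
  | nil => exact h
  | cons c l ih => exact ih (h.sub (contDiff_fderiv_apply h c))

theorem hasCompactSupport_dirOp (l : List V) {Φ : V → G} (h : HasCompactSupport Φ) :
    HasCompactSupport (dirOp l Φ) := by
  induction l generalizing Φ with
  | nil => exact h
  | cons c l ih => exact ih (h.sub (h.fderiv_apply ℝ c))

theorem contDiff_dirOpT (l : List V) {Φ : V → G} (h : ContDiff ℝ ∞ Φ) :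
    ContDiff ℝ ∞ (dirOpT l Φ) := by
  induction l with
  | nil => exact h
  | cons c l ih => exact ih.add (contDiff_fderiv_apply ih c)

theorem hasCompactSupport_dirOpT (l : List V) {Φ : V → G} (h : HasCompactSupport Φ) :
    HasCompactSupport (dirOpT l Φ) := by
  induction l with
  | nil => exact h
  | cons c l ih => exact ih.add (ih.fderiv_apply ℝ c)

theorem fderiv_fderiv_comm {Φ : V → G} (h : ContDiff ℝ ∞ Φ) (a b c : V) :
    fderiv ℝ (fun x => fderiv ℝ Φ x b) a c = fderiv ℝ (fun x => fderiv ℝ Φ x c) a b := by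
  have hd : DifferentiableAt ℝ (fderiv ℝ Φ) a :=
    ((h.fderiv_right (m := ∞) (by simp)).differentiable (by simp)).differentiableAt
  have h1 : ∀ e e', fderiv ℝ (fun x => fderiv ℝ Φ x e) a e' = fderiv ℝ (fderiv ℝ Φ) a e' e := by
    intro e e'
    rw [fderiv_clm_apply hd (differentiableAt_const e)]
    simp
  rw [h1, h1]
  exact (h.contDiffAt.isSymmSndFDerivAt (by simp; norm_cast)) c b

theorem fderiv_dirOp (l : List V) {Φ : V → G} (h : ContDiff ℝ ∞ Φ) (a c : V) :
    fderiv ℝ (dirOp l Φ) a c = dirOp l (fun x => fderiv ℝ Φ x c) a := by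
  induction l generalizing Φ with
  | nil => rfl
  | cons e l ih =>
    change fderiv ℝ (dirOp l fun a => Φ a - fderiv ℝ Φ a e) a c = _
    rw [ih (h.sub (contDiff_fderiv_apply h e))]
    change _ = dirOp l (fun x => fderiv ℝ Φ x c - fderiv ℝ (fun x => fderiv ℝ Φ x c) x e) a
    congr 1
    funext x
    rw [fderiv_fun_sub (h.differentiable (by simp)).differentiableAt
      ((contDiff_fderiv_apply h e).differentiable (by simp)).differentiableAt]
    rw [sub_apply, fderiv_fderiv_comm h]

theorem dirOp_add_const (l : List V) (Φ : V → G) (a b : V) :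
    dirOp l (fun x => Φ (x + b)) a = dirOp l Φ (a + b) := by
  induction l generalizing Φ with
  | nil => rfl
  | cons e l ih =>
    simp only [dirOp, fderiv_comp_add_right]
    exact ih (fun a => Φ a - fderiv ℝ Φ a e)

theorem dirOp_add (l : List V) {Φ Ψ : V → G} (h : ContDiff ℝ ∞ Φ) (h' : ContDiff ℝ ∞ Ψ) (a : V) :
    dirOp l (fun x => Φ x + Ψ x) a = dirOp l Φ a + dirOp l Ψ a := by
  induction l generalizing Φ Ψ with
  | nil => rfl
  | cons e l ih =>
    simp only [dirOp]
    rw [← ih (h.sub (contDiff_fderiv_apply h e)) (h'.sub (contDiff_fderiv_apply h' e))]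
    congr 1
    funext x
    rw [fderiv_fun_add (h.differentiable (by simp)).differentiableAt
      (h'.differentiable (by simp)).differentiableAt, add_apply]
    abel

variable [FiniteDimensional ℝ V] [MeasurableSpace V] [BorelSpace V] {μ : Measure V}
  [μ.IsAddHaarMeasure]

theorem integral_smul_dirOp (l : List V) {g : V → ℝ} (hg : ContDiff ℝ ∞ g)
    (hgs : HasCompactSupport g) {Φ : V → G} (h : ContDiff ℝ ∞ Φ) :
    ∫ a, g a • dirOp l Φ a ∂μ = ∫ a, dirOpT l g a • Φ a ∂μ := by
  induction l generalizing Φ with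
  | nil => rfl
  | cons e l ih =>
    have hT := contDiff_dirOpT l hg
    have hTs := hasCompactSupport_dirOpT l hgs
    have hint : ∀ {u : V → ℝ} {Ψ : V → G}, Continuous u → HasCompactSupport u → Continuous Ψ →
        Integrable (fun a => u a • Ψ a) μ := fun hu hus hΨ =>
      (hu.smul hΨ).integrable_of_hasCompactSupport hus.smul_right
    have h1 : Integrable (fun a => dirOpT l g a • Φ a) μ :=
      hint hT.continuous hTs h.continuous
    have h2 : Integrable (fun a => dirOpT l g a • fderiv ℝ Φ a e) μ :=
      hint hT.continuous hTs (contDiff_fderiv_apply h e).continuous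
    have h3 : Integrable (fun a => fderiv ℝ (dirOpT l g) a e • Φ a) μ :=
      hint (contDiff_fderiv_apply hT e).continuous (hTs.fderiv_apply ℝ e) h.continuous
    simp only [dirOp]
    rw [ih (h.sub (contDiff_fderiv_apply h e))]
    simp only [dirOpT, smul_sub, add_smul]
    have h4 := integral_bilinear_fderiv_right_eq_neg_left_of_integrable
      (B := ContinuousLinearMap.lsmul ℝ ℝ) (f := dirOpT l g) (g := Φ) (v := e) (μ := μ) h3 h2 h1
      (fun x _ => (hT.differentiable (by simp)).differentiableAt)
      (fun x _ => (h.differentiable (by simp)).differentiableAt)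
    simp only [ContinuousLinearMap.lsmul_apply] at h4
    rw [integral_sub h1 h2, integral_add h1 h3, h4, sub_neg_eq_add]

end DirOp

/-! ### Point evaluation as a square-integrable functional of a mixed derivative. -/

/-- The kernel `∏ e^{-t_i} 1_{t_i > 0}`. -/
def expKernel {n : ℕ} (t : Fin n → ℝ) : ℝ :=
  ∏ i, (Set.Ioi (0 : ℝ)).indicator (fun s => Real.exp (-s)) (t i)

theorem integrable_expKernel_one :
    Integrable ((Set.Ioi (0 : ℝ)).indicator fun s => Real.exp (-s)) volume := by
  rw [integrable_indicator_iff measurableSet_Ioi]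
  simpa using integrableOn_exp_neg_Ioi 0

theorem integrable_expKernel (n : ℕ) : Integrable (expKernel (n := n)) volume :=
  Integrable.fintype_prod (𝕜 := ℝ) (ι := Fin n) (E := ℝ) (μ := fun _ => volume)
    (f := fun _ => (Set.Ioi (0 : ℝ)).indicator fun s => Real.exp (-s))
    fun _ => integrable_expKernel_one

theorem memLp_expKernel (n : ℕ) : MemLp (expKernel (n := n)) 2 volume := by
  refine (memLp_two_iff_integrable_sq (integrable_expKernel n).aestronglyMeasurable).2 ?_
  refine (integrable_expKernel n).mono ((integrable_expKernel n).aestronglyMeasurable.pow 2)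
    (ae_of_all _ fun t => ?_)
  have h0 : ∀ s : ℝ, 0 ≤ (Set.Ioi (0 : ℝ)).indicator (fun s => Real.exp (-s)) s := fun s =>
    Set.indicator_nonneg (fun _ _ => (Real.exp_pos _).le) s
  have h1 : ∀ s : ℝ, (Set.Ioi (0 : ℝ)).indicator (fun s => Real.exp (-s)) s ≤ 1 := fun s => by
    refine Set.indicator_apply_le' (fun hs => ?_) fun _ => zero_le_one
    rw [Real.exp_le_one_iff]; linarith [Set.mem_Ioi.1 hs]
  have h2 : 0 ≤ expKernel t := Finset.prod_nonneg fun i _ => h0 _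
  have h3 : expKernel t ≤ 1 := Finset.prod_le_one (fun i _ => h0 _) fun i _ => h1 _
  rw [Real.norm_of_nonneg (by positivity), Real.norm_of_nonneg h2]
  nlinarith

/-- The integrand is the derivative of -e^{-s} f(s) on the half line: e^{-s} 1_{s>0} inverts 1 -
d/ds. -/
theorem integral_exp_smul_sub_deriv {f : ℝ → ℂ} (h : ContDiff ℝ ∞ f)
    {C : ℝ} (hC : ∀ s, ‖f s‖ ≤ C) (hC' : ∀ s, ‖deriv f s‖ ≤ C) :
    ∫ s, (Set.Ioi (0 : ℝ)).indicator (fun s => Real.exp (-s)) s • (f s - deriv f s) = f 0 := by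
  have hd : ∀ s, HasDerivAt (fun s => -(Real.exp (-s) • f s)) (Real.exp (-s) • (f s - deriv f s)) s := by
    intro s
    have h1 : HasDerivAt (fun s => Real.exp (-s)) (-Real.exp (-s)) s := by
      simpa using (hasDerivAt_neg s).exp
    have h2 := (h1.smul (h.differentiable (by simp)).differentiableAt.hasDerivAt).neg
    refine h2.congr_deriv ?_
    simp only [smul_sub, neg_smul]
    abel
  have hi : (fun s => (Set.Ioi (0 : ℝ)).indicator (fun s => Real.exp (-s)) s • (f s - deriv f s)) =
      (Set.Ioi (0 : ℝ)).indicator fun s => Real.exp (-s) • (f s - deriv f s) := by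
    funext s
    by_cases hs : s ∈ Set.Ioi (0 : ℝ)
    · simp only [Set.indicator_of_mem hs]
    · simp only [Set.indicator_of_notMem hs, zero_smul]
  have hdc : Continuous (deriv f) := h.continuous_deriv (by simp)
  rw [hi, integral_indicator measurableSet_Ioi,
    integral_Ioi_of_hasDerivAt_of_tendsto (hd 0).continuousAt.continuousWithinAt
      (fun s _ => hd s) (m := 0)]
  · simp
  · refine Integrable.mono' (g := fun s => Real.exp (-s) * (C + C)) ?_ ?_ (ae_of_all _ fun s => ?_)
    · exact (integrableOn_exp_neg_Ioi 0).mul_const _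
    · exact (by fun_prop : Continuous fun s => Real.exp (-s)).smul
        (h.continuous.sub hdc) |>.aestronglyMeasurable
    · rw [norm_smul, Real.norm_of_nonneg (Real.exp_pos _).le]
      gcongr
      exact (norm_sub_le _ _).trans (add_le_add (hC s) (hC' s))
  · rw [← neg_zero]
    refine Tendsto.neg ?_
    refine squeeze_zero_norm (a := fun s => Real.exp (-s) * C) (fun s => ?_) ?_
    · rw [norm_smul, Real.norm_of_nonneg (Real.exp_pos _).le]
      gcongr
      exact hC s
    · simpa using Real.tendsto_exp_neg_atTop_nhds_zero.mul_const C

/-- Fubini, one direction at a time: the induction hypothesis integrates out the remaining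
directions, and the first one is the scalar identity `integral_exp_smul_sub_deriv` on the line v + s
c. -/
theorem integral_expKernel_dirOp {V : Type} [NormedAddCommGroup V] [NormedSpace ℝ V]
    (l : List V) {ψ : V → ℂ} (h : ContDiff ℝ ∞ ψ) (hs : HasCompactSupport ψ) (v : V) :
    ∫ t : Fin l.length → ℝ, expKernel t • dirOp l ψ (v + ∑ i, t i • l.get i) = ψ v := by
  induction l generalizing ψ v with
  | nil =>
    have : (volume : Measure (Fin 0 → ℝ)) = Measure.dirac default := by
      rw [volume_pi]; exact Measure.pi_of_empty _ _
    change ∫ t : Fin 0 → ℝ, _ = _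
    rw [this, integral_dirac]
    simp [expKernel, dirOp]
  | cons c l ih =>
    have hψ' := h.sub (contDiff_fderiv_apply h c)
    have hs' := hs.sub (hs.fderiv_apply ℝ c)
    set Ψ : V → ℂ := dirOp l fun a => ψ a - fderiv ℝ ψ a c with hΨ
    have hΨc : Continuous Ψ := (contDiff_dirOp l hψ').continuous
    obtain ⟨B, hB⟩ := (hasCompactSupport_dirOp l hs').exists_bound_of_continuous hΨc
    have e := volume_preserving_piFinSuccAbove (fun _ : Fin (l.length + 1) => ℝ) 0
    change ∫ t : Fin (l.length + 1) → ℝ, expKernel t •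
      Ψ (v + ∑ i : Fin (l.length + 1), t i • (c :: l).get i) = ψ v
    have h1 : ∫ t : Fin (l.length + 1) → ℝ, expKernel t •
        Ψ (v + ∑ i : Fin (l.length + 1), t i • (c :: l).get i) =
        ∫ x : ℝ × (Fin l.length → ℝ),
          ((Set.Ioi (0 : ℝ)).indicator (fun s => Real.exp (-s)) x.1 * expKernel x.2) •
            Ψ (v + x.1 • c + ∑ i, x.2 i • l.get i) := by
      rw [← e.integral_comp']
      refine integral_congr_ae (ae_of_all _ fun t => ?_)
      simp only [expKernel, Fin.prod_univ_succ, Fin.sum_univ_succ]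
      rw [← add_assoc]
      rfl
    rw [h1]
    have hint : Integrable (fun x : ℝ × (Fin l.length → ℝ) =>
        ((Set.Ioi (0 : ℝ)).indicator (fun s => Real.exp (-s)) x.1 * expKernel x.2) •
            Ψ (v + x.1 • c + ∑ i, x.2 i • l.get i)) (volume.prod volume) := by
      refine (integrable_expKernel_one.mul_prod (integrable_expKernel l.length)).smul_bdd B ?_ ?_
      · exact (hΨc.comp (by fun_prop)).aestronglyMeasurable
      · exact ae_of_all _ fun x => hB _
    rw [show (volume : Measure (ℝ × (Fin l.length → ℝ))) = volume.prod volume from rfl,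
      integral_prod _ hint]
    simp only [mul_smul, integral_smul]
    have h2 : ∀ s : ℝ, ∫ t : Fin l.length → ℝ, expKernel t • Ψ (v + s • c + ∑ i, t i • l.get i) =
        ψ (v + s • c) - fderiv ℝ ψ (v + s • c) c := fun s => ih hψ' hs' (v + s • c)
    simp only [h2]
    have hline : ContDiff ℝ ∞ fun s : ℝ => ψ (v + s • c) := h.comp (by fun_prop)
    have hder : ∀ s : ℝ, deriv (fun s : ℝ => ψ (v + s • c)) s = fderiv ℝ ψ (v + s • c) c := by
      intro s
      have h3 : HasDerivAt (fun s : ℝ => v + s • c) c s := by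
        simpa using ((hasDerivAt_id s).smul_const c).const_add v
      exact ((h.differentiable (by simp)).differentiableAt.hasFDerivAt.comp_hasDerivAt s h3).deriv
    obtain ⟨C1, hC1⟩ := hs.exists_bound_of_continuous h.continuous
    obtain ⟨C2, hC2⟩ := (hs.fderiv_apply ℝ c).exists_bound_of_continuous
      (contDiff_fderiv_apply h c).continuous
    have := integral_exp_smul_sub_deriv hline (C := max C1 C2)
      (fun s => (hC1 _).trans (le_max_left _ _))
      (fun s => by rw [hder]; exact (hC2 _).trans (le_max_right _ _))
    simpa [hder] using this

/-- The coordinate directions of `(ℝ^d)^{m+1}`. -/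
def coordDirs (d m : ℕ) : List (Vel d m) :=
  (Finset.univ : Finset (Fin (m + 1) × Fin d)).toList.map coordVec

theorem sum_coordDirs {G : Type} [AddCommGroup G] (f : Vel d m → G) :
    ∑ i, f ((coordDirs d m).get i) = ∑ c, f (coordVec c) := by
  have := Fin.sum_univ_fun_getElem (coordDirs d m) f
  simp only [List.get_eq_getElem]
  rw [this, coordDirs, List.map_map, ← Finset.sum_map_toList]
  rfl

/-- Coordinates with respect to `coordDirs`. -/
def coordEquiv (d m : ℕ) : (Fin (coordDirs d m).length → ℝ) ≃L[ℝ] Vel d m := by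
  let L : (Fin (coordDirs d m).length → ℝ) →ₗ[ℝ] Vel d m :=
    { toFun := fun t => ∑ i, t i • (coordDirs d m).get i
      map_add' := fun s t => by simp [add_smul, Finset.sum_add_distrib]
      map_smul' := fun c t => by simp [mul_smul, Finset.smul_sum] }
  have hsurj : Function.Surjective L := by
    intro v
    refine ⟨fun i => ∑ j, ∑ k, v j k * (coordDirs d m).get i j k, ?_⟩
    change ∑ i, (∑ j, ∑ k, v j k * (coordDirs d m).get i j k) • (coordDirs d m).get i = v
    rw [sum_coordDirs fun w => (∑ j, ∑ k, v j k * w j k) • w]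
    conv_rhs => rw [sum_coordVec v]
    refine Finset.sum_congr rfl fun c _ => ?_
    congr 1
    simp only [coordVec_apply]
    rw [← Fintype.sum_prod_type' (f := fun j k => v j k * if (j, k) = c then 1 else 0)]
    simp
  have hinj : Function.Injective L := by
    refine (LinearMap.injective_iff_surjective_of_finrank_eq_finrank ?_).2 hsurj
    have : (coordDirs d m).length = (m + 1) * d := by simp [coordDirs]
    rw [Module.finrank_fintype_fun_eq_card, Fintype.card_fin, this]
    simp [Module.finrank_pi_fintype]
  exact (LinearEquiv.ofBijective L ⟨hinj, hsurj⟩).toContinuousLinearEquiv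

theorem coordEquiv_apply (t : Fin (coordDirs d m).length → ℝ) :
    coordEquiv d m t = ∑ i, t i • (coordDirs d m).get i := rfl

theorem IsTest.dirOp {ψ : Vel d m → ℂ} (h : IsTest ψ) (l : List (Vel d m)) :
    IsTest (dirOp l ψ) := ⟨contDiff_dirOp l h.1, hasCompactSupport_dirOp l h.2⟩

/-- One derivative per coordinate suffices to evaluate at a point, since the product of the
exponential kernels is in L². This is an elementary Sobolev embedding, which needs only Hilbert
space pairings. -/
theorem exists_evalVec (d m : ℕ) : ∃ G : L2 d m, ∀ ψ : Vel d m → ℂ, IsTest ψ →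
    ψ 0 = inner ℂ G (toL2 (dirOp (coordDirs d m) ψ)) := by
  obtain ⟨e, he⟩ : ∃ e, e = coordEquiv d m := ⟨_, rfl⟩
  have hemb : MeasurableEmbedding e := e.toHomeomorph.measurableEmbedding
  have : (Measure.map e (volume : Measure (Fin (coordDirs d m).length → ℝ))).IsAddHaarMeasure :=
    e.isAddHaarMeasure_map volume
  -- The coordinates carry Lebesgue measure to some Haar measure. Its density against the volume
  -- need not be computed; it is put into the representing vector.
  obtain ⟨κ, hκ0, hκt, hκ⟩ : ∃ κ : ℝ≥0∞, κ ≠ 0 ∧ κ ≠ ⊤ ∧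
      Measure.map e (volume : Measure (Fin (coordDirs d m).length → ℝ)) = κ • (volume : Measure (Vel d m)) := by
    refine ⟨Measure.addHaarScalarFactor (Measure.map e volume) volume, ?_, by simp, ?_⟩
    · have := Measure.addHaarScalarFactor_pos_of_isAddHaarMeasure
        (Measure.map e (volume : Measure (Fin (coordDirs d m).length → ℝ))) (volume : Measure (Vel d m))
      simpa using this.ne'
    · exact Measure.isAddLeftInvariant_eq_smul _ _
  let g : Vel d m → ℂ := fun w => ((expKernel (e.symm w) : ℝ) : ℂ)
  have hg : MemLp g 2 volume := by
    have h1 : MemLp (fun t : Fin (coordDirs d m).length → ℝ => ((expKernel t : ℝ) : ℂ)) 2 volume :=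
      (memLp_expKernel _).ofReal
    have h2 : MemLp g 2 (Measure.map e (volume : Measure (Fin (coordDirs d m).length → ℝ))) := by
      rw [hemb.memLp_map_measure_iff]
      refine h1.congr_norm ?_ ?_ 
      · convert h1.aestronglyMeasurable using 1
        funext t
        simp [g]
      · exact ae_of_all _ fun t => by simp [g]
    rw [hκ] at h2
    refine h2.of_measure_le_smul (c := κ⁻¹) (ENNReal.inv_ne_top.2 hκ0) ?_
    rw [smul_smul, ENNReal.inv_mul_cancel hκ0 hκt, one_smul]
  refine ⟨(κ.toReal : ℂ) • toL2 g, fun ψ hψ => ?_⟩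
  have hP := hψ.dirOp (coordDirs d m)
  rw [inner_smul_left, inner_toL2 hg (hP.memLp 2), Complex.conj_ofReal, pairing]
  have h1 := integral_expKernel_dirOp (coordDirs d m) hψ.1 hψ.2 0
  rw [← h1]
  have h2 : ∫ v, starRingEnd ℂ (g v) * RenormalizedPropagator.dirOp (coordDirs d m) ψ v
      ∂(Measure.map e (volume : Measure (Fin (coordDirs d m).length → ℝ))) = ∫ t : Fin (coordDirs d m).length → ℝ, expKernel t •
        RenormalizedPropagator.dirOp (coordDirs d m) ψ (0 + ∑ i, t i • (coordDirs d m).get i) := by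
    rw [hemb.integral_map]
    refine integral_congr_ae (ae_of_all _ fun t => ?_)
    simp only [g, ContinuousLinearEquiv.symm_apply_apply, Complex.conj_ofReal, zero_add,
      Complex.real_smul]
    rw [he, coordEquiv_apply]
  rw [← h2, hκ, integral_smul_measure, Complex.real_smul]

/-- The element of `L²` which represents point evaluation at `0`. -/
def evalVec (d m : ℕ) : L2 d m := (exists_evalVec d m).choose

theorem inner_evalVec {ψ : Vel d m → ℂ} (h : IsTest ψ) :
    inner ℂ (evalVec d m) (toL2 (dirOp (coordDirs d m) ψ)) = ψ 0 :=
  ((exists_evalVec d m).choose_spec ψ h).symm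

theorem IsTest.dirOp_tau {ψ : Vel d m → ℂ} (h : IsTest ψ) (l : List (Fin (m + 1) × Fin d))
    (a : Vel d m) : RenormalizedPropagator.dirOp (l.map coordVec) (fun a => tau a (toL2 ψ)) a =
      tau a (toL2 (RenormalizedPropagator.dirOp (l.map coordVec) ψ)) := by
  induction l generalizing ψ with
  | nil => rfl
  | cons c l ih =>
    have hs : IsTest fun a => ψ a - fderiv ℝ ψ a (coordVec c) := by
      have := h.add ((isTest_grad h c.1 c.2).smul (-1))
      convert this using 1
      funext v
      simp [grad, sub_eq_add_neg]
    simp only [List.map_cons, RenormalizedPropagator.dirOp]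
    rw [← ih hs]
    congr 1
    funext b
    rw [h.fderiv_tau, ← map_sub, ← toL2_sub (h.memLp 2) ((isTest_grad h c.1 c.2).memLp 2)]
    rfl

/-- The pointwise values of a family `Φ a = τ_a f`. -/
def rep (Φ : Vel d m → L2 d m) (a : Vel d m) : ℂ :=
  inner ℂ (evalVec d m) (dirOp (coordDirs d m) Φ a)

theorem contDiff_rep {Φ : Vel d m → L2 d m} (h : ContDiff ℝ ∞ Φ) : ContDiff ℝ ∞ (rep Φ) :=
  ((innerSL ℂ (evalVec d m)).restrictScalars ℝ).contDiff.comp (contDiff_dirOp _ h)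

/-- `dirOp` has constant coefficients and so commutes with directional derivatives of the orbit.
Gradients of `rep` therefore need no new estimate. -/
theorem grad_rep {Φ : Vel d m → L2 d m} (h : ContDiff ℝ ∞ Φ) (j : Fin (m + 1)) (i : Fin d) :
    grad (rep Φ) j i = rep fun a => fderiv ℝ Φ a (coordVec (j, i)) := by
  funext v
  have h1 : HasFDerivAt (dirOp (coordDirs d m) Φ) (fderiv ℝ (dirOp (coordDirs d m) Φ) v) v :=
    ((contDiff_dirOp _ h).differentiable (by simp)).differentiableAt.hasFDerivAt
  have h2 := ((innerSL ℂ (evalVec d m)).restrictScalars ℝ).hasFDerivAt.comp v h1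
  change fderiv ℝ (((innerSL ℂ (evalVec d m)).restrictScalars ℝ) ∘ dirOp (coordDirs d m) Φ) v _ = _
  rw [h2.fderiv, rep, ← fderiv_dirOp _ h]
  rfl

theorem rep_add {Φ Ψ : Vel d m → L2 d m} (h : ContDiff ℝ ∞ Φ) (h' : ContDiff ℝ ∞ Ψ) :
    (rep fun a => Φ a + Ψ a) = rep Φ + rep Ψ := by
  funext v
  simp only [rep, dirOp_add _ h h', inner_add_right, Pi.add_apply]

theorem IsTest.rep_eq {ψ : Vel d m → ℂ} (h : IsTest ψ) : rep (fun a => tau a (toL2 ψ)) = ψ := by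
  funext a
  have h1 := (h.dirOp (coordDirs d m)).memLp 2
  rw [rep, coordDirs, h.dirOp_tau, ← coordDirs, tau_toL2 a h1]
  have := inner_evalVec (h.translate a)
  rw [zero_add] at this
  rw [← this]
  congr 2
  funext v
  exact (dirOp_add_const (coordDirs d m) ψ v a).symm

/-! ### Smooth vectors of the translation group are smooth functions. -/

/-- The average `∫ κ(a) τ_a f da`. -/
def avg (κ : Vel d m → ℝ) (f : L2 d m) : L2 d m := ∫ a, κ a • tau a f

theorem integrable_smul_tau {κ : Vel d m → ℝ} (hc : Continuous κ) (hs : HasCompactSupport κ)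
    (f : L2 d m) : Integrable fun a => κ a • tau a f :=
  (hc.smul (continuous_tau f)).integrable_of_hasCompactSupport hs.smul_right

theorem continuous_avg {κ : Vel d m → ℝ} (hc : Continuous κ) (hs : HasCompactSupport κ) :
    Continuous (avg κ) := by
  have hint : Integrable (fun a => ‖κ a‖) := (hc.integrable_of_hasCompactSupport hs).norm
  have hlip : LipschitzWith (∫ a, ‖κ a‖).toNNReal (avg κ) := by
    refine LipschitzWith.of_dist_le_mul fun f g => ?_
    rw [dist_eq_norm, dist_eq_norm, Real.coe_toNNReal _ (integral_nonneg fun _ => norm_nonneg _),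
      avg, avg, ← integral_sub (integrable_smul_tau hc hs f) (integrable_smul_tau hc hs g),
      ← integral_mul_const]
    refine norm_integral_le_of_norm_le (hint.mul_const _) (ae_of_all _ fun a => ?_)
    rw [← smul_sub, ← map_sub, norm_smul, norm_tau]
  exact hlip.continuous

theorem dense_test : Dense {f : L2 d m | ∃ φ, IsTest φ ∧ f = toL2 φ} := by
  refine (Lp.dense_hasCompactSupport_contDiff (F := ℂ) (μ := (volume : Measure (Vel d m)))
    (p := 2) (by simp)).mono ?_
  rintro f ⟨g, hfg, hg1, hg2⟩
  exact ⟨g, ⟨hg2, hg1⟩, by rw [← toL2_coe f]; exact toL2_congr hfg⟩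

theorem locallyIntegrable_coe (f : L2 d m) : LocallyIntegrable (f : Vel d m → ℂ) volume :=
  (Lp.memLp f).locallyIntegrable (by norm_num)

/-- A smooth vector for the translations is represented by a smooth function. -/
theorem rep_ae_eq {f : L2 d m} (h : ContDiff ℝ ∞ fun a => tau a f) :
    rep (fun a => tau a f) =ᵐ[volume] f := by
  refine ae_eq_of_integral_contDiff_smul_eq ((contDiff_rep h).continuous.locallyIntegrable)
    (locallyIntegrable_coe f) fun g hg hgs => ?_
  have hT := contDiff_dirOpT (coordDirs d m) hg
  have hTs := hasCompactSupport_dirOpT (coordDirs d m) hgs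
  -- Moving all derivatives onto the weight g leaves an average of translates of f, an expression
  -- that is defined and continuous for every f in L².
  have key : ∀ f : L2 d m, ContDiff ℝ ∞ (fun a => tau a f) →
      ∫ a, g a • rep (fun a => tau a f) a =
        inner ℂ (evalVec d m) (avg (dirOpT (coordDirs d m) g) f) := by
    intro f h
    rw [avg, ← integral_smul_dirOp (μ := volume) (coordDirs d m) hg hgs h]
    have hint : Integrable fun a => g a • dirOp (coordDirs d m) (fun a => tau a f) a :=
      (hg.continuous.smul (contDiff_dirOp _ h).continuous).integrable_of_hasCompactSupport
        hgs.smul_right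
    rw [← integral_inner hint]
    refine integral_congr_ae (ae_of_all _ fun a => ?_)
    simp only [rep]
    exact ((innerSL ℂ (evalVec d m)).map_smul_of_tower (g a) _).symm
  have hgt : IsTest fun v => ((g v : ℝ) : ℂ) :=
    ⟨Complex.ofRealCLM.contDiff.comp hg, hgs.comp_left (g := fun x : ℝ => (x : ℂ)) (by simp)⟩
  have hpair : ∀ f : L2 d m, ∫ a, g a • (f : Vel d m → ℂ) a =
      inner ℂ (toL2 fun v => ((g v : ℝ) : ℂ)) f := by
    intro f
    rw [inner_toL2_coe (hgt.memLp 2), pairing]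
    refine integral_congr_ae (ae_of_all _ fun a => ?_)
    simp [Complex.real_smul]
  rw [key f h, hpair]
  have h1 : Continuous fun f : L2 d m =>
      inner ℂ (evalVec d m) (avg (dirOpT (coordDirs d m) g) f) :=
    continuous_const.inner (continuous_avg hT.continuous hTs)
  have h2 : Continuous fun f : L2 d m => inner ℂ (toL2 fun v => ((g v : ℝ) : ℂ)) f := by fun_prop
  -- Both sides are now continuous in f, so it is enough to compare them on test functions, for
  -- which `rep` gives the function itself.
  refine congrFun (h1.ext_on dense_test h2 ?_) f
  rintro _ ⟨φ, hφ, rfl⟩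
  change inner ℂ (evalVec d m) (avg (dirOpT (coordDirs d m) g) (toL2 φ)) =
    inner ℂ (toL2 fun v => ((g v : ℝ) : ℂ)) (toL2 φ)
  rw [← key _ hφ.contDiff_tau, ← hpair, hφ.rep_eq]
  refine integral_congr_ae ?_
  filter_upwards [coe_toL2 (hφ.memLp 2)] with v hv
  rw [hv]

end RenormalizedPropagator

end

noncomputable section

namespace RenormalizedPropagator

/-! ### Translation-covariant holomorphic families of operators -/

open Filter Topology

attribute [local irreducible] tau

variable {d m : ℕ}

theorem toCVel_apply (v : Vel d m) (j : Fin (m + 1)) (i : Fin d) :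
    toCVel v j i = ((v j i : ℝ) : ℂ) := rfl

/-- The inclusion `(ℝ^d)^{m+1} ⊆ (ℂ^d)^{m+1}` as a continuous linear map. -/
def toCVelL (d m : ℕ) : Vel d m →L[ℝ] CVel d m :=
  LinearMap.toContinuousLinearMap
    { toFun := toCVel
      map_add' := fun a b => by
        funext j; ext i; simp [toCVel_apply]
      map_smul' := fun c a => by
        funext j; ext i; simp [toCVel_apply] }

theorem toCVel_zero : toCVel (0 : Vel d m) = 0 := (toCVelL d m).map_zero

theorem norm_toCVel_coordVec_le (c : Fin (m + 1) × Fin d) :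
    ‖toCVel (coordVec c : Vel d m)‖ ≤ 1 := by
  refine (pi_norm_le_iff_of_nonneg zero_le_one).2 fun j => ?_
  rw [EuclideanSpace.norm_eq, Real.sqrt_le_one]
  simp only [toCVel_apply, coordVec_apply]
  obtain ⟨j', i'⟩ := c
  by_cases hj : j = j' <;> simp [hj, Prod.ext_iff, Finset.sum_ite_eq', apply_ite]

/-- Covariant holomorphic families `X_{ξ+a} = τ_a X_ξ τ_{-a}`. -/
structure CovFam (U : Set (CVel d m)) (X : CVel d m → L2 d m →L[ℂ] L2 d m) : Prop where
  isOpen : IsOpen U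
  add_mem : ∀ ξ ∈ U, ∀ a, ξ + toCVel a ∈ U
  hol : DifferentiableOn ℂ X U
  cov : ∀ ξ ∈ U, ∀ a f, X (ξ + toCVel a) (tau a f) = tau a (X ξ f)

/-- The complex partial derivatives of a family of operators. -/
def cpd (X : CVel d m → L2 d m →L[ℂ] L2 d m) (c : Fin (m + 1) × Fin d) :
    CVel d m → L2 d m →L[ℂ] L2 d m :=
  fun ξ => fderiv ℂ X ξ (toCVel (coordVec c))

variable {U : Set (CVel d m)} {X : CVel d m → L2 d m →L[ℂ] L2 d m}

theorem CovFam.differentiableAt (h : CovFam U X) {ξ : CVel d m} (hξ : ξ ∈ U) :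
    DifferentiableAt ℂ X ξ := (h.hol ξ hξ).differentiableAt (h.isOpen.mem_nhds hξ)

/-- Differentiating the covariance relation in ξ at fixed real a shows that ξ-derivatives are again
covariant. The calculus below can therefore be iterated. -/
theorem CovFam.cpd (h : CovFam U X) (c : Fin (m + 1) × Fin d) : CovFam U (cpd X c) where
  isOpen := h.isOpen
  add_mem := h.add_mem
  hol := (differentiableOn_fderiv h.isOpen h.hol).clm_apply (differentiableOn_const _)
  cov ξ hξ a f := by
    have h1 : HasFDerivAt (fun ζ => X (ζ + toCVel a) (tau a f))
        ((fderiv ℂ X (ξ + toCVel a)).flip (tau a f)) ξ := by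
      have h0 := (h.differentiableAt (h.add_mem ξ hξ a)).hasFDerivAt
      have h2 : HasFDerivAt (fun ζ => X (ζ + toCVel a)) (fderiv ℂ X (ξ + toCVel a)) ξ :=
        h0.comp ξ ((hasFDerivAt_id ξ).add_const _)
      exact (h2.clm_apply (hasFDerivAt_const (tau a f) ξ)).congr_fderiv (by simp)
    have h2 : HasFDerivAt (fun ζ => tau a (X ζ f))
        ((tau a).comp ((fderiv ℂ X ξ).flip f)) ξ := by
      have h0 := (h.differentiableAt hξ).hasFDerivAt
      have h3 := (h0.clm_apply (hasFDerivAt_const f ξ)).congr_fderiv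
        (show _ = (fderiv ℂ X ξ).flip f by simp)
      exact (tau a).hasFDerivAt.comp ξ h3
    have h3 : (fun ζ => X (ζ + toCVel a) (tau a f)) =ᶠ[𝓝 ξ] fun ζ => tau a (X ζ f) := by
      filter_upwards [h.isOpen.mem_nhds hξ] with ζ hζ
      exact h.cov ζ hζ a f
    have := h1.unique (h2.congr_of_eventuallyEq h3)
    exact congrArg (fun L => L (toCVel (coordVec c))) this

theorem norm_iteratedFDeriv_fderiv_apply_le {V G : Type} [NormedAddCommGroup V]
    [NormedSpace ℂ V] [NormedAddCommGroup G] [NormedSpace ℂ G] {f : V → G} {x : V} {s : ℕ}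
    (h : ContDiffAt ℂ s (fderiv ℂ f) x) {v : V} (hv : ‖v‖ ≤ 1) :
    ‖iteratedFDeriv ℂ s (fun y => fderiv ℂ f y v) x‖ ≤ ‖iteratedFDeriv ℂ (s + 1) f x‖ := by
  rw [← norm_iteratedFDeriv_fderiv]
  refine ((ContinuousLinearMap.apply ℂ G v).norm_iteratedFDeriv_comp_left h le_rfl).trans ?_
  refine mul_le_of_le_one_left (norm_nonneg _) ?_
  refine ContinuousLinearMap.opNorm_le_bound _ zero_le_one fun L => ?_
  rw [one_mul]
  exact (L.le_opNorm _).trans (mul_le_of_le_one_right (norm_nonneg _) hv)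

theorem CovFam.enorm_iteratedFDeriv_cpd_le (h : CovFam U X) {ξ : CVel d m} (hξ : ξ ∈ U)
    (c : Fin (m + 1) × Fin d) (s : ℕ) :
    ‖iteratedFDeriv ℂ s (RenormalizedPropagator.cpd X c) ξ‖ₑ ≤ ‖iteratedFDeriv ℂ (s + 1) X ξ‖ₑ := by
  rw [enorm_le_iff_norm_le]
  have hc : ContDiffAt ℂ s (fderiv ℂ X) ξ :=
    (contDiffOn_of_differentiableOn_complex h.isOpen (differentiableOn_fderiv h.isOpen h.hol)
      s).contDiffAt (h.isOpen.mem_nhds hξ)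
  exact norm_iteratedFDeriv_fderiv_apply_le hc (norm_toCVel_coordVec_le c)

/-- The translates of `X_ξ g`. -/
def famOrbit (X : CVel d m → L2 d m →L[ℂ] L2 d m) (ξ : CVel d m) (g : Vel d m → ℂ)
    (a : Vel d m) : L2 d m := X (ξ + toCVel a) (tau a (toL2 g))

/-- The continuous representative of `X_ξ g`. -/
def famEval (X : CVel d m → L2 d m →L[ℂ] L2 d m) (ξ : CVel d m) (g : Vel d m → ℂ) :
    Vel d m → ℂ := rep (famOrbit X ξ g)

theorem CovFam.famOrbit_eq (h : CovFam U X) {ξ : CVel d m} (hξ : ξ ∈ U) (g : Vel d m → ℂ) :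
    famOrbit X ξ g = fun a => tau a (X ξ (toL2 g)) :=
  funext fun a => h.cov ξ hξ a _

theorem CovFam.hasFDerivAt_comp (h : CovFam U X) {ξ : CVel d m} (hξ : ξ ∈ U) (a : Vel d m) :
    HasFDerivAt (fun a => X (ξ + toCVel a))
      (((fderiv ℂ X (ξ + toCVel a)).restrictScalars ℝ).comp (toCVelL d m)) a := by
  have h0 := ((h.differentiableAt (h.add_mem ξ hξ a)).hasFDerivAt).restrictScalars ℝ
  have h1 : HasFDerivAt (fun a => ξ + toCVel a) (toCVelL d m) a :=
    (toCVelL d m).hasFDerivAt.const_add ξ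
  exact h0.comp a h1

/-- By covariance the orbit of X_ξ g is a ↦ X_{ξ+a} τ_a g, a product of a family smooth in a and the
orbit of a test function. So X_ξ g is a smooth vector although X_ξ itself need not be smoothing. -/
theorem CovFam.contDiff_famOrbit (h : CovFam U X) {ξ : CVel d m} (hξ : ξ ∈ U)
    {g : Vel d m → ℂ} (hg : IsTest g) : ContDiff ℝ ∞ (famOrbit X ξ g) := by
  have h1 : ContDiff ℝ ∞ fun a : Vel d m => X (ξ + toCVel a) := by
    refine contDiff_infty.2 fun n => contDiff_iff_contDiffAt.2 fun a => ?_
    have h2 : ContDiffAt ℝ n X (ξ + toCVel a) :=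
      ((contDiffOn_of_differentiableOn_complex h.isOpen h.hol n).contDiffAt
        (h.isOpen.mem_nhds (h.add_mem ξ hξ a))).restrict_scalars ℝ
    refine h2.comp a ?_
    exact (contDiff_const.add (toCVelL d m).contDiff).contDiffAt
  exact (ContinuousLinearMap.restrictScalarsL ℂ (L2 d m) (L2 d m) ℝ ℝ).contDiff.comp h1
    |>.clm_apply hg.contDiff_tau

theorem hasFDerivAt_apply_restrictScalars {V G G' : Type} [NormedAddCommGroup V]
    [NormedSpace ℝ V] [NormedAddCommGroup G] [NormedSpace ℂ G] [NormedSpace ℝ G]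
    [IsScalarTower ℝ ℂ G] [NormedAddCommGroup G'] [NormedSpace ℂ G'] [NormedSpace ℝ G']
    [IsScalarTower ℝ ℂ G'] {A : V → G →L[ℂ] G'} {A' : V →L[ℝ] G →L[ℂ] G'} {u : V → G}
    {u' : V →L[ℝ] G} {x : V} (hA : HasFDerivAt A A' x) (hu : HasFDerivAt u u' x) (v : V) :
    fderiv ℝ (fun y => A y (u y)) x v = A' v (u x) + A x (u' v) := by
  have h1 := (ContinuousLinearMap.restrictScalarsL ℂ G G' ℝ ℝ).hasFDerivAt.comp x hA
  have h4 : fderiv ℝ (fun y => A y (u y)) x = _ := (h1.clm_apply hu).fderiv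
  rw [h4, add_comm]
  rfl

theorem CovFam.fderiv_famOrbit (h : CovFam U X) {ξ : CVel d m} (hξ : ξ ∈ U)
    {g : Vel d m → ℂ} (hg : IsTest g) (c : Fin (m + 1) × Fin d) (a : Vel d m) :
    fderiv ℝ (famOrbit X ξ g) a (coordVec c) =
      famOrbit (RenormalizedPropagator.cpd X c) ξ g a + famOrbit X ξ (grad g c.1 c.2) a := by
  have h2 := (hg.hasFDerivAt_tau a).differentiableAt.hasFDerivAt
  have h3 := hasFDerivAt_apply_restrictScalars (h.hasFDerivAt_comp hξ a) h2 (coordVec c)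
  rw [hg.fderiv_tau] at h3
  exact h3

theorem CovFam.contDiff_famEval (h : CovFam U X) {ξ : CVel d m} (hξ : ξ ∈ U)
    {g : Vel d m → ℂ} (hg : IsTest g) : ContDiff ℝ ∞ (famEval X ξ g) :=
  contDiff_rep (h.contDiff_famOrbit hξ hg)

theorem CovFam.famEval_ae_eq (h : CovFam U X) {ξ : CVel d m} (hξ : ξ ∈ U)
    {g : Vel d m → ℂ} (hg : IsTest g) : famEval X ξ g =ᵐ[volume] X ξ (toL2 g) := by
  have h1 := h.contDiff_famOrbit hξ hg
  rw [h.famOrbit_eq hξ] at h1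
  rw [famEval, h.famOrbit_eq hξ]
  exact rep_ae_eq h1

theorem CovFam.memLp_famEval (h : CovFam U X) {ξ : CVel d m} (hξ : ξ ∈ U)
    {g : Vel d m → ℂ} (hg : IsTest g) : MemLp (famEval X ξ g) 2 volume :=
  (Lp.memLp _).ae_eq (h.famEval_ae_eq hξ hg).symm

theorem CovFam.toL2_famEval (h : CovFam U X) {ξ : CVel d m} (hξ : ξ ∈ U)
    {g : Vel d m → ℂ} (hg : IsTest g) : toL2 (famEval X ξ g) = X ξ (toL2 g) := by
  rw [toL2_congr (h.famEval_ae_eq hξ hg), toL2_coe]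

/-- The product rule for a ↦ X_{ξ+a} τ_a g, in other words the commutator identity [∂_c, X_ξ] =
∂_{ξ_c} X_ξ. All bounds on velocity derivatives rest on it. -/
theorem CovFam.grad_famEval (h : CovFam U X) {ξ : CVel d m} (hξ : ξ ∈ U)
    {g : Vel d m → ℂ} (hg : IsTest g) (j : Fin (m + 1)) (i : Fin d) :
    grad (famEval X ξ g) j i =
      famEval (RenormalizedPropagator.cpd X (j, i)) ξ g + famEval X ξ (grad g j i) := by
  rw [famEval, grad_rep (h.contDiff_famOrbit hξ hg), famEval, famEval,
    ← rep_add ((h.cpd _).contDiff_famOrbit hξ hg) (h.contDiff_famOrbit hξ (isTest_grad hg j i))]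
  congr 1
  funext a
  exact h.fderiv_famOrbit hξ hg (j, i) a

theorem dirOp_sub {V G : Type} [NormedAddCommGroup V] [NormedSpace ℝ V] [NormedAddCommGroup G]
    [NormedSpace ℝ G] (l : List V) {Φ Ψ : V → G} (h : ContDiff ℝ ∞ Φ) (h' : ContDiff ℝ ∞ Ψ)
    (a : V) : dirOp l (fun x => Φ x - Ψ x) a = dirOp l Φ a - dirOp l Ψ a := by
  have := dirOp_add l (h.sub h') h' a
  simp only [sub_add_cancel] at this
  rw [this, add_sub_cancel_right]

/-- The values of the continuous representative of `X_ξ g` are holomorphic in `ξ`. -/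
theorem CovFam.differentiableOn_famEval (h : CovFam U X) {g : Vel d m → ℂ} (hg : IsTest g)
    (v : Vel d m) : DifferentiableOn ℂ (fun ξ => famEval X ξ g v) U := by
  -- The family and the test function must both vary in the induction, because each factor 1 - ∂_c
  -- produces a derivative of the family and a derivative of g.
  have key : ∀ (l : List (Fin (m + 1) × Fin d)) (X : CVel d m → L2 d m →L[ℂ] L2 d m)
      (g : Vel d m → ℂ), CovFam U X → IsTest g →
      DifferentiableOn ℂ (fun ξ => dirOp (l.map coordVec) (famOrbit X ξ g) v) U := by
    intro l
    induction l with
    | nil =>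
      intro X g h hg
      refine DifferentiableOn.clm_apply ?_ (differentiableOn_const _)
      exact h.hol.comp (differentiableOn_id.add_const _) fun ξ hξ => h.add_mem ξ hξ v
    | cons c l ih =>
      intro X g h hg
      refine (((ih X g h hg).sub (ih _ g (h.cpd c) hg)).sub
        (ih X _ h (isTest_grad hg c.1 c.2))).congr fun ξ hξ => ?_
      have h0 := h.contDiff_famOrbit hξ hg
      have h1 := (h.cpd c).contDiff_famOrbit hξ hg
      have h2 := h.contDiff_famOrbit hξ (isTest_grad hg c.1 c.2)
      simp only [List.map_cons, dirOp]
      rw [Pi.sub_apply, Pi.sub_apply, ← dirOp_sub _ h0 h1, ← dirOp_sub _ (h0.sub h1) h2]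
      congr 1
      funext a
      rw [h.fderiv_famOrbit hξ hg, sub_sub]
  intro ξ hξ
  exact ((innerSL ℂ (evalVec d m)).differentiableAt.comp_differentiableWithinAt ξ
    (key _ X g h hg ξ hξ))

/-! ### Tensors of derivatives -/

theorem partialD_zero (I : Fin 0 → Fin (m + 1) × Fin d) (f : Vel d m → ℂ) : partialD I f = f := by
  funext v; simp [partialD]

theorem partialD_succ {ℓ : ℕ} (I : Fin (ℓ + 1) → Fin (m + 1) × Fin d) {f : Vel d m → ℂ}
    (hf : ContDiff ℝ ∞ f) : partialD I f =
      partialD (Fin.init I) (grad f (I (Fin.last ℓ)).1 (I (Fin.last ℓ)).2) := by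
  funext v
  rw [partialD, iteratedFDeriv_succ_apply_right]
  have hc : ContDiffAt ℝ ℓ (fderiv ℝ f) v :=
    ((hf.fderiv_right (m := ∞) (by simp)).of_le (by exact_mod_cast le_top)).contDiffAt
  have := (ContinuousLinearMap.apply ℝ ℂ
    (coordVec (I (Fin.last ℓ)) : Vel d m)).iteratedFDeriv_comp_left hc le_rfl
  change _ = iteratedFDeriv ℝ ℓ ((ContinuousLinearMap.apply ℝ ℂ
    (coordVec (I (Fin.last ℓ)) : Vel d m)) ∘ fderiv ℝ f) v _
  rw [this]
  rfl

theorem contDiff_grad {f : Vel d m → ℂ} (hf : ContDiff ℝ ∞ f) (j : Fin (m + 1)) (i : Fin d) :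
    ContDiff ℝ ∞ (grad f j i) := contDiff_fderiv_apply hf _

theorem partialD_add {ℓ : ℕ} (I : Fin ℓ → Fin (m + 1) × Fin d) {f g : Vel d m → ℂ}
    (hf : ContDiff ℝ ∞ f) (hg : ContDiff ℝ ∞ g) :
    partialD I (f + g) = partialD I f + partialD I g := by
  funext v
  have h1 : (ℓ : WithTop ℕ∞) ≤ (∞ : WithTop ℕ∞) := by exact_mod_cast le_top
  rw [partialD, iteratedFDeriv_add_apply (hf.of_le h1).contDiffAt (hg.of_le h1).contDiffAt]
  rfl

theorem IsTest.partialD {ℓ : ℕ} (I : Fin ℓ → Fin (m + 1) × Fin d) {f : Vel d m → ℂ}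
    (hf : IsTest f) : IsTest (partialD I f) := by
  induction ℓ generalizing f with
  | zero => rwa [partialD_zero]
  | succ ℓ ih => rw [partialD_succ I hf.1]; exact ih _ (isTest_grad hf _ _)

theorem eLpNorm_partialD_le {ℓ : ℕ} (I : Fin ℓ → Fin (m + 1) × Fin d) (f : Vel d m → ℂ) :
    eLpNorm (partialD I f) 2 volume ≤ derivNorm ℓ f := by
  rw [derivNorm, one_div, ENNReal.le_rpow_inv_iff (by norm_num), ENNReal.rpow_ofNat]
  exact Finset.single_le_sum (f := fun I => eLpNorm (partialD I f) 2 volume ^ 2)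
    (fun _ _ => zero_le) (Finset.mem_univ I)

theorem sum_sq_le_sq_sum {ι : Type} (s : Finset ι) (f : ι → ℝ≥0∞) :
    ∑ i ∈ s, f i ^ 2 ≤ (∑ i ∈ s, f i) ^ 2 := by
  rw [sq, Finset.sum_mul]
  refine Finset.sum_le_sum fun i hi => ?_
  rw [sq]
  gcongr
  exact Finset.single_le_sum (fun _ _ => zero_le) hi

theorem derivNorm_le_sum (ℓ : ℕ) (f : Vel d m → ℂ) :
    derivNorm ℓ f ≤ ∑ I : Fin ℓ → Fin (m + 1) × Fin d, eLpNorm (partialD I f) 2 volume := by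
  rw [derivNorm, one_div, ENNReal.rpow_inv_le_iff (by norm_num), ENNReal.rpow_ofNat]
  exact sum_sq_le_sq_sum Finset.univ
    fun I : Fin ℓ → Fin (m + 1) × Fin d => eLpNorm (partialD I f) 2 volume

theorem derivNorm_zero (f : Vel d m → ℂ) : derivNorm 0 f = eLpNorm f 2 volume := by
  refine le_antisymm ((derivNorm_le_sum 0 f).trans (by simp [partialD_zero])) ?_
  simpa [partialD_zero] using eLpNorm_partialD_le (default : Fin 0 → Fin (m + 1) × Fin d) f

/-- Appending the index (j, i) injects the components of order ℓ of the partial derivative into the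
components of order ℓ + 1 of f, where they form part of the sum. -/
theorem derivNorm_grad_le (ℓ : ℕ) {f : Vel d m → ℂ} (hf : ContDiff ℝ ∞ f) (j : Fin (m + 1))
    (i : Fin d) : derivNorm ℓ (grad f j i) ≤ derivNorm (ℓ + 1) f := by
  rw [derivNorm, derivNorm]
  gcongr
  have hinj : Function.Injective fun I : Fin ℓ → Fin (m + 1) × Fin d =>
      (Fin.snoc I (j, i) : Fin (ℓ + 1) → Fin (m + 1) × Fin d) := by
    intro I I' h
    have := congrArg Fin.init h
    simpa using this
  have h1 : ∀ I : Fin ℓ → Fin (m + 1) × Fin d, partialD I (grad f j i) =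
      partialD (Fin.snoc I (j, i) : Fin (ℓ + 1) → Fin (m + 1) × Fin d) f := by
    intro I
    rw [partialD_succ _ hf]
    simp
  simp only [h1]
  rw [← Finset.sum_image (f := fun J => eLpNorm (partialD J f) 2 volume ^ 2)
    (s := Finset.univ) (g := fun I : Fin ℓ → Fin (m + 1) × Fin d =>
      (Fin.snoc I (j, i) : Fin (ℓ + 1) → Fin (m + 1) × Fin d)) hinj.injOn]
  exact Finset.sum_le_sum_of_subset (Finset.subset_univ _)

theorem sum_Icc_one_succ (f : ℕ → ℝ≥0∞) (ℓ : ℕ) :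
    ∑ s ∈ Finset.Icc 1 (ℓ + 1), f s = f 1 + ∑ s ∈ Finset.Icc 1 ℓ, f (s + 1) := by
  rw [← Finset.Ico_add_one_right_eq_Icc, ← Finset.Ico_add_one_right_eq_Icc,
    Finset.sum_eq_sum_Ico_succ_bot (by omega), Finset.sum_Ico_add']

theorem enorm_add_sub_le {G : Type} [NormedAddCommGroup G] {A A' B B' : G} {a a' b : ℝ≥0∞}
    (h : ‖A - A'‖ₑ ≤ a) (h' : ‖A'‖ₑ ≤ a') (h'' : ‖B - B'‖ₑ ≤ b) : ‖A + B - B'‖ₑ ≤ a + a' + b := by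
  have hsplit : A + B - B' = (A - A') + A' + (B - B') := by abel
  rw [hsplit]
  exact (enorm_add_le _ _).trans (add_le_add ((enorm_add_le _ _).trans (add_le_add h h')) h'')

theorem CovFam.enorm_cpd_toL2_le {ℓ : ℕ} (I : Fin ℓ → Fin (m + 1) × Fin d)
    (h : CovFam U X) {ξ : CVel d m} (hξ : ξ ∈ U) {g : Vel d m → ℂ} (hg : IsTest g)
    (c : Fin (m + 1) × Fin d) {M : ℝ≥0∞} (hM : ‖iteratedFDeriv ℂ 1 X ξ‖ₑ ≤ M) :
    ‖RenormalizedPropagator.cpd X c ξ (toL2 (RenormalizedPropagator.partialD I g))‖ₑ ≤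
      M * derivNorm ℓ g := by
  refine (ContinuousLinearMap.le_opENorm _ _).trans ?_
  have h3 := h.enorm_iteratedFDeriv_cpd_le hξ c 0
  rw [enorm_eq_iff_norm_eq.2 norm_iteratedFDeriv_zero] at h3
  refine mul_le_mul' (h3.trans hM) ?_
  rw [enorm_toL2 ((hg.partialD _).memLp 2)]
  exact eLpNorm_partialD_le _ _

theorem sum_mul_derivNorm_grad_le {g : Vel d m → ℂ} (hg : IsTest g) (c : Fin (m + 1) × Fin d)
    (M : ℕ → ℝ≥0∞) (ℓ : ℕ) :
    ∑ s ∈ Finset.Icc 1 ℓ, M s * derivNorm (ℓ - s) (grad g c.1 c.2) ≤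
      ∑ s ∈ Finset.Icc 1 (ℓ + 1), M s * derivNorm (ℓ + 1 - s) g := by
  refine le_trans (Finset.sum_le_sum fun s hs => ?_)
    (Finset.sum_le_sum_of_subset (Finset.Icc_subset_Icc_right (Nat.le_succ ℓ)))
  have := (Finset.mem_Icc.1 hs).2
  rw [Nat.succ_sub this]
  gcongr
  exact derivNorm_grad_le _ hg.1 _ _

theorem CovFam.partialD_famEval_succ {ℓ : ℕ} (J : Fin (ℓ + 1) → Fin (m + 1) × Fin d)
    (h : CovFam U X) {ξ : CVel d m} (hξ : ξ ∈ U) {g : Vel d m → ℂ} (hg : IsTest g) :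
    RenormalizedPropagator.partialD J (famEval X ξ g) =
      RenormalizedPropagator.partialD (Fin.init J)
        (famEval (RenormalizedPropagator.cpd X (J (Fin.last ℓ))) ξ g) +
      RenormalizedPropagator.partialD (Fin.init J)
        (famEval X ξ (grad g (J (Fin.last ℓ)).1 (J (Fin.last ℓ)).2)) := by
  rw [partialD_succ J (h.contDiff_famEval hξ hg), h.grad_famEval hξ hg,
    partialD_add _ ((h.cpd _).contDiff_famEval hξ hg)
      (h.contDiff_famEval hξ (isTest_grad hg _ _))]

/-- Leibniz rule for `∂_J (X_ξ g)`, up to the leading term `X_ξ ∂_J g`. -/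
theorem CovFam.enorm_partialD_famEval_sub_le {ℓ : ℕ} (J : Fin ℓ → Fin (m + 1) × Fin d)
    (h : CovFam U X) {ξ : CVel d m} (hξ : ξ ∈ U) {g : Vel d m → ℂ} (hg : IsTest g)
    {M : ℕ → ℝ≥0∞} (hM : ∀ s, ‖iteratedFDeriv ℂ s X ξ‖ₑ ≤ M s) :
    MemLp (RenormalizedPropagator.partialD J (famEval X ξ g)) 2 volume ∧
    ‖toL2 (RenormalizedPropagator.partialD J (famEval X ξ g)) -
        X ξ (toL2 (RenormalizedPropagator.partialD J g))‖ₑ ≤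
      2 ^ ℓ * ∑ s ∈ Finset.Icc 1 ℓ, M s * derivNorm (ℓ - s) g := by
  induction ℓ generalizing X g M with
  | zero =>
    rw [partialD_zero, partialD_zero, h.toL2_famEval hξ hg]
    exact ⟨h.memLp_famEval hξ hg, by simp⟩
  | succ ℓ ih =>
    have hg' := isTest_grad hg (J (Fin.last ℓ)).1 (J (Fin.last ℓ)).2
    -- The differentiated family starts one ξ-derivative higher, so its bounds are those of X
    -- shifted by one.
    obtain ⟨h1, h1'⟩ := ih (Fin.init J) (h.cpd (J (Fin.last ℓ))) hg (M := fun s => M (s + 1))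
      fun s => (h.enorm_iteratedFDeriv_cpd_le hξ _ s).trans (hM (s + 1))
    obtain ⟨h2, h2'⟩ := ih (Fin.init J) h hg' hM
    rw [h.partialD_famEval_succ J hξ hg]
    refine ⟨h1.add h2, ?_⟩
    rw [toL2_add h1 h2, partialD_succ J hg.1]
    -- Besides the two remainders, the leading term of the differentiated family has to be counted:
    -- it is the s = 1 term. Each order at most doubles the constant, whence 2 ^ ℓ.
    refine (enorm_add_sub_le h1' (h.enorm_cpd_toL2_le _ hξ hg _ (hM 1)) h2').trans ?_
    calc _ ≤ 2 ^ ℓ * (∑ s ∈ Finset.Icc 1 ℓ, M (s + 1) * derivNorm (ℓ - s) g) +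
          2 ^ ℓ * (M 1 * derivNorm ℓ g) +
          2 ^ ℓ * ∑ s ∈ Finset.Icc 1 (ℓ + 1), M s * derivNorm (ℓ + 1 - s) g :=
          add_le_add (add_le_add le_rfl
            (le_mul_of_one_le_left zero_le (one_le_pow₀ (by norm_num))))
            (mul_le_mul_right (sum_mul_derivNorm_grad_le hg _ M ℓ) _)
      _ = _ := by
        rw [sum_Icc_one_succ (fun s => M s * derivNorm (ℓ + 1 - s) g)]
        simp only [Nat.add_sub_add_right, Nat.add_sub_cancel]
        ring

theorem CovFam.eLpNorm_partialD_famEval_le {ℓ : ℕ} (J : Fin ℓ → Fin (m + 1) × Fin d)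
    (h : CovFam U X) {ξ : CVel d m} (hξ : ξ ∈ U) {g : Vel d m → ℂ} (hg : IsTest g)
    {M : ℕ → ℝ≥0∞} (hM : ∀ s, ‖iteratedFDeriv ℂ s X ξ‖ₑ ≤ M s) :
    eLpNorm (RenormalizedPropagator.partialD J (famEval X ξ g)) 2 volume ≤
      2 ^ ℓ * ∑ s ∈ Finset.range (ℓ + 1), M s * derivNorm (ℓ - s) g := by
  obtain ⟨h1, h2⟩ := h.enorm_partialD_famEval_sub_le J hξ hg hM
  have h3 : ‖X ξ (toL2 (RenormalizedPropagator.partialD J g))‖ₑ ≤ 2 ^ ℓ * (M 0 * derivNorm ℓ g) := by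
    refine (ContinuousLinearMap.le_opENorm _ _).trans ?_
    have h4 := hM 0
    rw [enorm_eq_iff_norm_eq.2 norm_iteratedFDeriv_zero] at h4
    refine (mul_le_mul' h4 ?_).trans
      (le_mul_of_one_le_left (zero_le) (one_le_pow₀ (by norm_num)))
    rw [enorm_toL2 ((hg.partialD _).memLp 2)]
    exact eLpNorm_partialD_le _ _
  rw [← enorm_toL2 h1, ← sub_add_cancel (toL2 _) (X ξ (toL2 (RenormalizedPropagator.partialD J g)))]
  refine (enorm_add_le _ _).trans ((add_le_add h2 h3).trans (le_of_eq ?_))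
  rw [← mul_add, add_comm, Finset.range_eq_Ico, Finset.sum_eq_sum_Ico_succ_bot (by omega)]
  rfl

theorem CovFam.derivNorm_famEval_le (ℓ : ℕ) (h : CovFam U X) {ξ : CVel d m} (hξ : ξ ∈ U)
    {g : Vel d m → ℂ} (hg : IsTest g) {M : ℕ → ℝ≥0∞}
    (hM : ∀ s, ‖iteratedFDeriv ℂ s X ξ‖ₑ ≤ M s) :
    derivNorm ℓ (famEval X ξ g) ≤
      (((m + 1) * d : ℕ) : ℝ≥0∞) ^ ℓ * 2 ^ ℓ *
        ∑ s ∈ Finset.range (ℓ + 1), M s * derivNorm (ℓ - s) g := by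
  refine (derivNorm_le_sum _ _).trans ((Finset.sum_le_card_nsmul _ _ _ fun J _ =>
    h.eLpNorm_partialD_famEval_le J hξ hg hM).trans (le_of_eq ?_))
  simp [mul_assoc]

end RenormalizedPropagator

end

noncomputable section

namespace RenormalizedPropagator

/-! ### Weak gradients and smooth approximation -/

open Filter Topology

attribute [local irreducible] tau

variable {d m : ℕ}

/-- `D` is the weak gradient of `f`. -/
def IsWeakGrad (f : L2 d m) (D : Fin (m + 1) × Fin d → L2 d m) : Prop :=
  ∀ φ : Vel d m → ℂ, IsTest φ → ∀ c : Fin (m + 1) × Fin d,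
    inner ℂ (toL2 (grad φ c.1 c.2)) f = -inner ℂ (toL2 φ) (D c)

theorem ext_inner_test {f g : L2 d m}
    (h : ∀ φ : Vel d m → ℂ, IsTest φ → inner ℂ (toL2 φ) f = inner ℂ (toL2 φ) g) : f = g := by
  refine ext_inner_left ℂ fun w => ?_
  have h1 : Continuous fun w : L2 d m => inner ℂ w f := by fun_prop
  have h2 : Continuous fun w : L2 d m => inner ℂ w g := by fun_prop
  refine congrFun (h1.ext_on dense_test h2 ?_) w
  rintro _ ⟨φ, hφ, rfl⟩
  exact h φ hφ

theorem inner_tau_test {φ : Vel d m → ℂ} (h : IsTest φ) (a : Vel d m) (f : L2 d m) :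
    inner ℂ (toL2 φ) (tau a f) = inner ℂ (toL2 fun v => φ (v + -a)) f := by
  rw [← tau_toL2 (-a) (h.memLp 2), inner_tau_left, neg_neg]

theorem IsWeakGrad.tau {f : L2 d m} {D : Fin (m + 1) × Fin d → L2 d m} (h : IsWeakGrad f D)
    (a : Vel d m) : IsWeakGrad (tau a f) fun c => tau a (D c) := by
  intro φ hφ c
  rw [inner_tau_test hφ, inner_tau_test (isTest_grad hφ _ _), ← h _ (hφ.translate (-a)) c]
  congr 2
  funext v
  rw [grad_translate]

/-- The definition pairs bilinearly and the Hilbert space sesquilinearly; since conjugates of test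
functions are test functions, the two notions agree. -/
theorem hasWeakGrad_iff {f : Vel d m → ℂ} {D : Fin (m + 1) → Fin d → Vel d m → ℂ} :
    HasWeakGrad f D ↔ MemLp f 2 volume ∧ (∀ j i, MemLp (D j i) 2 volume) ∧
      IsWeakGrad (toL2 f) fun c => toL2 (D c.1 c.2) := by
  have key : ∀ (φ : Vel d m → ℂ), IsTest φ → ∀ j i, MemLp f 2 volume → MemLp (D j i) 2 volume →
      ((∫ v, grad φ j i v * f v = -∫ v, φ v * D j i v) ↔
        inner ℂ (toL2 (grad (fun v => starRingEnd ℂ (φ v)) j i)) (toL2 f) =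
          -inner ℂ (toL2 fun v => starRingEnd ℂ (φ v)) (toL2 (D j i))) := by
    intro φ hφ j i hf hD
    rw [inner_toL2 ((isTest_grad hφ.conj j i).memLp 2) hf, inner_toL2 (hφ.conj.memLp 2) hD]
    simp only [pairing, grad_conj hφ, Complex.conj_conj]
  constructor
  · rintro ⟨h1, h2⟩
    refine ⟨h1, fun j i => (h2 j i).1, fun φ hφ c => ?_⟩
    have h3 := (key _ hφ.conj c.1 c.2 h1 (h2 _ _).1).1 ((h2 c.1 c.2).2 _ hφ.conj)
    simpa only [Complex.conj_conj] using h3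
  · rintro ⟨h1, h2, h3⟩
    exact ⟨h1, fun j i => ⟨h2 j i, fun φ hφ => (key φ hφ j i h1 (h2 j i)).2 (h3 _ hφ.conj (j, i))⟩⟩

/-- The mollified translates of `f`. -/
def moll (ρ : ContDiffBump (0 : Vel d m)) (f : L2 d m) (a : Vel d m) : L2 d m :=
  ∫ b, ρ.normed volume b • tau (a - b) f

theorem moll_eq_convolution (ρ : ContDiffBump (0 : Vel d m)) (f : L2 d m) :
    moll ρ f = convolution (ρ.normed volume) (fun a => tau a f)
      (ContinuousLinearMap.lsmul ℝ ℝ) volume := rfl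

theorem contDiff_moll (ρ : ContDiffBump (0 : Vel d m)) (f : L2 d m) : ContDiff ℝ ∞ (moll ρ f) := by
  rw [moll_eq_convolution]
  have : (volume : Measure (Vel d m)).IsNegInvariant :=
    ⟨(measurePreserving_pi (fun _ => volume) (fun _ => volume)
      fun _ : Fin (m + 1) => Measure.measurePreserving_neg (volume : Measure (E d))).map_eq⟩
  exact ρ.hasCompactSupport_normed.contDiff_convolution_left (n := (⊤ : ℕ∞)) _ ρ.contDiff_normed
    (continuous_tau f).locallyIntegrable

theorem integrable_moll (ρ : ContDiffBump (0 : Vel d m)) (f : L2 d m) (a : Vel d m) :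
    Integrable fun b => ρ.normed volume b • tau (a - b) f :=
  (ρ.continuous_normed.smul ((continuous_tau f).comp (by fun_prop))).integrable_of_hasCompactSupport
    ρ.hasCompactSupport_normed.smul_right

/-- The orbit of the mollified vector is the mollified orbit, which is smooth as a convolution.
Hence mollified elements of L² are smooth vectors. -/
theorem tau_moll (ρ : ContDiffBump (0 : Vel d m)) (f : L2 d m) (a : Vel d m) :
    tau a (moll ρ f 0) = moll ρ f a := by
  rw [moll, moll, ← (tau a).integral_comp_comm (integrable_moll ρ f 0)]
  congr 1
  funext b
  rw [(tau a).map_smul_of_tower, tau_tau, zero_sub, sub_eq_add_neg]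

theorem IsWeakGrad.moll {f : L2 d m} {D : Fin (m + 1) × Fin d → L2 d m} (h : IsWeakGrad f D)
    (ρ : ContDiffBump (0 : Vel d m)) (a : Vel d m) :
    IsWeakGrad (moll ρ f a) fun c => moll ρ (D c) a := by
  intro φ hφ c
  simp only [RenormalizedPropagator.moll]
  rw [← integral_inner (integrable_moll ρ f a), ← integral_inner (integrable_moll ρ (D c) a),
    ← integral_neg]
  congr 1
  funext b
  have h1 := (h.tau (a - b)) φ hφ c
  have h2 : ∀ (w z : L2 d m) (t : ℝ), inner ℂ w (t • z) = t • inner ℂ w z := fun w z t =>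
    (innerSL ℂ w).map_smul_of_tower t z
  rw [h2, h2, h1, smul_neg]

/-- After pairing with a test function the translation can be moved onto it, where it is
differentiable; the definition of the weak gradient then moves the derivative back. -/
theorem IsWeakGrad.fderiv_moll {f : L2 d m} {D : Fin (m + 1) × Fin d → L2 d m}
    (h : IsWeakGrad f D) (ρ : ContDiffBump (0 : Vel d m)) (a : Vel d m)
    (c : Fin (m + 1) × Fin d) :
    fderiv ℝ (RenormalizedPropagator.moll ρ f) a (coordVec c) =
      RenormalizedPropagator.moll ρ (D c) a := by
  refine ext_inner_test fun φ hφ => ?_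
  have hd : HasFDerivAt (RenormalizedPropagator.moll ρ f)
      (fderiv ℝ (RenormalizedPropagator.moll ρ f) a) a :=
    ((contDiff_moll ρ f).differentiable (by simp)).differentiableAt.hasFDerivAt
  have h1 := ((innerSL ℂ (toL2 φ)).restrictScalars ℝ).hasFDerivAt.comp a hd
  have hneg : HasFDerivAt (fun b : Vel d m => RenormalizedPropagator.tau (-b) (toL2 φ))
      ((dTau φ (-a)).comp (-ContinuousLinearMap.id ℝ (Vel d m))) a := by
    have := (hφ.hasFDerivAt_tau (-a)).comp a ((hasFDerivAt_id a).neg)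
    simpa only [Function.comp_def] using this
  have h2 := hneg.inner ℂ (hasFDerivAt_const (RenormalizedPropagator.moll ρ f 0) a)
  have h3 : (fun b : Vel d m => inner ℂ (RenormalizedPropagator.tau (-b) (toL2 φ))
      (RenormalizedPropagator.moll ρ f 0)) =
      ((innerSL ℂ (toL2 φ)).restrictScalars ℝ) ∘ RenormalizedPropagator.moll ρ f := by
    funext b
    rw [inner_tau_left, neg_neg, tau_moll]
    rfl
  rw [h3] at h2
  have h4 := congrArg (fun L => L (coordVec c)) (h1.unique h2)
  simp only [ContinuousLinearMap.comp_apply, fderivInnerCLM_apply, zero_apply,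
    inner_zero_right, zero_add, ContinuousLinearMap.prod_apply] at h4
  refine h4.trans ?_
  have h5 : dTau φ (-a) ((-ContinuousLinearMap.id ℝ (Vel d m)) (coordVec c)) =
      -RenormalizedPropagator.tau (-a) (toL2 (grad φ c.1 c.2)) := by
    rw [neg_apply, ContinuousLinearMap.id_apply, map_neg, ← hφ.fderiv_tau,
      (hφ.hasFDerivAt_tau (-a)).fderiv]
  rw [h5, inner_neg_left, inner_tau_left, neg_neg, tau_moll, h.moll ρ a φ hφ c, neg_neg]

theorem tendsto_moll (f : L2 d m) (ε : ℝ) (hε : 0 < ε) : ∃ δ > 0, ∀ ρ : ContDiffBump (0 : Vel d m),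
    ρ.rOut < δ → ‖moll ρ f 0 - f‖ ≤ ε := by
  have h := Metric.continuous_iff.1 (continuous_tau f) 0 ε hε
  obtain ⟨δ, hδ, h⟩ := h
  refine ⟨δ, hδ, fun ρ hρ => ?_⟩
  have h1 := ρ.dist_normed_convolution_le (μ := (volume : Measure (Vel d m)))
    (g := fun a => tau a f) (x₀ := 0) (ε := ε)
    (continuous_tau f).aestronglyMeasurable fun x hx => (h x (hx.trans hρ)).le
  rw [dist_eq_norm, ← moll_eq_convolution] at h1
  simpa only [tau_zero] using h1

/-- Functions with a weak gradient are approximated by smooth functions. -/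
theorem IsWeakGrad.exists_smooth {f : L2 d m} {D : Fin (m + 1) × Fin d → L2 d m}
    (h : IsWeakGrad f D) : ∃ u : ℕ → Vel d m → ℂ,
      (∀ n, ContDiff ℝ ∞ (u n)) ∧ (∀ n, MemLp (u n) 2 volume) ∧
      (∀ n (c : Fin (m + 1) × Fin d), MemLp (grad (u n) c.1 c.2) 2 volume) ∧
      Tendsto (fun n => toL2 (u n)) atTop (𝓝 f) ∧
      ∀ c : Fin (m + 1) × Fin d, Tendsto (fun n => toL2 (grad (u n) c.1 c.2)) atTop (𝓝 (D c)) := by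
  let ρ : ℕ → ContDiffBump (0 : Vel d m) := fun n =>
    { rIn := 1 / (n + 1) / 2, rOut := 1 / (n + 1), rIn_pos := by positivity,
      rIn_lt_rOut := half_lt_self (by positivity) }
  have hlim : ∀ g : L2 d m, Tendsto (fun n => RenormalizedPropagator.moll (ρ n) g 0) atTop (𝓝 g) := by
    intro g
    refine Metric.tendsto_atTop'.2 fun ε hε => ?_
    obtain ⟨δ, hδ, h⟩ := tendsto_moll g (ε / 2) (by positivity)
    obtain ⟨n₀, hn₀⟩ := exists_nat_one_div_lt hδ
    refine ⟨n₀, fun n hn => ?_⟩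
    rw [dist_eq_norm]
    refine (h (ρ n) (lt_of_le_of_lt ?_ hn₀)).trans_lt (by linarith)
    change (1 : ℝ) / (n + 1) ≤ 1 / (n₀ + 1)
    have : (n₀ : ℝ) ≤ n := by exact_mod_cast hn.le
    gcongr
  have htau : ∀ n g, (fun a => RenormalizedPropagator.tau a (RenormalizedPropagator.moll (ρ n) g 0)) =
      RenormalizedPropagator.moll (ρ n) g := fun n g => funext fun a => tau_moll (ρ n) g a
  -- Mollification was defined on vectors of L²; the smooth functions themselves are obtained as
  -- pointwise representatives.
  have hrep : ∀ n g, rep (RenormalizedPropagator.moll (ρ n) g) =ᵐ[volume]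
      RenormalizedPropagator.moll (ρ n) g 0 := by
    intro n g
    have h1 := contDiff_moll (ρ n) g
    rw [← htau] at h1
    have h2 := rep_ae_eq h1
    rwa [htau] at h2
  have hmem : ∀ n g, MemLp (rep (RenormalizedPropagator.moll (ρ n) g)) 2 volume := fun n g =>
    (Lp.memLp _).ae_eq (hrep n g).symm
  have hgrad : ∀ n c, grad (rep (RenormalizedPropagator.moll (ρ n) f)) c.1 c.2 =
      rep (RenormalizedPropagator.moll (ρ n) (D c)) := by
    intro n c
    rw [grad_rep (contDiff_moll _ _)]
    congr 1
    funext a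
    exact h.fderiv_moll (ρ n) a c
  refine ⟨fun n => rep (RenormalizedPropagator.moll (ρ n) f), fun n => contDiff_rep (contDiff_moll _ _),
    fun n => hmem n f, fun n c => by rw [hgrad]; exact hmem n _, ?_, fun c => ?_⟩
  · refine (hlim f).congr fun n => ?_
    rw [toL2_congr (hrep n f), toL2_coe]
  · refine (hlim (D c)).congr fun n => ?_
    rw [hgrad, toL2_congr (hrep n (D c)), toL2_coe]

/-- Cut-off functions `χ(v/n)`. -/
theorem exists_cutoff (d m : ℕ) : ∃ χ : ℕ → Vel d m → ℂ, (∀ n, IsTest (χ n)) ∧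
    (∀ n v, ‖χ n v‖ ≤ 1) ∧ (∀ n v, starRingEnd ℂ (χ n v) = χ n v) ∧
    (∀ v, Tendsto (fun n => χ n v) atTop (𝓝 1)) ∧
    (∃ C : ℝ, ∀ n (c : Fin (m + 1) × Fin d) v, ‖grad (χ n) c.1 c.2 v‖ ≤ C) ∧
    ∀ (c : Fin (m + 1) × Fin d) v, Tendsto (fun n => grad (χ n) c.1 c.2 v) atTop (𝓝 0) := by
  let ρ : ContDiffBump (0 : Vel d m) :=
    { rIn := 1, rOut := 2, rIn_pos := one_pos, rIn_lt_rOut := one_lt_two }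
  have hρ : IsTest fun v : Vel d m => ((ρ v : ℝ) : ℂ) :=
    ⟨Complex.ofRealCLM.contDiff.comp ρ.contDiff,
      ρ.hasCompactSupport.comp_left (g := fun x : ℝ => (x : ℂ)) (by simp)⟩
  have hfd := (hρ.1.continuous_fderiv (by simp))
  obtain ⟨C, hC⟩ := (hρ.2.fderiv ℝ).exists_bound_of_continuous hfd
  let s : ℕ → ℝ := fun n => (n + 1 : ℝ)⁻¹
  have hs0 : ∀ n, 0 < s n := fun n => by positivity
  have hs1 : ∀ n, s n ≤ 1 := fun n => inv_le_one_of_one_le₀ (by simp)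
  have hs : Tendsto s atTop (𝓝 0) := by
    simpa [s, one_div] using tendsto_one_div_add_atTop_nhds_zero_nat (𝕜 := ℝ)
  have hgrad : ∀ n (c : Fin (m + 1) × Fin d) v,
      grad (fun v : Vel d m => ((ρ (s n • v) : ℝ) : ℂ)) c.1 c.2 v =
        s n • fderiv ℝ (fun v : Vel d m => ((ρ v : ℝ) : ℂ)) (s n • v) (coordVec c) := by
    intro n c v
    have h1 : HasFDerivAt (fun v : Vel d m => s n • v) (s n • ContinuousLinearMap.id ℝ (Vel d m)) v :=
      (hasFDerivAt_id v).const_smul (s n)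
    have h2 := ((hρ.1.differentiable (by simp)).differentiableAt (x := s n • v)).hasFDerivAt.comp v h1
    have h3 : grad (fun v : Vel d m => ((ρ (s n • v) : ℝ) : ℂ)) c.1 c.2 v = _ :=
      congrArg (fun L => L (coordVec c)) h2.fderiv
    rw [h3]
    simp
  have hcn : ∀ c : Fin (m + 1) × Fin d, ‖(coordVec c : Vel d m)‖ ≤ 1 := fun c => by
    rw [coordVec, Pi.norm_single]; simp
  have hbd : ∀ n (c : Fin (m + 1) × Fin d) v,
      ‖grad (fun v : Vel d m => ((ρ (s n • v) : ℝ) : ℂ)) c.1 c.2 v‖ ≤ s n * C := by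
    intro n c v
    rw [hgrad, norm_smul, Real.norm_of_nonneg (hs0 n).le]
    have hC0 := (norm_nonneg _).trans (hC 0)
    refine mul_le_mul_of_nonneg_left ?_ (hs0 n).le
    refine (ContinuousLinearMap.le_opNorm _ _).trans ?_
    exact (mul_le_of_le_one_right (norm_nonneg _) (hcn c)).trans (hC _)
  have hC0 := (norm_nonneg _).trans (hC 0)
  refine ⟨fun n v => ((ρ (s n • v) : ℝ) : ℂ), fun n => ⟨?_, ?_⟩, fun n v => ?_, fun n v => ?_,
    fun v => ?_, ⟨C, fun n c v => (hbd n c v).trans (mul_le_of_le_one_left hC0 (hs1 n))⟩,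
    fun c v => ?_⟩
  · exact hρ.1.comp (contDiff_const_smul (s n))
  · exact hρ.2.comp_homeomorph (Homeomorph.smulOfNeZero (s n) (hs0 n).ne')
  · rw [Complex.norm_real, Real.norm_of_nonneg ρ.nonneg]; exact ρ.le_one
  · exact Complex.conj_ofReal _
  · refine tendsto_const_nhds.congr' ?_
    have h1 : Tendsto (fun n => s n • v) atTop (𝓝 0) := by simpa using hs.smul_const v
    filter_upwards [h1.eventually (Metric.closedBall_mem_nhds 0 one_pos)] with n hn
    rw [ρ.one_of_mem_closedBall hn, Complex.ofReal_one]
  · refine squeeze_zero_norm (fun n => hbd n c v) ?_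
    simpa using hs.mul_const C

theorem memLp_mul_bounded {χ f : Vel d m → ℂ} (hχ : Continuous χ) {C : ℝ} (hC : ∀ v, ‖χ v‖ ≤ C)
    (hf : MemLp f 2 volume) : MemLp (fun v => χ v * f v) 2 volume :=
  hf.of_le_mul (c := C) (hχ.aestronglyMeasurable.mul hf.1) (ae_of_all _ fun v => by
    rw [norm_mul]; gcongr; exact hC v)

/-- Multiplications by uniformly bounded, pointwise convergent functions converge weakly. -/
theorem tendsto_inner_mul {χ : ℕ → Vel d m → ℂ} {χ₀ : Vel d m → ℂ} (hχ : ∀ n, Continuous (χ n))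
    {C : ℝ} (hC : ∀ n v, ‖χ n v‖ ≤ C) (hχ₀ : Continuous χ₀) (hC₀ : ∀ v, ‖χ₀ v‖ ≤ C)
    (hlim : ∀ v, Tendsto (fun n => χ n v) atTop (𝓝 (χ₀ v))) (f g : L2 d m) :
    Tendsto (fun n => inner ℂ f (toL2 fun v => χ n v * g v)) atTop
      (𝓝 (inner ℂ f (toL2 fun v => χ₀ v * g v))) := by
  have h1 : ∀ {χ : Vel d m → ℂ}, Continuous χ → (∀ v, ‖χ v‖ ≤ C) →
      inner ℂ f (toL2 fun v => χ v * g v) = ∫ v, starRingEnd ℂ (f v) * (χ v * g v) := by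
    intro χ hχ hC
    conv_lhs => rw [← toL2_coe f]
    exact inner_toL2 (Lp.memLp f) (memLp_mul_bounded hχ hC (Lp.memLp g))
  simp only [h1 (hχ _) (hC _), h1 hχ₀ hC₀]
  have hint : Integrable (fun v => C * (‖f v‖ * ‖g v‖)) volume :=
    ((Lp.memLp f).norm.integrable_mul (Lp.memLp g).norm).const_mul C
  refine tendsto_integral_of_dominated_convergence _ (fun n => ?_) hint (fun n => ae_of_all _ fun v => ?_)
    (ae_of_all _ fun v => ?_)
  · exact (Complex.continuous_conj.comp_aestronglyMeasurable (Lp.memLp f).1).mul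
      ((hχ n).aestronglyMeasurable.mul (Lp.memLp g).1)
  · rw [norm_mul, norm_mul, RCLike.norm_conj]
    calc ‖f v‖ * (‖χ n v‖ * ‖g v‖) = ‖χ n v‖ * (‖f v‖ * ‖g v‖) := by ring
      _ ≤ C * (‖f v‖ * ‖g v‖) := by gcongr; exact hC n v
  · exact tendsto_const_nhds.mul ((hlim v).mul tendsto_const_nhds)

theorem inner_toL2_mul {χ φ : Vel d m → ℂ} (hχ : Continuous χ) {C : ℝ} (hC : ∀ v, ‖χ v‖ ≤ C)
    (hφ : MemLp φ 2 volume) (g : L2 d m) :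
    inner ℂ (toL2 fun v => χ v * φ v) g =
      inner ℂ (toL2 φ) (toL2 fun v => starRingEnd ℂ (χ v) * g v) := by
  have h1 : MemLp (fun v => starRingEnd ℂ (χ v) * g v) 2 volume :=
    memLp_mul_bounded (Complex.continuous_conj.comp hχ) (C := C) (by simpa using hC) (Lp.memLp g)
  rw [inner_toL2_coe (memLp_mul_bounded hχ hC hφ), inner_toL2 hφ h1]
  simp only [pairing, map_mul]
  congr 1
  funext v
  ring

end RenormalizedPropagator

end

noncomputable section

namespace RenormalizedPropagator

/-! ### The weak form of the resolvent equation -/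

open Filter Topology

attribute [local irreducible] tau

variable {d m : ℕ}

/-- Square-integrable velocity gradients. -/
abbrev GradSp (d m : ℕ) := PiLp 2 fun _ : Fin (m + 1) × Fin d => L2 d m

/-- Pairs of a function and its gradient. -/
def Pairs (d m : ℕ) := WithLp 2 (L2 d m × GradSp d m)

instance : NormedAddCommGroup (Pairs d m) :=
  inferInstanceAs (NormedAddCommGroup (WithLp 2 (L2 d m × GradSp d m)))

instance : InnerProductSpace ℂ (Pairs d m) :=
  inferInstanceAs (InnerProductSpace ℂ (WithLp 2 (L2 d m × GradSp d m)))

instance : CompleteSpace (Pairs d m) :=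
  inferInstanceAs (CompleteSpace (WithLp 2 (L2 d m × GradSp d m)))

/-- The function. -/
def fstP (d m : ℕ) : Pairs d m →L[ℂ] L2 d m := WithLp.fstL 2 ℂ (L2 d m) (GradSp d m)

/-- The gradient. -/
def sndP (d m : ℕ) : Pairs d m →L[ℂ] GradSp d m := WithLp.sndL 2 ℂ (L2 d m) (GradSp d m)

/-- The first component. -/
def Pairs.fst (x : Pairs d m) : L2 d m := fstP d m x

/-- The second component. -/
def Pairs.snd (x : Pairs d m) : GradSp d m := sndP d m x

/-- The pair with given components. -/
def mkP (f : L2 d m) (D : GradSp d m) : Pairs d m := (WithLp.toLp 2 (f, D) : WithLp 2 _)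

theorem fst_mkP (f : L2 d m) (D : GradSp d m) : (mkP f D).fst = f := rfl

theorem snd_mkP (f : L2 d m) (D : GradSp d m) : (mkP f D).snd = D := rfl

theorem fst_add (x y : Pairs d m) : (x + y).fst = x.fst + y.fst := (fstP d m).map_add x y

theorem snd_add (x y : Pairs d m) : (x + y).snd = x.snd + y.snd := (sndP d m).map_add x y

theorem fst_sub (x y : Pairs d m) : (x - y).fst = x.fst - y.fst := (fstP d m).map_sub x y

theorem fst_smul (r : ℂ) (x : Pairs d m) : (r • x).fst = r • x.fst := (fstP d m).map_smul r x

theorem snd_smul (r : ℂ) (x : Pairs d m) : (r • x).snd = r • x.snd := (sndP d m).map_smul r x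

theorem inner_pairs (x y : Pairs d m) : inner ℂ x y = inner ℂ x.fst y.fst + inner ℂ x.snd y.snd :=
  WithLp.prod_inner_apply (𝕜 := ℂ) (E := L2 d m) (F := GradSp d m) x y

theorem norm_sq_pairs (x : Pairs d m) : ‖x‖ ^ 2 = ‖x.fst‖ ^ 2 + ‖x.snd‖ ^ 2 :=
  WithLp.prod_norm_sq_eq_of_L2 (α := L2 d m) (β := GradSp d m) x

/-- The Sobolev space `H¹`, as the space of pairs of a function and its weak gradient. -/
def sobolev (d m : ℕ) : Submodule ℂ (Pairs d m) where
  carrier := {x | IsWeakGrad x.fst fun c => x.snd c}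
  add_mem' := by
    intro x y hx hy φ hφ c
    have h1 := hx φ hφ c
    have h2 := hy φ hφ c
    simp only [fst_add, snd_add, PiLp.add_apply, inner_add_right] at h1 h2 ⊢
    rw [h1, h2, neg_add]
  zero_mem' := by
    intro φ hφ c
    have h1 : (0 : Pairs d m).fst = 0 := (fstP d m).map_zero
    have h2 : (0 : Pairs d m).snd = 0 := (sndP d m).map_zero
    simp [h1, h2]
  smul_mem' := by
    intro r x hx φ hφ c
    have h1 := hx φ hφ c
    simp only [fst_smul, snd_smul, PiLp.smul_apply, inner_smul_right] at h1 ⊢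
    rw [h1, mul_neg]

theorem mem_sobolev {x : Pairs d m} : x ∈ sobolev d m ↔ IsWeakGrad x.fst fun c => x.snd c := Iff.rfl

theorem isClosed_sobolev : IsClosed (sobolev d m : Set (Pairs d m)) := by
  have : (sobolev d m : Set (Pairs d m)) = ⋂ φ : {φ : Vel d m → ℂ // IsTest φ},
      ⋂ c : Fin (m + 1) × Fin d, {x | inner ℂ (toL2 (grad φ.1 c.1 c.2)) x.fst =
        -inner ℂ (toL2 φ.1) (x.snd c)} := by
    ext x
    simp only [SetLike.mem_coe, mem_sobolev, IsWeakGrad, Set.mem_iInter, Set.mem_ofPred_eq,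
      Subtype.forall]
  rw [this]
  refine isClosed_iInter fun φ => isClosed_iInter fun c => isClosed_eq ?_ ?_
  · exact continuous_const.inner (fstP d m).continuous
  · exact (continuous_const.inner ((PiLp.proj 2 (fun _ : Fin (m + 1) × Fin d => L2 d m) c :
      GradSp d m →L[ℂ] L2 d m).continuous.comp
        (sndP d m).continuous)).neg

instance : CompleteSpace (sobolev d m) := isClosed_sobolev.completeSpace_coe

/-- A function with its gradient. -/
def gradPair (φ : Vel d m → ℂ) : Pairs d m :=
  mkP (toL2 φ) (WithLp.toLp 2 fun c => toL2 (grad φ c.1 c.2))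

theorem gradPair_fst (φ : Vel d m → ℂ) : (gradPair φ).fst = toL2 φ := rfl

theorem gradPair_snd (φ : Vel d m → ℂ) (c : Fin (m + 1) × Fin d) :
    (gradPair φ).snd c = toL2 (grad φ c.1 c.2) := rfl

theorem pairing_grad_eq_neg {φ u : Vel d m → ℂ} (hφ : IsTest φ) (hu : ContDiff ℝ ∞ u)
    (j : Fin (m + 1)) (i : Fin d) : pairing (grad φ j i) u = -pairing φ (grad u j i) := by
  have h1 := integral_bilinear_fderiv_right_eq_neg_left_of_integrable
    (B := ContinuousLinearMap.mul ℝ ℂ) (f := fun v => starRingEnd ℂ (φ v)) (g := u)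
    (v := coordVec (j, i)) (μ := (volume : Measure (Vel d m))) ?_ ?_ ?_
    (fun x _ => (hφ.conj.1.differentiable (by simp)).differentiableAt)
    (fun x _ => (hu.differentiable (by simp)).differentiableAt)
  · simp only [ContinuousLinearMap.mul_apply'] at h1
    simp only [pairing]
    rw [show ∫ v, starRingEnd ℂ (φ v) * grad u j i v = _ from h1, neg_neg]
    refine integral_congr_ae (ae_of_all _ fun v => ?_)
    change starRingEnd ℂ (grad φ j i v) * u v = grad (fun v => starRingEnd ℂ (φ v)) j i v * u v
    rw [grad_conj hφ]
  all_goals simp only [ContinuousLinearMap.mul_apply']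
  · exact ((contDiff_fderiv_apply hφ.conj.1 _).continuous.mul
      hu.continuous).integrable_of_hasCompactSupport ((hφ.conj.2.fderiv_apply ℝ _).mul_right)
  · exact (hφ.conj.1.continuous.mul
      (contDiff_fderiv_apply hu _).continuous).integrable_of_hasCompactSupport hφ.conj.2.mul_right
  · exact (hφ.conj.1.continuous.mul
      hu.continuous).integrable_of_hasCompactSupport hφ.conj.2.mul_right

theorem IsTest.gradPair_mem {φ : Vel d m → ℂ} (h : IsTest φ) : gradPair φ ∈ sobolev d m := by
  intro ψ hψ c
  change inner ℂ (toL2 (grad ψ c.1 c.2)) (toL2 φ) = -inner ℂ (toL2 ψ) (toL2 (grad φ c.1 c.2))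
  rw [inner_toL2 ((isTest_grad hψ _ _).memLp 2) (h.memLp 2),
    inner_toL2 (hψ.memLp 2) ((isTest_grad h _ _).memLp 2), pairing_grad_eq_neg hψ h.1]

/-- The multiplication `φ ↦ -i k·v φ`. -/
def transport (k : Vel d m) (φ : Vel d m → ℂ) (v : Vel d m) : ℂ :=
  -(I * ((∑ l, inner ℝ (k l) (v l) : ℝ) : ℂ)) * φ v

theorem contDiff_transport_factor (k : Vel d m) :
    ContDiff ℝ ∞ fun v : Vel d m => -(I * ((∑ l, inner ℝ (k l) (v l) : ℝ) : ℂ)) := by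
  have h : ContDiff ℝ ∞ fun v : Vel d m => ∑ l, inner ℝ (k l) (v l) :=
    ContDiff.sum fun l _ => contDiff_const.inner ℝ
      (ContinuousLinearMap.proj (R := ℝ) (φ := fun _ : Fin (m + 1) => E d) l).contDiff
  exact (contDiff_const.mul (Complex.ofRealCLM.contDiff.comp h)).neg

theorem IsTest.transport {φ : Vel d m → ℂ} (h : IsTest φ) (k : Vel d m) :
    IsTest (transport k φ) := h.mul_left (contDiff_transport_factor k)

theorem transport_add (k : Vel d m) (φ ψ : Vel d m → ℂ) :
    transport k (φ + ψ) = transport k φ + transport k ψ := by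
  funext v; simp [transport, mul_add]

theorem transport_smul (k : Vel d m) (c : ℂ) (φ : Vel d m → ℂ) :
    transport k (c • φ) = c • transport k φ := by
  funext v; simp only [transport, Pi.smul_apply, smul_eq_mul]; ring

theorem tendsto_inner_cutoff {χ : ℕ → Vel d m → ℂ} {χ₀ : ℂ} (hχ : ∀ n, IsTest (χ n)) {C : ℝ}
    (hC : ∀ n v, ‖χ n v‖ ≤ C) (hC₀ : ‖χ₀‖ ≤ C)
    (hlim : ∀ v, Tendsto (fun n => χ n v) atTop (𝓝 χ₀)) (f g : L2 d m) :
    Tendsto (fun n => inner ℂ f (toL2 fun v => χ n v * g v)) atTop (𝓝 (χ₀ * inner ℂ f g)) := by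
  have h := tendsto_inner_mul (χ₀ := fun _ => χ₀) (fun n => (hχ n).1.continuous) hC
    continuous_const (fun _ => hC₀) hlim f g
  have h1 : (toL2 fun v => χ₀ * g v) = χ₀ • g := by
    conv_rhs => rw [← toL2_coe g, ← toL2_smul χ₀ (Lp.memLp g)]
    rfl
  rwa [h1, inner_smul_right] at h

theorem grad_mul {χ u : Vel d m → ℂ} (hχ : ContDiff ℝ ∞ χ) (hu : ContDiff ℝ ∞ u) (j : Fin (m + 1))
    (i : Fin d) : grad (fun v => χ v * u v) j i =
      (fun v => χ v * grad u j i v) + fun v => grad χ j i v * u v := by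
  funext v
  have h1 := (hχ.differentiable (by simp)).differentiableAt (x := v)
  have h2 := (hu.differentiable (by simp)).differentiableAt (x := v)
  simp only [grad, Pi.add_apply]
  rw [fderiv_fun_mul h1 h2]
  simp only [add_apply, smul_apply, smul_eq_mul]
  ring

theorem IsTest.exists_bound {χ : Vel d m → ℂ} (h : IsTest χ) : ∃ C : ℝ, ∀ v, ‖χ v‖ ≤ C :=
  h.2.exists_bound_of_continuous h.1.continuous

theorem toL2_conj_mul_congr {χ : Vel d m → ℂ} (h : ∀ v, starRingEnd ℂ (χ v) = χ v) (g : L2 d m) :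
    (toL2 fun v => starRingEnd ℂ (χ v) * g v) = toL2 fun v => χ v * g v := by simp only [h]

theorem re_inner_mul_self_eq_zero {χ : Vel d m → ℂ} (hχ : IsTest χ)
    (hre : ∀ v, starRingEnd ℂ (χ v) = -χ v) (f : L2 d m) :
    (inner ℂ f (toL2 fun v => χ v * f v)).re = 0 := by
  obtain ⟨C, hC⟩ := hχ.exists_bound
  have h1 : inner ℂ f (toL2 fun v => χ v * f v) = pairing f fun v => χ v * f v := by
    have := inner_toL2 (Lp.memLp f) (memLp_mul_bounded hχ.1.continuous hC (Lp.memLp f))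
    rwa [toL2_coe] at this
  have h2 : starRingEnd ℂ (pairing f fun v => χ v * f v) = -pairing f fun v => χ v * f v := by
    rw [pairing, ← integral_conj, ← integral_neg]
    congr 1
    funext v
    simp only [map_mul, hre, Complex.conj_conj]
    ring
  rw [h1]
  have := congrArg Complex.re h2
  rw [Complex.conj_re, Complex.neg_re] at this
  linarith

/-- The product rule for ∇(χu), with the real factors χ and ∇χ moved to the other side. There they
multiply fixed elements of L², so that u need only converge in H¹. -/
theorem inner_gradPair_cutoff {χ u : Vel d m → ℂ} (hχ : IsTest χ) (hu : ContDiff ℝ ∞ u)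
    (hu2 : MemLp u 2 volume) (hgu : ∀ c : Fin (m + 1) × Fin d, MemLp (grad u c.1 c.2) 2 volume)
    (hre : ∀ v, starRingEnd ℂ (χ v) = χ v) (z : Pairs d m) :
    inner ℂ (gradPair fun v => χ v * u v) z =
      inner ℂ (toL2 u) (toL2 fun v => χ v * z.fst v) +
      ∑ c : Fin (m + 1) × Fin d, (inner ℂ (toL2 (grad u c.1 c.2)) (toL2 fun v => χ v * z.snd c v) +
        inner ℂ (toL2 u) (toL2 fun v => grad χ c.1 c.2 v * z.snd c v)) := by
  obtain ⟨C, hC⟩ := hχ.exists_bound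
  have hreg : ∀ (c : Fin (m + 1) × Fin d) v,
      starRingEnd ℂ (grad χ c.1 c.2 v) = grad χ c.1 c.2 v := by
    intro c v
    rw [← grad_conj hχ]
    simp only [hre]
  rw [inner_pairs, PiLp.inner_apply, gradPair_fst,
    inner_toL2_mul hχ.1.continuous hC hu2, toL2_conj_mul_congr hre]
  congr 1
  refine Finset.sum_congr rfl fun c _ => ?_
  obtain ⟨C', hC'⟩ := (isTest_grad hχ c.1 c.2).exists_bound
  have hcg := (isTest_grad hχ c.1 c.2).1.continuous
  rw [gradPair_snd, grad_mul hχ.1 hu, toL2_add (memLp_mul_bounded hχ.1.continuous hC (hgu c))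
    (memLp_mul_bounded hcg hC' hu2), inner_add_left, inner_toL2_mul hχ.1.continuous hC (hgu c),
    inner_toL2_mul hcg hC' hu2, toL2_conj_mul_congr hre, toL2_conj_mul_congr (hreg c)]

/-- The transport term does not contribute to energies. -/
theorem re_inner_eq_zero_of_transport {k : Vel d m} {x z : Pairs d m} (hx : x ∈ sobolev d m)
    (h : ∀ φ : Vel d m → ℂ, IsTest φ →
      inner ℂ (toL2 (transport k φ)) x.fst = inner ℂ (gradPair φ) z) :
    (inner ℂ x z).re = 0 := by
  obtain ⟨u, hu, hu2, hgu, hlim, hlimg⟩ := IsWeakGrad.exists_smooth (mem_sobolev.1 hx)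
  obtain ⟨χ, hχ, hχ1, hχre, hχlim, ⟨C, hχg⟩, hχglim⟩ := exists_cutoff d m
  -- At fixed cut-off the equation is tested with χ_n u_l and l → ∞ is taken first: the transport
  -- factor is then bounded. Only afterwards is the cut-off removed.
  have key : ∀ n, (inner ℂ x.fst (toL2 fun v => χ n v * z.fst v) +
      ∑ c : Fin (m + 1) × Fin d, (inner ℂ (x.snd c) (toL2 fun v => χ n v * z.snd c v) +
        inner ℂ x.fst (toL2 fun v => grad (χ n) c.1 c.2 v * z.snd c v))).re = 0 := by
    intro n
    let κ : Vel d m → ℂ := fun v => starRingEnd ℂ (transport k (χ n) v)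
    have hκ : IsTest κ := ((hχ n).transport k).conj
    obtain ⟨Cκ, hCκ⟩ := ((hχ n).transport k).exists_bound
    have h1 : ∀ l, inner ℂ (toL2 (u l)) (toL2 fun v => κ v * x.fst v) =
        inner ℂ (toL2 (u l)) (toL2 fun v => χ n v * z.fst v) +
        ∑ c : Fin (m + 1) × Fin d,
          (inner ℂ (toL2 (grad (u l) c.1 c.2)) (toL2 fun v => χ n v * z.snd c v) +
          inner ℂ (toL2 (u l)) (toL2 fun v => grad (χ n) c.1 c.2 v * z.snd c v)) := by
      intro l
      have htest : IsTest fun v => χ n v * u l v :=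
        ⟨(hχ n).1.mul (hu l), (hχ n).2.mul_right⟩
      rw [← inner_gradPair_cutoff (hχ n) (hu l) (hu2 l) (hgu l) (hχre n) z, ← h _ htest]
      have h2 : transport k (fun v => χ n v * u l v) = fun v => transport k (χ n) v * u l v := by
        funext v; simp only [transport]; ring
      rw [h2, inner_toL2_mul ((hχ n).transport k).1.continuous hCκ (hu2 l)]
    have h2 : Tendsto (fun l => inner ℂ (toL2 (u l)) (toL2 fun v => κ v * x.fst v)) atTop
        (𝓝 (inner ℂ x.fst (toL2 fun v => κ v * x.fst v))) := hlim.inner tendsto_const_nhds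
    have h3 := (hlim.inner (tendsto_const_nhds (x := toL2 fun v => χ n v * z.fst v))).add
      (tendsto_finsetSum Finset.univ fun (c : Fin (m + 1) × Fin d) _ =>
        ((hlimg c).inner (𝕜 := ℂ) (tendsto_const_nhds (x := toL2 fun v => χ n v * z.snd c v))).add
        (hlim.inner (𝕜 := ℂ)
          (tendsto_const_nhds (x := toL2 fun v => grad (χ n) c.1 c.2 v * z.snd c v))))
    have h4 := tendsto_nhds_unique (h2.congr h1) h3
    rw [← h4]
    -- The localized transport factor takes purely imaginary values, so its quadratic form has no
    -- real part.
    refine re_inner_mul_self_eq_zero hκ (fun v => ?_) x.fst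
    simp only [κ, transport, map_mul, map_neg, Complex.conj_I, Complex.conj_ofReal,
      hχre]
    ring
  have hC0 : ∀ c : Fin (m + 1) × Fin d, ‖(0 : ℂ)‖ ≤ C := fun c => by
    rw [norm_zero]; exact (norm_nonneg _).trans (hχg 0 c 0)
  -- As n → ∞ the terms with χ_n tend to those without cut-off, while the terms with ∇χ_n vanish.
  have h5 := (tendsto_inner_cutoff (χ₀ := 1) hχ hχ1 (by simp) hχlim x.fst z.fst).add
    (tendsto_finsetSum Finset.univ fun (c : Fin (m + 1) × Fin d) _ =>
      (tendsto_inner_cutoff (χ₀ := 1) hχ hχ1 (by simp) hχlim (x.snd c) (z.snd c)).add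
      (tendsto_inner_cutoff (χ₀ := 0) (fun n => isTest_grad (hχ n) c.1 c.2) (fun n v => hχg n c v)
        (hC0 c) (hχglim c) x.fst (z.snd c)))
  have h6 := (Complex.continuous_re.tendsto _).comp h5
  have h7 := tendsto_nhds_unique h6 (tendsto_const_nhds.congr fun n => (key n).symm)
  simpa [inner_pairs, PiLp.inner_apply] using h7

/-! ### Energy identity, uniqueness and existence for the weak equation. -/

/-- `x` solves `(B + i k·v) x = y` in the weak sense. -/
def IsSol (k : Vel d m) (B : Pairs d m →L[ℂ] Pairs d m) (y x : Pairs d m) : Prop :=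
  x ∈ sobolev d m ∧ ∀ φ : Vel d m → ℂ, IsTest φ →
    inner ℂ (gradPair φ) (B x) + inner ℂ (toL2 (transport k φ)) x.fst = inner ℂ (gradPair φ) y

/-- The energy identity. -/
theorem IsSol.energy {k : Vel d m} {B : Pairs d m →L[ℂ] Pairs d m} {y x : Pairs d m}
    (h : IsSol k B y x) : (inner ℂ x (B x)).re = (inner ℂ x y).re := by
  have := re_inner_eq_zero_of_transport (z := y - B x) h.1 fun φ hφ => by
    rw [inner_sub_right, ← h.2 φ hφ, add_sub_cancel_left]
  rw [inner_sub_right, Complex.sub_re] at this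
  linarith

theorem IsSol.sub {k : Vel d m} {B : Pairs d m →L[ℂ] Pairs d m} {y x y' x' : Pairs d m}
    (h : IsSol k B y x) (h' : IsSol k B y' x') : IsSol k B (y - y') (x - x') := by
  refine ⟨(sobolev d m).sub_mem h.1 h'.1, fun φ hφ => ?_⟩
  rw [map_sub, fst_sub, inner_sub_right, inner_sub_right, inner_sub_right, ← h.2 φ hφ,
    ← h'.2 φ hφ]
  ring

/-- Coercivity with constant `c`. -/
def Coercive (c : ℝ) (B : Pairs d m →L[ℂ] Pairs d m) : Prop :=
  ∀ x, c * ‖x‖ ^ 2 ≤ (inner ℂ x (B x)).re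

theorem IsSol.norm_le {k : Vel d m} {B : Pairs d m →L[ℂ] Pairs d m} {y x : Pairs d m} {c : ℝ}
    (h : IsSol k B y x) (hB : Coercive c B) : c * ‖x‖ ≤ ‖y‖ := by
  rcases (norm_nonneg x).eq_or_lt with h0 | h0
  · rw [← h0, mul_zero]; exact norm_nonneg y
  · refine le_of_mul_le_mul_right ?_ h0
    calc c * ‖x‖ * ‖x‖ = c * ‖x‖ ^ 2 := by ring
      _ ≤ (inner ℂ x (B x)).re := hB x
      _ = (inner ℂ x y).re := h.energy
      _ ≤ ‖inner ℂ x y‖ := Complex.re_le_norm _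
      _ ≤ ‖x‖ * ‖y‖ := norm_inner_le_norm _ _
      _ = ‖y‖ * ‖x‖ := mul_comm _ _

theorem IsSol.unique {k : Vel d m} {B : Pairs d m →L[ℂ] Pairs d m} {y x x' : Pairs d m} {c : ℝ}
    (hc : 0 < c) (hB : Coercive c B) (h : IsSol k B y x) (h' : IsSol k B y x') : x = x' := by
  have h1 := (h.sub h').norm_le hB
  rw [sub_self, norm_zero] at h1
  have h2 : ‖x - x'‖ ≤ 0 := by nlinarith [norm_nonneg (x - x')]
  exact sub_eq_zero.1 (norm_le_zero_iff.1 h2)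

/-- The test functions. -/
def testSpace (d m : ℕ) : Submodule ℂ (Vel d m → ℂ) where
  carrier := {φ | IsTest φ}
  add_mem' := fun h h' => h.add h'
  zero_mem' := isTest_zero
  smul_mem' := fun c _ h => h.smul c

theorem grad_add {φ ψ : Vel d m → ℂ} (h : ContDiff ℝ ∞ φ) (h' : ContDiff ℝ ∞ ψ) (j : Fin (m + 1))
    (i : Fin d) : grad (φ + ψ) j i = grad φ j i + grad ψ j i := by
  funext v
  simp only [grad, Pi.add_apply]
  rw [fderiv_add (h.differentiable (by simp)).differentiableAt
    (h'.differentiable (by simp)).differentiableAt, add_apply]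

theorem grad_smul {φ : Vel d m → ℂ} (h : ContDiff ℝ ∞ φ) (c : ℂ) (j : Fin (m + 1))
    (i : Fin d) : grad (c • φ) j i = c • grad φ j i := by
  funext v
  simp only [grad, Pi.smul_apply]
  rw [fderiv_const_smul (h.differentiable (by simp)).differentiableAt, smul_apply]

theorem gradPair_add {φ ψ : Vel d m → ℂ} (h : IsTest φ) (h' : IsTest ψ) :
    gradPair (φ + ψ) = gradPair φ + gradPair ψ := by
  rw [gradPair, toL2_add (h.memLp 2) (h'.memLp 2)]
  simp only [grad_add h.1 h'.1,
    fun j i => toL2_add ((isTest_grad h j i).memLp 2) ((isTest_grad h' j i).memLp 2)]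
  rfl

theorem gradPair_smul {φ : Vel d m → ℂ} (h : IsTest φ) (c : ℂ) :
    gradPair (c • φ) = c • gradPair φ := by
  rw [gradPair, toL2_smul c (h.memLp 2)]
  simp only [grad_smul h.1, fun j i => toL2_smul c ((isTest_grad h j i).memLp 2)]
  rfl

/-- `gradPair` as a linear map. -/
def gradPairL (d m : ℕ) : testSpace d m →ₗ[ℂ] Pairs d m where
  toFun φ := gradPair φ.1
  map_add' φ ψ := gradPair_add φ.2 ψ.2
  map_smul' c φ := gradPair_smul φ.2 c

/-- Weak formulations of coercive problems on a closed subspace are solvable. -/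
theorem exists_op_of_coercive {F H : Type} [AddCommGroup F] [Module ℂ F] [NormedAddCommGroup H]
    [InnerProductSpace ℂ H] [CompleteSpace H] (X : Submodule ℂ H) [CompleteSpace X]
    (J L : F →ₗ[ℂ] H) (hJ : ∀ φ, J φ ∈ X) {c : ℝ} (hc : 0 < c)
    (hL : ∀ φ, c * ‖J φ‖ ^ 2 ≤ (inner ℂ (L φ) (J φ)).re)
    (hdense : ∀ x ∈ X, (∀ φ, inner ℂ (L φ) x = 0) → x = 0) :
    ∃ G : H →L[ℂ] H, ∀ y, G y ∈ X ∧ ∀ φ, inner ℂ (L φ) (G y) = inner ℂ (J φ) y := by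
  let J' : F →ₗ[ℂ] X := J.codRestrict X hJ
  let L' : F →ₗ[ℂ] X := X.subtypeL.adjoint.toLinearMap ∘ₗ L
  have hin : ∀ φ (x : X), inner ℂ (L' φ) x = inner ℂ (L φ) (x : H) := fun φ x =>
    ContinuousLinearMap.adjoint_inner_left X.subtypeL x (L φ)
  have hd : DenseRange L' := by
    have h1 : (LinearMap.range L').topologicalClosure = ⊤ := by
      rw [Submodule.topologicalClosure_eq_top_iff, Submodule.eq_bot_iff]
      intro x hx
      refine Subtype.ext (hdense x.1 x.2 fun φ => ?_)
      have := (Submodule.mem_orthogonal _ _).1 hx _ (LinearMap.mem_range_self L' φ)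
      rwa [hin] at this
    intro x
    have h2 : x ∈ (LinearMap.range L').topologicalClosure := by rw [h1]; trivial
    simpa only [← SetLike.mem_coe, Submodule.topologicalClosure_coe, LinearMap.coe_range] using h2
  have hn : ∀ φ, ‖J' φ‖ ≤ c⁻¹ * ‖L' φ‖ := by
    intro φ
    rw [inv_mul_eq_div, le_div_iff₀ hc, mul_comm]
    rcases (norm_nonneg (J' φ)).eq_or_lt with h0 | h0
    · rw [← h0, mul_zero]; exact norm_nonneg _
    · refine le_of_mul_le_mul_right ?_ h0
      calc c * ‖J' φ‖ * ‖J' φ‖ = c * ‖J φ‖ ^ 2 := by rw [sq, mul_assoc]; rfl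
        _ ≤ (inner ℂ (L φ) (J φ)).re := hL φ
        _ = (inner ℂ (L' φ) (J' φ)).re := by rw [hin]; rfl
        _ ≤ ‖inner ℂ (L' φ) (J' φ)‖ := Complex.re_le_norm _
        _ ≤ ‖L' φ‖ * ‖J' φ‖ := norm_inner_le_norm _ _
  -- Coercivity on test vectors gives ‖J'φ‖ ≤ c⁻¹‖L'φ‖, so L'φ ↦ J'φ extends from a dense range. The
  -- adjoint of the extension solves the weak problem, as in Lions' projection lemma.
  obtain ⟨Γ, hΓ⟩ : ∃ Γ : X →L[ℂ] X, ∀ φ, Γ (L' φ) = J' φ :=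
    ⟨_, LinearMap.extendOfNorm_eq hd ⟨_, hn⟩⟩
  refine ⟨X.subtypeL ∘L Γ.adjoint ∘L X.subtypeL.adjoint, fun y => ⟨Subtype.prop _, fun φ => ?_⟩⟩
  refine (hin φ (Γ.adjoint (X.subtypeL.adjoint y))).symm.trans ?_
  rw [ContinuousLinearMap.adjoint_inner_right, hΓ, ContinuousLinearMap.adjoint_inner_right]
  rfl

/-- Functions as pairs with vanishing gradient component. -/
def inlP (d m : ℕ) : L2 d m →L[ℂ] Pairs d m := (fstP d m).adjoint

theorem inner_inlP_left (f : L2 d m) (x : Pairs d m) : inner ℂ (inlP d m f) x = inner ℂ f x.fst :=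
  ContinuousLinearMap.adjoint_inner_left _ _ _

theorem inner_inlP_right (f : L2 d m) (x : Pairs d m) : inner ℂ x (inlP d m f) = inner ℂ x.fst f :=
  ContinuousLinearMap.adjoint_inner_right _ _ _

theorem inlP_eq (f : L2 d m) : inlP d m f = mkP f 0 := by
  refine ext_inner_right ℂ fun y => ?_
  rw [inner_inlP_left, inner_pairs, fst_mkP, snd_mkP, inner_zero_left, add_zero]

/-- The inclusion of the gradient component. -/
def inrP (d m : ℕ) : GradSp d m →L[ℂ] Pairs d m := (sndP d m).adjoint

theorem inner_inrP_left (D : GradSp d m) (x : Pairs d m) :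
    inner ℂ (inrP d m D) x = inner ℂ D x.snd :=
  ContinuousLinearMap.adjoint_inner_left _ _ _

theorem inner_inrP_right (D : GradSp d m) (x : Pairs d m) :
    inner ℂ x (inrP d m D) = inner ℂ x.snd D :=
  ContinuousLinearMap.adjoint_inner_right _ _ _

/-- The adjoint of `B + i k·v` on test functions. -/
def adjTest (k : Vel d m) (B : Pairs d m →L[ℂ] Pairs d m) (φ : Vel d m → ℂ) : Pairs d m :=
  B.adjoint (gradPair φ) + inlP d m (toL2 (transport k φ))

theorem inner_adjTest (k : Vel d m) (B : Pairs d m →L[ℂ] Pairs d m) (φ : Vel d m → ℂ)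
    (x : Pairs d m) : inner ℂ (adjTest k B φ) x =
      inner ℂ (gradPair φ) (B x) + inner ℂ (toL2 (transport k φ)) x.fst := by
  rw [adjTest, inner_add_left, ContinuousLinearMap.adjoint_inner_left, inner_inlP_left]

theorem isSol_iff {k : Vel d m} {B : Pairs d m →L[ℂ] Pairs d m} {y x : Pairs d m} :
    IsSol k B y x ↔ x ∈ sobolev d m ∧ ∀ φ : Vel d m → ℂ, IsTest φ →
      inner ℂ (adjTest k B φ) x = inner ℂ (gradPair φ) y := by
  simp only [inner_adjTest, IsSol]

theorem add_eq_add_add {G : Type} [AddCommGroup G] {a b a₁ a₂ b₁ b₂ : G} (h : a = a₁ + a₂)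
    (h' : b = b₁ + b₂) : a + b = a₁ + b₁ + (a₂ + b₂) := by
  rw [h, h', add_add_add_comm]

theorem adjTest_add (k : Vel d m) (B : Pairs d m →L[ℂ] Pairs d m) {φ ψ : Vel d m → ℂ}
    (h : IsTest φ) (h' : IsTest ψ) : adjTest k B (φ + ψ) = adjTest k B φ + adjTest k B ψ := by
  have h1 : toL2 (transport k φ + transport k ψ) = toL2 (transport k φ) + toL2 (transport k ψ) :=
    toL2_add ((h.transport k).memLp 2) ((h'.transport k).memLp 2)
  have h2 : inlP d m (toL2 (transport k (φ + ψ))) =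
      inlP d m (toL2 (transport k φ)) + inlP d m (toL2 (transport k ψ)) := by
    rw [transport_add, h1]
    exact (inlP d m).map_add (toL2 (transport k φ)) (toL2 (transport k ψ))
  have h3 : B.adjoint (gradPair (φ + ψ)) =
      B.adjoint (gradPair φ) + B.adjoint (gradPair ψ) := by
    rw [gradPair_add h h']
    exact B.adjoint.map_add (gradPair φ) (gradPair ψ)
  exact add_eq_add_add h3 h2

theorem adjTest_smul (k : Vel d m) (B : Pairs d m →L[ℂ] Pairs d m) {φ : Vel d m → ℂ}
    (h : IsTest φ) (c : ℂ) : adjTest k B (c • φ) = c • adjTest k B φ := by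
  have h1 : toL2 (c • transport k φ) = c • toL2 (transport k φ) :=
    toL2_smul c ((h.transport k).memLp 2)
  simp only [adjTest]
  have h2 := (inlP d m).map_smul c (toL2 (transport k φ))
  have h3 := (ContinuousLinearMap.adjoint B).map_smul c (gradPair φ)
  rw [gradPair_smul h, transport_smul, h1, h2, h3, smul_add]

/-- `adjTest` as a linear map. -/
def adjTestL (k : Vel d m) (B : Pairs d m →L[ℂ] Pairs d m) : testSpace d m →ₗ[ℂ] Pairs d m where
  toFun φ := adjTest k B φ.1
  map_add' φ ψ := adjTest_add k B φ.2 ψ.2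
  map_smul' c φ := adjTest_smul k B φ.2 c

theorem IsTest.re_inner_transport {φ : Vel d m → ℂ} (h : IsTest φ) (k : Vel d m) :
    (inner ℂ (toL2 (RenormalizedPropagator.transport k φ)) (toL2 φ)).re = 0 := by
  rw [inner_toL2 ((h.transport k).memLp 2) (h.memLp 2)]
  have h2 : starRingEnd ℂ (pairing (RenormalizedPropagator.transport k φ) φ) =
      -pairing (RenormalizedPropagator.transport k φ) φ := by
    rw [pairing, ← integral_conj, ← integral_neg]
    congr 1
    funext v
    simp only [RenormalizedPropagator.transport, map_mul, map_neg, Complex.conj_I,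
      Complex.conj_ofReal, Complex.conj_conj]
    ring
  have := congrArg Complex.re h2
  rw [Complex.conj_re, Complex.neg_re] at this
  linarith

/-- Orthogonality to the adjoint operator on test functions says that x is a weak solution with zero
right-hand side. The energy estimate excludes this, which gives the density needed for existence. -/
theorem eq_zero_of_inner_adjTest {k : Vel d m} {B : Pairs d m →L[ℂ] Pairs d m} {c : ℝ} (hc : 0 < c)
    (hB : Coercive c B) {x : Pairs d m} (hx : x ∈ sobolev d m)
    (h : ∀ φ : Vel d m → ℂ, IsTest φ → inner ℂ (adjTest k B φ) x = 0) : x = 0 := by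
  have h1 : IsSol k B 0 x := isSol_iff.2 ⟨hx, fun φ hφ => by rw [h φ hφ, inner_zero_right]⟩
  have h2 := h1.norm_le hB
  rw [norm_zero] at h2
  have h3 : ‖x‖ ≤ 0 := by nlinarith [norm_nonneg x]
  exact norm_le_zero_iff.1 h3

/-- The weak resolvent equation is uniquely solvable. -/
theorem exists_solOp {k : Vel d m} {B : Pairs d m →L[ℂ] Pairs d m} {c : ℝ} (hc : 0 < c)
    (hB : Coercive c B) : ∃ G : Pairs d m →L[ℂ] Pairs d m, ∀ y x, IsSol k B y x ↔ x = G y := by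
  have hL : ∀ φ : testSpace d m, c * ‖gradPairL d m φ‖ ^ 2 ≤
      (inner ℂ (adjTestL k B φ) (gradPairL d m φ)).re := by
    intro φ
    refine (hB _).trans (le_of_eq ?_)
    change (inner ℂ (gradPair φ.1) (B (gradPair φ.1))).re =
      (inner ℂ (adjTest k B φ.1) (gradPair φ.1)).re
    rw [inner_adjTest, Complex.add_re, gradPair_fst]
    exact (add_eq_left.2 (IsTest.re_inner_transport φ.2 k)).symm
  obtain ⟨G, hG⟩ := exists_op_of_coercive (sobolev d m) (gradPairL d m) (adjTestL k B)
    (fun φ => IsTest.gradPair_mem φ.2) hc hL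
    (fun x hx h => eq_zero_of_inner_adjTest hc hB hx fun φ hφ => h ⟨φ, hφ⟩)
  have hsol : ∀ y, IsSol k B y (G y) := fun y =>
    isSol_iff.2 ⟨(hG y).1, fun φ hφ => (hG y).2 ⟨φ, hφ⟩⟩
  exact ⟨G, fun y x => ⟨fun h => h.unique hc hB (hsol y), fun h => h ▸ hsol y⟩⟩

end RenormalizedPropagator

end

noncomputable section

namespace RenormalizedPropagator

/-! ### From hat operators to propagators -/

open Filter Topology

attribute [local irreducible] tau

variable {d m : ℕ}

theorem tendsto_clm_of_dense {ι H H' : Type} [NormedAddCommGroup H] [NormedSpace ℂ H]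
    [NormedAddCommGroup H'] [NormedSpace ℂ H'] {l : Filter ι} {A : ι → H →L[ℂ] H'}
    {A₀ : H →L[ℂ] H'} {M : ℝ} (hM : ∀ᶠ i in l, ‖A i‖ ≤ M) {S : Set H} (hS : Dense S)
    (h : ∀ w ∈ S, Tendsto (fun i => A i w) l (𝓝 (A₀ w))) (w : H) :
    Tendsto (fun i => A i w) l (𝓝 (A₀ w)) := by
  rw [Metric.tendsto_nhds]
  intro ε hε
  set C := max M ‖A₀‖ + 1 with hC
  have hC0 : 0 < C := by
    have := (norm_nonneg A₀).trans (le_max_right M ‖A₀‖)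
    linarith
  obtain ⟨w', hw', hd⟩ := Metric.dense_iff.1 hS w (ε / (3 * C)) (by positivity)
  have hd' : ‖w - w'‖ < ε / (3 * C) := by
    rw [← dist_eq_norm, dist_comm]; exact hw'
  have hb : ∀ L : H →L[ℂ] H', ‖L‖ ≤ C → ‖L w - L w'‖ ≤ ε / 3 := by
    intro L hL
    rw [← map_sub]
    refine (L.le_opNorm _).trans ((mul_le_mul hL hd'.le (norm_nonneg _) hC0.le).trans (le_of_eq ?_))
    field_simp
  filter_upwards [hM, (Metric.tendsto_nhds.1 (h w' hd)) (ε / 3) (by positivity)] with i hi hi'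
  rw [dist_eq_norm] at hi' ⊢
  have h1 := hb (A i) (hi.trans ((le_max_left _ _).trans (by linarith)))
  have h2 := hb A₀ ((le_max_right M _).trans (by linarith))
  have : A i w - A₀ w = (A i w - A i w') + (A i w' - A₀ w') - (A₀ w - A₀ w') := by abel
  rw [this]
  refine lt_of_le_of_lt (norm_sub_le _ _) ?_
  have := norm_add_le (A i w - A i w') (A i w' - A₀ w')
  linarith

open Classical in
/-- The solution operator of the weak resolvent equation. -/
def solOp (k : Vel d m) (B : Pairs d m →L[ℂ] Pairs d m) : Pairs d m →L[ℂ] Pairs d m :=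
  if h : ∃ G : Pairs d m →L[ℂ] Pairs d m, ∀ y x, IsSol k B y x ↔ x = G y then h.choose else 0

/-! ### The solution operator and its dependence on the coefficients. -/

section SolOp

variable {k : Vel d m} {B : Pairs d m →L[ℂ] Pairs d m} {c : ℝ}

theorem isSol_iff_eq_solOp (hc : 0 < c) (hB : Coercive c B) {y x : Pairs d m} :
    IsSol k B y x ↔ x = solOp k B y := by
  have h := exists_solOp (k := k) hc hB
  rw [solOp, dif_pos h]
  exact h.choose_spec y x

theorem isSol_solOp (hc : 0 < c) (hB : Coercive c B) (y : Pairs d m) : IsSol k B y (solOp k B y) :=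
  (isSol_iff_eq_solOp hc hB).2 rfl

theorem norm_solOp_le (hc : 0 < c) (hB : Coercive c B) : ‖solOp k B‖ ≤ c⁻¹ := by
  refine ContinuousLinearMap.opNorm_le_bound _ (by positivity) fun y => ?_
  rw [inv_mul_eq_div, le_div_iff₀ hc, mul_comm]
  exact (isSol_solOp hc hB y).norm_le hB

/-- The adjoint solution operator is explicit on the image of test functions. This is why continuity
is tracked for adjoints. -/
theorem solOp_adjoint_adjTest (hc : 0 < c) (hB : Coercive c B) {φ : Vel d m → ℂ} (h : IsTest φ) :
    (solOp k B).adjoint (adjTest k B φ) = gradPair φ := by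
  refine ext_inner_right ℂ fun y => ?_
  rw [ContinuousLinearMap.adjoint_inner_left]
  exact (isSol_iff.1 (isSol_solOp hc hB y)).2 φ h

theorem solOp_adjoint_orthogonal (hc : 0 < c) (hB : Coercive c B) {w : Pairs d m}
    (hw : w ∈ (sobolev d m)ᗮ) : (solOp k B).adjoint w = 0 := by
  refine ext_inner_right ℂ fun y => ?_
  rw [ContinuousLinearMap.adjoint_inner_left, inner_zero_left]
  exact (Submodule.mem_orthogonal' _ _).1 hw _ (isSol_solOp hc hB y).1

/-- A vector orthogonal to both subspaces lies in H¹, which is closed, and is then annihilated by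
`eq_zero_of_inner_adjTest`. -/
theorem dense_adjTest (hc : 0 < c) (hB : Coercive c B) :
    Dense (((LinearMap.range (adjTestL k B)) ⊔ (sobolev d m)ᗮ : Submodule ℂ (Pairs d m)) :
      Set (Pairs d m)) := by
  rw [Submodule.dense_iff_topologicalClosure_eq_top, Submodule.topologicalClosure_eq_top_iff,
    Submodule.eq_bot_iff]
  intro x hx
  have hx1 : x ∈ (sobolev d m)ᗮᗮ :=
    Submodule.orthogonal_le le_sup_right hx
  rw [Submodule.orthogonal_orthogonal] at hx1
  have hx2 : x ∈ (LinearMap.range (adjTestL k B))ᗮ := Submodule.orthogonal_le le_sup_left hx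
  exact eq_zero_of_inner_adjTest (k := k) hc hB hx1 fun φ hφ =>
    (Submodule.mem_orthogonal _ _).1 hx2 _ (LinearMap.mem_range_self (adjTestL k B) ⟨φ, hφ⟩)

/-- With uniform coercivity, convergence has to be checked only on a dense set. There the difference
of the adjoint solution operators is one of them applied to the difference of `adjTest`, which tends
to 0 for each test function even though the unbounded transport term varies with k. -/
theorem tendsto_solOp_adjoint {ι : Type} {l : Filter ι} {k' : ι → Vel d m}
    {B' : ι → Pairs d m →L[ℂ] Pairs d m} (hc : 0 < c) (hB : Coercive c B)
    (hB' : ∀ᶠ i in l, Coercive c (B' i))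
    (hlim : ∀ φ : Vel d m → ℂ, IsTest φ →
      Tendsto (fun i => adjTest (k' i) (B' i) φ) l (𝓝 (adjTest k B φ))) (w : Pairs d m) :
    Tendsto (fun i => (solOp (k' i) (B' i)).adjoint w) l (𝓝 ((solOp k B).adjoint w)) := by
  refine tendsto_clm_of_dense (M := c⁻¹) ?_ (dense_adjTest (k := k) hc hB) ?_ w
  · filter_upwards [hB'] with i hi
    rw [LinearIsometryEquiv.norm_map]
    exact norm_solOp_le hc hi
  intro w hw
  obtain ⟨w₁, ⟨φ, rfl⟩, w₂, hw₂, rfl⟩ := Submodule.mem_sup.1 hw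
  change Tendsto (fun i => (solOp (k' i) (B' i)).adjoint (adjTest k B φ.1 + w₂)) l
    (𝓝 ((solOp k B).adjoint (adjTest k B φ.1 + w₂)))
  rw [map_add, solOp_adjoint_adjTest hc hB φ.2, solOp_adjoint_orthogonal hc hB hw₂, add_zero,
    tendsto_iff_norm_sub_tendsto_zero]
  have h1 : Tendsto (fun i => c⁻¹ * ‖adjTest k B φ.1 - adjTest (k' i) (B' i) φ.1‖) l (𝓝 0) := by
    have h2 := (tendsto_const_nhds (x := adjTest k B φ.1)).sub (hlim φ.1 φ.2)
    have h3 := (h2.norm).const_mul c⁻¹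
    rwa [sub_self, norm_zero, mul_zero] at h3
  refine squeeze_zero' (Eventually.of_forall fun _ => norm_nonneg _) ?_ h1
  filter_upwards [hB'] with i hi
  rw [map_add, solOp_adjoint_orthogonal hc hi hw₂, add_zero, ← solOp_adjoint_adjTest hc hi φ.2,
    ← map_sub]
  refine (ContinuousLinearMap.le_opNorm _ _).trans ?_
  gcongr
  rw [LinearIsometryEquiv.norm_map]
  exact norm_solOp_le hc hi

/-- The second resolvent identity. The transport term is the same for both operators and cancels, so
only the bounded difference of the coefficients remains. -/
theorem solOp_eq_sub {B₁ : Pairs d m →L[ℂ] Pairs d m} {c₁ : ℝ} (hc : 0 < c) (hB : Coercive c B)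
    (hc₁ : 0 < c₁) (hB₁ : Coercive c₁ B₁) :
    (1 + solOp k B * (B₁ - B)) * solOp k B₁ = solOp k B := by
  ext1 y
  have h1 := isSol_solOp (k := k) hc₁ hB₁ y
  have h2 : IsSol k B (y - (B₁ - B) (solOp k B₁ y)) (solOp k B₁ y) := by
    refine ⟨h1.1, fun φ hφ => ?_⟩
    rw [inner_sub_right, ← h1.2 φ hφ, sub_apply, inner_sub_right]
    ring
  have h3 := (isSol_iff_eq_solOp hc hB).1 h2
  rw [map_sub] at h3
  change solOp k B₁ y + solOp k B ((B₁ - B) (solOp k B₁ y)) = solOp k B y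
  rw [← eq_sub_iff_add_eq]
  exact h3

/-- By the resolvent identity the solution operator at w is u(w)⁻¹ times that at z, where u is
differentiable at z and equals 1 there; inversion is holomorphic near 1. -/
theorem differentiableAt_solOp {Z : Type} [NormedAddCommGroup Z] [NormedSpace ℂ Z]
    {B' : Z → Pairs d m →L[ℂ] Pairs d m} {z : Z} (hB : DifferentiableAt ℂ B' z)
    (hc : ∀ᶠ w in 𝓝 z, ∃ c > 0, Coercive c (B' w)) :
    DifferentiableAt ℂ (fun w => solOp k (B' w)) z := by
  obtain ⟨c, hc0, hcz⟩ := hc.self_of_nhds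
  let u : Z → Pairs d m →L[ℂ] Pairs d m := fun w => 1 + solOp k (B' z) * (B' w - B' z)
  have hu : DifferentiableAt ℂ u z :=
    (((hB.sub_const (B' z)).const_mul (solOp k (B' z))).const_add 1)
  have huz : u z = 1 := by simp [u]
  have hinv : DifferentiableAt ℂ (fun w => Ring.inverse (u w)) z := by
    have h1 : DifferentiableAt ℂ (Ring.inverse : (Pairs d m →L[ℂ] Pairs d m) → _) (u z) := by
      rw [huz]; exact differentiableAt_inverse isUnit_one
    exact h1.comp z hu
  refine (hinv.mul_const (solOp k (B' z))).congr_of_eventuallyEq ?_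
  have hunit : ∀ᶠ w in 𝓝 z, IsUnit (u w) := by
    have : ∀ᶠ A in 𝓝 (u z), IsUnit A := by
      rw [huz]; exact Units.isOpen.mem_nhds isUnit_one
    exact hu.continuousAt.eventually this
  filter_upwards [hc, hunit] with w hw hwu
  obtain ⟨c', hc', hcw⟩ := hw
  have h1 := solOp_eq_sub (k := k) hc0 hcz hc' hcw
  have h2 : Ring.inverse (u w) * (u w * solOp k (B' w)) = solOp k (B' w) := by
    rw [← mul_assoc, Ring.inverse_mul_cancel _ hwu, one_mul]
  rw [← h2]
  exact congrArg _ h1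

end SolOp

/-- The block-diagonal operator `z ⊕ A`. -/
def blockOp (z : ℂ) (A : GradSp d m →L[ℂ] GradSp d m) : Pairs d m →L[ℂ] Pairs d m :=
  z • (inlP d m ∘L fstP d m) +
    inrP d m ∘L A ∘L sndP d m

theorem blockOp_apply (z : ℂ) (A : GradSp d m →L[ℂ] GradSp d m) (x : Pairs d m) :
    blockOp z A x = z • inlP d m x.fst + inrP d m (A x.snd) := rfl

theorem inner_blockOp (z : ℂ) (A : GradSp d m →L[ℂ] GradSp d m) (x y : Pairs d m) :
    inner ℂ x (blockOp z A y) = z * inner ℂ x.fst y.fst + inner ℂ x.snd (A y.snd) := by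
  rw [blockOp_apply, inner_add_right, inner_smul_right, inner_inlP_right, inner_inrP_right]

theorem blockOp_adjoint_apply (z : ℂ) (A : GradSp d m →L[ℂ] GradSp d m) (x : Pairs d m) :
    (blockOp z A).adjoint x = starRingEnd ℂ z • inlP d m x.fst + inrP d m (A.adjoint x.snd) := by
  refine ext_inner_right ℂ fun y => ?_
  rw [ContinuousLinearMap.adjoint_inner_left, inner_blockOp, inner_add_left, inner_smul_left,
    Complex.conj_conj, inner_inlP_left, inner_inrP_left, ContinuousLinearMap.adjoint_inner_left]

theorem differentiableAt_blockOp {Z : Type} [NormedAddCommGroup Z] [NormedSpace ℂ Z] {z : Z → ℂ}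
    {A : Z → GradSp d m →L[ℂ] GradSp d m} {w : Z} (hz : DifferentiableAt ℂ z w)
    (hA : DifferentiableAt ℂ A w) : DifferentiableAt ℂ (fun w => blockOp (z w) (A w)) w :=
  (hz.smul_const _).add
    ((differentiableAt_const (inrP d m)).clm_comp
      (hA.clm_comp (differentiableAt_const (sndP d m))))

theorem coercive_blockOp {z : ℂ} {A : GradSp d m →L[ℂ] GradSp d m} {c : ℝ} (hz : c ≤ z.re)
    (hA : ∀ D, c * ‖D‖ ^ 2 ≤ (inner ℂ D (A D)).re) : Coercive c (blockOp z A) := by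
  intro x
  have h1 : (inner ℂ x.fst x.fst : ℂ) = ((‖x.fst‖ ^ 2 : ℝ) : ℂ) := by
    rw [inner_self_eq_norm_sq_to_K]; norm_cast
  rw [inner_blockOp, h1, Complex.add_re, Complex.re_mul_ofReal, norm_sq_pairs, mul_add]
  exact add_le_add (mul_le_mul_of_nonneg_right hz (by positivity)) (hA _)

/-! ### Domains of deformation and covariant families of hat operators and propagators. -/

/-- The imaginary parts. -/
def imPart (ξ : CVel d m) (j : Fin (m + 1)) : E d := WithLp.toLp 2 fun i => (ξ j i).im

/-- The domain of the deformations. -/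
def deform (tN : ℝ) (k : Vel d m) : Set (CVel d m) :=
  {ξ | (∀ j, ‖imPart ξ j‖ < m + 1) ∧ 0 < rate tN k ξ}

theorem continuous_imPart (j : Fin (m + 1)) : Continuous fun ξ : CVel d m => imPart ξ j := by
  refine (PiLp.continuous_toLp 2 _).comp (continuous_pi fun i => Complex.continuous_im.comp ?_)
  exact (EuclideanSpace.proj (𝕜 := ℂ) i).continuous.comp (continuous_apply j)

/-- The bilinear pairing `∑ k_{j,i} ξ_{j,i}`. -/
def dotC (k : Vel d m) (ξ : CVel d m) : ℂ := ∑ j, ∑ i, (k j i : ℂ) * ξ j i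

theorem rate_eq (tN : ℝ) (k : Vel d m) (ξ : CVel d m) :
    rate tN k ξ = 1 / tN + (I * dotC k ξ).re := rfl

theorem continuous_dotC : Continuous fun p : Vel d m × CVel d m => dotC p.1 p.2 := by
  refine continuous_finsetSum _ fun j _ => continuous_finsetSum _ fun i _ => ?_
  refine (Complex.continuous_ofReal.comp ?_).mul ?_
  · exact (EuclideanSpace.proj (𝕜 := ℝ) i).continuous.comp ((continuous_apply j).comp continuous_fst)
  · exact (EuclideanSpace.proj (𝕜 := ℂ) i).continuous.comp ((continuous_apply j).comp continuous_snd)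

theorem continuous_rate (tN : ℝ) : Continuous fun p : Vel d m × CVel d m => rate tN p.1 p.2 :=
  continuous_const.add (Complex.continuous_re.comp (continuous_const.mul continuous_dotC))

theorem dotC_add (k : Vel d m) (ξ η : CVel d m) : dotC k (ξ + η) = dotC k ξ + dotC k η := by
  simp [dotC, mul_add, Finset.sum_add_distrib]

theorem dotC_smul (k : Vel d m) (c : ℂ) (ξ : CVel d m) : dotC k (c • ξ) = c * dotC k ξ := by
  simp only [dotC, Finset.mul_sum, Pi.smul_apply, PiLp.smul_apply, smul_eq_mul]
  exact Finset.sum_congr rfl fun j _ => Finset.sum_congr rfl fun i _ => by ring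

theorem differentiable_dotC (k : Vel d m) : Differentiable ℂ (dotC k) :=
  (LinearMap.toContinuousLinearMap
    { toFun := dotC k, map_add' := dotC_add k, map_smul' := dotC_smul k }).differentiable

theorem isOpen_deform (tN : ℝ) (k : Vel d m) : IsOpen (deform tN k) := by
  have h1 : deform tN k = (⋂ j, {ξ | ‖imPart ξ j‖ < m + 1}) ∩ {ξ | 0 < rate tN k ξ} := by
    ext ξ; simp [deform]
  rw [h1]
  refine (isOpen_iInter_of_finite fun j =>
    isOpen_lt (continuous_imPart j).norm continuous_const).inter ?_
  have h2 : Continuous fun ξ : CVel d m => (k, ξ) := Continuous.prodMk_right k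
  have h3 : Continuous fun ξ : CVel d m => rate tN k ξ := by
    simpa only [Function.comp_def] using (continuous_rate tN).comp h2
  exact isOpen_lt continuous_const h3

theorem imPart_add_toCVel (ξ : CVel d m) (a : Vel d m) (j : Fin (m + 1)) :
    imPart (ξ + toCVel a) j = imPart ξ j := by
  ext i
  simp [imPart, toCVel_apply]

theorem dotC_toCVel (k a : Vel d m) : dotC k (toCVel a) = ((∑ l, inner ℝ (k l) (a l) : ℝ) : ℂ) := by
  simp only [dotC, toCVel_apply, PiLp.inner_apply, RCLike.inner_apply, conj_trivial]
  push_cast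
  simp only [mul_comm]

theorem rate_add_toCVel (tN : ℝ) (k : Vel d m) (ξ : CVel d m) (a : Vel d m) :
    rate tN k (ξ + toCVel a) = rate tN k ξ := by
  simp only [rate_eq, dotC_add, dotC_toCVel, mul_add, Complex.add_re]
  simp

theorem add_mem_deform {tN : ℝ} {k : Vel d m} {ξ : CVel d m} (h : ξ ∈ deform tN k) (a : Vel d m) :
    ξ + toCVel a ∈ deform tN k :=
  ⟨fun j => by rw [imPart_add_toCVel]; exact h.1 j, by rw [rate_add_toCVel]; exact h.2⟩

theorem zero_mem_deform {tN : ℝ} (h : 0 < tN) (k : Vel d m) : (0 : CVel d m) ∈ deform tN k := by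
  refine ⟨fun j => ?_, ?_⟩
  · have : imPart (0 : CVel d m) j = 0 := by ext i; simp [imPart]
    rw [this, norm_zero]
    positivity
  · simp [rate, h]

/-- Componentwise translation of gradients. -/
def tauG (a : Vel d m) (D : GradSp d m) : GradSp d m := WithLp.toLp 2 fun c => tau a (D c)

/-- Deformed hat operators, acting on gradients. -/
structure HatFam (tN K : ℝ) (b : Vel d m → CVel d m → GradSp d m →L[ℂ] GradSp d m) : Prop where
  cov : ∀ k, ∀ ξ ∈ deform tN k, ∀ a D, b k (ξ + toCVel a) (tauG a D) = tauG a (b k ξ D)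
  hol : ∀ k, DifferentiableOn ℂ (b k) (deform tN k)
  norm_le : ∀ k, ∀ ξ ∈ deform tN k, ‖b k ξ‖ ≤ K
  cont : ∀ D, ContinuousOn (fun p : Vel d m × CVel d m => (b p.1 p.2).adjoint D)
    {p | p.2 ∈ deform tN p.1}

/-- Deformed propagators. -/
structure PropFam (tN : ℝ) (T : Vel d m → CVel d m → L2 d m →L[ℂ] L2 d m) : Prop where
  cov : ∀ k, ∀ ξ ∈ deform tN k, ∀ a f, T k (ξ + toCVel a) (tau a f) = tau a (T k ξ f)
  hol : ∀ k, DifferentiableOn ℂ (T k) (deform tN k)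
  norm_le : ∀ k, ∀ ξ ∈ deform tN k, ‖T k ξ‖ ≤ (rate tN k ξ)⁻¹
  cont : ∀ f, ContinuousOn (fun p : Vel d m × CVel d m => (T p.1 p.2).adjoint f)
    {p | p.2 ∈ deform tN p.1}
  re_nonneg : ∀ k f, 0 ≤ (inner ℂ f (T k 0 f)).re

/-- The bounded part of the deformed resolvent equation. -/
def energyOp (p : Params d) (b : Vel d m → CVel d m → GradSp d m →L[ℂ] GradSp d m) (k : Vel d m)
    (ξ : CVel d m) : Pairs d m →L[ℂ] Pairs d m :=
  blockOp ((1 + I * (p.alpha : ℂ)) / (p.tN : ℂ) + I * dotC k ξ)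
    (((p.kappa : ℂ) / (p.N : ℂ)) • 1 + (1 / (p.N : ℂ)) • b k ξ)

/-- The deformed propagator. -/
def propOf (p : Params d) (b : Vel d m → CVel d m → GradSp d m →L[ℂ] GradSp d m) (k : Vel d m)
    (ξ : CVel d m) : L2 d m →L[ℂ] L2 d m :=
  fstP d m ∘L solOp k (energyOp p b k ξ) ∘L inlP d m

theorem propOf_apply (p : Params d) (b : Vel d m → CVel d m → GradSp d m →L[ℂ] GradSp d m)
    (k : Vel d m) (ξ : CVel d m) (f : L2 d m) :
    propOf p b k ξ f = (solOp k (energyOp p b k ξ) (inlP d m f)).fst := rfl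

variable {p : Params d} {b : Vel d m → CVel d m → GradSp d m →L[ℂ] GradSp d m}

theorem energyOp_re (p : Params d) (k : Vel d m) (ξ : CVel d m) :
    ((1 + I * (p.alpha : ℂ)) / (p.tN : ℂ) + I * dotC k ξ).re = rate p.tN k ξ := by
  rw [rate_eq, Complex.add_re, Complex.div_ofReal_re]
  simp

/-- Half of the diffusion constant pays for the hat operator; κ/(2N) is what is left. -/
theorem re_inner_energyOp_snd (hN : 1 ≤ p.N) {A : GradSp d m →L[ℂ] GradSp d m}
    (hA : ‖A‖ ≤ p.kappa / 2) (D : GradSp d m) : p.kappa / (2 * p.N) * ‖D‖ ^ 2 ≤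
      (inner ℂ D ((((p.kappa : ℂ) / (p.N : ℂ)) • (1 : GradSp d m →L[ℂ] GradSp d m) +
        (1 / (p.N : ℂ)) • A) D)).re := by
  have hN' : (0 : ℝ) < p.N := by exact_mod_cast hN
  have h1 : (inner ℂ D D : ℂ) = ((‖D‖ ^ 2 : ℝ) : ℂ) := by
    rw [inner_self_eq_norm_sq_to_K]; norm_cast
  have h2 : -(p.kappa / 2 * ‖D‖ ^ 2) ≤ (inner ℂ D (A D)).re := by
    have h3 : ‖inner ℂ D (A D)‖ ≤ p.kappa / 2 * ‖D‖ ^ 2 := by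
      refine (norm_inner_le_norm _ _).trans ?_
      have := A.le_of_opNorm_le hA D
      nlinarith [norm_nonneg D]
    have := neg_le_of_abs_le ((Complex.abs_re_le_norm _).trans h3)
    linarith
  have h4 : inner ℂ D ((((p.kappa : ℂ) / (p.N : ℂ)) • (1 : GradSp d m →L[ℂ] GradSp d m) +
      (1 / (p.N : ℂ)) • A) D) = ((p.kappa / p.N : ℝ) : ℂ) * inner ℂ D D +
        ((1 / p.N : ℝ) : ℂ) * inner ℂ D (A D) := by
    rw [add_apply, smul_apply, smul_apply, inner_add_right, inner_smul_right, inner_smul_right]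
    push_cast
    rfl
  rw [h4, Complex.add_re, Complex.re_ofReal_mul, Complex.re_ofReal_mul, h1, Complex.ofReal_re]
  have h5 : 1 / (p.N : ℝ) * -(p.kappa / 2 * ‖D‖ ^ 2) ≤ 1 / p.N * (inner ℂ D (A D)).re :=
    mul_le_mul_of_nonneg_left h2 (by positivity)
  refine le_trans (le_of_eq ?_) (add_le_add_right h5 _)
  field_simp
  ring

/-- The coercivity constant of the deformed equation. -/
theorem coercive_energyOp (hN : 1 ≤ p.N) {k : Vel d m} {ξ : CVel d m}
    (hb : ‖b k ξ‖ ≤ p.kappa / 2) {c : ℝ} (hc : c ≤ rate p.tN k ξ) (hc' : c ≤ p.kappa / (2 * p.N)) :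
    Coercive c (energyOp p b k ξ) := by
  refine coercive_blockOp (by rwa [energyOp_re]) fun D => ?_
  exact (mul_le_mul_of_nonneg_right hc' (by positivity)).trans (re_inner_energyOp_snd hN hb D)

theorem inner_gradPair_tauG {φ : Vel d m → ℂ} (h : IsTest φ) (a : Vel d m) (D : GradSp d m) :
    inner ℂ (gradPair φ).snd (tauG a D) = inner ℂ (gradPair fun v => φ (v + -a)).snd D := by
  rw [PiLp.inner_apply, PiLp.inner_apply]
  refine Finset.sum_congr rfl fun c _ => ?_
  change inner ℂ (toL2 (grad φ c.1 c.2)) (tau a (D c)) =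
    inner ℂ (toL2 (grad (fun v => φ (v + -a)) c.1 c.2)) (D c)
  rw [inner_tau_test (isTest_grad h _ _)]
  congr 2
  funext v
  rw [grad_translate]

/-- Componentwise translation of pairs. -/
def tauP (a : Vel d m) (x : Pairs d m) : Pairs d m := mkP (tau a x.fst) (tauG a x.snd)

theorem transport_translate (k a : Vel d m) (φ : Vel d m → ℂ) (v : Vel d m) :
    transport k φ (v + -a) = transport k (fun v => φ (v + -a)) v +
      I * ((∑ l, inner ℝ (k l) (a l) : ℝ) : ℂ) * φ (v + -a) := by
  simp only [transport, Pi.add_apply, Pi.neg_apply, inner_add_right, inner_neg_right,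
    Finset.sum_add_distrib, Finset.sum_neg_distrib]
  push_cast
  ring

/-- Multiplication by k·v does not commute with translation by a: the defect is the constant i k·a.
The term i k·ξ of the deformed equation changes by exactly this amount when ξ becomes ξ + a. -/
theorem inner_transport_tau {φ : Vel d m → ℂ} (h : IsTest φ) (k a : Vel d m) (f : L2 d m) :
    inner ℂ (toL2 (transport k φ)) (tau a f) =
      inner ℂ (toL2 (transport k fun v => φ (v + -a))) f -
        I * dotC k (toCVel a) * inner ℂ (toL2 φ) (tau a f) := by
  have h1 := (h.translate (-a)).transport k
  have h2 : (fun v => transport k φ (v + -a)) = (transport k fun v => φ (v + -a)) +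
      (I * dotC k (toCVel a)) • fun v => φ (v + -a) := by
    funext v
    rw [transport_translate, dotC_toCVel]
    rfl
  rw [inner_tau_test (h.transport k), h2, toL2_add (h1.memLp 2)
    (((h.translate (-a)).smul _).memLp 2), toL2_smul _ ((h.translate (-a)).memLp 2),
    inner_add_left, inner_smul_left, inner_tau_test h, dotC_toCVel]
  simp only [map_mul, Complex.conj_I, Complex.conj_ofReal]
  ring

theorem inner_energyOp (p : Params d) (b : Vel d m → CVel d m → GradSp d m →L[ℂ] GradSp d m)
    (k : Vel d m) (ξ : CVel d m) (u x : Pairs d m) :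
    inner ℂ u (energyOp p b k ξ x) =
      ((1 + I * (p.alpha : ℂ)) / (p.tN : ℂ) + I * dotC k ξ) * inner ℂ u.fst x.fst +
        ((p.kappa : ℂ) / (p.N : ℂ) * inner ℂ u.snd x.snd +
          1 / (p.N : ℂ) * inner ℂ u.snd (b k ξ x.snd)) := by
  rw [energyOp, inner_blockOp, add_apply, smul_apply, smul_apply, inner_add_right,
    inner_smul_right, inner_smul_right]
  rfl

/-- The translate of a solution at ξ solves the equation at ξ + a; together with uniqueness this
gives the covariance of the propagators. -/
theorem IsSol.tauP {k : Vel d m} {ξ : CVel d m} {x y : Pairs d m} {a : Vel d m}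
    (hcov : b k (ξ + toCVel a) (tauG a x.snd) = tauG a (b k ξ x.snd))
    (h : IsSol k (energyOp p b k ξ) y x) :
    IsSol k (energyOp p b k (ξ + toCVel a)) (tauP a y) (RenormalizedPropagator.tauP a x) := by
  refine ⟨IsWeakGrad.tau (mem_sobolev.1 h.1) a, fun φ hφ => ?_⟩
  have h1 := h.2 _ (hφ.translate (-a))
  rw [inner_pairs _ y, inner_energyOp, gradPair_fst] at h1
  rw [inner_pairs _ (RenormalizedPropagator.tauP a y), inner_energyOp]
  simp only [RenormalizedPropagator.tauP, fst_mkP, snd_mkP, hcov, gradPair_fst]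
  rw [inner_transport_tau hφ, inner_gradPair_tauG hφ, inner_gradPair_tauG hφ,
    inner_gradPair_tauG hφ, inner_tau_test hφ, inner_tau_test hφ, ← h1, dotC_add]
  ring

/-- `transport`, as a function of the momenta. -/
theorem continuous_toL2_transport {φ : Vel d m → ℂ} (h : IsTest φ) :
    Continuous fun k : Vel d m => toL2 (transport k φ) := by
  let L : Vel d m →ₗ[ℝ] L2 d m :=
    { toFun := fun k => toL2 (transport k φ)
      map_add' := fun k k' => by
        rw [← toL2_add ((h.transport k).memLp 2) ((h.transport k').memLp 2)]
        congr 1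
        funext v
        simp only [transport, Pi.add_apply, inner_add_left, Finset.sum_add_distrib]
        push_cast
        ring
      map_smul' := fun r k => by
        have h1 : r • toL2 (transport k φ) = (r : ℂ) • toL2 (transport k φ) :=
          (Complex.coe_smul r _).symm
        rw [RingHom.id_apply, h1, ← toL2_smul _ ((h.transport k).memLp 2)]
        congr 1
        funext v
        simp only [transport, Pi.smul_apply, real_inner_smul_left, ← Finset.mul_sum, smul_eq_mul]
        push_cast
        ring }
  exact L.continuous_of_finiteDimensional

theorem HatFam.continuousOn_adjTest {K : ℝ} (hb : HatFam p.tN K b) {φ : Vel d m → ℂ} (h : IsTest φ) :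
    ContinuousOn (fun q : Vel d m × CVel d m => adjTest q.1 (energyOp p b q.1 q.2) φ)
      {q | q.2 ∈ deform p.tN q.1} := by
  have h1 : ∀ q : Vel d m × CVel d m, adjTest q.1 (energyOp p b q.1 q.2) φ =
      (starRingEnd ℂ ((1 + I * (p.alpha : ℂ)) / (p.tN : ℂ) + I * dotC q.1 q.2) •
        inlP d m (gradPair φ).fst + inrP d m
          (starRingEnd ℂ ((p.kappa : ℂ) / (p.N : ℂ)) • (gradPair φ).snd +
            starRingEnd ℂ (1 / (p.N : ℂ)) • (b q.1 q.2).adjoint (gradPair φ).snd)) +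
      inlP d m (toL2 (transport q.1 φ)) := by
    intro q
    rw [adjTest, energyOp, blockOp_adjoint_apply]
    congr 3
    refine ext_inner_right ℂ fun y => ?_
    rw [ContinuousLinearMap.adjoint_inner_left, inner_add_left, inner_smul_left, inner_smul_left,
      Complex.conj_conj, Complex.conj_conj, ContinuousLinearMap.adjoint_inner_left, add_apply,
      smul_apply, smul_apply, inner_add_right, inner_smul_right, inner_smul_right]
    rfl
  simp only [h1]
  refine ContinuousOn.add (ContinuousOn.add ?_ ?_) ?_
  · have h2 : Continuous fun q : Vel d m × CVel d m =>
        starRingEnd ℂ ((1 + I * (p.alpha : ℂ)) / (p.tN : ℂ) + I * dotC q.1 q.2) :=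
      Complex.continuous_conj.comp (continuous_const.add (continuous_const.mul continuous_dotC))
    exact (h2.smul continuous_const).continuousOn
  · refine (inrP d m).continuous.comp_continuousOn (continuousOn_const.add ?_)
    exact ContinuousOn.const_smul (hb.cont _) (starRingEnd ℂ (1 / (p.N : ℂ)))
  · exact ((inlP d m).continuous.comp ((continuous_toL2_transport h).comp
      continuous_fst)).continuousOn

theorem propOf_adjoint (p : Params d) (b : Vel d m → CVel d m → GradSp d m →L[ℂ] GradSp d m)
    (k : Vel d m) (ξ : CVel d m) (f : L2 d m) :
    (propOf p b k ξ).adjoint f = ((solOp k (energyOp p b k ξ)).adjoint (inlP d m f)).fst := by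
  refine ext_inner_right ℂ fun g => ?_
  rw [ContinuousLinearMap.adjoint_inner_left, propOf_apply, ← inner_inlP_left,
    ← ContinuousLinearMap.adjoint_inner_left, inner_inlP_right]

/-- The deformed propagators built from deformed hat operators. -/
theorem HatFam.propFam (hN : 1 ≤ p.N) (hκ : 0 < p.kappa) (ht : 0 < p.tN)
    (hb : HatFam p.tN (p.kappa / 2) b) : PropFam p.tN (propOf p b) := by
  have hκN : 0 < p.kappa / (2 * p.N) := by
    have : (0 : ℝ) < p.N := by exact_mod_cast hN
    positivity
  have hco : ∀ k, ∀ ξ ∈ deform p.tN k,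
      Coercive (min (rate p.tN k ξ) (p.kappa / (2 * p.N))) (energyOp p b k ξ) := fun k ξ hξ =>
    coercive_energyOp hN (hb.norm_le k ξ hξ) (min_le_left _ _) (min_le_right _ _)
  have hpos : ∀ k : Vel d m, ∀ ξ ∈ deform p.tN k, 0 < min (rate p.tN k ξ) (p.kappa / (2 * p.N)) :=
    fun k ξ hξ => lt_min hξ.2 hκN
  -- Dropping the nonnegative gradient part of the energy leaves the rate alone. The coercivity
  -- constant also involves κ/(2N) and would give a bound that is not uniform in N.
  have hen : ∀ k, ∀ ξ ∈ deform p.tN k, ∀ f,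
      rate p.tN k ξ * ‖propOf p b k ξ f‖ ^ 2 ≤ (inner ℂ (propOf p b k ξ f) f).re := by
    intro k ξ hξ f
    have h1 := isSol_solOp (k := k) (hpos k ξ hξ) (hco k ξ hξ) (inlP d m f)
    have h2 := h1.energy
    rw [inner_inlP_right] at h2
    rw [propOf_apply, ← h2, energyOp, inner_blockOp, Complex.add_re]
    have h3 : ∀ g : L2 d m, (inner ℂ g g : ℂ) = ((‖g‖ ^ 2 : ℝ) : ℂ) := fun g => by
      rw [inner_self_eq_norm_sq_to_K]; norm_cast
    rw [h3, Complex.re_mul_ofReal, energyOp_re]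
    have h4 := re_inner_energyOp_snd hN (hb.norm_le k ξ hξ)
      (solOp k (energyOp p b k ξ) (inlP d m f)).snd
    have h5 : 0 ≤ p.kappa / (2 * p.N) * ‖(solOp k (energyOp p b k ξ) (inlP d m f)).snd‖ ^ 2 := by
      positivity
    exact le_add_of_nonneg_right (h5.trans h4)
  refine ⟨fun k ξ hξ a f => ?_, fun k ξ hξ => ?_, fun k ξ hξ => ?_, fun f => ?_, fun k f => ?_⟩
  · have hξ' := add_mem_deform hξ a
    have h1 := isSol_solOp (k := k) (hpos k ξ hξ) (hco k ξ hξ) (inlP d m f)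
    have h2 := h1.tauP (a := a) (hb.cov k ξ hξ a _)
    have h3 : tauP a (inlP d m f) = inlP d m (tau a f) := by
      rw [tauP, inlP_eq, inlP_eq]
      congr 1
      ext1 c
      exact (tau a).map_zero
    rw [h3] at h2
    have h4 := (isSol_iff_eq_solOp (hpos k _ hξ') (hco k _ hξ')).1 h2
    rw [propOf_apply, ← h4]
    rfl
  · refine DifferentiableAt.differentiableWithinAt ?_
    have h1 : DifferentiableAt ℂ (energyOp p b k) ξ := by
      refine differentiableAt_blockOp ?_ ?_
      · exact ((differentiable_dotC k).differentiableAt.const_mul I).const_add _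
      · exact (((hb.hol k ξ hξ).differentiableAt ((isOpen_deform _ k).mem_nhds hξ)).const_smul
          (1 / (p.N : ℂ))).const_add _
    have h2 := differentiableAt_solOp (k := k) h1 (by
      filter_upwards [(isOpen_deform p.tN k).mem_nhds hξ] with ζ hζ
      exact ⟨_, hpos k ζ hζ, hco k ζ hζ⟩)
    exact (differentiableAt_const (fstP d m)).clm_comp
      (h2.clm_comp (differentiableAt_const (inlP d m)))
  · refine ContinuousLinearMap.opNorm_le_bound _ (inv_nonneg.2 hξ.2.le) fun f => ?_
    rw [inv_mul_eq_div, le_div_iff₀ hξ.2]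
    rcases (norm_nonneg (propOf p b k ξ f)).eq_or_lt with h0 | h0
    · rw [← h0, zero_mul]; exact norm_nonneg _
    · refine le_of_mul_le_mul_right ?_ h0
      have h1 := (hen k ξ hξ f).trans ((Complex.re_le_norm _).trans (norm_inner_le_norm _ _))
      linarith
  · intro q hq
    simp only [propOf_adjoint]
    refine ((fstP d m).continuous.tendsto _).comp ?_
    have hr : 0 < rate p.tN q.1 q.2 := hq.2
    -- Half of the rate serves as a coercivity constant valid at all nearby momenta and
    -- deformations.
    have hcq : 0 < min (rate p.tN q.1 q.2 / 2) (p.kappa / (2 * p.N)) := lt_min (by linarith) hκN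
    refine tendsto_solOp_adjoint hcq ?_ ?_ (fun φ hφ => hb.continuousOn_adjTest hφ q hq) _
    · exact coercive_energyOp hN (hb.norm_le _ _ hq) ((min_le_left _ _).trans (by linarith))
        (min_le_right _ _)
    · have h1 : ∀ᶠ q' in 𝓝[{q | q.2 ∈ deform p.tN q.1}] q, rate p.tN q.1 q.2 / 2 < rate p.tN q'.1 q'.2 :=
        ((continuous_rate p.tN).tendsto q).mono_left nhdsWithin_le_nhds |>.eventually
          (lt_mem_nhds (by linarith))
      filter_upwards [h1, self_mem_nhdsWithin] with q' h1 h2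
      exact coercive_energyOp hN (hb.norm_le _ _ h2) ((min_le_left _ _).trans h1.le)
        (min_le_right _ _)
  · have h0 := zero_mem_deform ht k
    have h1 := hen k 0 h0 f
    have h2 : 0 ≤ rate p.tN k 0 * ‖propOf p b k 0 f‖ ^ 2 := mul_nonneg h0.2.le (by positivity)
    rw [← inner_conj_symm, Complex.conj_re]
    exact h2.trans h1

/-- Bridge to the distributional equation of the statement: functions and weak gradients correspond
to elements of `sobolev`, and the transport term moves onto the test function with its sign
conjugated. -/
theorem solvesResolventEq_iff {k : Vel d m} {A : GradSp d m →L[ℂ] GradSp d m}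
    {B : (Fin (m + 1) → Fin d → Vel d m → ℂ) → (Vel d m → ℂ) → ℂ}
    (hB : ∀ D : Fin (m + 1) → Fin d → Vel d m → ℂ, (∀ j i, MemLp (D j i) 2 volume) →
      ∀ φ : Vel d m → ℂ, IsTest φ →
        B D φ = inner ℂ (gradPair φ).snd (A (WithLp.toLp 2 fun c => toL2 (D c.1 c.2))))
    {g h : L2 d m} : SolvesResolventEq p k B g h ↔ ∃ x : Pairs d m, x.fst = h ∧
      IsSol k (energyOp p (fun _ _ => A) k 0) (inlP d m g) x := by
  have key : ∀ D : Fin (m + 1) → Fin d → Vel d m → ℂ, (∀ j i, MemLp (D j i) 2 volume) →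
      ∀ φ : Vel d m → ℂ, IsTest φ → (((1 + I * (p.alpha : ℂ)) / (p.tN : ℂ) * pairing φ h
        + pairing φ (fun v => I * ((∑ l, inner ℝ (k l) (v l) : ℝ) : ℂ) * h v)
        + (p.kappa : ℂ) / (p.N : ℂ) * ∑ j, ∑ i, pairing (grad φ j i) (D j i)
        + 1 / (p.N : ℂ) * B D φ = pairing φ g) ↔
      inner ℂ (gradPair φ) (energyOp p (fun _ _ => A) k 0
          (mkP h (WithLp.toLp 2 fun c => toL2 (D c.1 c.2)))) +
        inner ℂ (toL2 (transport k φ)) h = inner ℂ (gradPair φ) (inlP d m g)) := by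
    intro D hD φ hφ
    have h1 : pairing φ (fun v => I * ((∑ l, inner ℝ (k l) (v l) : ℝ) : ℂ) * h v) =
        inner ℂ (toL2 (transport k φ)) h := by
      rw [inner_toL2_coe ((hφ.transport k).memLp 2), pairing, pairing]
      congr 1
      funext v
      simp only [transport, map_mul, map_neg, Complex.conj_I, Complex.conj_ofReal]
      ring
    have h2 : ∑ j, ∑ i, pairing (grad φ j i) (D j i) =
        inner ℂ (gradPair φ).snd (WithLp.toLp 2 fun c => toL2 (D c.1 c.2) : GradSp d m) := by
      rw [PiLp.inner_apply, ← Fintype.sum_prod_type' (f := fun j i => pairing (grad φ j i) (D j i))]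
      refine Finset.sum_congr rfl fun c _ => ?_
      exact (inner_toL2 ((isTest_grad hφ _ _).memLp 2) (hD _ _)).symm
    have h3 : dotC k 0 = 0 := by simp [dotC]
    rw [h1, h2, hB D hD φ hφ, energyOp, inner_blockOp, inner_inlP_right, gradPair_fst,
      inner_toL2_coe (hφ.memLp 2) g, h3, mul_zero, add_zero, add_apply, smul_apply, smul_apply,
      inner_add_right, inner_smul_right, inner_smul_right]
    change _ ↔ _ * inner ℂ (toL2 φ) h + _ + _ = _
    rw [inner_toL2_coe (hφ.memLp 2) h]
    have h4 : ∀ {a b c e f : ℂ}, a + b + c + e = f ↔ a + (c + e) + b = f := by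
      intro a b c e f
      rw [show a + b + c + e = a + (c + e) + b by ring]
    exact h4
  constructor
  · rintro ⟨D, hD, h1⟩
    obtain ⟨h2, h3, h4⟩ := hasWeakGrad_iff.1 hD
    rw [toL2_coe] at h4
    exact ⟨mkP h (WithLp.toLp 2 fun c => toL2 (D c.1 c.2)), rfl, h4,
      fun φ hφ => (key D h3 φ hφ).1 (h1 φ hφ)⟩
  · rintro ⟨x, rfl, h1, h2⟩
    have h3 : ∀ j i, MemLp (x.snd (j, i) : Vel d m → ℂ) 2 volume := fun j i => Lp.memLp _
    have h4 : (WithLp.toLp 2 fun c => toL2 (x.snd (c.1, c.2) : Vel d m → ℂ) : GradSp d m) = x.snd := by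
      ext1 c
      exact toL2_coe _
    refine ⟨fun j i => x.snd (j, i), hasWeakGrad_iff.2 ⟨Lp.memLp _, h3, ?_⟩, fun φ hφ => ?_⟩
    · simp only [toL2_coe]
      exact h1
    · refine (key _ h3 φ hφ).2 ?_
      rw [h4]
      exact h2 φ hφ

/-- The undeformed propagator is the resolvent. -/
theorem HatFam.isResolvent (hN : 1 ≤ p.N) (hκ : 0 < p.kappa) (ht : 0 < p.tN)
    (hb : HatFam p.tN (p.kappa / 2) b) {k : Vel d m}
    {B : (Fin (m + 1) → Fin d → Vel d m → ℂ) → (Vel d m → ℂ) → ℂ}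
    (hB : ∀ D : Fin (m + 1) → Fin d → Vel d m → ℂ, (∀ j i, MemLp (D j i) 2 volume) →
      ∀ φ : Vel d m → ℂ, IsTest φ →
        B D φ = inner ℂ (gradPair φ).snd (b k 0 (WithLp.toLp 2 fun c => toL2 (D c.1 c.2)))) :
    IsResolvent p k B (propOf p b k 0) := by
  have h0 := zero_mem_deform ht k
  have hκN : 0 < p.kappa / (2 * p.N) := by
    have : (0 : ℝ) < p.N := by exact_mod_cast hN
    positivity
  have hpos : 0 < min (rate p.tN k 0) (p.kappa / (2 * p.N)) := lt_min h0.2 hκN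
  have hco : Coercive (min (rate p.tN k 0) (p.kappa / (2 * p.N))) (energyOp p b k 0) :=
    coercive_energyOp hN (hb.norm_le k 0 h0) (min_le_left _ _) (min_le_right _ _)
  intro g
  refine ⟨(solvesResolventEq_iff hB).2 ⟨_, rfl, isSol_solOp hpos hco (inlP d m g)⟩, fun h hh => ?_⟩
  obtain ⟨x, rfl, hx⟩ := (solvesResolventEq_iff hB).1 hh
  rw [propOf_apply, ← (isSol_iff_eq_solOp hpos hco).1 hx]

theorem IsResolvent.unique {k : Vel d m}
    {B : (Fin (m + 1) → Fin d → Vel d m → ℂ) → (Vel d m → ℂ) → ℂ} {W W' : L2 d m →L[ℂ] L2 d m}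
    (h : IsResolvent p k B W) (h' : IsResolvent p k B W') : W = W' := by
  ext1 g
  exact (h' g).2 _ (h g).1

theorem resolventOf_eq {k : Vel d m}
    {B : (Fin (m + 1) → Fin d → Vel d m → ℂ) → (Vel d m → ℂ) → ℂ} {W : L2 d m →L[ℂ] L2 d m}
    (h : IsResolvent p k B W) : resolventOf p k B = W := by
  have hW : ∃ W, IsResolvent p k B W := ⟨W, h⟩
  rw [resolventOf, dif_pos hW]
  exact hW.choose_spec.unique h

/-- The trivial hat operator. -/
theorem hatFam_zero (tN : ℝ) {K : ℝ} (hK : 0 ≤ K) :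
    HatFam tN K (fun _ _ => 0 : Vel d m → CVel d m → GradSp d m →L[ℂ] GradSp d m) where
  cov k ξ _ a D := by
    ext1 c
    simp [tauG]
  hol k := differentiableOn_const _
  norm_le k ξ _ := by rwa [norm_zero]
  cont D := by simpa using continuousOn_const

end RenormalizedPropagator

end

noncomputable section

namespace RenormalizedPropagator

/-! ### Creation of a particle with a deformed Maxwellian -/

open Filter Topology

attribute [local irreducible] tau

variable {d m : ℕ}

/-- The velocities of all particles but the last one. -/
def initV (w : Vel d (m + 1)) : Vel d m := fun l => w l.castSucc

/-- The velocity of the last particle. -/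
def lastV (w : Vel d (m + 1)) : E d := w (Fin.last (m + 1))

theorem measurePreserving_last_init : MeasurePreserving
    (fun w : Vel d (m + 1) => (lastV w, initV w)) volume
    ((volume : Measure (E d)).prod (volume : Measure (Vel d m))) := by
  have h := volume_preserving_piFinSuccAbove (fun _ : Fin (m + 2) => E d) (Fin.last (m + 1))
  refine (?_ : (fun w : Vel d (m + 1) => (lastV w, initV w)) = _) ▸ h
  funext w
  refine Prod.ext rfl ?_
  funext l
  change w l.castSucc = w ((Fin.last (m + 1)).succAbove l)
  rw [Fin.succAbove_last_apply]

theorem measurableEmbedding_last_init : MeasurableEmbedding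
    (fun w : Vel d (m + 1) => (lastV w, initV w)) := by
  have h := (MeasurableEquiv.piFinSuccAbove (fun _ : Fin (m + 2) => E d)
    (Fin.last (m + 1))).measurableEmbedding
  refine (?_ : (fun w : Vel d (m + 1) => (lastV w, initV w)) = _) ▸ h
  funext w
  refine Prod.ext rfl ?_
  funext l
  change w l.castSucc = w ((Fin.last (m + 1)).succAbove l)
  rw [Fin.succAbove_last_apply]

theorem quasiMeasurePreserving_lastV : Measure.QuasiMeasurePreserving
    (lastV : Vel d (m + 1) → E d) volume volume :=
  Measure.quasiMeasurePreserving_fst.comp measurePreserving_last_init.quasiMeasurePreserving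

theorem quasiMeasurePreserving_initV : Measure.QuasiMeasurePreserving
    (initV : Vel d (m + 1) → Vel d m) volume volume :=
  Measure.quasiMeasurePreserving_snd.comp measurePreserving_last_init.quasiMeasurePreserving

/-- The product of a function of the last velocity and a function of the other ones. -/
def tensor (Γ : E d → ℂ) (f : Vel d m → ℂ) (w : Vel d (m + 1)) : ℂ := Γ (lastV w) * f (initV w)

theorem eLpNorm_tensor {Γ : E d → ℂ} {f : Vel d m → ℂ} (hΓ : AEStronglyMeasurable Γ volume)
    (hf : AEStronglyMeasurable f volume) :
    eLpNorm (tensor Γ f) 2 volume = eLpNorm Γ 2 volume * eLpNorm f 2 volume := by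
  have h1 : ∫⁻ w : Vel d (m + 1), ‖tensor Γ f w‖ₑ ^ (2 : ℝ) =
      (∫⁻ u, ‖Γ u‖ₑ ^ (2 : ℝ)) * ∫⁻ v, ‖f v‖ₑ ^ (2 : ℝ) := by
    rw [← lintegral_prod_mul (hΓ.enorm.pow_const 2) (hf.enorm.pow_const 2),
      ← measurePreserving_last_init.lintegral_comp_emb measurableEmbedding_last_init]
    refine lintegral_congr fun w => ?_
    rw [tensor, enorm_mul, ENNReal.mul_rpow_of_nonneg _ _ (by norm_num)]
  rw [eLpNorm_eq_lintegral_rpow_enorm_toReal (by norm_num) (by norm_num),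
    eLpNorm_eq_lintegral_rpow_enorm_toReal (by norm_num) (by norm_num),
    eLpNorm_eq_lintegral_rpow_enorm_toReal (by norm_num) (by norm_num)]
  simp only [ENNReal.toReal_ofNat]
  rw [h1, ENNReal.mul_rpow_of_nonneg _ _ (by norm_num)]

theorem memLp_tensor {Γ : E d → ℂ} {f : Vel d m → ℂ} (hΓ : MemLp Γ 2 volume)
    (hf : MemLp f 2 volume) : MemLp (tensor Γ f) 2 volume := by
  refine ⟨(hΓ.1.comp_quasiMeasurePreserving quasiMeasurePreserving_lastV).mul
    (hf.1.comp_quasiMeasurePreserving quasiMeasurePreserving_initV), ?_⟩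
  rw [eLpNorm_tensor hΓ.1 hf.1]
  exact ENNReal.mul_lt_top hΓ.2 hf.2

theorem tensor_congr (Γ : E d → ℂ) {f g : Vel d m → ℂ} (h : f =ᵐ[volume] g) :
    tensor Γ f =ᵐ[volume] tensor Γ g := by
  filter_upwards [quasiMeasurePreserving_initV.ae h] with w hw
  rw [tensor, tensor, hw]

open Classical in
/-- Tensor product with a function of the velocity of an additional particle. -/
def tensorOp (Γ : E d → ℂ) : L2 d m →L[ℂ] L2 d (m + 1) :=
  if hΓ : MemLp Γ 2 volume then
    LinearMap.mkContinuous
      { toFun := fun f => toL2 (tensor Γ f)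
        map_add' := fun f g => by
          rw [← toL2_add (memLp_tensor hΓ (Lp.memLp f)) (memLp_tensor hΓ (Lp.memLp g))]
          refine toL2_congr ((tensor_congr Γ (Lp.coeFn_add f g)).trans (ae_of_all _ fun w => ?_))
          simp only [tensor, Pi.add_apply, mul_add]
        map_smul' := fun c f => by
          rw [RingHom.id_apply, ← toL2_smul c (memLp_tensor hΓ (Lp.memLp f))]
          refine toL2_congr ((tensor_congr Γ (Lp.coeFn_smul c f)).trans (ae_of_all _ fun w => ?_))
          simp only [tensor, Pi.smul_apply, smul_eq_mul]
          ring } (eLpNorm Γ 2 volume).toReal fun f => by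
        change ‖toL2 (tensor Γ f)‖ ≤ _
        rw [← toReal_enorm, enorm_toL2 (memLp_tensor hΓ (Lp.memLp f)),
          eLpNorm_tensor hΓ.1 (Lp.memLp f).1, ENNReal.toReal_mul]
        rfl
  else 0

theorem tensorOp_apply {Γ : E d → ℂ} (hΓ : MemLp Γ 2 volume) (f : L2 d m) :
    tensorOp Γ f = toL2 (tensor Γ f) := by
  rw [tensorOp, dif_pos hΓ]; rfl

theorem tensorOp_toL2 {Γ : E d → ℂ} (hΓ : MemLp Γ 2 volume) {f : Vel d m → ℂ}
    (hf : MemLp f 2 volume) : tensorOp Γ (toL2 f) = toL2 (tensor Γ f) := by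
  rw [tensorOp_apply hΓ]
  exact toL2_congr (tensor_congr Γ (coe_toL2 hf))

theorem norm_tensorOp_le (Γ : E d → ℂ) :
    ‖(tensorOp Γ : L2 d m →L[ℂ] L2 d (m + 1))‖ ≤ (eLpNorm Γ 2 volume).toReal := by
  by_cases hΓ : MemLp Γ 2 volume
  · rw [tensorOp, dif_pos hΓ]
    exact LinearMap.mkContinuous_norm_le _ ENNReal.toReal_nonneg _
  · rw [tensorOp, dif_neg hΓ, norm_zero]
    exact ENNReal.toReal_nonneg

/-- Adding a velocity or momentum of an additional particle. -/
def snocV (v : Vel d m) (u : E d) : Vel d (m + 1) := Fin.snoc (α := fun _ => E d) v u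

theorem tau_tensorOp {Γ : E d → ℂ} (hΓ : MemLp Γ 2 volume) (a : Vel d m) (a' : E d) (f : L2 d m) :
    tau (snocV a a') (tensorOp Γ f) = tensorOp (fun u => Γ (u + a')) (tau a f) := by
  have hΓ' : MemLp (fun u => Γ (u + a')) 2 volume :=
    hΓ.comp_measurePreserving (measurePreserving_add_right volume a')
  rw [tensorOp_apply hΓ, tensorOp_apply hΓ', tau_toL2 _ (memLp_tensor hΓ (Lp.memLp f))]
  have h1 : ∀ w, lastV (w + snocV a a') = lastV w + a' := fun w => by simp [lastV, snocV]
  have h2 : ∀ w, initV (w + snocV a a') = initV w + a := fun w => by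
    funext l; simp [initV, snocV]
  refine toL2_congr ?_
  filter_upwards [tensor_congr (fun u => Γ (u + a')) (coe_tau a f)] with w hw
  rw [hw]
  simp only [tensor, h1, h2]

/-! ### The Gaussian at complex velocities. -/

/-- The square root of the Maxwellian at complex velocities. -/
def gaussC (β : ℝ) (η : EuclideanSpace ℂ (Fin d)) (u : E d) : ℂ :=
  ((Real.sqrt ((β / (2 * Real.pi)) ^ ((d : ℝ) / 2)) : ℝ) : ℂ) *
    cexp (-((β / 4 : ℝ) : ℂ) * ∑ i, ((u i : ℂ) + η i) ^ 2)

theorem gaussC_zero {β : ℝ} (hβ : 0 < β) (u : E d) :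
    gaussC β 0 u = ((Real.sqrt (maxwellian β u) : ℝ) : ℂ) := by
  have h : ‖u‖ ^ 2 = ∑ i, u i ^ 2 := by
    rw [EuclideanSpace.norm_sq_eq]
    simp only [Real.norm_eq_abs, sq_abs]
  rw [maxwellian, Real.sqrt_mul (by positivity), Real.sqrt_eq_rpow (Real.exp _), ← Real.exp_mul,
    gaussC, h]
  simp only [PiLp.zero_apply, add_zero]
  push_cast
  congr 2
  ring

theorem gaussC_add_toC (β : ℝ) (η : EuclideanSpace ℂ (Fin d)) (a u : E d) :
    gaussC β (η + WithLp.toLp 2 fun i => ((a i : ℝ) : ℂ)) u = gaussC β η (u + a) := by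
  simp only [gaussC, PiLp.add_apply, Complex.ofReal_add]
  congr 3
  refine Finset.sum_congr rfl fun i _ => ?_
  ring

theorem conj_gaussC (β : ℝ) (η : EuclideanSpace ℂ (Fin d)) (u : E d) :
    starRingEnd ℂ (gaussC β η u) = gaussC β (WithLp.toLp 2 fun i => starRingEnd ℂ (η i)) u := by
  simp only [gaussC, map_mul, Complex.conj_ofReal, ← Complex.exp_conj, map_neg, map_sum, map_pow,
    map_add]

theorem continuous_gaussC (β : ℝ) (η : EuclideanSpace ℂ (Fin d)) : Continuous (gaussC β η) := by
  unfold gaussC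
  fun_prop

theorem norm_gaussC (β : ℝ) (η : EuclideanSpace ℂ (Fin d)) (u : E d) :
    ‖gaussC β η u‖ = Real.sqrt ((β / (2 * Real.pi)) ^ ((d : ℝ) / 2)) *
      Real.exp (-(β / 4) * ∑ i, ((u i + (η i).re) ^ 2 - (η i).im ^ 2)) := by
  rw [gaussC, norm_mul, Complex.norm_exp, Complex.norm_real,
    Real.norm_of_nonneg (Real.sqrt_nonneg _), ← Complex.ofReal_neg, Complex.re_ofReal_mul,
    Complex.re_sum]
  congr 3
  refine Finset.sum_congr rfl fun i _ => ?_
  simp [sq]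

theorem integrable_gaussian {b : ℝ} (hb : 0 < b) : Integrable (fun u : E d => Real.exp (-b * ‖u‖ ^ 2)) := by
  have h := GaussianFourier.integrable_cexp_neg_mul_sq_norm_add (V := E d) (b := (b : ℂ)) (by simpa) 0 0
  refine h.norm.congr (ae_of_all _ fun u => ?_)
  simp only [Complex.norm_exp, inner_zero_left, Complex.ofReal_zero, mul_zero, add_zero]
  congr 1
  rw [← Complex.ofReal_neg, ← Complex.ofReal_pow, ← Complex.ofReal_mul, Complex.ofReal_re]

theorem memLp_gaussian {b : ℝ} (hb : 0 < b) :
    MemLp (fun u : E d => ((Real.exp (-b * ‖u‖ ^ 2) : ℝ) : ℂ)) 2 volume := by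
  have hc : Continuous fun u : E d => ((Real.exp (-b * ‖u‖ ^ 2) : ℝ) : ℂ) := by fun_prop
  refine (memLp_two_iff_integrable_sq_norm hc.aestronglyMeasurable).2 ?_
  refine (integrable_gaussian (d := d) (b := 2 * b) (by positivity)).congr (ae_of_all _ fun u => ?_)
  simp only [Complex.norm_real, Real.norm_of_nonneg (Real.exp_pos _).le, sq, ← Real.exp_add]
  congr 1
  ring

/-- The constant in the Gaussian bounds. -/
def gaussBd (d : ℕ) (β y : ℝ) : ℝ :=
  Real.sqrt ((β / (2 * Real.pi)) ^ ((d : ℝ) / 2)) * Real.exp (β / 4 * y ^ 2)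

theorem gaussBd_nonneg (d : ℕ) (β y : ℝ) : 0 ≤ gaussBd d β y :=
  mul_nonneg (Real.sqrt_nonneg _) (Real.exp_pos _).le

/-- For η in a bounded set, all these functions are dominated by one fixed Gaussian, as needed for
differentiation under the integral. -/
theorem norm_gaussC_le {β : ℝ} (hβ : 0 < β) {η : EuclideanSpace ℂ (Fin d)} {y : ℝ} (hy : ‖η‖ ≤ y)
    (u : E d) : ‖gaussC β η u‖ ≤ gaussBd d β y * Real.exp (-(β / 8) * ‖u‖ ^ 2) := by
  rw [norm_gaussC, gaussBd, mul_assoc, ← Real.exp_add]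
  gcongr
  have h1 : ‖η‖ ^ 2 = ∑ i, ((η i).re ^ 2 + (η i).im ^ 2) := by
    rw [EuclideanSpace.norm_sq_eq]
    refine Finset.sum_congr rfl fun i _ => ?_
    rw [Complex.sq_norm, Complex.normSq_apply]
    ring
  have h2 : ∑ i, (u i ^ 2 / 2 - (η i).re ^ 2 - (η i).im ^ 2) ≤
      ∑ i, ((u i + (η i).re) ^ 2 - (η i).im ^ 2) := by
    refine Finset.sum_le_sum fun i _ => ?_
    -- The difference of the two sides is half of this square.
    nlinarith [sq_nonneg (u i + 2 * (η i).re)]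
  have h3 : ∑ i, (u i ^ 2 / 2 - (η i).re ^ 2 - (η i).im ^ 2) = ‖u‖ ^ 2 / 2 - ‖η‖ ^ 2 := by
    rw [h1, EuclideanSpace.norm_sq_eq, Finset.sum_div, ← Finset.sum_sub_distrib]
    refine Finset.sum_congr rfl fun i _ => ?_
    rw [Real.norm_eq_abs, sq_abs]
    ring
  have h4 : ‖η‖ ^ 2 ≤ y ^ 2 := by gcongr
  nlinarith

theorem memLp_gaussC {β : ℝ} (hβ : 0 < β) (η : EuclideanSpace ℂ (Fin d)) :
    MemLp (gaussC β η) 2 volume :=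
  (memLp_gaussian (b := β / 8) (by positivity)).of_le_mul (c := gaussBd d β ‖η‖)
    (continuous_gaussC β η).aestronglyMeasurable (ae_of_all _ fun u => by
      rw [Complex.norm_real, Real.norm_of_nonneg (Real.exp_pos _).le]
      exact norm_gaussC_le hβ le_rfl u)

/-- The operator norm of the creation of a particle. -/
def creaBd (d : ℕ) (β y : ℝ) : ℝ :=
  gaussBd d β y * (eLpNorm (fun u : E d => ((Real.exp (-(β / 8) * ‖u‖ ^ 2) : ℝ) : ℂ)) 2 volume).toReal

theorem creaBd_nonneg (d : ℕ) (β y : ℝ) : 0 ≤ creaBd d β y :=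
  mul_nonneg (gaussBd_nonneg _ _ _) ENNReal.toReal_nonneg

theorem eLpNorm_gaussC_le {β : ℝ} (hβ : 0 < β) {η : EuclideanSpace ℂ (Fin d)} {y : ℝ}
    (hy : ‖η‖ ≤ y) : (eLpNorm (gaussC β η) 2 volume).toReal ≤ creaBd d β y := by
  have h1 : eLpNorm (gaussC β η) 2 volume ≤ ENNReal.ofReal (gaussBd d β y) *
      eLpNorm (fun u : E d => ((Real.exp (-(β / 8) * ‖u‖ ^ 2) : ℝ) : ℂ)) 2 volume := by
    refine eLpNorm_le_mul_eLpNorm_of_ae_le_mul (ae_of_all _ fun u => ?_) 2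
    rw [Complex.norm_real, Real.norm_of_nonneg (Real.exp_pos _).le]
    exact norm_gaussC_le hβ hy u
  have h2 := ENNReal.toReal_mono (ENNReal.mul_ne_top ENNReal.ofReal_ne_top
    (memLp_gaussian (d := d) (b := β / 8) (by positivity)).2.ne) h1
  rwa [ENNReal.toReal_mul, ENNReal.toReal_ofReal (gaussBd_nonneg _ _ _)] at h2

/-- Real parts. -/
def reE (η : EuclideanSpace ℂ (Fin d)) : E d := WithLp.toLp 2 fun i => (η i).re

/-- Imaginary parts. -/
def imE (η : EuclideanSpace ℂ (Fin d)) : E d := WithLp.toLp 2 fun i => (η i).im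

/-- The purely imaginary vector with given imaginary part. -/
def iE (y : E d) : EuclideanSpace ℂ (Fin d) := WithLp.toLp 2 fun i => I * ((y i : ℝ) : ℂ)

/-- Creation of a particle with the Maxwellian shifted by `η`. -/
def crea (β : ℝ) (η : EuclideanSpace ℂ (Fin d)) : L2 d m →L[ℂ] L2 d (m + 1) := tensorOp (gaussC β η)

/-- The complex conjugate vector. -/
def conjE (η : EuclideanSpace ℂ (Fin d)) : EuclideanSpace ℂ (Fin d) :=
  WithLp.toLp 2 fun i => starRingEnd ℂ (η i)

/-- The transposed operator, holomorphic in `η`. -/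
def anni (β : ℝ) (η : EuclideanSpace ℂ (Fin d)) : L2 d (m + 1) →L[ℂ] L2 d m :=
  (crea β (conjE η)).adjoint

theorem norm_iE (y : E d) : ‖iE y‖ = ‖y‖ := by
  rw [EuclideanSpace.norm_eq, EuclideanSpace.norm_eq]
  simp [iE]

theorem conjE_conjE (η : EuclideanSpace ℂ (Fin d)) : conjE (conjE η) = η := by
  ext i; simp [conjE]

theorem imE_conjE (η : EuclideanSpace ℂ (Fin d)) : imE (conjE η) = -imE η := by
  ext i; simp [imE, conjE]

/-- Real vectors as complex vectors. -/
def toC (a : E d) : EuclideanSpace ℂ (Fin d) := WithLp.toLp 2 fun i => ((a i : ℝ) : ℂ)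

theorem eq_iE_add_toC (η : EuclideanSpace ℂ (Fin d)) : η = iE (imE η) + toC (reE η) := by
  ext i
  simp only [iE, imE, toC, reE, PiLp.add_apply]
  rw [mul_comm, add_comm, Complex.re_add_im]

/-- A real shift only translates the Gaussian and preserves its L² norm, so the bound depends on Im
η alone. This is what makes it uniform on strips. -/
theorem norm_crea_le {β : ℝ} (hβ : 0 < β) {η : EuclideanSpace ℂ (Fin d)} {y : ℝ}
    (hy : ‖imE η‖ ≤ y) : ‖(crea β η : L2 d m →L[ℂ] L2 d (m + 1))‖ ≤ creaBd d β y := by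
  refine (norm_tensorOp_le _).trans ?_
  have h1 : gaussC β η = fun u => gaussC β (iE (imE η)) (u + reE η) := by
    funext u
    rw [← gaussC_add_toC]
    congr 1
    exact eq_iE_add_toC η
  have h2 := eLpNorm_comp_measurePreserving (p := 2)
    (memLp_gaussC hβ (iE (imE η))).1 (measurePreserving_add_right (volume : Measure (E d)) (reE η))
  rw [h1]
  change (eLpNorm (gaussC β (iE (imE η)) ∘ fun u => u + reE η) 2 volume).toReal ≤ _
  rw [h2]
  exact eLpNorm_gaussC_le hβ (by rwa [norm_iE])

theorem norm_anni_le {β : ℝ} (hβ : 0 < β) {η : EuclideanSpace ℂ (Fin d)} {y : ℝ}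
    (hy : ‖imE η‖ ≤ y) : ‖(anni β η : L2 d (m + 1) →L[ℂ] L2 d m)‖ ≤ creaBd d β y := by
  rw [anni, LinearIsometryEquiv.norm_map]
  exact norm_crea_le hβ (by rwa [imE_conjE, norm_neg])

theorem tau_crea {β : ℝ} (hβ : 0 < β) (η : EuclideanSpace ℂ (Fin d)) (a : Vel d m) (a' : E d)
    (f : L2 d m) : tau (snocV a a') (crea β η f) = crea β (η + toC a') (tau a f) := by
  rw [crea, tau_tensorOp (memLp_gaussC hβ η), crea]
  congr 2
  funext u
  exact (gaussC_add_toC β η a' u).symm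

theorem conjE_add_toC (η : EuclideanSpace ℂ (Fin d)) (a : E d) :
    conjE (η + toC a) = conjE η + toC a := by
  ext i; simp [conjE, toC]

theorem tau_anni {β : ℝ} (hβ : 0 < β) (η : EuclideanSpace ℂ (Fin d)) (a : Vel d m) (a' : E d)
    (f : L2 d (m + 1)) : tau a (anni β η f) = anni β (η + toC a') (tau (snocV a a') f) := by
  refine ext_inner_left ℂ fun g => ?_
  have h1 : inner ℂ g (tau a (anni β η f)) = inner ℂ (tau (-a) g) (anni β η f) := by
    rw [inner_tau_left, neg_neg]
  rw [h1, anni, anni, ContinuousLinearMap.adjoint_inner_right,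
    ContinuousLinearMap.adjoint_inner_right, conjE_add_toC]
  have h2 := tau_crea hβ (conjE η) a a' (tau (-a) g)
  rw [tau_tau, add_neg_cancel, tau_zero] at h2
  rw [← h2, inner_tau_tau]

theorem differentiable_gaussC (β : ℝ) (u : E d) :
    Differentiable ℂ fun η : EuclideanSpace ℂ (Fin d) => gaussC β η u := by
  have h1 : ∀ i, Differentiable ℂ fun η : EuclideanSpace ℂ (Fin d) => η i := fun i =>
    (EuclideanSpace.proj (𝕜 := ℂ) i : EuclideanSpace ℂ (Fin d) →L[ℂ] ℂ).differentiable
  have h2 : Differentiable ℂ fun η : EuclideanSpace ℂ (Fin d) => ∑ i, ((u i : ℂ) + η i) ^ 2 :=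
    Differentiable.fun_sum fun i _ => ((h1 i).const_add _).pow 2
  exact ((h2.const_mul _).cexp).const_mul _

/-- Matrix elements of `crea` and `anni` are holomorphic. -/
theorem differentiable_integral_gaussC {β : ℝ} (hβ : 0 < β) {h : Vel d (m + 1) → ℂ}
    {f : Vel d m → ℂ} (hh : MemLp h 2 volume) (hf : MemLp f 2 volume) :
    Differentiable ℂ fun η : EuclideanSpace ℂ (Fin d) => ∫ w, h w * tensor (gaussC β η) f w := by
  have hΓ := memLp_gaussian (d := d) (b := β / 8) (by positivity)
  have hdom : DominatedHolomorphic (volume : Measure (Vel d (m + 1))) Set.univ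
      fun (η : EuclideanSpace ℂ (Fin d)) w => h w * tensor (gaussC β η) f w := by
    refine ⟨fun η _ => hh.1.mul (memLp_tensor (memLp_gaussC hβ η) hf).1, fun w => ?_, fun η _ => ?_⟩
    · exact (((differentiable_gaussC β (lastV w)).mul_const _).const_mul _).differentiableOn
    · refine ⟨1, one_pos, Set.subset_univ _, fun w => gaussBd d β (‖η‖ + 1) *
        (‖h w‖ * ‖tensor (fun u : E d => ((Real.exp (-(β / 8) * ‖u‖ ^ 2) : ℝ) : ℂ)) f w‖),
        (hh.norm.integrable_mul (memLp_tensor hΓ hf).norm).const_mul _, fun ζ hζ w => ?_⟩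
      have hζ' : ‖ζ‖ ≤ ‖η‖ + 1 := by
        have h1 : ‖ζ - η‖ < 1 := by rwa [Metric.mem_ball, dist_eq_norm] at hζ
        have h2 := norm_add_le (ζ - η) η
        rw [sub_add_cancel] at h2
        linarith
      have h3 := norm_gaussC_le hβ hζ' (lastV w)
      simp only [tensor, norm_mul, Complex.norm_real, Real.norm_of_nonneg (Real.exp_pos _).le]
      calc ‖h w‖ * (‖gaussC β ζ (lastV w)‖ * ‖f (initV w)‖)
          ≤ ‖h w‖ * ((gaussBd d β (‖η‖ + 1) * Real.exp (-(β / 8) * ‖lastV w‖ ^ 2)) *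
            ‖f (initV w)‖) := by gcongr
        _ = _ := by ring
  exact differentiableOn_univ.1 hdom.differentiableOn_integral

theorem norm_imE_le (η : EuclideanSpace ℂ (Fin d)) : ‖imE η‖ ≤ ‖η‖ := by
  rw [EuclideanSpace.norm_eq, EuclideanSpace.norm_eq]
  refine Real.sqrt_le_sqrt (Finset.sum_le_sum fun i _ => ?_)
  gcongr
  exact Complex.abs_im_le_norm (η i)

theorem norm_imE_le_of_ball {η ζ : EuclideanSpace ℂ (Fin d)} (h : ζ ∈ Metric.ball η 1) :
    ‖imE ζ‖ ≤ ‖η‖ + 1 := by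
  have h1 : ‖ζ - η‖ < 1 := by rwa [Metric.mem_ball, dist_eq_norm] at h
  have h2 := norm_add_le (ζ - η) η
  rw [sub_add_cancel] at h2
  linarith [norm_imE_le ζ]

/-- Matrix elements are integrals of entire functions of η, and the norms are locally bounded; weak
holomorphy then gives norm holomorphy. -/
theorem differentiable_crea {β : ℝ} (hβ : 0 < β) :
    Differentiable ℂ (crea β : EuclideanSpace ℂ (Fin d) → L2 d m →L[ℂ] L2 d (m + 1)) := by
  intro η
  refine differentiableAt_of_weakly_of_ball one_pos (fun f g => ?_)
    fun ζ hζ => norm_crea_le hβ (norm_imE_le_of_ball hζ)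
  refine Differentiable.differentiableOn ?_
  have h1 := differentiable_integral_gaussC hβ (Lp.memLp g).star (Lp.memLp f)
  have h2 : (fun ζ => inner ℂ g (crea β ζ f)) =
      fun ζ => ∫ w, (star (g : Vel d (m + 1) → ℂ)) w * tensor (gaussC β ζ) f w := by
    funext ζ
    rw [crea, tensorOp_apply (memLp_gaussC hβ ζ)]
    conv_lhs => rw [← toL2_coe g]
    exact inner_toL2 (Lp.memLp g) (memLp_tensor (memLp_gaussC hβ ζ) (Lp.memLp f))
  rw [h2]
  exact h1

theorem differentiable_anni {β : ℝ} (hβ : 0 < β) :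
    Differentiable ℂ (anni β : EuclideanSpace ℂ (Fin d) → L2 d (m + 1) →L[ℂ] L2 d m) := by
  intro η
  refine differentiableAt_of_weakly_of_ball one_pos (fun f g => ?_)
    fun ζ hζ => norm_anni_le hβ (norm_imE_le_of_ball hζ)
  refine Differentiable.differentiableOn ?_
  have h1 := differentiable_integral_gaussC hβ (Lp.memLp f) (Lp.memLp g).star
  have h2 : (fun ζ => inner ℂ g (anni β ζ f)) =
      fun ζ => ∫ w, f w * tensor (gaussC β ζ) (star (g : Vel d m → ℂ)) w := by
    funext ζ
    rw [anni, ContinuousLinearMap.adjoint_inner_right, crea, tensorOp_apply (memLp_gaussC hβ _),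
      inner_toL2_coe (memLp_tensor (memLp_gaussC hβ _) (Lp.memLp g)), pairing]
    congr 1
    funext w
    have h3 := conj_gaussC β (conjE ζ) (lastV w)
    simp only [tensor, map_mul, h3]
    rw [show (WithLp.toLp 2 fun i => starRingEnd ℂ (conjE ζ i)) = ζ from conjE_conjE ζ, mul_comm]
    rfl
  rw [h2]
  exact h1

end RenormalizedPropagator

end

noncomputable section

namespace RenormalizedPropagator
/-! ### The deformed emission and absorption of one particle -/
open Filter Topology
attribute [local irreducible] tau
variable {d m : ℕ}

/-- Adding a complex velocity of an additional particle. -/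
def snocC (ξ : CVel d m) (η : EuclideanSpace ℂ (Fin d)) : CVel d (m + 1) :=
  Fin.snoc (α := fun _ => EuclideanSpace ℂ (Fin d)) ξ η

@[simp] theorem snocC_castSucc (ξ : CVel d m) (η : EuclideanSpace ℂ (Fin d)) (l : Fin (m + 1)) :
    snocC ξ η l.castSucc = ξ l := by
  simp [snocC]

@[simp] theorem snocC_last (ξ : CVel d m) (η : EuclideanSpace ℂ (Fin d)) :
    snocC ξ η (Fin.last (m + 1)) = η := by
  simp [snocC]

theorem snocC_add_toCVel (ξ : CVel d m) (η : EuclideanSpace ℂ (Fin d)) (a : Vel d m) (a' : E d) :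
    snocC (ξ + toCVel a) (η + toC a') = snocC ξ η + toCVel (snocV a a') := by
  funext l
  induction l using Fin.lastCases with
  | last =>
    ext i
    simp [toCVel_apply, snocV, toC]
  | cast l =>
    ext i
    simp [toCVel_apply, snocV]

theorem differentiable_snocC {Z : Type} [NormedAddCommGroup Z] [NormedSpace ℂ Z] {f : Z → CVel d m}
    {g : Z → EuclideanSpace ℂ (Fin d)} (hf : Differentiable ℂ f) (hg : Differentiable ℂ g) :
    Differentiable ℂ fun z => snocC (f z) (g z) := by
  refine differentiable_pi.2 fun l => ?_
  induction l using Fin.lastCases with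
  | last => simpa using hg
  | cast l => simpa using differentiable_pi.1 hf l

theorem continuousOn_snocC {Z : Type} [TopologicalSpace Z] {s : Set Z} {f : Z → CVel d m}
    {g : Z → EuclideanSpace ℂ (Fin d)} (hf : ContinuousOn f s) (hg : ContinuousOn g s) :
    ContinuousOn (fun z => snocC (f z) (g z)) s := by
  refine continuousOn_pi.2 fun l => ?_
  induction l using Fin.lastCases with
  | last => simpa using hg
  | cast l => simpa using continuousOn_pi.1 hf l

/-- The bilinear product of a momentum and a complex velocity. -/
def dotE (q : E d) (η : EuclideanSpace ℂ (Fin d)) : ℂ := ∑ i, (q i : ℂ) * η i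

theorem dotE_sub (q : E d) (η ζ : EuclideanSpace ℂ (Fin d)) :
    dotE q (η - ζ) = dotE q η - dotE q ζ := by
  simp [dotE, mul_sub, Finset.sum_sub_distrib]

theorem dotE_smul (q : E d) (z : ℂ) (ζ : EuclideanSpace ℂ (Fin d)) :
    dotE q (z • ζ) = z * dotE q ζ := by
  simp only [dotE, PiLp.smul_apply, smul_eq_mul, Finset.mul_sum]
  exact Finset.sum_congr rfl fun i _ => by ring

theorem dotE_toC_self {q : E d} (hq : q ≠ 0) : dotE q (toC (‖q‖⁻¹ • q)) = ‖q‖ := by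
  have h1 : dotE q (toC (‖q‖⁻¹ • q)) = ((‖q‖⁻¹ * ∑ i, q i ^ 2 : ℝ) : ℂ) := by
    simp only [dotE, toC, PiLp.smul_apply, smul_eq_mul]
    push_cast
    rw [Finset.mul_sum]
    exact Finset.sum_congr rfl fun i _ => by ring
  have h2 : ∑ i, q i ^ 2 = ‖q‖ ^ 2 := by
    rw [EuclideanSpace.norm_sq_eq]
    simp only [Real.norm_eq_abs, sq_abs]
  have h3 : ‖q‖ ≠ 0 := norm_ne_zero_iff.2 hq
  rw [h1, h2]
  congr 1
  field_simp

/-- The emission moves q from particle j to the new particle, so the phase changes only by q·(η -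
ξ_j). -/
theorem dotC_splitMom (k : Vel d m) (j : Fin (m + 1)) (q : E d) (ξ : CVel d m)
    (η : EuclideanSpace ℂ (Fin d)) :
    dotC (splitMom k j q) (snocC ξ η) = dotC k ξ - dotE q (ξ j) + dotE q η := by
  rw [dotC, Fin.sum_univ_castSucc]
  simp only [splitMom, Fin.snoc_castSucc, Fin.snoc_last, snocC_castSucc, snocC_last]
  congr 1
  have h1 : ∀ l, ∑ i, ((Function.update k j (k j - q) l i : ℝ) : ℂ) * ξ l i =
      ∑ i, (k l i : ℂ) * ξ l i - if l = j then dotE q (ξ j) else 0 := by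
    intro l
    by_cases h : l = j
    · subst h
      simp [dotE, sub_mul, Finset.sum_sub_distrib]
    · simp [h]
  rw [Finset.sum_congr rfl fun l _ => h1 l, Finset.sum_sub_distrib, Finset.sum_ite_eq']
  simp [dotC]

/-- Emission, propagation, and absorption. -/
def sandw (β : ℝ) (T : CVel d (m + 1) → L2 d (m + 1) →L[ℂ] L2 d (m + 1)) (ξ : CVel d m)
    (η : EuclideanSpace ℂ (Fin d)) : L2 d m →L[ℂ] L2 d m :=
  anni β η ∘L T (snocC ξ η) ∘L crea β η

theorem sandw_apply (β : ℝ) (T : CVel d (m + 1) → L2 d (m + 1) →L[ℂ] L2 d (m + 1)) (ξ : CVel d m)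
    (η : EuclideanSpace ℂ (Fin d)) (f : L2 d m) :
    sandw β T ξ η f = anni β η (T (snocC ξ η) (crea β η f)) := rfl

theorem sandw_tau {β : ℝ} (hβ : 0 < β) {T : CVel d (m + 1) → L2 d (m + 1) →L[ℂ] L2 d (m + 1)}
    {ξ : CVel d m} {η : EuclideanSpace ℂ (Fin d)} (a : Vel d m) (a' : E d)
    (hT : ∀ f, T (snocC ξ η + toCVel (snocV a a')) (tau (snocV a a') f) =
      tau (snocV a a') (T (snocC ξ η) f)) (f : L2 d m) :
    sandw β T (ξ + toCVel a) (η + toC a') (tau a f) = tau a (sandw β T ξ η f) := by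
  rw [sandw_apply, sandw_apply, tau_anni hβ η a a', ← tau_crea hβ η a a', snocC_add_toCVel, hT]

theorem norm_sandw_le {β : ℝ} (hβ : 0 < β) {T : CVel d (m + 1) → L2 d (m + 1) →L[ℂ] L2 d (m + 1)}
    {ξ : CVel d m} {η : EuclideanSpace ℂ (Fin d)} {y c : ℝ} (hη : ‖imE η‖ ≤ y)
    (hT : ‖T (snocC ξ η)‖ ≤ c) : ‖sandw β T ξ η‖ ≤ creaBd d β y ^ 2 * c := by
  have h1 := norm_crea_le (m := m) hβ hη
  have h2 := norm_anni_le (m := m) hβ hη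
  have h0 := creaBd_nonneg d β y
  have hc : 0 ≤ c := (norm_nonneg _).trans hT
  calc ‖sandw β T ξ η‖ ≤ ‖(anni β η : L2 d (m + 1) →L[ℂ] L2 d m)‖ *
        (‖T (snocC ξ η)‖ * ‖(crea β η : L2 d m →L[ℂ] L2 d (m + 1))‖) :=
        (ContinuousLinearMap.opNorm_comp_le _ _).trans
          (mul_le_mul_of_nonneg_left (ContinuousLinearMap.opNorm_comp_le _ _) (norm_nonneg _))
    _ ≤ creaBd d β y * (c * creaBd d β y) := by gcongr
    _ = _ := by ring

theorem differentiableAt_clm_comp₃ {Z A B C D : Type} [NormedAddCommGroup Z] [NormedSpace ℂ Z]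
    [NormedAddCommGroup A] [NormedSpace ℂ A] [NormedAddCommGroup B] [NormedSpace ℂ B]
    [NormedAddCommGroup C] [NormedSpace ℂ C] [NormedAddCommGroup D] [NormedSpace ℂ D]
    {f : Z → C →L[ℂ] D} {g : Z → B →L[ℂ] C} {h : Z → A →L[ℂ] B} {z : Z}
    (hf : DifferentiableAt ℂ f z) (hg : DifferentiableAt ℂ g z) (hh : DifferentiableAt ℂ h z) :
    DifferentiableAt ℂ (fun z => f z ∘L g z ∘L h z) z :=
  hf.clm_comp (hg.clm_comp hh)

theorem differentiableAt_sandw {β : ℝ} (hβ : 0 < β)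
    {T : CVel d (m + 1) → L2 d (m + 1) →L[ℂ] L2 d (m + 1)} {Z : Type} [NormedAddCommGroup Z]
    [NormedSpace ℂ Z] {ξ : Z → CVel d m} {η : Z → EuclideanSpace ℂ (Fin d)} {z : Z}
    (hξ : Differentiable ℂ ξ) (hη : Differentiable ℂ η)
    (hT : DifferentiableAt ℂ T (snocC (ξ z) (η z))) :
    DifferentiableAt ℂ (fun z => sandw β T (ξ z) (η z)) z := by
  have h1 : DifferentiableAt ℂ (fun z => T (snocC (ξ z) (η z))) z := by
    simpa only [Function.comp_def] using hT.comp z (differentiable_snocC hξ hη z)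
  have h2 : DifferentiableAt ℂ (fun z => (crea β (η z) : L2 d m →L[ℂ] L2 d (m + 1))) z := by
    simpa only [Function.comp_def] using (differentiable_crea hβ (η z)).comp z (hη z)
  have h3 : DifferentiableAt ℂ (fun z => (anni β (η z) : L2 d (m + 1) →L[ℂ] L2 d m)) z := by
    simpa only [Function.comp_def] using (differentiable_anni hβ (η z)).comp z (hη z)
  exact differentiableAt_clm_comp₃ h3 h1 h2

/-- A holomorphic function on a convex set that is invariant under real translations is constant. -/
theorem eq_of_real_invariant {F : Type} [NormedAddCommGroup F] [NormedSpace ℂ F] {U : Set ℂ}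
    (hU : IsOpen U) (hc : Convex ℝ U) {G : ℂ → F} (hG : DifferentiableOn ℂ G U)
    (h : ∀ z ∈ U, ∀ x : ℝ, G (z + x) = G z) {z w : ℂ} (hz : z ∈ U) (hw : w ∈ U) : G z = G w := by
  refine hU.is_const_of_deriv_eq_zero hc.isPreconnected hG (fun z hz => ?_) hz hw
  have h1 : HasDerivAt G (deriv G z) (z + ((0 : ℝ) : ℂ)) := by
    simpa using (hG.differentiableAt (hU.mem_nhds hz)).hasDerivAt
  have h2 : HasDerivAt (fun x : ℂ => G (z + x)) (deriv G z) ((0 : ℝ) : ℂ) :=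
    HasDerivAt.comp_const_add z _ h1
  have h3 := hasDerivAt_iff_tendsto_slope_zero.1 h2
  have h4 : Tendsto (fun x : ℝ => (x : ℂ)) (𝓝[≠] 0) (𝓝[≠] ((0 : ℝ) : ℂ)) :=
    tendsto_nhdsWithin_of_tendsto_nhds_of_eventually_within _
      (Complex.continuous_ofReal.tendsto 0 |>.mono_left nhdsWithin_le_nhds)
      (eventually_mem_nhdsWithin.mono fun x hx h => hx (Complex.ofReal_injective h))
  refine tendsto_nhds_unique (h3.comp h4) (tendsto_const_nhds.congr fun x => ?_)
  have h5 := h z hz x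
  simp [h5]

theorem imPart_snocC_castSucc (ξ : CVel d m) (η : EuclideanSpace ℂ (Fin d)) (l : Fin (m + 1)) :
    imPart (snocC ξ η) l.castSucc = imPart ξ l := by
  simp [imPart]

theorem imPart_snocC_last (ξ : CVel d m) (η : EuclideanSpace ℂ (Fin d)) :
    imPart (snocC ξ η) (Fin.last (m + 1)) = imE η := by
  simp [imPart, imE]

/-- The deformation of the velocity of the emitted particle. -/
def emit (q : E d) (η : EuclideanSpace ℂ (Fin d)) : EuclideanSpace ℂ (Fin d) :=
  η - I • toC (‖q‖⁻¹ • q)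

theorem emit_add (q : E d) (η ζ : EuclideanSpace ℂ (Fin d)) : emit q (η + ζ) = emit q η + ζ := by
  simp only [emit, sub_eq_add_neg, add_right_comm]

theorem norm_unit {q : E d} (hq : q ≠ 0) : ‖‖q‖⁻¹ • q‖ = 1 := by
  rw [norm_smul, norm_inv, norm_norm, inv_mul_cancel₀ (norm_ne_zero_iff.2 hq)]

theorem imE_emit (q : E d) (η : EuclideanSpace ℂ (Fin d)) :
    imE (emit q η) = imE η - ‖q‖⁻¹ • q := by
  ext i
  simp [imE, emit, toC]

theorem norm_imE_emit_le {q : E d} (hq : q ≠ 0) (η : EuclideanSpace ℂ (Fin d)) :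
    ‖imE (emit q η)‖ ≤ ‖imE η‖ + 1 := by
  rw [imE_emit]
  refine (norm_sub_le _ _).trans ?_
  rw [norm_unit hq]

/-- The deformed emission and absorption of a particle with momentum `q`. -/
def partOp (β : ℝ) (T : Vel d (m + 1) → CVel d (m + 1) → L2 d (m + 1) →L[ℂ] L2 d (m + 1))
    (j : Fin (m + 1)) (q : E d) (k : Vel d m) (ξ : CVel d m) : L2 d m →L[ℂ] L2 d m :=
  sandw β (T (splitMom k j q)) ξ (emit q (ξ j))

/-- The domain of the deformed emission and absorption of a particle with momentum `q`. -/
def deformAt (tN : ℝ) (q : E d) (k : Vel d m) : Set (CVel d m) :=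
  {ξ | (∀ j, ‖imPart ξ j‖ < m + 1) ∧ 0 < rate tN k ξ + ‖q‖}

theorem deform_subset (tN : ℝ) (q : E d) (k : Vel d m) : deform tN k ⊆ deformAt tN q k :=
  fun _ h => ⟨h.1, add_pos_of_pos_of_nonneg h.2 (norm_nonneg q)⟩

/-- The contributions of ξ_j cancel, and i q·(-i q/|q|) = |q|: the decay rate gains |q|, whatever
the deformation ξ. -/
theorem rate_emit (tN : ℝ) {q : E d} (hq : q ≠ 0) (k : Vel d m) (j : Fin (m + 1)) (ξ : CVel d m) :
    rate tN (splitMom k j q) (snocC ξ (emit q (ξ j))) = rate tN k ξ + ‖q‖ := by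
  rw [rate_eq, rate_eq, dotC_splitMom, emit, dotE_sub, dotE_smul, dotE_toC_self hq]
  simp [mul_sub]
  ring

/-- The emitted particle inherits Im ξ_j up to a unit vector. The bound m + 1 thus becomes m + 2,
the bound for one more particle. -/
theorem emit_mem_deform {tN : ℝ} {q : E d} (hq : q ≠ 0) {k : Vel d m} (j : Fin (m + 1))
    {ξ : CVel d m} (h : ξ ∈ deformAt tN q k) :
    snocC ξ (emit q (ξ j)) ∈ deform tN (splitMom k j q) := by
  refine ⟨fun l => ?_, ?_⟩
  · induction l using Fin.lastCases with
    | last =>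
      rw [imPart_snocC_last]
      have h1 := norm_imE_emit_le hq (ξ j)
      have h2 : ‖imE (ξ j)‖ < m + 1 := h.1 j
      push_cast
      linarith
    | cast l =>
      rw [imPart_snocC_castSucc]
      have := h.1 l
      push_cast
      linarith
  · rw [rate_emit tN hq]
    exact h.2

variable {tN β : ℝ} {T : Vel d (m + 1) → CVel d (m + 1) → L2 d (m + 1) →L[ℂ] L2 d (m + 1)}

theorem PropFam.partOp_cov (hT : PropFam tN T) (hβ : 0 < β) (j : Fin (m + 1)) {q : E d} (hq : q ≠ 0)
    {k : Vel d m} {ξ : CVel d m} (h : ξ ∈ deformAt tN q k) (a : Vel d m) (f : L2 d m) :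
    partOp β T j q k (ξ + toCVel a) (tau a f) = tau a (partOp β T j q k ξ f) := by
  have h1 : emit q ((ξ + toCVel a) j) = emit q (ξ j) + toC (a j) := emit_add q (ξ j) (toC (a j))
  rw [partOp, h1]
  exact sandw_tau hβ a (a j)
    (fun g => hT.cov _ _ (emit_mem_deform hq j h) (snocV a (a j)) g) f

theorem PropFam.norm_partOp_le (hT : PropFam tN T) (hβ : 0 < β) (j : Fin (m + 1)) {q : E d}
    (hq : q ≠ 0) {k : Vel d m} {ξ : CVel d m} (h : ξ ∈ deformAt tN q k) :
    ‖partOp β T j q k ξ‖ ≤ creaBd d β (m + 2) ^ 2 * (rate tN k ξ + ‖q‖)⁻¹ := by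
  refine norm_sandw_le hβ ?_ ?_
  · have h1 := norm_imE_emit_le hq (ξ j)
    have h2 : ‖imE (ξ j)‖ < m + 1 := h.1 j
    linarith
  · rw [← rate_emit tN hq k j ξ]
    exact hT.norm_le _ _ (emit_mem_deform hq j h)

theorem differentiable_emit (q : E d) (j : Fin (m + 1)) :
    Differentiable ℂ fun ξ : CVel d m => emit q (ξ j) :=
  (differentiable_apply j).sub_const _

theorem PropFam.differentiableOn_partOp (hT : PropFam tN T) (hβ : 0 < β) (j : Fin (m + 1)) {q : E d}
    (hq : q ≠ 0) (k : Vel d m) : DifferentiableOn ℂ (partOp β T j q k) (deformAt tN q k) := by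
  intro ξ h
  refine DifferentiableAt.differentiableWithinAt ?_
  have h1 := (hT.hol (splitMom k j q)).differentiableAt
    ((isOpen_deform _ _).mem_nhds (emit_mem_deform hq j h))
  exact differentiableAt_sandw hβ differentiable_id (differentiable_emit q j) h1

theorem convex_im_slab (c₁ c₂ c₃ c₄ : ℝ) : Convex ℝ {z : ℂ | |z.im| < c₁ ∧ c₂ < c₃ - c₄ * z.im} := by
  intro z hz w hw a b ha hb hab
  simp only [Set.mem_ofPred_eq, abs_lt] at hz hw ⊢
  simp only [Complex.add_im, Complex.real_smul, Complex.mul_im, Complex.ofReal_re,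
    Complex.ofReal_im, zero_mul, add_zero]
  have h1 : a = 1 - b := by linarith
  subst h1
  rcases eq_or_lt_of_le hb with h0 | h0
  · subst h0
    simpa using hz
  · refine ⟨⟨?_, ?_⟩, ?_⟩
    · nlinarith [mul_lt_mul_of_pos_left hw.1.1 h0, mul_le_mul_of_nonneg_left hz.1.1.le ha]
    · nlinarith [mul_lt_mul_of_pos_left hw.1.2 h0, mul_le_mul_of_nonneg_left hz.1.2.le ha]
    · nlinarith [mul_lt_mul_of_pos_left hw.2 h0, mul_le_mul_of_nonneg_left hz.2.le ha]

/-- Without deformation of the existing particles, the deformation of the emitted particle is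
immaterial. -/
theorem PropFam.partOp_zero (hT : PropFam tN T) (ht : 0 < tN) (hβ : 0 < β) (j : Fin (m + 1))
    {q : E d} (hq : q ≠ 0) (k : Vel d m) :
    partOp β T j q k 0 = sandw β (T (splitMom k j q)) 0 0 := by
  set u : EuclideanSpace ℂ (Fin d) := toC (‖q‖⁻¹ • q) with hu
  -- The z for which the emitted velocity may be shifted by z q/|q|. The set is convex and contains
  -- both z = 0, no shift, and z = -i, the shift of `emit`.
  set U : Set ℂ := {z : ℂ | |z.im| < 2 ∧ 0 < 1 / tN - ‖q‖ * z.im} with hU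
  have hUo : IsOpen U := by
    have h1 : U = {z : ℂ | |z.im| < 2} ∩ {z : ℂ | 0 < 1 / tN - ‖q‖ * z.im} := rfl
    rw [h1]
    exact (isOpen_lt (by fun_prop) (by fun_prop)).inter (isOpen_lt (by fun_prop) (by fun_prop))
  have hmem : ∀ z ∈ U, snocC (0 : CVel d m) (z • u) ∈ deform tN (splitMom k j q) := by
    intro z hz
    refine ⟨fun l => ?_, ?_⟩
    · induction l using Fin.lastCases with
      | last =>
        rw [imPart_snocC_last]
        have h1 : imE (z • u) = z.im • (‖q‖⁻¹ • q) := by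
          ext i
          simp [imE, hu, toC]
        rw [h1, norm_smul, norm_unit hq, mul_one, Real.norm_eq_abs]
        have := hz.1
        have hm : (0 : ℝ) ≤ m := m.cast_nonneg
        push_cast
        linarith
      | cast l =>
        rw [imPart_snocC_castSucc]
        have h1 : imPart (0 : CVel d m) l = 0 := by ext i; simp [imPart]
        rw [h1, norm_zero]
        positivity
    · have h1 : dotE q ((0 : CVel d m) j) = 0 := by simp [dotE]
      have h2 : dotC k (0 : CVel d m) = 0 := by simp [dotC]
      rw [rate_eq, dotC_splitMom, dotE_smul, hu, dotE_toC_self hq, h1, h2]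
      have := hz.2
      simp
      simp at this
      linarith
  have hG : DifferentiableOn ℂ (fun z => sandw β (T (splitMom k j q)) (0 : CVel d m) (z • u)) U := by
    intro z hz
    refine DifferentiableAt.differentiableWithinAt ?_
    exact differentiableAt_sandw hβ (differentiable_const 0) (differentiable_id.smul_const u)
      ((hT.hol (splitMom k j q)).differentiableAt ((isOpen_deform _ _).mem_nhds (hmem z hz)))
  -- A real translation of the emitted velocity alone disappears, since this velocity is integrated
  -- out.
  have hinv : ∀ z ∈ U, ∀ x : ℝ, sandw β (T (splitMom k j q)) (0 : CVel d m) ((z + x) • u) =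
      sandw β (T (splitMom k j q)) (0 : CVel d m) (z • u) := by
    intro z hz x
    ext1 f
    have h1 := sandw_tau (T := T (splitMom k j q)) (ξ := 0) (η := z • u) hβ (0 : Vel d m)
      (x • (‖q‖⁻¹ • q)) (fun g => hT.cov _ _ (hmem z hz) _ g) f
    rw [tau_zero, tau_zero, toCVel_zero, add_zero] at h1
    rw [← h1]
    congr 2
    ext i
    simp [hu, toC, add_mul]
  have h0 : (0 : ℂ) ∈ U := by
    refine ⟨by simp, ?_⟩
    simp [ht]
  have hI : -I ∈ U := by
    refine ⟨by simp, ?_⟩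
    have h1 : 0 < tN⁻¹ := inv_pos.2 ht
    have h2 := norm_nonneg q
    simp
    linarith
  have h1 := eq_of_real_invariant hUo (convex_im_slab _ _ _ _) hG hinv hI h0
  simp only [zero_smul] at h1
  rw [← h1, partOp]
  congr 1
  simp [emit, hu]

/-- Without deformation absorption is the adjoint of emission, so the quadratic form is that of the
propagator on the emitted state. -/
theorem PropFam.re_inner_sandw_nonneg (hT : PropFam tN T) (β : ℝ) (k : Vel d (m + 1)) (f : L2 d m) :
    0 ≤ (inner ℂ f (sandw β (T k) 0 0 f)).re := by
  have h1 : snocC (0 : CVel d m) 0 = 0 := by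
    funext l
    induction l using Fin.lastCases with
    | last => simp
    | cast l => simp
  have h2 : conjE (0 : EuclideanSpace ℂ (Fin d)) = 0 := by ext i; simp [conjE]
  rw [sandw_apply, anni, ContinuousLinearMap.adjoint_inner_right, h1, h2]
  exact hT.re_nonneg k _

/-- The local bound c allows the argument to vary together with the operator; strong continuity
alone would only handle fixed arguments. -/
theorem continuousOn_clm_apply_of_strong {P H H' : Type} [TopologicalSpace P] [NormedAddCommGroup H]
    [NormedSpace ℂ H] [NormedAddCommGroup H'] [NormedSpace ℂ H'] {s : Set P} {A : P → H →L[ℂ] H'}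
    {c : P → ℝ} {F : P → H} (hA : ∀ x, ContinuousOn (fun p => A p x) s) (hc : ContinuousOn c s)
    (hAc : ∀ p ∈ s, ‖A p‖ ≤ c p) (hF : ContinuousOn F s) :
    ContinuousOn (fun p => A p (F p)) s := by
  intro p hp
  have h1 : Tendsto (fun r => c r * ‖F r - F p‖ + ‖A r (F p) - A p (F p)‖) (𝓝[s] p)
      (𝓝 (c p * 0 + 0)) := by
    refine ((show Tendsto c _ _ from hc p hp).mul ?_).add ?_
    · have := ((hF p hp).sub (continuousWithinAt_const (b := F p))).norm
      simpa [ContinuousWithinAt] using this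
    · have := ((hA (F p) p hp).sub (continuousWithinAt_const (b := A p (F p)))).norm
      simpa [ContinuousWithinAt] using this
  rw [mul_zero, add_zero] at h1
  refine tendsto_iff_norm_sub_tendsto_zero.2 (squeeze_zero' (Eventually.of_forall fun _ =>
    norm_nonneg _) ?_ h1)
  filter_upwards [self_mem_nhdsWithin] with r hr
  have h2 : A r (F r) - A p (F p) = A r (F r - F p) + (A r (F p) - A p (F p)) := by
    rw [map_sub]; exact (sub_add_sub_cancel _ _ _).symm
  rw [h2]
  refine (norm_add_le _ _).trans ?_
  gcongr
  exact (A r).le_of_opNorm_le (hAc r hr) _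

theorem adjoint_comp₃_apply {A B C D : Type} [NormedAddCommGroup A] [InnerProductSpace ℂ A]
    [CompleteSpace A] [NormedAddCommGroup B] [InnerProductSpace ℂ B] [CompleteSpace B]
    [NormedAddCommGroup C] [InnerProductSpace ℂ C] [CompleteSpace C]
    [NormedAddCommGroup D] [InnerProductSpace ℂ D] [CompleteSpace D]
    (f : C →L[ℂ] D) (g : B →L[ℂ] C) (h : A →L[ℂ] B) (x : D) :
    (f ∘L g ∘L h).adjoint x = h.adjoint (g.adjoint (f.adjoint x)) := by
  rw [ContinuousLinearMap.adjoint_comp, ContinuousLinearMap.adjoint_comp]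
  rfl

theorem anni_adjoint (β : ℝ) (η : EuclideanSpace ℂ (Fin d)) :
    (anni β η : L2 d (m + 1) →L[ℂ] L2 d m).adjoint = crea β (conjE η) :=
  ContinuousLinearMap.adjoint_adjoint _

theorem crea_adjoint (β : ℝ) (η : EuclideanSpace ℂ (Fin d)) :
    (crea β η : L2 d m →L[ℂ] L2 d (m + 1)).adjoint = anni β (conjE η) :=
  (congrArg (fun ζ => (crea β ζ : L2 d m →L[ℂ] L2 d (m + 1)).adjoint) (conjE_conjE η)).symm

attribute [local irreducible] crea anni

theorem sandw_adjoint (β : ℝ) (T : CVel d (m + 1) → L2 d (m + 1) →L[ℂ] L2 d (m + 1)) (ξ : CVel d m)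
    (η : EuclideanSpace ℂ (Fin d)) (f : L2 d m) : (sandw β T ξ η).adjoint f =
      anni β (conjE η) ((T (snocC ξ η)).adjoint (crea β (conjE η) f)) := by
  have h1 := adjoint_comp₃_apply (A := L2 d m) (B := L2 d (m + 1)) (C := L2 d (m + 1)) (D := L2 d m)
    (anni β η) (T (snocC ξ η)) (crea β η) f
  have h2 : (anni β η : L2 d (m + 1) →L[ℂ] L2 d m).adjoint f = crea β (conjE η) f :=
    congrArg (fun A : L2 d m →L[ℂ] L2 d (m + 1) => A f) (anni_adjoint β η)
  have h3 : ∀ g, (crea β η : L2 d m →L[ℂ] L2 d (m + 1)).adjoint g = anni β (conjE η) g := fun g =>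
    congrArg (fun A : L2 d (m + 1) →L[ℂ] L2 d m => A g) (crea_adjoint β η)
  rw [h2] at h1
  exact h1.trans (h3 _)

theorem continuous_crea_apply {β : ℝ} (hβ : 0 < β) (f : L2 d m) :
    Continuous fun η : EuclideanSpace ℂ (Fin d) => crea β η f :=
  continuous_iff_continuousAt.2 fun η =>
    (ContinuousLinearMap.apply ℂ (L2 d (m + 1)) f).continuous.continuousAt.comp
      (differentiable_crea hβ η).continuousAt

theorem continuous_anni_apply {β : ℝ} (hβ : 0 < β) (f : L2 d (m + 1)) :
    Continuous fun η : EuclideanSpace ℂ (Fin d) => anni β η f :=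
  continuous_iff_continuousAt.2 fun η =>
    (ContinuousLinearMap.apply ℂ (L2 d m) f).continuous.continuousAt.comp
      (differentiable_anni hβ η).continuousAt

theorem continuous_conjE : Continuous (conjE : EuclideanSpace ℂ (Fin d) → _) := by
  unfold conjE
  fun_prop

theorem continuous_splitMom (j : Fin (m + 1)) :
    Continuous fun p : Vel d m × E d => splitMom p.1 j p.2 := by
  unfold splitMom
  refine continuous_pi fun l => ?_
  induction l using Fin.lastCases with
  | last => simpa using continuous_snd
  | cast l =>
    simp only [Fin.snoc_castSucc]
    by_cases h : l = j
    · subst h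
      simp only [Function.update_self]
      fun_prop
    · simp only [Function.update_of_ne h]
      fun_prop

theorem continuousOn_emit (j : Fin (m + 1)) : ContinuousOn
    (fun p : E d × Vel d m × CVel d m => emit p.1 (p.2.2 j)) {p | p.1 ≠ 0} := by
  have h1 : ContinuousOn (fun p : E d × Vel d m × CVel d m => ‖p.1‖⁻¹ • p.1) {p | p.1 ≠ 0} :=
    (continuous_fst.norm.continuousOn.inv₀ fun p hp => norm_ne_zero_iff.2 hp).smul
      continuous_fst.continuousOn
  have h2 : Continuous (toC : E d → EuclideanSpace ℂ (Fin d)) := by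
    unfold toC
    fun_prop
  have h3 : Continuous fun p : E d × Vel d m × CVel d m => p.2.2 j := by fun_prop
  exact h3.continuousOn.sub ((h2.comp_continuousOn h1).const_smul I)

/-- The origin q = 0 has to be removed because the direction q/|q| has no limit there. -/
theorem PropFam.continuousOn_partOp (hT : PropFam tN T) (hβ : 0 < β) (j : Fin (m + 1)) (f : L2 d m) :
    ContinuousOn (fun p : E d × Vel d m × CVel d m => (partOp β T j p.1 p.2.1 p.2.2).adjoint f)
      {p | p.1 ≠ 0 ∧ p.2.2 ∈ deformAt tN p.1 p.2.1} := by
  set s : Set (E d × Vel d m × CVel d m) := {p | p.1 ≠ 0 ∧ p.2.2 ∈ deformAt tN p.1 p.2.1} with hs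
  have he : ContinuousOn (fun p : E d × Vel d m × CVel d m => conjE (emit p.1 (p.2.2 j))) s :=
    continuous_conjE.comp_continuousOn ((continuousOn_emit j).mono fun p hp => hp.1)
  have h1 : ContinuousOn (fun p : E d × Vel d m × CVel d m =>
      (splitMom p.2.1 j p.1, snocC p.2.2 (emit p.1 (p.2.2 j)))) s := by
    refine ContinuousOn.prodMk ?_ (continuousOn_snocC (by fun_prop)
      ((continuousOn_emit j).mono fun p hp => hp.1))
    exact ((continuous_splitMom j).comp
      ((continuous_fst.comp continuous_snd).prodMk continuous_fst)).continuousOn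
  have h2 : ∀ g, ContinuousOn (fun p : E d × Vel d m × CVel d m =>
      (T (splitMom p.2.1 j p.1) (snocC p.2.2 (emit p.1 (p.2.2 j)))).adjoint g) s := fun g => by
    simpa only [Function.comp_def] using
      (hT.cont g).comp h1 fun p hp => emit_mem_deform hp.1 j hp.2
  have hr : ContinuousOn (fun p : E d × Vel d m × CVel d m => (rate tN p.2.1 p.2.2 + ‖p.1‖)⁻¹) s := by
    refine ContinuousOn.inv₀ ?_ fun p hp => hp.2.2.ne'
    exact (((continuous_rate tN).comp continuous_snd).add continuous_fst.norm).continuousOn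
  have h3 : ContinuousOn (fun p : E d × Vel d m × CVel d m =>
      crea β (conjE (emit p.1 (p.2.2 j))) f) s := by
    simpa only [Function.comp_def] using (continuous_crea_apply hβ f).comp_continuousOn he
  have h4 : ContinuousOn (fun p : E d × Vel d m × CVel d m =>
      (T (splitMom p.2.1 j p.1) (snocC p.2.2 (emit p.1 (p.2.2 j)))).adjoint
        (crea β (conjE (emit p.1 (p.2.2 j))) f)) s := by
    refine continuousOn_clm_apply_of_strong h2 hr (fun p hp => ?_) h3
    rw [LinearIsometryEquiv.norm_map, ← rate_emit tN hp.1 p.2.1 j p.2.2]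
    exact hT.norm_le _ _ (emit_mem_deform hp.1 j hp.2)
  have h5 : ∀ g : L2 d (m + 1), ContinuousOn (fun p : E d × Vel d m × CVel d m =>
      anni β (conjE (emit p.1 (p.2.2 j))) g) s := fun g => by
    simpa only [Function.comp_def] using (continuous_anni_apply hβ g).comp_continuousOn he
  have h6 : ∀ p ∈ s, ‖(anni β (conjE (emit p.1 (p.2.2 j))) : L2 d (m + 1) →L[ℂ] L2 d m)‖ ≤
      creaBd d β (m + 2) := fun p hp => by
    refine norm_anni_le hβ ?_
    rw [imE_conjE, norm_neg]
    have h1 := norm_imE_emit_le hp.1 (p.2.2 j)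
    have h2 : ‖imE (p.2.2 j)‖ < m + 1 := hp.2.1 j
    linarith
  simpa only [partOp, sandw_adjoint] using
    continuousOn_clm_apply_of_strong h5 (c := fun _ => creaBd d β (m + 2)) continuousOn_const h6 h4

end RenormalizedPropagator

end

noncomputable section

namespace RenormalizedPropagator
/-! ### Weak integrals of families of operators -/
open Filter Topology

section StrongInt

variable {Q H : Type} [MeasurableSpace Q] {μ : Measure Q} [NormedAddCommGroup H]
  [InnerProductSpace ℂ H] [CompleteSpace H]

/-- Families of operators that can be integrated. -/
def StrongIntegrable (μ : Measure Q) (A : Q → H →L[ℂ] H) (g : Q → ℝ) : Prop :=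
  Integrable g μ ∧ (∀ q, ‖A q‖ ≤ g q) ∧ ∀ x, AEStronglyMeasurable (fun q => (A q).adjoint x) μ

theorem StrongIntegrable.integrable {A : Q → H →L[ℂ] H} {g : Q → ℝ} (h : StrongIntegrable μ A g)
    (x : H) : Integrable (fun q => (A q).adjoint x) μ :=
  (h.1.mul_const ‖x‖).mono' (h.2.2 x) (ae_of_all _ fun q => by
    have h1 := ((A q).adjoint).le_opNorm x
    rw [LinearIsometryEquiv.norm_map] at h1
    exact h1.trans (mul_le_mul_of_nonneg_right (h.2.1 q) (norm_nonneg x)))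

open Classical in
/-- The weak integral of a family of operators. -/
def strongInt (μ : Measure Q) (A : Q → H →L[ℂ] H) : H →L[ℂ] H :=
  if h : ∃ g, StrongIntegrable μ A g then
    (LinearMap.mkContinuous
      { toFun := fun x => ∫ q, (A q).adjoint x ∂μ
        map_add' := fun x y => by
          simp only [map_add]
          exact integral_add (h.choose_spec.integrable x) (h.choose_spec.integrable y)
        map_smul' := fun c x => by
          simp only [map_smul, RingHom.id_apply]
          exact integral_smul c _ } (∫ q, h.choose q ∂μ) fun x => by
        refine (norm_integral_le_of_norm_le (h.choose_spec.1.mul_const ‖x‖)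
          (ae_of_all _ fun q => ?_)).trans_eq (integral_mul_const _ _)
        have h1 := ((A q).adjoint).le_opNorm x
        rw [LinearIsometryEquiv.norm_map] at h1
        exact h1.trans (mul_le_mul_of_nonneg_right (h.choose_spec.2.1 q) (norm_nonneg x))).adjoint
  else 0

theorem StrongIntegrable.adjoint_apply {A : Q → H →L[ℂ] H} {g : Q → ℝ} (h : StrongIntegrable μ A g)
    (x : H) : (strongInt μ A).adjoint x = ∫ q, (A q).adjoint x ∂μ := by
  rw [strongInt, dif_pos ⟨g, h⟩, ContinuousLinearMap.adjoint_adjoint]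
  rfl

theorem StrongIntegrable.inner_strongInt {A : Q → H →L[ℂ] H} {g : Q → ℝ}
    (h : StrongIntegrable μ A g) (x y : H) :
    inner ℂ x (strongInt μ A y) = ∫ q, inner ℂ x (A q y) ∂μ := by
  rw [← ContinuousLinearMap.adjoint_inner_left, h.adjoint_apply, ← inner_conj_symm,
    ← integral_inner (h.integrable x), ← integral_conj]
  refine integral_congr_ae (ae_of_all _ fun q => ?_)
  simp only [inner_conj_symm, ContinuousLinearMap.adjoint_inner_left]

theorem StrongIntegrable.aestronglyMeasurable_inner {A : Q → H →L[ℂ] H} {g : Q → ℝ}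
    (h : StrongIntegrable μ A g) (x y : H) :
    AEStronglyMeasurable (fun q => inner ℂ x (A q y)) μ := by
  simp only [← ContinuousLinearMap.adjoint_inner_left]
  exact (h.2.2 x).inner aestronglyMeasurable_const

theorem norm_inner_le_of_norm_le {H : Type} [NormedAddCommGroup H] [InnerProductSpace ℂ H]
    {A : H →L[ℂ] H} {c : ℝ} (h : ‖A‖ ≤ c) (x y : H) :
    ‖(inner ℂ x (A y) : ℂ)‖ ≤ c * (‖y‖ * ‖x‖) := by
  refine (norm_inner_le_norm x (A y)).trans ?_
  have h1 := A.le_of_opNorm_le h y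
  nlinarith [norm_nonneg x]

theorem StrongIntegrable.norm_le {A : Q → H →L[ℂ] H} {g : Q → ℝ}
    (h : StrongIntegrable μ A g) : ‖strongInt μ A‖ ≤ ∫ q, g q ∂μ := by
  refine opNorm_le_of_inner (integral_nonneg fun q => (norm_nonneg _).trans (h.2.1 q)) fun x y => ?_
  rw [h.inner_strongInt, mul_assoc, ← integral_mul_const]
  exact norm_integral_le_of_norm_le (h.1.mul_const _)
    (ae_of_all _ fun q => norm_inner_le_of_norm_le (h.2.1 q) y x)

theorem StrongIntegrable.re_inner_nonneg {A : Q → H →L[ℂ] H} {g : Q → ℝ}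
    (h : StrongIntegrable μ A g) {x : H} (hx : ∀ q, 0 ≤ (inner ℂ x (A q x)).re) :
    0 ≤ (inner ℂ x (strongInt μ A x)).re := by
  have h1 : Integrable (fun q => inner ℂ x (A q x)) μ :=
    (h.1.mul_const _).mono' (h.aestronglyMeasurable_inner x x)
      (ae_of_all _ fun q => norm_inner_le_of_norm_le (h.2.1 q) x x)
  have h2 := integral_re h1
  rw [h.inner_strongInt]
  change 0 ≤ RCLike.re (∫ q, inner ℂ x (A q x) ∂μ)
  rw [← h2]
  exact integral_nonneg hx

variable {Z : Type} [NormedAddCommGroup Z] [NormedSpace ℂ Z] {U : Set Z}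
  {A : Z → Q → H →L[ℂ] H} {g : Q → ℝ}

theorem dominatedHolomorphic_inner (hU : IsOpen U) (h : ∀ z ∈ U, StrongIntegrable μ (A z) g)
    (hA : ∀ q, DifferentiableOn ℂ (fun z => A z q) U) (x y : H) :
    DominatedHolomorphic μ U fun z q => inner ℂ x (A z q y) where
  meas z hz := (h z hz).aestronglyMeasurable_inner x y
  hol q := by
    have h1 : DifferentiableOn ℂ (fun z => A z q y) U := (hA q).clm_apply (differentiableOn_const y)
    exact (innerSL ℂ x).differentiable.comp_differentiableOn h1
  dom z hz := by
    obtain ⟨R, hR, hsub⟩ := Metric.isOpen_iff.1 hU z hz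
    exact ⟨R, hR, hsub, fun q => g q * (‖y‖ * ‖x‖), (h z hz).1.mul_const _, fun w hw q =>
      norm_inner_le_of_norm_le ((h w (hsub hw)).2.1 q) x y⟩

variable [FiniteDimensional ℂ Z]

theorem differentiableOn_strongInt (hU : IsOpen U) (h : ∀ z ∈ U, StrongIntegrable μ (A z) g)
    (hA : ∀ q, DifferentiableOn ℂ (fun z => A z q) U) :
    DifferentiableOn ℂ (fun z => strongInt μ (A z)) U := by
  intro z hz
  refine DifferentiableAt.differentiableWithinAt ?_
  obtain ⟨R, hR, hsub⟩ := Metric.isOpen_iff.1 hU z hz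
  refine differentiableAt_of_weakly_of_ball (M := ∫ q, g q ∂μ) hR (fun y x => ?_)
    fun w hw => (h w (hsub hw)).norm_le
  have h1 := (dominatedHolomorphic_inner hU h hA x y).differentiableOn_integral.mono hsub
  exact h1.congr fun w hw => (h w (hsub hw)).inner_strongInt x y

theorem inner_iteratedFDeriv_apply {A : Z → H →L[ℂ] H} (hU : IsOpen U) (hA : DifferentiableOn ℂ A U)
    {z : Z} (hz : z ∈ U) (x y : H) (n : ℕ) (v : Fin n → Z) :
    iteratedFDeriv ℂ n (fun z => inner ℂ x (A z y)) z v =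
      inner ℂ x (iteratedFDeriv ℂ n A z v y) := by
  have h1 : ContDiffAt ℂ n A z :=
    (contDiffOn_of_differentiableOn_complex hU hA n).contDiffAt (hU.mem_nhds hz)
  have h2 := ((innerSL ℂ x).comp (ContinuousLinearMap.apply ℂ H y)).iteratedFDeriv_comp_left h1 le_rfl
  have h3 : (fun z => inner ℂ x (A z y)) =
      ((innerSL ℂ x).comp (ContinuousLinearMap.apply ℂ H y)) ∘ A := rfl
  rw [h3, h2]
  rfl

/-- Derivatives are taken of matrix elements, for which differentiation under the integral is
available, and the bound is reassembled over unit vectors. No Bochner integrability in operator norm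
is required. -/
theorem enorm_iteratedFDeriv_strongInt_le (hU : IsOpen U) (h : ∀ z ∈ U, StrongIntegrable μ (A z) g)
    (hA : ∀ q, DifferentiableOn ℂ (fun z => A z q) U) {z : Z} (hz : z ∈ U) {n : ℕ} {M : Q → ℝ≥0∞}
    (hM : ∀ q, ‖iteratedFDeriv ℂ n (fun z => A z q) z‖ₑ ≤ M q) :
    ‖iteratedFDeriv ℂ n (fun z => strongInt μ (A z)) z‖ₑ ≤ ∫⁻ q, M q ∂μ := by
  by_cases hfin : ∫⁻ q, M q ∂μ = ⊤
  · rw [hfin]; exact le_top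
  have key : ‖iteratedFDeriv ℂ n (fun z => strongInt μ (A z)) z‖ ≤ (∫⁻ q, M q ∂μ).toReal := by
    refine ContinuousMultilinearMap.opNorm_le_bound ENNReal.toReal_nonneg fun v => ?_
    refine opNorm_le_of_inner (by positivity) fun y x => ?_
    have h1 := inner_iteratedFDeriv_apply hU (differentiableOn_strongInt hU h hA) hz x y n v
    have h2 : (fun w => inner ℂ x (strongInt μ (A w) y)) =ᶠ[𝓝 z]
        fun w => ∫ q, inner ℂ x (A w q y) ∂μ :=
      Filter.mem_of_superset (hU.mem_nhds hz) fun w hw => (h w hw).inner_strongInt x y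
    rw [← h1, (h2.iteratedFDeriv ℂ n).eq_of_nhds,
      (dominatedHolomorphic_inner hU h hA x y).iteratedFDeriv_integral hU hz n v]
    have h3 : ‖∫ q, iteratedFDeriv ℂ n (fun w => inner ℂ x (A w q y)) z v ∂μ‖ₑ ≤
        ∫⁻ q, M q * ENNReal.ofReal ((∏ i, ‖v i‖) * ‖y‖ * ‖x‖) ∂μ := by
      refine (enorm_integral_le_lintegral_enorm _).trans (lintegral_mono fun q => ?_)
      rw [inner_iteratedFDeriv_apply hU (hA q) hz x y n v, ← ofReal_norm]
      refine le_trans (ENNReal.ofReal_le_ofReal (q := ‖iteratedFDeriv ℂ n (fun z => A z q) z‖ *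
        ((∏ i, ‖v i‖) * ‖y‖ * ‖x‖)) ?_) ?_
      · refine (norm_inner_le_of_norm_le
          (ContinuousMultilinearMap.le_opNorm _ v) x y).trans_eq ?_
        ring
      · rw [ENNReal.ofReal_mul (norm_nonneg _), ofReal_norm]
        gcongr
        exact hM q
    rw [lintegral_mul_const' _ _ ENNReal.ofReal_ne_top] at h3
    have h4 := ENNReal.toReal_mono (ENNReal.mul_ne_top hfin ENNReal.ofReal_ne_top) h3
    rw [toReal_enorm, ENNReal.toReal_mul, ENNReal.toReal_ofReal (by positivity)] at h4
    refine h4.trans_eq ?_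
    ring
  rw [← ofReal_norm]
  exact ENNReal.ofReal_le_of_le_toReal key

end StrongInt

/-! ### The measure (2π)^{-d} |V̂(q)|² dq and its weighted moments. -/

section Measure

variable {d : ℕ} {V : E d → ℝ}

theorem IsPotential.continuous_fourierV (h : IsPotential V) : Continuous (fourierV V) := by
  have h1 : Integrable V := h.1.continuous.integrable_of_hasCompactSupport h.2.1
  refine continuous_of_dominated (bound := fun x => ‖V x‖) (fun k => ?_) (fun k => ?_) h1.norm ?_
  · have := h.1.continuous
    exact Continuous.aestronglyMeasurable (by fun_prop)
  · refine ae_of_all _ fun x => ?_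
    rw [norm_mul, Complex.norm_real, ← mul_neg, mul_comm I, ← Complex.ofReal_neg,
      Complex.norm_exp_ofReal_mul_I, one_mul]
  · exact ae_of_all _ fun x => by fun_prop

/-- V is real and even, so V̂ is real. The product of the factors V̂ from emission and absorption is
therefore a positive density. -/
theorem IsPotential.fourierV_sq (h : IsPotential V) (k : E d) :
    fourierV V k ^ 2 = ((‖fourierV V k‖ ^ 2 : ℝ) : ℂ) := by
  have h1 : starRingEnd ℂ (fourierV V k) = fourierV V k := by
    rw [fourierV, ← integral_conj, ← integral_neg_eq_self]
    refine integral_congr_ae (ae_of_all _ fun x => ?_)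
    simp only [map_mul, Complex.conj_ofReal, ← Complex.exp_conj, map_neg, Complex.conj_I, h.2.2,
      inner_neg_right]
    congr 2
    push_cast
    ring
  rw [← Complex.normSq_eq_norm_sq, ← Complex.mul_conj, h1, sq]

/-- The weight `(2π)^{-d} |V̂(q)|²`. -/
def hatWeight (V : E d → ℝ) (q : E d) : ℝ := ((2 * Real.pi) ^ d)⁻¹ * ‖fourierV V q‖ ^ 2

theorem hatWeight_nonneg (V : E d → ℝ) (q : E d) : 0 ≤ hatWeight V q := by
  unfold hatWeight
  positivity

/-- The measure `(2π)^{-d} |V̂(q)|² dq`. -/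
def hatMeas (V : E d → ℝ) : Measure (E d) :=
  volume.withDensity fun q => ENNReal.ofReal (hatWeight V q)

theorem IsPotential.continuous_hatWeight (h : IsPotential V) : Continuous (hatWeight V) :=
  continuous_const.mul (h.continuous_fourierV.norm.pow 2)

theorem IsPotential.integral_hatMeas (h : IsPotential V) (f : E d → ℂ) :
    ∫ q, f q ∂hatMeas V = ((((2 * Real.pi) ^ d : ℝ) : ℂ))⁻¹ * ∫ q, fourierV V q ^ 2 * f q := by
  rw [hatMeas, integral_withDensity_eq_integral_toReal_smul
    h.continuous_hatWeight.measurable.ennreal_ofReal (ae_of_all _ fun _ => ENNReal.ofReal_lt_top),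
    ← integral_const_mul]
  refine integral_congr_ae (ae_of_all _ fun q => ?_)
  simp only [ENNReal.toReal_ofReal (hatWeight_nonneg V q), h.fourierV_sq]
  rw [Complex.real_smul, hatWeight]
  push_cast
  ring

theorem IsPotential.lintegral_hatMeas (h : IsPotential V) (s : ℕ) :
    ∫⁻ q, ENNReal.ofReal (Real.sqrt (1 + ‖q‖ ^ 2) ^ s * ‖q‖ ^ (1 - (s : ℝ))) ∂hatMeas V =
      ENNReal.ofReal ((2 * Real.pi) ^ d)⁻¹ * normV V s := by
  rw [hatMeas, lintegral_withDensity_eq_lintegral_mul_non_measurable _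
    h.continuous_hatWeight.measurable.ennreal_ofReal (ae_of_all _ fun _ => ENNReal.ofReal_lt_top),
    normV, ← lintegral_const_mul' _ _ ENNReal.ofReal_ne_top]
  refine lintegral_congr fun q => ?_
  rw [Pi.mul_apply, ← ENNReal.ofReal_mul (hatWeight_nonneg V q), ← ENNReal.ofReal_mul (by positivity),
    hatWeight]
  congr 1
  ring

theorem IsPotential.lintegral_norm_hatMeas (h : IsPotential V) :
    ∫⁻ q, ENNReal.ofReal ‖q‖ ∂hatMeas V = ENNReal.ofReal ((2 * Real.pi) ^ d)⁻¹ * normV V 0 := by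
  rw [← h.lintegral_hatMeas 0]
  simp

theorem IsPotential.integrable_norm (h : IsPotential V) (h0 : normV V 0 ≠ ⊤) :
    Integrable (fun q : E d => ‖q‖) (hatMeas V) := by
  refine ⟨continuous_norm.aestronglyMeasurable, ?_⟩
  rw [hasFiniteIntegral_iff_norm]
  simp only [norm_norm, h.lintegral_norm_hatMeas]
  exact ENNReal.mul_lt_top ENNReal.ofReal_lt_top h0.lt_top

theorem IsPotential.integral_norm (h : IsPotential V) :
    ∫ q, ‖q‖ ∂hatMeas V = ((2 * Real.pi) ^ d)⁻¹ * (normV V 0).toReal := by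
  rw [integral_eq_lintegral_of_nonneg_ae (ae_of_all _ fun q => norm_nonneg q)
    continuous_norm.aestronglyMeasurable, h.lintegral_norm_hatMeas, ENNReal.toReal_mul,
    ENNReal.toReal_ofReal (by positivity)]

end Measure

end RenormalizedPropagator

end

noncomputable section

namespace RenormalizedPropagator
/-! ### The deformed hat operators -/
open Filter Topology
attribute [local irreducible] tau crea anni
variable {d m : ℕ}

/-- The operator `D ↦ q·D_j`. -/
def contr (j : Fin (m + 1)) (q : E d) : GradSp d m →L[ℂ] L2 d m :=
  ∑ i, (q i : ℂ) • (PiLp.proj 2 (fun _ : Fin (m + 1) × Fin d => L2 d m) (j, i) :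
    GradSp d m →L[ℂ] L2 d m)

theorem contr_apply (j : Fin (m + 1)) (q : E d) (D : GradSp d m) :
    contr j q D = ∑ i, (q i : ℂ) • D (j, i) := by
  rw [contr, sum_apply]
  exact Finset.sum_congr rfl fun i _ => rfl

theorem norm_contr_le (j : Fin (m + 1)) (q : E d) :
    ‖(contr j q : GradSp d m →L[ℂ] L2 d m)‖ ≤ d * ‖q‖ := by
  refine ContinuousLinearMap.opNorm_le_bound _ (by positivity) fun D => ?_
  rw [contr_apply]
  refine (norm_sum_le _ _).trans ((Finset.sum_le_sum (g := fun _ => ‖q‖ * ‖D‖) fun i _ => ?_).trans_eq ?_)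
  · rw [norm_smul, Complex.norm_real]
    exact mul_le_mul (PiLp.norm_apply_le q i) (PiLp.norm_apply_le D (j, i)) (norm_nonneg _)
      (norm_nonneg _)
  · rw [Finset.sum_const, Finset.card_univ, Fintype.card_fin, nsmul_eq_mul, mul_assoc]

theorem contr_zero (j : Fin (m + 1)) : (contr j 0 : GradSp d m →L[ℂ] L2 d m) = 0 := by
  simp [contr]

theorem contr_tauG (j : Fin (m + 1)) (q : E d) (a : Vel d m) (D : GradSp d m) :
    contr j q (tauG a D) = tau a (contr j q D) := by
  rw [contr_apply, contr_apply, map_sum]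
  simp only [map_smul]
  rfl

theorem continuous_contr (j : Fin (m + 1)) :
    Continuous (contr j : E d → GradSp d m →L[ℂ] L2 d m) := by
  unfold contr
  fun_prop

theorem inner_tauG_left (a : Vel d m) (D D' : GradSp d m) :
    (inner ℂ (tauG a D) D' : ℂ) = inner ℂ D (tauG (-a) D') := by
  rw [PiLp.inner_apply, PiLp.inner_apply]
  exact Finset.sum_congr rfl fun c _ => inner_tau_left a (D c) (D' c)

variable {β tN : ℝ} {T : Vel d (m + 1) → CVel d (m + 1) → L2 d (m + 1) →L[ℂ] L2 d (m + 1)}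

/-- The contribution of the emission of a particle of momentum `q` by the particle `j`. -/
def hatPart (β : ℝ) (T : Vel d (m + 1) → CVel d (m + 1) → L2 d (m + 1) →L[ℂ] L2 d (m + 1))
    (j : Fin (m + 1)) (k : Vel d m) (ξ : CVel d m) (q : E d) : GradSp d m →L[ℂ] GradSp d m :=
  (contr j q).adjoint ∘L partOp β T j q k ξ ∘L contr j q

theorem inner_adjoint_comp {A B : Type} [NormedAddCommGroup A] [InnerProductSpace ℂ A]
    [CompleteSpace A] [NormedAddCommGroup B] [InnerProductSpace ℂ B] [CompleteSpace B]
    (P : A →L[ℂ] B) (X : B →L[ℂ] B) (x y : A) :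
    inner ℂ x ((P.adjoint ∘L X ∘L P) y) = inner ℂ (P x) (X (P y)) :=
  ContinuousLinearMap.adjoint_inner_right P x _

theorem norm_adjoint_comp_le {A B : Type} [NormedAddCommGroup A] [InnerProductSpace ℂ A]
    [CompleteSpace A] [NormedAddCommGroup B] [InnerProductSpace ℂ B] [CompleteSpace B]
    (P : A →L[ℂ] B) (X : B →L[ℂ] B) {p c : ℝ} (hP : ‖P‖ ≤ p) (hX : ‖X‖ ≤ c) :
    ‖P.adjoint ∘L X ∘L P‖ ≤ p ^ 2 * c := by
  have hc : 0 ≤ c := (norm_nonneg _).trans hX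
  have hp : 0 ≤ p := (norm_nonneg _).trans hP
  calc ‖P.adjoint ∘L X ∘L P‖ ≤ ‖P.adjoint‖ * (‖X‖ * ‖P‖) :=
        (ContinuousLinearMap.opNorm_comp_le _ _).trans
          (mul_le_mul_of_nonneg_left (ContinuousLinearMap.opNorm_comp_le _ _) (norm_nonneg _))
    _ ≤ p * (c * p) := by
        rw [LinearIsometryEquiv.norm_map]
        gcongr
    _ = _ := by ring

theorem adjoint_adjoint_comp_apply {A B : Type} [NormedAddCommGroup A] [InnerProductSpace ℂ A]
    [CompleteSpace A] [NormedAddCommGroup B] [InnerProductSpace ℂ B] [CompleteSpace B]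
    (P : A →L[ℂ] B) (X : B →L[ℂ] B) (x : A) :
    (P.adjoint ∘L X ∘L P).adjoint x = P.adjoint (X.adjoint (P x)) := by
  rw [adjoint_comp₃_apply, ContinuousLinearMap.adjoint_adjoint]

theorem differentiableOn_adjoint_comp {A B Z : Type} [NormedAddCommGroup A] [InnerProductSpace ℂ A]
    [CompleteSpace A] [NormedAddCommGroup B] [InnerProductSpace ℂ B] [CompleteSpace B]
    [NormedAddCommGroup Z] [NormedSpace ℂ Z] (P : A →L[ℂ] B) {X : Z → B →L[ℂ] B} {U : Set Z}
    (hX : DifferentiableOn ℂ X U) : DifferentiableOn ℂ (fun z => P.adjoint ∘L X z ∘L P) U :=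
  (differentiableOn_const _).clm_comp (hX.clm_comp (differentiableOn_const _))

theorem inner_hatPart (j : Fin (m + 1)) (k : Vel d m) (ξ : CVel d m) (q : E d) (D D' : GradSp d m) :
    inner ℂ D (hatPart β T j k ξ q D') =
      inner ℂ (contr j q D) (partOp β T j q k ξ (contr j q D')) :=
  inner_adjoint_comp (contr j q) (partOp β T j q k ξ) D D'

theorem hatPart_zero (j : Fin (m + 1)) (k : Vel d m) (ξ : CVel d m) : hatPart β T j k ξ 0 = 0 := by
  refine ContinuousLinearMap.ext fun D => ext_inner_left ℂ fun D' => ?_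
  rw [inner_hatPart, contr_zero, zero_apply, inner_zero_left, zero_apply, inner_zero_right]

/-- The constant in the bounds on the hat operators. -/
def partBd (d m : ℕ) (β : ℝ) : ℝ := (d : ℝ) ^ 2 * creaBd d β (m + 2) ^ 2

theorem partBd_nonneg (d m : ℕ) (β : ℝ) : 0 ≤ partBd d m β := by
  unfold partBd
  positivity

/-- The two contractions with q give |q|², the propagator gives (c|q|)⁻¹, and one power of |q|
survives. The constant is c = 1 on `deform` and c = 1/2 in the Cauchy estimates near 0, where the
rate may be negative. -/
theorem PropFam.norm_hatPart_le_of_rate (hT : PropFam tN T) (hβ : 0 < β) (j : Fin (m + 1))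
    {k : Vel d m} {ξ : CVel d m} {q : E d} (h : ξ ∈ deformAt tN q k) {c : ℝ} (hc : 0 < c)
    (hr : c * ‖q‖ ≤ rate tN k ξ + ‖q‖) : ‖hatPart β T j k ξ q‖ ≤ c⁻¹ * partBd d m β * ‖q‖ := by
  by_cases hq : q = 0
  · subst hq
    rw [hatPart_zero, norm_zero]
    simp
  have hq' : 0 < ‖q‖ := norm_pos_iff.2 hq
  refine (norm_adjoint_comp_le (contr j q) _ (norm_contr_le j q)
    (hT.norm_partOp_le hβ j hq h)).trans ?_
  have h1 : (rate tN k ξ + ‖q‖)⁻¹ ≤ (c * ‖q‖)⁻¹ := inv_anti₀ (by positivity) hr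
  calc (d * ‖q‖) ^ 2 * (creaBd d β (m + 2) ^ 2 * (rate tN k ξ + ‖q‖)⁻¹)
      ≤ (d * ‖q‖) ^ 2 * (creaBd d β (m + 2) ^ 2 * (c * ‖q‖)⁻¹) := by gcongr
    _ = c⁻¹ * partBd d m β * ‖q‖ := by
        rw [partBd]
        field_simp

theorem PropFam.norm_hatPart_le (hT : PropFam tN T) (hβ : 0 < β) (j : Fin (m + 1))
    {k : Vel d m} {ξ : CVel d m} (h : ξ ∈ deform tN k) (q : E d) :
    ‖hatPart β T j k ξ q‖ ≤ partBd d m β * ‖q‖ := by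
  have h1 := hT.norm_hatPart_le_of_rate hβ j (deform_subset tN q k h) one_pos
    (by linarith [h.2] : 1 * ‖q‖ ≤ rate tN k ξ + ‖q‖)
  rwa [inv_one, one_mul] at h1

theorem PropFam.differentiableOn_hatPart (hT : PropFam tN T) (hβ : 0 < β) (j : Fin (m + 1))
    (k : Vel d m) (q : E d) :
    DifferentiableOn ℂ (fun ξ => hatPart β T j k ξ q) (deformAt tN q k) := by
  by_cases hq : q = 0
  · subst hq
    simp only [hatPart_zero]
    exact differentiableOn_const 0
  · exact differentiableOn_adjoint_comp (contr j q) (hT.differentiableOn_partOp hβ j hq k)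

theorem continuousOn_clm_apply' {P H H' : Type} [TopologicalSpace P] [NormedAddCommGroup H]
    [NormedSpace ℂ H] [NormedAddCommGroup H'] [NormedSpace ℂ H'] {s : Set P} {A : P → H →L[ℂ] H'}
    {F : P → H} (hA : ContinuousOn A s) (hF : ContinuousOn F s) :
    ContinuousOn (fun p => A p (F p)) s := hA.clm_apply hF

theorem continuous_adjoint_comp {A B P : Type} [NormedAddCommGroup A] [InnerProductSpace ℂ A]
    [CompleteSpace A] [NormedAddCommGroup B] [InnerProductSpace ℂ B] [CompleteSpace B]
    [TopologicalSpace P] {X : P → A →L[ℂ] B} (hX : Continuous X) :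
    Continuous fun p => (X p).adjoint :=
  (ContinuousLinearMap.adjoint (𝕜 := ℂ) (E := A) (F := B)).continuous.comp hX

theorem PropFam.continuousOn_hatPart (hT : PropFam tN T) (hβ : 0 < β) (j : Fin (m + 1))
    (D : GradSp d m) :
    ContinuousOn (fun p : E d × Vel d m × CVel d m => (hatPart β T j p.2.1 p.2.2 p.1).adjoint D)
      {p | p.1 ≠ 0 ∧ p.2.2 ∈ deformAt tN p.1 p.2.1} := by
  set s : Set (E d × Vel d m × CVel d m) := {p | p.1 ≠ 0 ∧ p.2.2 ∈ deformAt tN p.1 p.2.1}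
  have h1 : ContinuousOn (fun p : E d × Vel d m × CVel d m => contr j p.1 D) s :=
    continuousOn_clm_apply' (((continuous_contr j).comp continuous_fst).continuousOn)
      continuousOn_const
  have hr : ContinuousOn (fun p : E d × Vel d m × CVel d m =>
      creaBd d β (m + 2) ^ 2 * (rate tN p.2.1 p.2.2 + ‖p.1‖)⁻¹) s := by
    refine continuousOn_const.mul (ContinuousOn.inv₀ ?_ fun p hp => hp.2.2.ne')
    exact (((continuous_rate tN).comp continuous_snd).add continuous_fst.norm).continuousOn
  have h2 : ContinuousOn (fun p : E d × Vel d m × CVel d m =>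
      (partOp β T j p.1 p.2.1 p.2.2).adjoint (contr j p.1 D)) s := by
    refine continuousOn_clm_apply_of_strong (fun f => hT.continuousOn_partOp hβ j f) hr
      (fun p hp => ?_) h1
    rw [LinearIsometryEquiv.norm_map]
    exact hT.norm_partOp_le hβ j hp.1 hp.2
  have h3 := (continuous_adjoint_comp ((continuous_contr (m := m) j).comp
    (continuous_fst (X := E d) (Y := Vel d m × CVel d m)))).continuousOn (s := s)
  refine (continuousOn_clm_apply' h3 h2).congr fun p hp => ?_
  exact adjoint_adjoint_comp_apply (contr j p.1) _ D

variable {V : E d → ℝ}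

/-- Measurability comes from continuity away from the origin, and the contribution vanishes at the
origin. -/
theorem PropFam.strongIntegrable (hT : PropFam tN T) (hβ : 0 < β) (hV : IsPotential V)
    (h0 : normV V 0 ≠ ⊤) (j : Fin (m + 1)) {k : Vel d m} {ξ : CVel d m} (h : ξ ∈ deform tN k) :
    StrongIntegrable (hatMeas V) (hatPart β T j k ξ) fun q => partBd d m β * ‖q‖ := by
  refine ⟨(hV.integrable_norm h0).const_mul _, hT.norm_hatPart_le hβ j h, fun D => ?_⟩
  have h1 : ContinuousOn (fun q : E d => (hatPart β T j k ξ q).adjoint D) {0}ᶜ := by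
    have h2 : Continuous fun q : E d => (q, k, ξ) := by fun_prop
    simpa only [Function.comp_def] using
      (hT.continuousOn_hatPart hβ j D).comp (s := ({0}ᶜ : Set (E d))) h2.continuousOn
        (fun q hq => ⟨hq, deform_subset tN q k h⟩)
  have hm : MeasurableSet ({0}ᶜ : Set (E d)) := (measurableSet_singleton 0).compl
  have h3 := (aestronglyMeasurable_indicator_iff hm).2
    (h1.aestronglyMeasurable (μ := hatMeas V) hm)
  refine h3.congr (ae_of_all _ fun q => ?_)
  by_cases hq : q = 0
  · subst hq
    simp [hatPart_zero]
  · exact Set.indicator_of_mem hq _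

/-- The deformed hat operator. -/
def hatFam (β : ℝ) (V : E d → ℝ)
    (T : Vel d (m + 1) → CVel d (m + 1) → L2 d (m + 1) →L[ℂ] L2 d (m + 1))
    (k : Vel d m) (ξ : CVel d m) : GradSp d m →L[ℂ] GradSp d m :=
  ∑ j, strongInt (hatMeas V) (hatPart β T j k ξ)

theorem inner_sum_apply {A ι : Type} [NormedAddCommGroup A] [InnerProductSpace ℂ A] [Fintype ι]
    (X : ι → A →L[ℂ] A) (x y : A) : (inner ℂ x ((∑ j, X j) y) : ℂ) = ∑ j, inner ℂ x (X j y) := by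
  rw [sum_apply, inner_sum]

theorem adjoint_sum_apply {A ι : Type} [NormedAddCommGroup A] [InnerProductSpace ℂ A]
    [CompleteSpace A] [Fintype ι] (X : ι → A →L[ℂ] A) (x : A) :
    (∑ j, X j).adjoint x = ∑ j, (X j).adjoint x := by
  rw [map_sum, sum_apply]

theorem PropFam.inner_hatFam (hT : PropFam tN T) (hβ : 0 < β) (hV : IsPotential V)
    (h0 : normV V 0 ≠ ⊤) {k : Vel d m} {ξ : CVel d m} (h : ξ ∈ deform tN k) (D D' : GradSp d m) :
    inner ℂ D (hatFam β V T k ξ D') =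
      ∑ j, ∫ q, inner ℂ (contr j q D) (partOp β T j q k ξ (contr j q D')) ∂hatMeas V := by
  refine (inner_sum_apply (fun j => strongInt (hatMeas V) (hatPart β T j k ξ)) D D').trans
    (Finset.sum_congr rfl fun j _ => ?_)
  rw [(hT.strongIntegrable hβ hV h0 j h).inner_strongInt]
  exact integral_congr_ae (ae_of_all _ fun q => inner_hatPart j k ξ q D D')

/-- The constant in the bound on the hat operators. -/
def hatBd (d m : ℕ) (β : ℝ) : ℝ := (m + 1) * partBd d m β * ((2 * Real.pi) ^ d)⁻¹

theorem PropFam.norm_hatFam_le (hT : PropFam tN T) (hβ : 0 < β) (hV : IsPotential V)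
    (h0 : normV V 0 ≠ ⊤) {k : Vel d m} {ξ : CVel d m} (h : ξ ∈ deform tN k) :
    ‖hatFam β V T k ξ‖ ≤ hatBd d m β * (normV V 0).toReal := by
  refine (norm_sum_le _ _).trans ((Finset.sum_le_sum fun j _ =>
    (hT.strongIntegrable hβ hV h0 j h).norm_le).trans_eq ?_)
  rw [integral_const_mul, hV.integral_norm, Finset.sum_const, Finset.card_univ, Fintype.card_fin,
    nsmul_eq_mul, hatBd]
  push_cast
  ring

/-- One half of the recursion: covariance, holomorphy, bounds and strong continuity pass from the
propagators through the q-integral, always with the integrable majorant |q|. -/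
theorem PropFam.hatFam (hT : PropFam tN T) (hβ : 0 < β) (hV : IsPotential V)
    (h0 : normV V 0 ≠ ⊤) {K : ℝ} (hK : hatBd d m β * (normV V 0).toReal ≤ K) :
    HatFam tN K (hatFam β V T : Vel d m → _) where
  cov k ξ h a D := by
    refine ext_inner_left ℂ fun D' => ?_
    have h1 : (inner ℂ D' (tauG a (RenormalizedPropagator.hatFam β V T k ξ D)) : ℂ) =
        inner ℂ (tauG (-a) D') (RenormalizedPropagator.hatFam β V T k ξ D) := by
      rw [inner_tauG_left, neg_neg]
    rw [h1, hT.inner_hatFam hβ hV h0 h, hT.inner_hatFam hβ hV h0 (add_mem_deform h a)]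
    refine Finset.sum_congr rfl fun j _ => integral_congr_ae (ae_of_all _ fun q => ?_)
    by_cases hq : q = 0
    · subst hq
      simp [contr_zero]
    · simp only [contr_tauG]
      rw [hT.partOp_cov hβ j hq (deform_subset tN q k h) a, inner_tau_left, neg_neg]
  hol k := by
    refine DifferentiableOn.fun_sum fun j _ => ?_
    exact differentiableOn_strongInt (isOpen_deform tN k)
      (fun ξ h => hT.strongIntegrable hβ hV h0 j h)
      fun q => (hT.differentiableOn_hatPart hβ j k q).mono (deform_subset tN q k)
  norm_le k ξ h := (hT.norm_hatFam_le hβ hV h0 h).trans hK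
  cont D := by
    have h1 : ∀ p ∈ {p : Vel d m × CVel d m | p.2 ∈ deform tN p.1},
        (RenormalizedPropagator.hatFam β V T p.1 p.2).adjoint D =
          ∑ j, ∫ q, (hatPart β T j p.1 p.2 q).adjoint D ∂hatMeas V := fun p hp => by
      refine (adjoint_sum_apply
        (fun j => strongInt (hatMeas V) (hatPart β T j p.1 p.2)) D).trans
        (Finset.sum_congr rfl fun j _ => ?_)
      exact (hT.strongIntegrable hβ hV h0 j hp).adjoint_apply D
    refine ContinuousOn.congr (continuousOn_finsetSum _ fun j _ => ?_) h1
    refine continuousOn_of_dominated (bound := fun q => partBd d m β * ‖q‖ * ‖D‖)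
      (fun p hp => (hT.strongIntegrable hβ hV h0 j hp).2.2 D) (fun p hp => ae_of_all _ fun q => ?_)
      (((hV.integrable_norm h0).const_mul _).mul_const _) (ae_of_all _ fun q => ?_)
    · have h2 := ((hatPart β T j p.1 p.2 q).adjoint).le_opNorm D
      rw [LinearIsometryEquiv.norm_map] at h2
      exact h2.trans (mul_le_mul_of_nonneg_right (hT.norm_hatPart_le hβ j hp q) (norm_nonneg D))
    · by_cases hq : q = 0
      · subst hq
        simp only [hatPart_zero]
        exact continuousOn_const
      · have h2 : Continuous fun p : Vel d m × CVel d m => (q, p) := by fun_prop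
        simpa only [Function.comp_def] using
          (hT.continuousOn_hatPart hβ j D).comp
            (s := {p : Vel d m × CVel d m | p.2 ∈ deform tN p.1}) h2.continuousOn
            (fun p hp => ⟨hq, deform_subset tN q p.1 hp⟩)

/-- At ξ = 0 the shift of the emitted velocity can be undone, which exhibits each contribution as a
propagator between two copies of the same state. -/
theorem PropFam.re_inner_hatFam_nonneg (hT : PropFam tN T) (ht : 0 < tN) (hβ : 0 < β)
    (hV : IsPotential V) (h0 : normV V 0 ≠ ⊤) (k : Vel d m) (D : GradSp d m) :
    0 ≤ (inner ℂ D (RenormalizedPropagator.hatFam β V T k 0 D)).re := by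
  have h1 := inner_sum_apply (fun j => strongInt (hatMeas V) (hatPart β T j k 0)) D D
  change 0 ≤ (inner ℂ D ((∑ j, strongInt (hatMeas V) (hatPart β T j k 0)) D)).re
  rw [h1, Complex.re_sum]
  refine Finset.sum_nonneg fun j _ =>
    (hT.strongIntegrable hβ hV h0 j (zero_mem_deform ht k)).re_inner_nonneg fun q => ?_
  by_cases hq : q = 0
  · subst hq
    simp [hatPart_zero]
  · rw [inner_hatPart, hT.partOp_zero ht hβ j hq]
    exact hT.re_inner_sandw_nonneg β _ _

end RenormalizedPropagator

end

noncomputable section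

namespace RenormalizedPropagator
/-! ### The hat operators as distributions -/
open Filter Topology
attribute [local irreducible] tau crea anni
variable {d m : ℕ}

theorem toL2_sum_smul {ι : Type} (s : Finset ι) (c : ι → ℂ) {F : ι → Vel d m → ℂ}
    (hF : ∀ i, MemLp (F i) 2 volume) :
    MemLp (fun v => ∑ i ∈ s, c i * F i v) 2 volume ∧
      toL2 (fun v => ∑ i ∈ s, c i * F i v) = ∑ i ∈ s, c i • toL2 (F i) := by
  classical
  induction s using Finset.induction_on with
  | empty =>
    simp only [Finset.sum_empty]
    exact ⟨MemLp.zero', toL2_zero⟩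
  | insert i s hi ih =>
    have h1 : MemLp (fun v => c i * F i v) 2 volume := (hF i).const_mul (c i)
    have h2 : toL2 (fun v => c i * F i v) = c i • toL2 (F i) := toL2_smul (c i) (hF i)
    simp only [Finset.sum_insert hi]
    refine ⟨h1.add ih.1, ?_⟩
    rw [← h2, ← ih.2]
    exact toL2_add h1 ih.1

variable {p : Params d}

theorem crea_zero_toL2 {β : ℝ} (hβ : 0 < β) {f : Vel d m → ℂ} (hf : MemLp f 2 volume) :
    crea β 0 (toL2 f) = toL2 (tensor (gaussC β 0) f) := by
  unfold crea
  exact tensorOp_toL2 (memLp_gaussC hβ 0) hf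

theorem contr_toL2 (j : Fin (m + 1)) (q : E d) {D : Fin (m + 1) → Fin d → Vel d m → ℂ}
    (hD : ∀ j i, MemLp (D j i) 2 volume) :
    MemLp (fun v => ∑ i, (q i : ℂ) * D j i v) 2 volume ∧
    toL2 (fun v => ∑ i, (q i : ℂ) * D j i v) =
      contr j q (WithLp.toLp 2 fun c => toL2 (D c.1 c.2)) := by
  have h1 := toL2_sum_smul Finset.univ (fun i => (q i : ℂ)) (hD j)
  rw [contr_apply]
  exact h1

theorem toL2_opMinus (hβ : 0 < p.beta) (q : E d) (j : Fin (m + 1))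
    {D : Fin (m + 1) → Fin d → Vel d m → ℂ} (hD : ∀ j i, MemLp (D j i) 2 volume) :
    toL2 (opMinus p q (D j)) = (-((Real.sqrt (m + 1) : ℝ) : ℂ)⁻¹ * fourierV p.pot q) •
      crea p.beta 0 (contr j q (WithLp.toLp 2 fun c => toL2 (D c.1 c.2))) := by
  obtain ⟨h1, h2⟩ := contr_toL2 j q hD
  rw [← h2, crea_zero_toL2 hβ h1, ← toL2_smul _ (memLp_tensor (memLp_gaussC hβ 0) h1)]
  congr 1
  funext w
  simp only [opMinus, tensor, gaussC_zero hβ, Pi.smul_apply, smul_eq_mul]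
  change _ * _ * _ * (∑ i, (q i : ℂ) * D j i (initV w)) =
    _ * (((Real.sqrt (maxwellian p.beta (w (Fin.last _))) : ℝ) : ℂ) * _)
  ring

theorem integral_conj_gaussian (hβ : 0 < p.beta) {φ : Vel d m → ℂ} (hφ : IsTest φ) (q : E d)
    (j : Fin (m + 1)) (f : L2 d (m + 1)) :
    ∫ w : Vel d (m + 1), starRingEnd ℂ (∑ i, (q i : ℂ) * grad φ j i (fun l => w l.castSucc)) *
        (((Real.sqrt (maxwellian p.beta (w (Fin.last _))) : ℝ) : ℂ) * fourierV p.pot q * f w) =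
      fourierV p.pot q * inner ℂ (crea p.beta 0 (contr j q (gradPair φ).snd)) f := by
  obtain ⟨h1, h2⟩ := contr_toL2 j q (D := grad φ) fun j i => (isTest_grad hφ j i).memLp 2
  have h3 : contr j q (gradPair φ).snd = toL2 (fun v => ∑ i, (q i : ℂ) * grad φ j i v) := h2.symm
  rw [h3, crea_zero_toL2 hβ h1, inner_toL2_coe (memLp_tensor (memLp_gaussC hβ 0) h1), pairing,
    ← integral_const_mul]
  refine integral_congr_ae (ae_of_all _ fun w => ?_)
  simp only [tensor, gaussC_zero hβ, map_mul, Complex.conj_ofReal]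
  change _ = _ * ((((Real.sqrt (maxwellian p.beta (w (Fin.last _))) : ℝ) : ℂ) *
    starRingEnd ℂ (∑ i, (q i : ℂ) * grad φ j i (fun l => w l.castSucc))) * _)
  ring

theorem inner_sandw_zero (β : ℝ) (T : CVel d (m + 1) → L2 d (m + 1) →L[ℂ] L2 d (m + 1))
    (f g : L2 d m) : inner ℂ f (sandw β T 0 0 g) = inner ℂ (crea β 0 f) (T 0 (crea β 0 g)) := by
  have h1 : snocC (0 : CVel d m) 0 = 0 := by
    funext l
    induction l using Fin.lastCases with
    | last => simp
    | cast l => simp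
  have h2 : conjE (0 : EuclideanSpace ℂ (Fin d)) = 0 := by ext i; simp [conjE]
  have h3 := congrArg (fun A : L2 d m →L[ℂ] L2 d (m + 1) => A f) (anni_adjoint (m := m) β 0)
  simp only [h2] at h3
  rw [sandw_apply, h1, ← h3, ContinuousLinearMap.adjoint_inner_left]

variable {T : Vel d (m + 1) → CVel d (m + 1) → L2 d (m + 1) →L[ℂ] L2 d (m + 1)}

/-- The factors (m+1)^{±1/2} cancel, as do the sign in Ŝ⁻ and the sign from integrating ∇ by parts
in Ŝ⁺; the two V̂ combine to the density of `hatMeas`. The undeformed expression may then be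
replaced by the deformed one through `PropFam.partOp_zero`. -/
theorem PropFam.hatOp_eq (hT : PropFam p.tN T) (ht : 0 < p.tN) (hβ : 0 < p.beta)
    (hV : IsPotential p.pot) (h0 : normV p.pot 0 ≠ ⊤) (k : Vel d m)
    {D : Fin (m + 1) → Fin d → Vel d m → ℂ} (hD : ∀ j i, MemLp (D j i) 2 volume)
    {φ : Vel d m → ℂ} (hφ : IsTest φ) :
    hatOp p (fun k' => T k' 0) k D φ = inner ℂ (gradPair φ).snd
      (RenormalizedPropagator.hatFam p.beta p.pot T k 0
        (WithLp.toLp 2 fun c => toL2 (D c.1 c.2))) := by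
  rw [hT.inner_hatFam hβ hV h0 (zero_mem_deform ht k), hatOp]
  refine Finset.sum_congr rfl fun j _ => ?_
  set DD : GradSp d m := WithLp.toLp 2 fun c => toL2 (D c.1 c.2) with hDD
  have hs : ((Real.sqrt (m + 1) : ℝ) : ℂ) ≠ 0 := by
    exact_mod_cast (Real.sqrt_pos.2 (by positivity)).ne'
  have h1 : ∀ q : E d, inner ℂ (contr j q (gradPair φ).snd)
      (partOp p.beta T j q k 0 (contr j q DD)) =
        inner ℂ (crea p.beta 0 (contr j q (gradPair φ).snd))
          (T (splitMom k j q) 0 (crea p.beta 0 (contr j q DD))) := by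
    intro q
    by_cases hq : q = 0
    · subst hq
      simp [contr_zero]
    · rw [hT.partOp_zero ht hβ j hq, inner_sandw_zero]
  have h2 : ∀ q : E d, ∫ w : Vel d (m + 1),
      starRingEnd ℂ (∑ i, (q i : ℂ) * grad φ j i (fun l => w l.castSucc)) *
        (((Real.sqrt (maxwellian p.beta (w (Fin.last _))) : ℝ) : ℂ) * fourierV p.pot q *
          (T (splitMom k j q) 0 (toL2 (opMinus p q (D j)))) w) =
      -((Real.sqrt (m + 1) : ℝ) : ℂ)⁻¹ * (fourierV p.pot q ^ 2 *
        inner ℂ (contr j q (gradPair φ).snd) (partOp p.beta T j q k 0 (contr j q DD))) := by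
    intro q
    rw [integral_conj_gaussian hβ hφ, toL2_opMinus hβ q j hD, map_smul, inner_smul_right, h1]
    ring
  rw [opPlus, integral_congr_ae (ae_of_all _ h2), integral_const_mul, hV.integral_hatMeas]
  field_simp

end RenormalizedPropagator

end

noncomputable section

namespace RenormalizedPropagator
/-! ### Derivatives of the deformed operators -/
open Filter Topology
attribute [local irreducible] tau crea anni
variable {d m : ℕ}

theorem norm_toC (a : E d) : ‖toC a‖ = ‖a‖ := by
  rw [EuclideanSpace.norm_eq, EuclideanSpace.norm_eq]
  simp [toC]

theorem norm_dotE_le (q : E d) (η : EuclideanSpace ℂ (Fin d)) : ‖dotE q η‖ ≤ ‖q‖ * ‖η‖ := by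
  have h1 : dotE q η = inner ℂ (toC q) η := by
    simp [dotE, toC, PiLp.inner_apply, mul_comm]
  rw [h1, ← norm_toC q]
  exact norm_inner_le_norm _ _

theorem norm_le_bracket (k : Vel d m) (j : Fin (m + 1)) : ‖k j‖ ≤ bracket k := by
  refine Real.le_sqrt_of_sq_le ?_
  have := Finset.single_le_sum (f := fun j => ‖k j‖ ^ 2) (fun j _ => sq_nonneg _) (Finset.mem_univ j)
  linarith

theorem one_le_bracket (k : Vel d m) : 1 ≤ bracket k := by
  refine Real.le_sqrt_of_sq_le ?_
  have : 0 ≤ ∑ j, ‖k j‖ ^ 2 := Finset.sum_nonneg fun j _ => sq_nonneg _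
  linarith

theorem norm_dotC_le (k : Vel d m) (ξ : CVel d m) : ‖dotC k ξ‖ ≤ (m + 1) * bracket k * ‖ξ‖ := by
  have h1 : dotC k ξ = ∑ j, dotE (k j) (ξ j) := rfl
  rw [h1]
  refine (norm_sum_le _ _).trans ((Finset.sum_le_sum (g := fun _ => bracket k * ‖ξ‖)
    fun j _ => (norm_dotE_le _ _).trans ?_).trans_eq ?_)
  · exact mul_le_mul (norm_le_bracket k j) (norm_le_pi_norm ξ j) (norm_nonneg _)
      (zero_le_one.trans (one_le_bracket k))
  · rw [Finset.sum_const, Finset.card_univ, Fintype.card_fin, nsmul_eq_mul]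
    push_cast
    ring

theorem rate_sub_le {tN : ℝ} (k : Vel d m) {ξ ζ : CVel d m} {R : ℝ} (h : ζ ∈ Metric.ball ξ R) :
    rate tN k ξ - (m + 1) * bracket k * R ≤ rate tN k ζ := by
  rw [Metric.mem_ball, dist_eq_norm] at h
  have h1 : dotC k ζ = dotC k ξ + dotC k (ζ - ξ) := by rw [← dotC_add]; congr 1; abel
  have h2 := (Complex.abs_re_le_norm (I * dotC k (ζ - ξ))).trans_eq
    (by rw [norm_mul, Complex.norm_I, one_mul])
  have h3 := neg_le_of_abs_le (h2.trans (norm_dotC_le k _))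
  have h4 : (m + 1) * bracket k * ‖ζ - ξ‖ ≤ (m + 1) * bracket k * R := by
    have := one_le_bracket k
    gcongr
  rw [rate_eq, rate_eq, h1, mul_add, Complex.add_re]
  linarith

theorem norm_imPart_le (ξ : CVel d m) (j : Fin (m + 1)) : ‖imPart ξ j‖ ≤ ‖ξ‖ :=
  (norm_imE_le (ξ j)).trans (norm_le_pi_norm ξ j)

theorem norm_imPart_lt_of_ball {ξ ζ : CVel d m} {R : ℝ} (h : ζ ∈ Metric.ball ξ R)
    (j : Fin (m + 1)) : ‖imPart ζ j‖ < ‖imPart ξ j‖ + R := by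
  rw [Metric.mem_ball, dist_eq_norm] at h
  have h1 : imPart ζ j = imPart ξ j + imPart (ζ - ξ) j := by
    ext i
    simp [imPart]
  rw [h1]
  have h2 := norm_add_le (imPart ξ j) (imPart (ζ - ξ) j)
  have h3 := norm_imPart_le (ζ - ξ) j
  linarith

theorem imPart_zero (j : Fin (m + 1)) : imPart (0 : CVel d m) j = 0 := by ext i; simp [imPart]

theorem rate_zero (tN : ℝ) (k : Vel d m) : rate tN k 0 = 1 / tN := by simp [rate]

variable {tN β : ℝ} {T : Vel d (m + 1) → CVel d (m + 1) → L2 d (m + 1) →L[ℂ] L2 d (m + 1)}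

theorem norm_iteratedFDeriv_zero_fun {Z F : Type} [NormedAddCommGroup Z] [NormedSpace ℂ Z]
    [NormedAddCommGroup F] [NormedSpace ℂ F] (s : ℕ) (z : Z) :
    ‖iteratedFDeriv ℂ s (fun _ : Z => (0 : F)) z‖ = 0 := by
  rw [iteratedFDeriv_fun_zero, Pi.zero_apply, norm_zero]

/-- The gain |q| keeps the deformed emission bounded slightly beyond `deform`, on a ball of radius
of order |q|/(⟨k⟩⟨q⟩). Cauchy's estimates there do not involve t_N. -/
theorem PropFam.norm_iteratedFDeriv_hatPart_le (hT : PropFam tN T) (ht : 0 < tN) (hβ : 0 < β)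
    (j : Fin (m + 1)) (k : Vel d m) (q : E d) (s : ℕ) :
    ‖iteratedFDeriv ℂ s (fun ξ => hatPart β T j k ξ q) 0‖ ≤
      2 * partBd d m β * (4 * s * (m + 1)) ^ s * bracket k ^ s *
        (Real.sqrt (1 + ‖q‖ ^ 2) ^ s * ‖q‖ ^ (1 - (s : ℝ))) := by
  by_cases hq : q = 0
  · subst hq
    simp only [hatPart_zero]
    rw [norm_iteratedFDeriv_zero_fun]
    have := partBd_nonneg d m β
    have := one_le_bracket k
    positivity
  have hq0 : 0 < ‖q‖ := norm_pos_iff.2 hq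
  set b := bracket k with hb
  set B := Real.sqrt (1 + ‖q‖ ^ 2) with hB
  have hb1 : 1 ≤ b := one_le_bracket k
  have hB1 : 1 ≤ B := Real.le_sqrt_of_sq_le (by nlinarith [sq_nonneg ‖q‖])
  have hBq : ‖q‖ ≤ B := Real.le_sqrt_of_sq_le (by linarith)
  -- On this ball the rate changes by at most |q|/2, so rate + |q| ≥ |q|/2. The factor B = ⟨q⟩ keeps
  -- r below 1 for large q, so that imaginary parts stay admissible.
  set r := ‖q‖ / (2 * (m + 1) * b * B) with hr
  have hr0 : 0 < r := by positivity
  have hr1 : (m + 1) * b * r ≤ ‖q‖ / 2 := by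
    have : (m + 1) * b * r = ‖q‖ / 2 / B := by rw [hr]; field_simp
    rw [this]
    exact div_le_self (by positivity) hB1
  have hm : (1 : ℝ) ≤ m + 1 := by have : (0 : ℝ) ≤ m := m.cast_nonneg; linarith
  have hr2 : r < 1 := by
    rw [hr, div_lt_one (by positivity)]
    have h1 : 1 * B ≤ (m + 1) * b * B :=
      mul_le_mul_of_nonneg_right (one_le_mul_of_one_le_of_one_le hm hb1) (by positivity)
    nlinarith
  have hsub : Metric.ball (0 : CVel d m) r ⊆ deformAt tN q k := fun ξ hξ => by
    refine ⟨fun l => ?_, ?_⟩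
    · have := norm_imPart_lt_of_ball hξ l
      rw [imPart_zero, norm_zero, zero_add] at this
      linarith
    · have := rate_sub_le (tN := tN) k hξ
      rw [rate_zero] at this
      have h2 : 0 < 1 / tN := by positivity
      linarith
  have h1 := norm_iteratedFDeriv_le_of_ball s hr0
    ((hT.differentiableOn_hatPart hβ j k q).mono hsub) (M := 2 * partBd d m β * ‖q‖) fun ξ hξ => by
      have h2 := rate_sub_le (tN := tN) k hξ
      rw [rate_zero] at h2
      have h3 : 0 < 1 / tN := by positivity
      have h4 := hT.norm_hatPart_le_of_rate hβ j (hsub hξ) (c := 1 / 2) (by norm_num) (by linarith)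
      simpa using h4
  refine h1.trans_eq ?_
  have h2 : ‖q‖ ^ (1 - (s : ℝ)) = ‖q‖ / ‖q‖ ^ s := by
    rw [Real.rpow_sub hq0, Real.rpow_one, Real.rpow_natCast]
  have h3 : 2 * (s : ℝ) / r = 4 * s * (m + 1) * b * B / ‖q‖ := by
    rw [hr]; field_simp; ring
  rw [h2, h3, div_pow, mul_pow, mul_pow]
  ring

/-- For vanishing momenta the rate does not depend on ξ, so a radius independent of q is available
and no negative power of |q| appears. -/
theorem PropFam.norm_iteratedFDeriv_hatPart_le_of_zero (hT : PropFam tN T) (ht : 0 < tN) (hβ : 0 < β)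
    (j : Fin (m + 1)) (q : E d) (s : ℕ) :
    ‖iteratedFDeriv ℂ s (fun ξ => hatPart β T j 0 ξ q) 0‖ ≤
      2 * partBd d m β * (4 * s * (m + 1)) ^ s * ‖q‖ := by
  have hm : (0 : ℝ) ≤ m := m.cast_nonneg
  have hsub : Metric.ball (0 : CVel d m) (1 / 2) ⊆ deform tN 0 := fun ξ hξ => by
    refine ⟨fun l => ?_, ?_⟩
    · have := norm_imPart_lt_of_ball hξ l
      rw [imPart_zero, norm_zero, zero_add] at this
      linarith
    · simp [rate, ht]
  have h1 := norm_iteratedFDeriv_le_of_ball s (by norm_num : (0 : ℝ) < 1 / 2)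
    ((hT.differentiableOn_hatPart hβ j 0 q).mono (hsub.trans (deform_subset tN q 0)))
    (fun ξ hξ => hT.norm_hatPart_le hβ j (hsub hξ) q)
  refine h1.trans ?_
  have h0 := partBd_nonneg d m β
  have h2 : (2 * s / (1 / 2) : ℝ) ≤ 4 * s * (m + 1) := by
    have : (0 : ℝ) ≤ s := s.cast_nonneg
    nlinarith [mul_nonneg this hm]
  calc partBd d m β * ‖q‖ * (2 * s / (1 / 2)) ^ s
      ≤ partBd d m β * ‖q‖ * (4 * s * (m + 1)) ^ s := by gcongr
    _ ≤ 2 * (partBd d m β * ‖q‖ * (4 * s * (m + 1)) ^ s) := by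
        have : 0 ≤ partBd d m β * ‖q‖ * (4 * s * (m + 1)) ^ s := by positivity
        linarith
    _ = _ := by ring

/-- The constants in the bounds on the derivatives of the deformed hat operators. -/
def hatDerivBd (d m : ℕ) (β : ℝ) (s : ℕ) : ℝ :=
  (m + 1) * (2 * partBd d m β * (4 * s * (m + 1)) ^ s) * ((2 * Real.pi) ^ d)⁻¹

theorem enorm_sum_le_card {G ι : Type} [NormedAddCommGroup G] (J : Finset ι) {a : ι → G} {M : ℝ≥0∞}
    (hM : ∀ j, ‖a j‖ₑ ≤ M) : ‖∑ j ∈ J, a j‖ₑ ≤ J.card * M :=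
  (enorm_sum_le _ _).trans ((Finset.sum_le_sum fun j _ => hM j).trans_eq (by simp))

theorem enorm_iteratedFDeriv_sum_le {Z F ι : Type} [NormedAddCommGroup Z] [NormedSpace ℂ Z]
    [NormedAddCommGroup F] [NormedSpace ℂ F] (J : Finset ι) {f : ι → Z → F} {z : Z} {n : ℕ}
    {M : ℝ≥0∞} (hf : ∀ j, ContDiffAt ℂ n (f j) z) (hM : ∀ j, ‖iteratedFDeriv ℂ n (f j) z‖ₑ ≤ M) :
    ‖iteratedFDeriv ℂ n (fun z => ∑ j ∈ J, f j z) z‖ₑ ≤ J.card * M := by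
  rw [iteratedFDeriv_fun_sum_apply fun j _ => hf j]
  exact enorm_sum_le_card J hM

variable {V : E d → ℝ}

theorem PropFam.enorm_iteratedFDeriv_strongInt_le (hT : PropFam tN T) (ht : 0 < tN) (hβ : 0 < β)
    (hV : IsPotential V) (h0 : normV V 0 ≠ ⊤) (j : Fin (m + 1)) (k : Vel d m) {s : ℕ} {c : ℝ}
    (hc : 0 ≤ c) {w : E d → ℝ} (hw : ∀ q, ‖iteratedFDeriv ℂ s (fun ξ => hatPart β T j k ξ q) 0‖ ≤
      c * w q) : ContDiffAt ℂ s (fun ξ => strongInt (hatMeas V) (hatPart β T j k ξ)) 0 ∧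
    ‖iteratedFDeriv ℂ s (fun ξ => strongInt (hatMeas V) (hatPart β T j k ξ)) 0‖ₑ ≤
      ENNReal.ofReal c * ∫⁻ q, ENNReal.ofReal (w q) ∂hatMeas V := by
  have hU := isOpen_deform tN k
  have hz := zero_mem_deform ht k
  have h1 : ∀ ξ ∈ deform tN k, StrongIntegrable (hatMeas V) (hatPart β T j k ξ)
      fun q => partBd d m β * ‖q‖ := fun ξ h => hT.strongIntegrable hβ hV h0 j h
  have h2 : ∀ q, DifferentiableOn ℂ (fun ξ => hatPart β T j k ξ q) (deform tN k) :=
    fun q => (hT.differentiableOn_hatPart hβ j k q).mono (deform_subset tN q k)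
  refine ⟨(contDiffOn_of_differentiableOn_complex hU (differentiableOn_strongInt hU h1 h2)
    s).contDiffAt (hU.mem_nhds hz), ?_⟩
  rw [← lintegral_const_mul' _ _ ENNReal.ofReal_ne_top]
  refine RenormalizedPropagator.enorm_iteratedFDeriv_strongInt_le hU h1 h2 hz fun q => ?_
  rw [← ENNReal.ofReal_mul hc, ← ofReal_norm]
  exact ENNReal.ofReal_le_ofReal (hw q)

/-- A single particle with total momentum zero has k = 0, so the weight |q| of C_0 suffices for
every s. Otherwise the weight is that of C_s. -/
theorem PropFam.enorm_iteratedFDeriv_strongInt_hatPart_le (hT : PropFam tN T) (ht : 0 < tN)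
    (hβ : 0 < β) (hV : IsPotential V) (h0 : normV V 0 ≠ ⊤) {k : Vel d m} (hk : ∑ j, k j = 0)
    {s e : ℕ} (he : e = if m = 0 then 0 else s) (j : Fin (m + 1)) :
    ContDiffAt ℂ s (fun ξ => strongInt (hatMeas V) (hatPart β T j k ξ)) 0 ∧
      ‖iteratedFDeriv ℂ s (fun ξ => strongInt (hatMeas V) (hatPart β T j k ξ)) 0‖ₑ ≤
      ENNReal.ofReal (2 * partBd d m β * (4 * s * (m + 1)) ^ s * bracket k ^ s) *
        (ENNReal.ofReal ((2 * Real.pi) ^ d)⁻¹ * normV V e) := by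
  set c : ℝ := 2 * partBd d m β * (4 * s * (m + 1)) ^ s with hc
  have hc0 : 0 ≤ c := by
    have := partBd_nonneg d m β
    positivity
  have hb0 : 0 ≤ bracket k ^ s := pow_nonneg (zero_le_one.trans (one_le_bracket k)) s
  by_cases hm : m = 0
  · subst hm
    have hk0 : k = 0 := by
      funext l
      have : l = 0 := Fin.eq_zero l
      subst this
      simpa using hk
    subst hk0
    have he' : e = 0 := he.trans (if_pos rfl)
    rw [he', ← hV.lintegral_norm_hatMeas]
    refine hT.enorm_iteratedFDeriv_strongInt_le ht hβ hV h0 j 0 (by positivity) fun q => ?_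
    have h2 : bracket (0 : Vel d 0) = 1 := by simp [bracket]
    rw [h2, one_pow, mul_one]
    exact hT.norm_iteratedFDeriv_hatPart_le_of_zero ht hβ j q s
  · have he' : e = s := he.trans (if_neg hm)
    subst he'
    have h7 := hT.enorm_iteratedFDeriv_strongInt_le (c := c * bracket k ^ e)
      (w := fun q => Real.sqrt (1 + ‖q‖ ^ 2) ^ e * ‖q‖ ^ (1 - (e : ℝ))) ht hβ hV h0 j k
      (by positivity) fun q => hT.norm_iteratedFDeriv_hatPart_le ht hβ j k q e
    refine ⟨h7.1, h7.2.trans_eq ?_⟩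
    exact congrArg (fun x => ENNReal.ofReal (c * bracket k ^ e) * x) (hV.lintegral_hatMeas e)

theorem PropFam.enorm_iteratedFDeriv_hatFam_le (hT : PropFam tN T) (ht : 0 < tN) (hβ : 0 < β)
    (hV : IsPotential V) (h0 : normV V 0 ≠ ⊤) {k : Vel d m} (hk : ∑ j, k j = 0) (s : ℕ) :
    ‖iteratedFDeriv ℂ s (RenormalizedPropagator.hatFam β V T k) 0‖ₑ ≤
      ENNReal.ofReal (hatDerivBd d m β s) *
        (normV V (if m = 0 then 0 else s) * ENNReal.ofReal (bracket k ^ s)) := by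
  have key := hT.enorm_iteratedFDeriv_strongInt_hatPart_le ht hβ hV h0 hk (s := s) rfl
  have hc0 : 0 ≤ 2 * partBd d m β * (4 * s * (m + 1)) ^ s := by
    have := partBd_nonneg d m β
    positivity
  have h5 := enorm_iteratedFDeriv_sum_le (n := s) (z := (0 : CVel d m)) Finset.univ
    (f := fun j ξ => strongInt (hatMeas V) (hatPart β T j k ξ))
    (fun j => (key j).1) fun j => (key j).2
  have h6 : RenormalizedPropagator.hatFam β V T k =
      fun ξ => ∑ j, strongInt (hatMeas V) (hatPart β T j k ξ) := rfl
  rw [h6]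
  refine h5.trans_eq ?_
  rw [Finset.card_univ, Fintype.card_fin, hatDerivBd]
  generalize 2 * partBd d m β * (4 * s * (m + 1)) ^ s = c at hc0 ⊢
  rw [ENNReal.ofReal_mul hc0, ENNReal.ofReal_mul (by positivity), ENNReal.ofReal_mul (by positivity)]
  have h1 : ENNReal.ofReal ((m : ℝ) + 1) = ((m + 1 : ℕ) : ℝ≥0∞) := by
    rw [← ENNReal.ofReal_natCast]
    push_cast
    rfl
  rw [h1]
  ring

theorem one_add_pow_le {x : ℝ} (hx : 0 ≤ x) (n : ℕ) : (1 + x) ^ n ≤ 2 ^ n * (1 + x ^ n) := by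
  have h1 : (0 : ℝ) ≤ x ^ n := by positivity
  rcases le_total x 1 with h | h
  · calc (1 + x) ^ n ≤ 2 ^ n := by gcongr; linarith
      _ ≤ _ := le_mul_of_one_le_right (by positivity) (by linarith)
  · calc (1 + x) ^ n ≤ (2 * x) ^ n := by gcongr; linarith
      _ = 2 ^ n * x ^ n := mul_pow _ _ _
      _ ≤ _ := by gcongr; linarith

/-- The constants in the bounds on the derivatives of the deformed propagators. -/
def propDerivBd (m s : ℕ) : ℝ := 2 * (4 * s * (m + 1)) ^ s * 2 ^ (s + 1)

theorem propDerivBd_nonneg (m s : ℕ) : 0 ≤ propDerivBd m s := by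
  unfold propDerivBd
  positivity

/-- Cauchy's estimates on a ball where the rate stays above half its central value. -/
theorem PropFam.norm_iteratedFDeriv_le {S : Vel d m → CVel d m → L2 d m →L[ℂ] L2 d m}
    (hS : PropFam tN S) (hm : 1 ≤ m) {k : Vel d m} {ξ : CVel d m} (hξ : ∀ j, ‖imPart ξ j‖ ≤ 1)
    (hl : 0 < rate tN k ξ) (s : ℕ) : ‖iteratedFDeriv ℂ s (S k) ξ‖ ≤
      propDerivBd m s * (bracket k ^ s * (1 + (rate tN k ξ ^ (s + 1))⁻¹)) := by
  set l := rate tN k ξ with hl'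
  set b := bracket k with hb
  have hb1 : 1 ≤ b := one_le_bracket k
  have hm1 : (1 : ℝ) ≤ m := by exact_mod_cast hm
  -- The factor l/(m+1)b protects the rate, and dividing by 1 + l gives r < 1. Imaginary parts then
  -- stay below 2 ≤ m + 1; this is where m ≥ 1 matters.
  set r := l / (2 * (m + 1) * b * (1 + l)) with hr
  have hr0 : 0 < r := by positivity
  have hr1 : (m + 1) * b * r ≤ l / 2 := by
    have : (m + 1) * b * r = l / 2 / (1 + l) := by rw [hr]; field_simp
    rw [this]
    exact div_le_self (by positivity) (by linarith)
  have hr2 : r < 1 := by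
    rw [hr, div_lt_one (by positivity)]
    have h1 : 1 * (1 + l) ≤ (m + 1) * b * (1 + l) :=
      mul_le_mul_of_nonneg_right (one_le_mul_of_one_le_of_one_le (by linarith) hb1) (by positivity)
    nlinarith
  have hsub : Metric.ball ξ r ⊆ deform tN k := fun ζ hζ => by
    refine ⟨fun j => ?_, ?_⟩
    · have := norm_imPart_lt_of_ball hζ j
      have := hξ j
      linarith
    · have := rate_sub_le (tN := tN) k hζ
      linarith
  have h1 := norm_iteratedFDeriv_le_of_ball s hr0 ((hS.hol k).mono hsub) (M := 2 * l⁻¹)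
    fun ζ hζ => by
      refine (hS.norm_le k ζ (hsub hζ)).trans ?_
      have h2 := rate_sub_le (tN := tN) k hζ
      have h3 : (rate tN k ζ)⁻¹ ≤ (l / 2)⁻¹ := inv_anti₀ (by positivity) (by linarith)
      rwa [inv_div, div_eq_mul_inv] at h3
  refine h1.trans ?_
  have h3 : 2 * (s : ℝ) / r = 4 * s * (m + 1) * b * (1 + l⁻¹) := by
    rw [hr]; field_simp; ring
  have h4 : l⁻¹ * (1 + l⁻¹) ^ s ≤ 2 ^ (s + 1) * (1 + (l ^ (s + 1))⁻¹) := by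
    have h5 := one_add_pow_le (inv_nonneg.2 hl.le) (s + 1)
    rw [inv_pow] at h5
    refine le_trans ?_ h5
    rw [pow_succ']
    gcongr
    linarith
  rw [h3, mul_pow, mul_pow, propDerivBd]
  calc 2 * l⁻¹ * ((4 * s * (m + 1)) ^ s * b ^ s * (1 + l⁻¹) ^ s)
      = 2 * (4 * s * (m + 1)) ^ s * b ^ s * (l⁻¹ * (1 + l⁻¹) ^ s) := by ring
    _ ≤ 2 * (4 * s * (m + 1)) ^ s * b ^ s * (2 ^ (s + 1) * (1 + (l ^ (s + 1))⁻¹)) := by gcongr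
    _ = _ := by ring

end RenormalizedPropagator

end

noncomputable section

namespace RenormalizedPropagator
/-! ### Bounds on hat operators -/
open Filter Topology
attribute [local irreducible] tau
variable {d m : ℕ}

/-- Covariant holomorphic families of operators on gradients. -/
structure GradCovFam (U : Set (CVel d m)) (b : CVel d m → GradSp d m →L[ℂ] GradSp d m) : Prop where
  isOpen : IsOpen U
  add_mem : ∀ ξ ∈ U, ∀ a, ξ + toCVel a ∈ U
  hol : DifferentiableOn ℂ b U
  cov : ∀ ξ ∈ U, ∀ a D, b (ξ + toCVel a) (tauG a D) = tauG a (b ξ D)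

theorem HatFam.gradCovFam {tN K : ℝ} {b : Vel d m → CVel d m → GradSp d m →L[ℂ] GradSp d m}
    (h : HatFam tN K b) (k : Vel d m) : GradCovFam (deform tN k) (b k) :=
  ⟨isOpen_deform tN k, fun _ h a => add_mem_deform h a, h.hol k, h.cov k⟩

/-- The components of gradients. -/
def projG (c : Fin (m + 1) × Fin d) : GradSp d m →L[ℂ] L2 d m :=
  PiLp.proj 2 (fun _ : Fin (m + 1) × Fin d => L2 d m) c

theorem projG_apply (c : Fin (m + 1) × Fin d) (D : GradSp d m) : projG c D = D c := rfl

theorem norm_projG_le (c : Fin (m + 1) × Fin d) : ‖(projG c : GradSp d m →L[ℂ] L2 d m)‖ ≤ 1 :=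
  ContinuousLinearMap.opNorm_le_bound _ zero_le_one fun D => by
    rw [one_mul]
    exact PiLp.norm_apply_le D c

theorem sum_projG_adjoint (D : GradSp d m) : ∑ c, (projG c).adjoint (D c) = D := by
  refine ext_inner_left ℂ fun D' => ?_
  rw [inner_sum, PiLp.inner_apply]
  exact Finset.sum_congr rfl fun c _ => ContinuousLinearMap.adjoint_inner_right (projG c) D' (D c)

theorem tauG_projG_adjoint (a : Vel d m) (c : Fin (m + 1) × Fin d) (f : L2 d m) :
    tauG a ((projG c).adjoint f) = (projG c).adjoint (tau a f) := by
  refine ext_inner_left ℂ fun D => ?_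
  have h1 : inner ℂ D (tauG a ((projG c).adjoint f)) = inner ℂ (tauG (-a) D) ((projG c).adjoint f) := by
    rw [inner_tauG_left, neg_neg]
  rw [h1, ContinuousLinearMap.adjoint_inner_right, ContinuousLinearMap.adjoint_inner_right]
  change inner ℂ (tau (-a) (D c)) f = inner ℂ (D c) (tau a f)
  rw [inner_tau_left, neg_neg]

/-- The matrix elements of an operator on gradients. -/
def compG (b : CVel d m → GradSp d m →L[ℂ] GradSp d m) (c c' : Fin (m + 1) × Fin d)
    (ξ : CVel d m) : L2 d m →L[ℂ] L2 d m := projG c ∘L b ξ ∘L (projG c').adjoint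

theorem compG_apply (b : CVel d m → GradSp d m →L[ℂ] GradSp d m) (c c' : Fin (m + 1) × Fin d)
    (ξ : CVel d m) (f : L2 d m) : compG b c c' ξ f = b ξ ((projG c').adjoint f) c := rfl

theorem sum_compG_apply (b : CVel d m → GradSp d m →L[ℂ] GradSp d m) (c : Fin (m + 1) × Fin d)
    (ξ : CVel d m) (D : GradSp d m) : ∑ c', compG b c c' ξ (D c') = b ξ D c := by
  have h1 : b ξ D = ∑ c', b ξ ((projG c').adjoint (D c')) := by
    rw [← map_sum, sum_projG_adjoint]
  rw [← projG_apply c (b ξ D), h1, map_sum]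
  rfl

theorem differentiableOn_comp_comp {A B C D Z : Type} [NormedAddCommGroup Z] [NormedSpace ℂ Z]
    [NormedAddCommGroup A] [NormedSpace ℂ A] [NormedAddCommGroup B] [NormedSpace ℂ B]
    [NormedAddCommGroup C] [NormedSpace ℂ C] [NormedAddCommGroup D] [NormedSpace ℂ D]
    (P : C →L[ℂ] D) (R : A →L[ℂ] B) {X : Z → B →L[ℂ] C} {U : Set Z} (hX : DifferentiableOn ℂ X U) :
    DifferentiableOn ℂ (fun z => P ∘L X z ∘L R) U :=
  (differentiableOn_const _).clm_comp (hX.clm_comp (differentiableOn_const _))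

theorem enorm_iteratedFDeriv_comp_comp_le {A B C D Z : Type} [NormedAddCommGroup Z]
    [NormedSpace ℂ Z] [NormedAddCommGroup A] [NormedSpace ℂ A] [NormedAddCommGroup B]
    [NormedSpace ℂ B] [NormedAddCommGroup C] [NormedSpace ℂ C] [NormedAddCommGroup D]
    [NormedSpace ℂ D] {P : C →L[ℂ] D} {R : A →L[ℂ] B} (hP : ‖P‖ ≤ 1) (hR : ‖R‖ ≤ 1)
    {X : Z → B →L[ℂ] C} {z : Z} {s : ℕ} (hX : ContDiffAt ℂ s X z) :
    ‖iteratedFDeriv ℂ s (fun z => P ∘L X z ∘L R) z‖ₑ ≤ ‖iteratedFDeriv ℂ s X z‖ₑ := by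
  set L : (B →L[ℂ] C) →L[ℂ] (A →L[ℂ] D) := (ContinuousLinearMap.compL ℂ A C D P).comp
    ((ContinuousLinearMap.compL ℂ A B C).flip R) with hL
  have h1 : ‖L‖ ≤ 1 := ContinuousLinearMap.opNorm_le_bound _ zero_le_one fun Y => by
    change ‖P ∘L Y ∘L R‖ ≤ 1 * ‖Y‖
    calc ‖P ∘L Y ∘L R‖ ≤ ‖P‖ * (‖Y‖ * ‖R‖) :=
          (ContinuousLinearMap.opNorm_comp_le _ _).trans
            (mul_le_mul_of_nonneg_left (ContinuousLinearMap.opNorm_comp_le _ _) (norm_nonneg _))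
      _ ≤ 1 * (‖Y‖ * 1) := by gcongr
      _ = 1 * ‖Y‖ := by ring
  rw [enorm_le_iff_norm_le]
  exact (L.norm_iteratedFDeriv_comp_left hX le_rfl).trans (mul_le_of_le_one_left (norm_nonneg _) h1)

variable {U : Set (CVel d m)} {b : CVel d m → GradSp d m →L[ℂ] GradSp d m}

/-- Passing to matrix elements makes the scalar calculus of covariant families available for
operators on gradients. -/
theorem GradCovFam.covFam (h : GradCovFam U b) (c c' : Fin (m + 1) × Fin d) :
    CovFam U (compG b c c') where
  isOpen := h.isOpen
  add_mem := h.add_mem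
  hol := differentiableOn_comp_comp (projG c) ((projG c').adjoint) h.hol
  cov ξ hξ a f := by
    rw [compG_apply, compG_apply, ← tauG_projG_adjoint, h.cov ξ hξ]
    rfl

theorem GradCovFam.enorm_iteratedFDeriv_compG_le (h : GradCovFam U b) {ξ : CVel d m} (hξ : ξ ∈ U)
    (c c' : Fin (m + 1) × Fin d) (s : ℕ) :
    ‖iteratedFDeriv ℂ s (compG b c c') ξ‖ₑ ≤ ‖iteratedFDeriv ℂ s b ξ‖ₑ := by
  refine enorm_iteratedFDeriv_comp_comp_le (norm_projG_le c) ?_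
    ((contDiffOn_of_differentiableOn_complex h.isOpen h.hol s).contDiffAt (h.isOpen.mem_nhds hξ))
  rw [LinearIsometryEquiv.norm_map]
  exact norm_projG_le c'

theorem contDiff_partialD {ℓ : ℕ} (J : Fin ℓ → Fin (m + 1) × Fin d) {f : Vel d m → ℂ}
    (hf : ContDiff ℝ ∞ f) : ContDiff ℝ ∞ (partialD J f) := by
  induction ℓ generalizing f with
  | zero => rwa [partialD_zero]
  | succ ℓ ih => rw [partialD_succ J hf]; exact ih _ (contDiff_grad hf _ _)

theorem grad_grad_comm {f : Vel d m → ℂ} (hf : ContDiff ℝ ∞ f) (j j' : Fin (m + 1)) (i i' : Fin d) :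
    grad (grad f j i) j' i' = grad (grad f j' i') j i :=
  funext fun v => fderiv_fderiv_comm hf v _ _

theorem partialD_grad {ℓ : ℕ} (J : Fin ℓ → Fin (m + 1) × Fin d) {f : Vel d m → ℂ}
    (hf : ContDiff ℝ ∞ f) (j : Fin (m + 1)) (i : Fin d) :
    partialD J (grad f j i) = grad (partialD J f) j i := by
  induction ℓ generalizing f with
  | zero => rw [partialD_zero, partialD_zero]
  | succ ℓ ih =>
    rw [partialD_succ J hf, partialD_succ J (contDiff_grad hf j i), grad_grad_comm hf,
      ih _ (contDiff_grad hf _ _)]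

theorem partialD_sum {ℓ : ℕ} {ι : Type} (s : Finset ι) (J : Fin ℓ → Fin (m + 1) × Fin d)
    {f : ι → Vel d m → ℂ} (hf : ∀ i, ContDiff ℝ ∞ (f i)) :
    partialD J (fun v => ∑ i ∈ s, f i v) = fun v => ∑ i ∈ s, partialD J (f i) v := by
  funext v
  have h1 : (ℓ : WithTop ℕ∞) ≤ (∞ : WithTop ℕ∞) := by exact_mod_cast le_top
  rw [partialD, iteratedFDeriv_fun_sum_apply fun i _ => ((hf i).of_le h1).contDiffAt,
    sum_apply]
  rfl

theorem partialD_neg {ℓ : ℕ} (J : Fin ℓ → Fin (m + 1) × Fin d) (f : Vel d m → ℂ) :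
    partialD J (fun v => -f v) = fun v => -partialD J f v := by
  funext v
  have h1 : (fun v => -f v) = -f := rfl
  rw [partialD, h1, iteratedFDeriv_neg_apply]
  rfl

theorem IsTest.integrable_conj_mul {φ f : Vel d m → ℂ} (hφ : IsTest φ) (hf : Continuous f) :
    Integrable fun v => starRingEnd ℂ (φ v) * f v :=
  (hφ.conj.1.continuous.mul hf).integrable_of_hasCompactSupport hφ.conj.2.mul_right

theorem pairing_neg_sum {ι : Type} [Fintype ι] {φ : Vel d m → ℂ} (hφ : IsTest φ)
    {f : ι → Vel d m → ℂ} (hf : ∀ i, Continuous (f i)) :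
    pairing φ (fun v => -∑ i, f i v) = -∑ i, pairing φ (f i) := by
  simp only [pairing]
  rw [← integral_finsetSum _ fun i _ => hφ.integrable_conj_mul (hf i), ← integral_neg]
  refine integral_congr_ae (ae_of_all _ fun v => ?_)
  simp only [mul_neg, Finset.mul_sum]

theorem enorm_pairing_le {f g : Vel d m → ℂ} (hf : MemLp f 2 volume) (hg : MemLp g 2 volume) :
    ‖pairing f g‖ₑ ≤ eLpNorm f 2 volume * eLpNorm g 2 volume := by
  rw [← inner_toL2 hf hg, ← enorm_toL2 hf, ← enorm_toL2 hg, ← ofReal_norm, ← ofReal_norm,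
    ← ofReal_norm, ← ENNReal.ofReal_mul (norm_nonneg _)]
  exact ENNReal.ofReal_le_ofReal (norm_inner_le_norm _ _)

/-- The components of `b ∇g`. -/
def hatComp (b : CVel d m → GradSp d m →L[ℂ] GradSp d m) (g : Vel d m → ℂ)
    (c : Fin (m + 1) × Fin d) (v : Vel d m) : ℂ := ∑ c', famEval (compG b c c') 0 (grad g c'.1 c'.2) v

/-- The function `-∇·b∇g`. -/
def hatFun (b : CVel d m → GradSp d m →L[ℂ] GradSp d m) (g : Vel d m → ℂ) (v : Vel d m) : ℂ :=
  -∑ c, grad (hatComp b g c) c.1 c.2 v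

variable {g : Vel d m → ℂ}

theorem GradCovFam.contDiff_hatComp (h : GradCovFam U b) (h0 : 0 ∈ U) (hg : IsTest g)
    (c : Fin (m + 1) × Fin d) : ContDiff ℝ ∞ (hatComp b g c) :=
  ContDiff.sum fun c' _ => (h.covFam c c').contDiff_famEval h0 (isTest_grad hg c'.1 c'.2)

theorem GradCovFam.contDiff_hatFun (h : GradCovFam U b) (h0 : 0 ∈ U) (hg : IsTest g) :
    ContDiff ℝ ∞ (hatFun b g) :=
  (ContDiff.sum fun c _ => contDiff_grad (h.contDiff_hatComp h0 hg c) c.1 c.2).neg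

theorem GradCovFam.partialD_hatComp (h : GradCovFam U b) (h0 : 0 ∈ U) (hg : IsTest g) {ℓ : ℕ}
    (J : Fin ℓ → Fin (m + 1) × Fin d) (c : Fin (m + 1) × Fin d) : partialD J (hatComp b g c) =
      fun v => ∑ c', partialD J (famEval (compG b c c') 0 (grad g c'.1 c'.2)) v :=
  partialD_sum Finset.univ J fun c' => (h.covFam c c').contDiff_famEval h0 (isTest_grad hg c'.1 c'.2)

theorem GradCovFam.partialD_hatFun (h : GradCovFam U b) (h0 : 0 ∈ U) (hg : IsTest g) {ℓ : ℕ}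
    (J : Fin ℓ → Fin (m + 1) × Fin d) : partialD J (hatFun b g) =
      fun v => -∑ c, grad (partialD J (hatComp b g c)) c.1 c.2 v := by
  have h1 := partialD_neg J fun v => ∑ c, grad (hatComp b g c) c.1 c.2 v
  rw [partialD_sum Finset.univ J fun c => contDiff_grad (h.contDiff_hatComp h0 hg c) c.1 c.2] at h1
  simp only [fun c => partialD_grad J (h.contDiff_hatComp h0 hg c) c.1 c.2] at h1
  exact h1

theorem GradCovFam.pairing_partialD_hatFun (h : GradCovFam U b) (h0 : 0 ∈ U) (hg : IsTest g)
    {φ : Vel d m → ℂ} (hφ : IsTest φ) {ℓ : ℕ} (J : Fin ℓ → Fin (m + 1) × Fin d) :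
    pairing φ (partialD J (hatFun b g)) =
      ∑ c, pairing (grad φ c.1 c.2) (partialD J (hatComp b g c)) := by
  have h1 := fun c => contDiff_partialD J (h.contDiff_hatComp h0 hg c)
  rw [h.partialD_hatFun h0 hg J, pairing_neg_sum hφ fun c => (contDiff_grad (h1 c) _ _).continuous,
    ← Finset.sum_neg_distrib]
  exact Finset.sum_congr rfl fun c _ => (pairing_grad_eq_neg hφ (h1 c) c.1 c.2).symm

theorem toL2_sum {ι : Type} (s : Finset ι) {F : ι → Vel d m → ℂ} (hF : ∀ i, MemLp (F i) 2 volume) :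
    MemLp (fun v => ∑ i ∈ s, F i v) 2 volume ∧
      toL2 (fun v => ∑ i ∈ s, F i v) = ∑ i ∈ s, toL2 (F i) := by
  simpa only [one_mul, one_smul] using toL2_sum_smul s (fun _ => 1) hF

/-- Used to discard an accretive leading term: only the error z - x can make the real part negative.
-/
theorem ofReal_neg_re_le_enorm {z x : ℂ} (hx : 0 ≤ x.re) :
    ENNReal.ofReal (-z.re) ≤ ‖z - x‖ₑ := by
  rw [← ofReal_norm]
  refine ENNReal.ofReal_le_ofReal ?_
  have h1 := neg_le_of_abs_le (Complex.abs_re_le_norm (z - x))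
  rw [Complex.sub_re] at h1
  linarith

/-! ### Estimates of -∇·b∇g in terms of bounds on the ξ-derivatives of b. -/

section Bounds

variable {M : ℕ → ℝ≥0∞} (hM : ∀ s, ‖iteratedFDeriv ℂ s b 0‖ₑ ≤ M s)
include hM

/-- Subtracting b applied to ∇∂_J g removes the term without ξ-derivatives, so that the sum starts
at s = 1. The accretivity bound needs precisely this. -/
theorem GradCovFam.toL2_partialD_hatComp (h : GradCovFam U b) (h0 : 0 ∈ U) (hg : IsTest g) {ℓ : ℕ}
    (J : Fin ℓ → Fin (m + 1) × Fin d) (c : Fin (m + 1) × Fin d) :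
    MemLp (partialD J (hatComp b g c)) 2 volume ∧
    ‖toL2 (partialD J (hatComp b g c)) - b 0 (gradPair (partialD J g)).snd c‖ₑ ≤
      ((m + 1) * d : ℕ) * 2 ^ ℓ * ∑ s ∈ Finset.Icc 1 ℓ, M s * derivNorm (ℓ + 1 - s) g := by
  have h1 := fun c' : Fin (m + 1) × Fin d => (h.covFam c c').enorm_partialD_famEval_sub_le J h0
    (isTest_grad hg c'.1 c'.2) fun s => (h.enorm_iteratedFDeriv_compG_le h0 c c' s).trans (hM s)
  obtain ⟨h2, h3⟩ := toL2_sum Finset.univ fun c' => (h1 c').1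
  rw [h.partialD_hatComp h0 hg J c]
  refine ⟨h2, ?_⟩
  rw [h3, ← sum_compG_apply, ← Finset.sum_sub_distrib]
  refine (enorm_sum_le_card Finset.univ (M := 2 ^ ℓ * ∑ s ∈ Finset.Icc 1 ℓ,
    M s * derivNorm (ℓ + 1 - s) g) fun c' => ?_).trans_eq ?_
  · rw [gradPair_snd, ← partialD_grad J hg.1]
    refine (h1 c').2.trans ?_
    gcongr with s hs
    rw [Nat.succ_sub (Finset.mem_Icc.1 hs).2]
    exact derivNorm_grad_le _ hg.1 _ _
  · simp [mul_assoc]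

theorem GradCovFam.eLpNorm_partialD_hatComp_le (h : GradCovFam U b) (h0 : 0 ∈ U) (hg : IsTest g)
    {ℓ : ℕ} (J : Fin ℓ → Fin (m + 1) × Fin d) (c : Fin (m + 1) × Fin d) :
    eLpNorm (partialD J (hatComp b g c)) 2 volume ≤
      ((m + 1) * d : ℕ) * 2 ^ ℓ * ∑ s ∈ Finset.range (ℓ + 1), M s * derivNorm (ℓ + 1 - s) g := by
  have h1 := fun c' : Fin (m + 1) × Fin d => (h.covFam c c').enorm_partialD_famEval_sub_le J h0
    (isTest_grad hg c'.1 c'.2) fun s => (h.enorm_iteratedFDeriv_compG_le h0 c c' s).trans (hM s)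
  obtain ⟨h2, h3⟩ := toL2_sum Finset.univ fun c' => (h1 c').1
  rw [h.partialD_hatComp h0 hg J c, ← enorm_toL2 h2, h3]
  refine (enorm_sum_le_card Finset.univ (M := 2 ^ ℓ * ∑ s ∈ Finset.range (ℓ + 1),
    M s * derivNorm (ℓ + 1 - s) g) fun c' => ?_).trans_eq ?_
  · rw [enorm_toL2 (h1 c').1]
    refine ((h.covFam c c').eLpNorm_partialD_famEval_le J h0 (isTest_grad hg c'.1 c'.2)
      fun s => (h.enorm_iteratedFDeriv_compG_le h0 c c' s).trans (hM s)).trans ?_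
    gcongr with s hs
    rw [Nat.succ_sub (Nat.lt_succ_iff.1 (Finset.mem_range.1 hs))]
    exact derivNorm_grad_le _ hg.1 _ _
  · simp [mul_assoc]

theorem GradCovFam.pairing_hatFun (h : GradCovFam U b) (h0 : 0 ∈ U) (hg : IsTest g)
    {φ : Vel d m → ℂ} (hφ : IsTest φ) :
    pairing φ (hatFun b g) = inner ℂ (gradPair φ).snd (b 0 (gradPair g).snd) := by
  have h1 := h.pairing_partialD_hatFun h0 hg hφ (default : Fin 0 → Fin (m + 1) × Fin d)
  rw [partialD_zero] at h1
  rw [h1, PiLp.inner_apply]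
  refine Finset.sum_congr rfl fun c _ => ?_
  obtain ⟨h2, h3⟩ := h.toL2_partialD_hatComp hM h0 hg (default : Fin 0 → Fin (m + 1) × Fin d) c
  simp only [Finset.Icc_eq_empty_of_lt zero_lt_one, Finset.sum_empty, mul_zero, nonpos_iff_eq_zero,
    enorm_eq_zero, sub_eq_zero] at h3
  rw [partialD_zero default g] at h3
  rw [← h3, gradPair_snd, inner_toL2 ((isTest_grad hφ _ _).memLp 2) h2]

/-- The outer divergence is integrated by parts onto φ, so only ℓ + 1 derivatives of g occur. -/
theorem GradCovFam.enorm_pairing_partialD_hatFun_le (h : GradCovFam U b) (h0 : 0 ∈ U)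
    (hg : IsTest g) {φ : Vel d m → ℂ} (hφ : IsTest φ) {ℓ : ℕ} (J : Fin ℓ → Fin (m + 1) × Fin d) :
    ‖pairing φ (partialD J (hatFun b g))‖ₑ ≤
      (((m + 1) * d : ℕ) : ℝ≥0∞) ^ 2 * 2 ^ ℓ * derivNorm 1 φ *
        ∑ s ∈ Finset.range (ℓ + 1), M s * derivNorm (ℓ + 1 - s) g := by
  rw [h.pairing_partialD_hatFun h0 hg hφ J]
  refine (enorm_sum_le_card Finset.univ (M := derivNorm 1 φ * (((m + 1) * d : ℕ) * 2 ^ ℓ *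
    ∑ s ∈ Finset.range (ℓ + 1), M s * derivNorm (ℓ + 1 - s) g)) fun c => ?_).trans_eq ?_
  · have hc := (isTest_grad hφ c.1 c.2).memLp 2
    refine (enorm_pairing_le hc (h.toL2_partialD_hatComp hM h0 hg J c).1).trans
      (mul_le_mul' ?_ (h.eLpNorm_partialD_hatComp_le hM h0 hg J c))
    rw [← derivNorm_zero]
    exact derivNorm_grad_le 0 hφ.1 c.1 c.2
  · rw [Finset.card_univ, Fintype.card_prod, Fintype.card_fin, Fintype.card_fin]
    ring

theorem GradCovFam.derivNorm_hatComp_le (h : GradCovFam U b) (h0 : 0 ∈ U) (hg : IsTest g) (ℓ : ℕ)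
    (c : Fin (m + 1) × Fin d) : derivNorm ℓ (hatComp b g c) ≤
      (((m + 1) * d : ℕ) : ℝ≥0∞) ^ (ℓ + 1) * 2 ^ ℓ *
        ∑ s ∈ Finset.range (ℓ + 1), M s * derivNorm (ℓ + 1 - s) g := by
  refine (derivNorm_le_sum _ _).trans ((Finset.sum_le_card_nsmul _ _ _ fun J _ =>
    h.eLpNorm_partialD_hatComp_le hM h0 hg J c).trans (le_of_eq ?_))
  rw [Finset.card_univ, Fintype.card_fun, Fintype.card_prod, Fintype.card_fin, Fintype.card_fin,
    Fintype.card_fin, nsmul_eq_mul, Nat.cast_pow]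
  ring

/-- The divergence costs a derivative, so the bound on `hatComp` is used at order ℓ + 1. The
exponent 2ℓ + 3 collects ℓ from the choice of J, one from the divergence and ℓ + 2 from `hatComp`.
-/
theorem GradCovFam.derivNorm_hatFun_le (h : GradCovFam U b) (h0 : 0 ∈ U) (hg : IsTest g) (ℓ : ℕ) :
    derivNorm ℓ (hatFun b g) ≤ (((m + 1) * d : ℕ) : ℝ≥0∞) ^ (2 * ℓ + 3) * 2 ^ (ℓ + 1) *
        ∑ s ∈ Finset.range (ℓ + 2), M s * derivNorm (ℓ + 2 - s) g := by
  have key : ∀ J : Fin ℓ → Fin (m + 1) × Fin d, eLpNorm (partialD J (hatFun b g)) 2 volume ≤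
      ((m + 1) * d : ℕ) * ((((m + 1) * d : ℕ) : ℝ≥0∞) ^ (ℓ + 2) * 2 ^ (ℓ + 1) *
        ∑ s ∈ Finset.range (ℓ + 2), M s * derivNorm (ℓ + 2 - s) g) := by
    intro J
    have h1 : partialD J (hatFun b g) = -∑ c, partialD J (grad (hatComp b g c) c.1 c.2) := by
      rw [h.partialD_hatFun h0 hg J]
      funext v
      simp only [Pi.neg_apply, Finset.sum_apply,
        fun c => partialD_grad J (h.contDiff_hatComp h0 hg c) c.1 c.2]
    rw [h1, eLpNorm_neg]
    refine (eLpNorm_sum_le (fun c _ => (contDiff_partialD J (contDiff_grad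
      (h.contDiff_hatComp h0 hg c) c.1 c.2)).continuous.aestronglyMeasurable) (by norm_num)).trans ?_
    refine (Finset.sum_le_card_nsmul _ _ _ fun c _ => (eLpNorm_partialD_le J _).trans
      ((derivNorm_grad_le ℓ (h.contDiff_hatComp h0 hg c) c.1 c.2).trans
        (h.derivNorm_hatComp_le hM h0 hg (ℓ + 1) c))).trans (le_of_eq ?_)
    rw [Finset.card_univ, Fintype.card_prod, Fintype.card_fin, Fintype.card_fin, nsmul_eq_mul]
  refine (derivNorm_le_sum _ _).trans ((Finset.sum_le_card_nsmul _ _ _ fun J _ => key J).trans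
    (le_of_eq ?_))
  rw [Finset.card_univ, Fintype.card_fun, Fintype.card_prod, Fintype.card_fin, Fintype.card_fin,
    Fintype.card_fin, nsmul_eq_mul, Nat.cast_pow]
  ring

/-- After integration by parts the leading term is the form of b at ∇∂_J g, which has nonnegative
real part. Only commutators, with s ≥ 1, contribute to a lower bound. -/
theorem GradCovFam.ofReal_neg_re_pairing_le (h : GradCovFam U b) (h0 : 0 ∈ U) (hg : IsTest g)
    (hre : ∀ D, 0 ≤ (inner ℂ D (b 0 D)).re) (ℓ : ℕ) :
    ENNReal.ofReal (-(∑ J : Fin ℓ → Fin (m + 1) × Fin d,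
      pairing (partialD J g) (partialD J (hatFun b g))).re) ≤
      (((m + 1) * d : ℕ) : ℝ≥0∞) ^ (ℓ + 2) * 2 ^ ℓ * derivNorm (ℓ + 1) g *
        ∑ s ∈ Finset.Icc 1 ℓ, M s * derivNorm (ℓ + 1 - s) g := by
  set D : (Fin ℓ → Fin (m + 1) × Fin d) → GradSp d m := fun J => (gradPair (partialD J g)).snd
    with hD
  have hx : 0 ≤ (∑ J, inner ℂ (D J) (b 0 (D J))).re := by
    rw [Complex.re_sum]
    exact Finset.sum_nonneg fun J _ => hre _
  refine (ofReal_neg_re_le_enorm hx).trans ?_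
  rw [← Finset.sum_sub_distrib]
  have key : ∀ J : Fin ℓ → Fin (m + 1) × Fin d,
      ‖pairing (partialD J g) (partialD J (hatFun b g)) - inner ℂ (D J) (b 0 (D J))‖ₑ ≤
      ((m + 1) * d : ℕ) * (derivNorm (ℓ + 1) g * (((m + 1) * d : ℕ) * 2 ^ ℓ *
        ∑ s ∈ Finset.Icc 1 ℓ, M s * derivNorm (ℓ + 1 - s) g)) := by
    intro J
    rw [h.pairing_partialD_hatFun h0 hg (hg.partialD J) J, PiLp.inner_apply,
      ← Finset.sum_sub_distrib]
    refine (enorm_sum_le_card Finset.univ (M := derivNorm (ℓ + 1) g * (((m + 1) * d : ℕ) * 2 ^ ℓ *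
      ∑ s ∈ Finset.Icc 1 ℓ, M s * derivNorm (ℓ + 1 - s) g)) fun c => ?_).trans_eq ?_
    · obtain ⟨h2, h3⟩ := h.toL2_partialD_hatComp hM h0 hg J c
      have hc := (isTest_grad (hg.partialD J) c.1 c.2).memLp 2
      rw [← inner_toL2 hc h2, hD, gradPair_snd, ← inner_sub_right, ← ofReal_norm]
      refine (ENNReal.ofReal_le_ofReal (norm_inner_le_norm _ _)).trans ?_
      rw [ENNReal.ofReal_mul (norm_nonneg _), ofReal_norm, ofReal_norm]
      refine mul_le_mul' ?_ h3
      rw [enorm_toL2 hc, ← partialD_grad J hg.1]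
      exact (eLpNorm_partialD_le J _).trans (derivNorm_grad_le ℓ hg.1 c.1 c.2)
    · rw [Finset.card_univ, Fintype.card_prod, Fintype.card_fin, Fintype.card_fin]
  refine (enorm_sum_le_card Finset.univ key).trans_eq ?_
  rw [Finset.card_univ, Fintype.card_fun, Fintype.card_prod, Fintype.card_fin, Fintype.card_fin,
    Fintype.card_fin, Nat.cast_pow]
  ring

end Bounds

end RenormalizedPropagator

end

noncomputable section

namespace RenormalizedPropagator
/-! ### The renormalized propagators -/
open Filter Topology
attribute [local irreducible] tau
variable {d m : ℕ}

/-- The deformed renormalized propagators. -/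
def iterFam (p : Params d) : (n m : ℕ) → Vel d m → CVel d m → L2 d m →L[ℂ] L2 d m
  | 0, _ => propOf p fun _ _ => 0
  | n + 1, m => propOf p (hatFam p.beta p.pot (iterFam p n (m + 1)))

/-- The conditions on the parameters. -/
structure Params.Good (p : Params d) (m₀ : ℕ) : Prop where
  N : 1 ≤ p.N
  kappa : 0 < p.kappa
  tN : 0 < p.tN
  beta : 0 < p.beta
  pot : IsPotential p.pot
  normV : normV p.pot 0 ≠ ⊤
  le : ∀ m < m₀, hatBd d m p.beta * (RenormalizedPropagator.normV p.pot 0).toReal ≤ p.kappa / 2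

variable {p : Params d} {m₀ : ℕ}

/-- The closed recursion: propagators with one more particle give hat operators of norm at most κ/2,
and these give propagators. The constraint m + n ≤ m₀ restricts the smallness condition to finitely
many m. -/
theorem Params.Good.propFam (h : p.Good m₀) (n m : ℕ) (hm : m + n ≤ m₀) :
    PropFam p.tN (iterFam p n m) := by
  induction n generalizing m with
  | zero => exact (hatFam_zero p.tN (half_pos h.kappa).le).propFam h.N h.kappa h.tN
  | succ n ih =>
    exact ((ih (m + 1) (by omega)).hatFam h.beta h.pot h.normV (h.le m (by omega))).propFam
      h.N h.kappa h.tN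

theorem Params.Good.isResolvent_succ (h : p.Good m₀) (n m : ℕ) (hm : m + (n + 1) ≤ m₀)
    (k : Vel d m) :
    IsResolvent p k (hatOp p (fun k' => iterFam p n (m + 1) k' 0) k) (iterFam p (n + 1) m k 0) := by
  have hT := h.propFam n (m + 1) (by omega)
  exact (hT.hatFam h.beta h.pot h.normV (h.le m (by omega))).isResolvent h.N h.kappa h.tN
    fun D hD φ hφ => hT.hatOp_eq h.tN h.beta h.pot h.normV k hD hφ

theorem Params.Good.isResolvent_zero (h : p.Good m₀) (m : ℕ) (k : Vel d m) :
    IsResolvent p k (fun _ _ => 0) (iterFam p 0 m k 0) :=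
  (hatFam_zero p.tN (half_pos h.kappa).le).isResolvent h.N h.kappa h.tN fun D _ φ _ => by
    rw [zero_apply, inner_zero_right]

/-- Uniqueness of the resolvent identifies the chosen inverse with the undeformed member of the
family at each stage. -/
theorem Params.Good.renormIter_eq (h : p.Good m₀) (n m : ℕ) (hm : m + n ≤ m₀) :
    renormIter p n m = fun k => iterFam p n m k 0 := by
  induction n generalizing m with
  | zero => exact funext fun k => resolventOf_eq (h.isResolvent_zero m k)
  | succ n ih =>
    funext k
    rw [renormIter, ih (m + 1) (by omega)]
    exact resolventOf_eq (h.isResolvent_succ n m hm k)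

theorem Params.Good.renormProp_eq (h : p.Good m₀) (hm : m ≤ m₀) :
    renormProp p m₀ m = fun k => iterFam p (m₀ - m) m k 0 :=
  h.renormIter_eq (m₀ - m) m (by omega)

theorem Params.Good.renormHat_eq (h : p.Good m₀) (hm : m < m₀) (k : Vel d m) :
    renormHat p m₀ m k = hatOp p (fun k' => iterFam p (m₀ - (m + 1)) (m + 1) k' 0) k := by
  funext D φ
  rw [renormHat, if_pos hm, h.renormProp_eq (m := m + 1) (by omega)]

theorem Params.Good.isResolvent (h : p.Good m₀) (hm : m ≤ m₀) (k : Vel d m) :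
    IsResolvent p k (renormHat p m₀ m k) (renormProp p m₀ m k) := by
  rw [h.renormProp_eq hm]
  rcases hm.lt_or_eq with hm | rfl
  · obtain ⟨n, hn⟩ : ∃ n, m₀ - m = n + 1 := ⟨m₀ - m - 1, by omega⟩
    have hn' : m₀ - (m + 1) = n := by omega
    rw [h.renormHat_eq hm, hn', hn]
    exact h.isResolvent_succ n m (by omega) k
  · have h1 : renormHat p m m k = fun _ _ => 0 := by
      funext D φ
      rw [renormHat, if_neg (lt_irrefl m)]
    rw [h1, Nat.sub_self]
    exact h.isResolvent_zero m k

theorem mul_sum_le_mul_sum {n : ℕ} {S : Finset ℕ} (hS : S ⊆ Finset.range n) {a C : ℝ≥0∞}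
    (A W X : ℕ → ℝ≥0∞) (hC : a * ∑ s ∈ Finset.range n, A s ≤ C) :
    a * ∑ s ∈ S, A s * W s * X s ≤ C * ∑ s ∈ S, W s * X s := by
  refine le_trans ?_ (mul_le_mul_left hC _)
  rw [mul_assoc]
  refine mul_le_mul_right ?_ _
  rw [Finset.mul_sum]
  refine Finset.sum_le_sum fun s hs => ?_
  rw [mul_assoc]
  exact mul_le_mul_left (Finset.single_le_sum (f := A) (fun _ _ => zero_le) (hS hs)) _

/-- The constants in the bounds on the renormalized hat operators. -/
def hatConst (d m : ℕ) (β : ℝ) (ℓ : ℕ) : ℝ≥0 :=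
  (((m + 1) * d : ℕ) : ℝ≥0) ^ (2 * ℓ + 3) * 2 ^ (ℓ + 1) *
    ∑ s ∈ Finset.range (ℓ + 2), (hatDerivBd d m β s).toNNReal

theorem coe_hatConst (d m : ℕ) (β : ℝ) (ℓ : ℕ) : (hatConst d m β ℓ : ℝ≥0∞) =
    (((m + 1) * d : ℕ) : ℝ≥0∞) ^ (2 * ℓ + 3) * 2 ^ (ℓ + 1) *
      ∑ s ∈ Finset.range (ℓ + 2), ENNReal.ofReal (hatDerivBd d m β s) := by
  rw [hatConst]
  push_cast
  rfl

/-- The constants in the bounds on the deformed renormalized propagators. -/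
def propConst (d m ℓ : ℕ) : ℝ≥0 :=
  (((m + 1) * d : ℕ) : ℝ≥0) ^ ℓ * 2 ^ ℓ * ∑ s ∈ Finset.range (ℓ + 1), (propDerivBd m s).toNNReal

theorem coe_propConst (d m ℓ : ℕ) : (propConst d m ℓ : ℝ≥0∞) =
    (((m + 1) * d : ℕ) : ℝ≥0∞) ^ ℓ * 2 ^ ℓ *
      ∑ s ∈ Finset.range (ℓ + 1), ENNReal.ofReal (propDerivBd m s) := by
  rw [propConst]
  push_cast
  rfl

theorem Params.Good.hat_bounds (h : p.Good m₀) (hd : 0 < d) (hm : m < m₀) {k : Vel d m}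
    (hk : ∑ j, k j = 0) {C : ℕ → ℝ≥0} (hC : ∀ ℓ, hatConst d m p.beta ℓ ≤ C ℓ) {g : Vel d m → ℂ}
    (hg : IsTest g) :
    ∃ u : Vel d m → ℂ, ContDiff ℝ ∞ u ∧
      (∀ φ : Vel d m → ℂ, IsTest φ → pairing φ u = renormHat p m₀ m k (grad g) φ) ∧
      (∀ h : Vel d m → ℂ, IsTest h → ‖pairing h u‖ₑ ≤
        C 0 * RenormalizedPropagator.normV p.pot 0 * derivNorm 1 h * derivNorm 1 g) ∧
      (∀ ℓ : ℕ, derivNorm ℓ u ≤ C ℓ * ∑ s ∈ Finset.range (ℓ + 2),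
        RenormalizedPropagator.normV p.pot (if m = 0 then 0 else s) *
          ENNReal.ofReal (bracket k ^ s) * derivNorm (ℓ + 2 - s) g) ∧
      (∀ ℓ : ℕ, ∀ h : Vel d m → ℂ, IsTest h → ∀ J : Fin ℓ → Fin (m + 1) × Fin d,
        ‖pairing h (partialD J u)‖ₑ ≤ C ℓ * derivNorm 1 h * ∑ s ∈ Finset.range (ℓ + 1),
          RenormalizedPropagator.normV p.pot (if m = 0 then 0 else s) *
            ENNReal.ofReal (bracket k ^ s) * derivNorm (ℓ + 1 - s) g) ∧
      (∀ ℓ : ℕ, ENNReal.ofReal (-(∑ J : Fin ℓ → Fin (m + 1) × Fin d,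
          pairing (partialD J g) (partialD J u)).re) ≤
        C ℓ * derivNorm (ℓ + 1) g * ∑ s ∈ Finset.Icc 1 ℓ,
          RenormalizedPropagator.normV p.pot (if m = 0 then 0 else s) *
            ENNReal.ofReal (bracket k ^ s) * derivNorm (ℓ + 1 - s) g) := by
  have hT := h.propFam (m₀ - (m + 1)) (m + 1) (by omega)
  have hb := (hT.hatFam h.beta h.pot h.normV (h.le m hm)).gradCovFam k
  have h0 := zero_mem_deform h.tN k
  have hM := hT.enorm_iteratedFDeriv_hatFam_le h.tN h.beta h.pot h.normV hk
  have hre := hT.re_inner_hatFam_nonneg h.tN h.beta h.pot h.normV k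
  rw [h.renormHat_eq hm]
  -- Here d > 0 enters: powers of (m+1)d increase with the exponent, so the largest constant serves
  -- all the estimates.
  have hn : (1 : ℝ≥0∞) ≤ (((m + 1) * d : ℕ) : ℝ≥0∞) := by
    exact_mod_cast Nat.succ_le_of_lt (Nat.mul_pos (Nat.succ_pos m) hd)
  have hC' : ∀ ℓ (e f : ℕ), e ≤ 2 * ℓ + 3 → f ≤ ℓ + 1 →
      (((m + 1) * d : ℕ) : ℝ≥0∞) ^ e * 2 ^ f *
        ∑ s ∈ Finset.range (ℓ + 2), ENNReal.ofReal (hatDerivBd d m p.beta s) ≤ C ℓ := by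
    intro ℓ e f he hf
    refine le_trans ?_ (ENNReal.coe_le_coe.2 (hC ℓ))
    rw [coe_hatConst]
    exact mul_le_mul_left (mul_le_mul' (pow_le_pow_right₀ hn he)
      (pow_le_pow_right₀ (by norm_num) hf)) _
  have h1c : ∀ ℓ : ℕ, ∀ h : Vel d m → ℂ, IsTest h → ∀ J : Fin ℓ → Fin (m + 1) × Fin d,
      ‖pairing h (partialD J (hatFun (hatFam p.beta p.pot
        (iterFam p (m₀ - (m + 1)) (m + 1)) k) g))‖ₑ ≤
        C ℓ * derivNorm 1 h * ∑ s ∈ Finset.range (ℓ + 1),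
          RenormalizedPropagator.normV p.pot (if m = 0 then 0 else s) *
            ENNReal.ofReal (bracket k ^ s) * derivNorm (ℓ + 1 - s) g := by
    intro ℓ f hf J
    refine (hb.enorm_pairing_partialD_hatFun_le hM h0 hg hf J).trans ?_
    rw [mul_right_comm _ (derivNorm 1 f), mul_right_comm _ (derivNorm 1 f)]
    exact mul_le_mul_left (mul_sum_le_mul_sum (Finset.range_mono (by omega)) _ _ _
      (hC' ℓ 2 ℓ (by omega) (by omega))) _
  refine ⟨hatFun (hatFam p.beta p.pot (iterFam p (m₀ - (m + 1)) (m + 1)) k) g,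
    hb.contDiff_hatFun h0 hg, fun φ hφ => ?_, fun f hf => ?_, fun ℓ => ?_, h1c, fun ℓ => ?_⟩
  · rw [hb.pairing_hatFun hM h0 hg hφ, hT.hatOp_eq h.tN h.beta h.pot h.normV k
      (fun j i => (isTest_grad hg j i).memLp 2) hφ]
    rfl
  -- The form bound is the case ℓ = 0 of the weak bound: the single term s = 0 has weight C_0 and no
  -- bracket.
  · have h1 := h1c 0 f hf default
    rw [partialD_zero] at h1
    refine h1.trans_eq ?_
    simp only [zero_add, Finset.sum_range_one, ite_self, pow_zero, ENNReal.ofReal_one, mul_one,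
      Nat.sub_zero]
    ring
  · exact (hb.derivNorm_hatFun_le hM h0 hg ℓ).trans
      (mul_sum_le_mul_sum (Finset.Subset.refl _) _ _ _ (hC' ℓ _ _ le_rfl le_rfl))
  · refine (hb.ofReal_neg_re_pairing_le hM h0 hg hre ℓ).trans ?_
    rw [mul_right_comm _ (derivNorm (ℓ + 1) g), mul_right_comm _ (derivNorm (ℓ + 1) g)]
    refine mul_le_mul_left (mul_sum_le_mul_sum (fun s hs => ?_) _ _ _
      (hC' ℓ (ℓ + 2) ℓ (by omega) (by omega))) _
    have := Finset.mem_Icc.1 hs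
    exact Finset.mem_range.2 (by omega)

theorem PropFam.covFam {tN : ℝ} {S : Vel d m → CVel d m → L2 d m →L[ℂ] L2 d m}
    (hS : PropFam tN S) (k : Vel d m) : CovFam (deform tN k) (S k) :=
  ⟨isOpen_deform tN k, fun _ h a => add_mem_deform h a, hS.hol k, hS.cov k⟩

theorem norm_imPart_le_of_mem_strip {ν : Vel d m} (hν : ∀ j, ‖ν j‖ = 1) (hm : m ≤ m₀)
    {ξ : CVel d m} (hξ : ξ ∈ strip m₀ ν) (j : Fin (m + 1)) : ‖imPart ξ j‖ ≤ 1 := by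
  obtain ⟨a, t, ht, hξ⟩ := hξ
  have h1 : imPart ξ j = -(t j • ν j) := by
    ext i
    simp [imPart, hξ]
  have h2 : (m : ℝ) / m₀ ≤ 1 := div_le_one_of_le₀ (by exact_mod_cast hm) (Nat.cast_nonneg _)
  rw [h1, norm_neg, norm_smul, hν, mul_one, Real.norm_of_nonneg (ht j).1]
  exact (ht j).2.trans h2

theorem PropFam.deformed_bounds {tN : ℝ} {S : Vel d m → CVel d m → L2 d m →L[ℂ] L2 d m}
    (hS : PropFam tN S) (ht : 0 < tN) (hm : 1 ≤ m) (hm₀ : m ≤ m₀) (k : Vel d m) {ν : Vel d m}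
    (hν : ∀ j, ‖ν j‖ = 1) {C : ℕ → ℝ≥0} (h1C : 1 ≤ C 0) (hC : ∀ ℓ, propConst d m ℓ ≤ C ℓ)
    {g : Vel d m → ℂ} (hg : IsTest g) :
    ∃ F : CVel d m → Vel d m → ℂ,
      (∀ ξ : Vel d m, F (toCVel ξ) =ᵐ[volume] conjT ξ (S k 0) (toL2 g)) ∧
      (∀ v : Vel d m, AnalyticOnNhd ℂ (fun ξ => F ξ v) (admissible m₀ tN k ν)) ∧
      ∀ ξ ∈ admissible m₀ tN k ν,
        ContDiff ℝ ∞ (F ξ) ∧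
        derivNorm 0 (F ξ) ≤ C 0 * ENNReal.ofReal (rate tN k ξ)⁻¹ * derivNorm 0 g ∧
        ∀ ℓ : ℕ, derivNorm ℓ (F ξ) ≤ C ℓ * ∑ s ∈ Finset.range (ℓ + 1),
          ENNReal.ofReal (bracket k ^ s) *
            ENNReal.ofReal (1 + ((rate tN k ξ) ^ (s + 1))⁻¹) * derivNorm (ℓ - s) g := by
  have hc := hS.covFam k
  have hsub : admissible m₀ tN k ν ⊆ deform tN k := fun ξ hξ => by
    refine ⟨fun j => (norm_imPart_le_of_mem_strip hν hm₀ hξ.1 j).trans_lt ?_, hξ.2⟩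
    have : (1 : ℝ) ≤ m := by exact_mod_cast hm
    linarith
  refine ⟨fun ξ => famEval (S k) ξ g, fun ξ => ?_, fun v => ?_, fun ξ hξ => ⟨?_, ?_, fun ℓ => ?_⟩⟩
  · have h0 := zero_mem_deform ht k
    have h1 := add_mem_deform h0 ξ
    -- Covariance at the undeformed point says that the value of the family at a real ξ is the
    -- conjugation by τ_ξ, so the family extends it.
    have h2 := hS.cov k 0 h0 ξ (tau (-ξ) (toL2 g))
    rw [tau_tau, add_neg_cancel, tau_zero] at h2
    rw [zero_add] at h1 h2
    have h3 : conjT ξ (S k 0) (toL2 g) = S k (toCVel ξ) (toL2 g) := h2.symm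
    rw [h3]
    exact hc.famEval_ae_eq h1 hg
  · exact (analyticOnNhd_of_differentiableOn_complex (isOpen_deform tN k)
      (hc.differentiableOn_famEval hg v)).mono hsub
  · exact hc.contDiff_famEval (hsub hξ) hg
  · rw [derivNorm_zero, derivNorm_zero, ← enorm_toL2 (hc.memLp_famEval (hsub hξ) hg),
      hc.toL2_famEval (hsub hξ) hg, ← enorm_toL2 (hg.memLp 2)]
    refine (ContinuousLinearMap.le_opENorm _ _).trans (mul_le_mul_left ?_ _)
    have h1 : ‖S k ξ‖ₑ ≤ ENNReal.ofReal (rate tN k ξ)⁻¹ := by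
      rw [← ofReal_norm]
      exact ENNReal.ofReal_le_ofReal (hS.norm_le k ξ (hsub hξ))
    refine h1.trans (le_mul_of_one_le_left zero_le ?_)
    exact_mod_cast h1C
  · have hM : ∀ s, ‖iteratedFDeriv ℂ s (S k) ξ‖ₑ ≤ ENNReal.ofReal (propDerivBd m s) *
        (ENNReal.ofReal (bracket k ^ s) * ENNReal.ofReal (1 + ((rate tN k ξ) ^ (s + 1))⁻¹)) := by
      intro s
      have hb0 : 0 ≤ bracket k ^ s := pow_nonneg (zero_le_one.trans (one_le_bracket k)) s
      rw [← ENNReal.ofReal_mul hb0, ← ENNReal.ofReal_mul (propDerivBd_nonneg m s), ← ofReal_norm]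
      exact ENNReal.ofReal_le_ofReal (hS.norm_iteratedFDeriv_le hm
        (norm_imPart_le_of_mem_strip hν hm₀ hξ.1) hξ.2 s)
    refine (hc.derivNorm_famEval_le ℓ (hsub hξ) hg hM).trans
      (mul_sum_le_mul_sum (Finset.Subset.refl _) _ _ _ ?_)
    rw [← coe_propConst]
    exact ENNReal.coe_le_coe.2 (hC ℓ)

/-- The lower bound on the diffusion constant. -/
def kappaConst (d m₀ : ℕ) (β : ℝ) : ℝ≥0 := 1 + ∑ m ∈ Finset.range m₀, (2 * hatBd d m β).toNNReal

/-- The constants in the bounds. -/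
def boundConst (d m₀ : ℕ) (β : ℝ) (ℓ : ℕ) : ℝ≥0 :=
  1 + ∑ m ∈ Finset.range (m₀ + 1), (hatConst d m β ℓ + propConst d m ℓ)

theorem hatConst_le (hm : m ≤ m₀) (β : ℝ) (ℓ : ℕ) : hatConst d m β ℓ ≤ boundConst d m₀ β ℓ :=
  (le_add_of_nonneg_right zero_le).trans
    ((Finset.single_le_sum (f := fun m => hatConst d m β ℓ + propConst d m ℓ) (fun _ _ => zero_le)
      (Finset.mem_range.2 (Nat.lt_succ_of_le hm))).trans (le_add_of_nonneg_left zero_le))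

theorem propConst_le (hm : m ≤ m₀) (β : ℝ) (ℓ : ℕ) : propConst d m ℓ ≤ boundConst d m₀ β ℓ :=
  (le_add_of_nonneg_left zero_le).trans
    ((Finset.single_le_sum (f := fun m => hatConst d m β ℓ + propConst d m ℓ) (fun _ _ => zero_le)
      (Finset.mem_range.2 (Nat.lt_succ_of_le hm))).trans (le_add_of_nonneg_left zero_le))

/-- The summand 1 in `kappaConst` forces C_0 to be finite, and the factor 2 in its other terms
reserves half of κ for coercivity. -/
theorem good_of_le {β κ tN α : ℝ} {V : E d → ℝ} {N : ℕ} (hβ : 0 < β) (hV : IsPotential V)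
    (hκ : 0 < κ) (hK : (kappaConst d m₀ β : ℝ≥0∞) * normV V 0 ≤ ENNReal.ofReal κ) (hN : 1 ≤ N)
    (ht : 0 < tN) : Params.Good ⟨β, V, κ, N, tN, α⟩ m₀ := by
  have h1 : (1 : ℝ≥0∞) ≤ (kappaConst d m₀ β : ℝ≥0∞) := by
    exact_mod_cast (le_add_of_nonneg_right zero_le : (1 : ℝ≥0) ≤ kappaConst d m₀ β)
  have h2 : normV V 0 ≠ ⊤ :=
    ((le_mul_of_one_le_left zero_le h1).trans hK).trans_lt ENNReal.ofReal_lt_top |>.ne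
  refine ⟨hN, hκ, ht, hβ, hV, h2, fun m hm => ?_⟩
  have h3 := ENNReal.toReal_mono ENNReal.ofReal_ne_top hK
  rw [ENNReal.toReal_mul, ENNReal.toReal_ofReal hκ.le, ENNReal.coe_toReal] at h3
  have h4 : (2 * hatBd d m β).toNNReal ≤ kappaConst d m₀ β :=
    (Finset.single_le_sum (f := fun m => (2 * hatBd d m β).toNNReal) (fun _ _ => zero_le)
      (Finset.mem_range.2 hm)).trans (le_add_of_nonneg_left zero_le)
  have h5 : 2 * hatBd d m β ≤ kappaConst d m₀ β := (Real.le_coe_toNNReal _).trans (by exact_mod_cast h4)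
  have h6 := mul_le_mul_of_nonneg_right h5 (ENNReal.toReal_nonneg (a := normV V 0))
  change hatBd d m β * (normV V 0).toReal ≤ κ / 2
  linarith

end RenormalizedPropagator

end

open RenormalizedPropagator in
theorem mainTheorem2 (d : ℕ) (hd : 0 < d) (m₀ : ℕ) (hm₀ : 1 ≤ m₀) (β : ℝ) (hβ : 0 < β) :
    ∃ (K : ℝ≥0) (C : ℕ → ℝ≥0),
      ∀ V : E d → ℝ, IsPotential V →
      ∀ κ : ℝ, 0 < κ → (K : ℝ≥0∞) * normV V 0 ≤ ENNReal.ofReal κ →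
      ∀ (N : ℕ) (tN α : ℝ), 1 ≤ N → 0 < tN →
      -- the renormalized propagators are well defined
      (∀ m : ℕ, 1 ≤ m → m ≤ m₀ → ∀ k : Vel d m, ∑ j, k j = 0 →
        IsResolvent ⟨β, V, κ, N, tN, α⟩ k (renormHat ⟨β, V, κ, N, tN, α⟩ m₀ m k)
          (renormProp ⟨β, V, κ, N, tN, α⟩ m₀ m k)) ∧
      -- bounds on the renormalized hat operators
      (∀ m : ℕ, m < m₀ → ∀ k : Vel d m, ∑ j, k j = 0 →
        ∀ g : Vel d m → ℂ, IsTest g →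
        ∃ u : Vel d m → ℂ, ContDiff ℝ ∞ u ∧
          (∀ φ : Vel d m → ℂ, IsTest φ →
            pairing φ u = renormHat ⟨β, V, κ, N, tN, α⟩ m₀ m k (grad g) φ) ∧
          (∀ h : Vel d m → ℂ, IsTest h →
            ‖pairing h u‖ₑ ≤ C 0 * normV V 0 * derivNorm 1 h * derivNorm 1 g) ∧
          (∀ ℓ : ℕ,
            derivNorm ℓ u ≤ C ℓ * ∑ s ∈ Finset.range (ℓ + 2),
              normV V (if m = 0 then 0 else s) * ENNReal.ofReal (bracket k ^ s) *
                derivNorm (ℓ + 2 - s) g) ∧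
          (∀ ℓ : ℕ, ∀ h : Vel d m → ℂ, IsTest h → ∀ J : Fin ℓ → Fin (m + 1) × Fin d,
            ‖pairing h (partialD J u)‖ₑ ≤ C ℓ * derivNorm 1 h * ∑ s ∈ Finset.range (ℓ + 1),
              normV V (if m = 0 then 0 else s) * ENNReal.ofReal (bracket k ^ s) *
                derivNorm (ℓ + 1 - s) g) ∧
          (∀ ℓ : ℕ,
            ENNReal.ofReal (-(∑ J : Fin ℓ → Fin (m + 1) × Fin d,
                pairing (partialD J g) (partialD J u)).re) ≤
              C ℓ * derivNorm (ℓ + 1) g * ∑ s ∈ Finset.Icc 1 ℓ,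
                normV V (if m = 0 then 0 else s) * ENNReal.ofReal (bracket k ^ s) *
                  derivNorm (ℓ + 1 - s) g)) ∧
      -- complex deformations of the renormalized propagators
      (∀ m : ℕ, 1 ≤ m → m ≤ m₀ → ∀ k : Vel d m, ∑ j, k j = 0 →
        ∀ ν : Vel d m, (∀ j, ‖ν j‖ = 1) → 0 < ∑ j, inner ℝ (k j) (ν j) →
        ∀ g : Vel d m → ℂ, IsTest g →
        ∃ F : CVel d m → Vel d m → ℂ,
          (∀ ξ : Vel d m,
            F (toCVel ξ) =ᵐ[MeasureTheory.volume]
              conjT ξ (renormProp ⟨β, V, κ, N, tN, α⟩ m₀ m k) (toL2 g)) ∧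
          (∀ v : Vel d m, AnalyticOnNhd ℂ (fun ξ => F ξ v) (admissible m₀ tN k ν)) ∧
          ∀ ξ ∈ admissible m₀ tN k ν,
            ContDiff ℝ ∞ (F ξ) ∧
            derivNorm 0 (F ξ) ≤ C 0 * ENNReal.ofReal (rate tN k ξ)⁻¹ * derivNorm 0 g ∧
            ∀ ℓ : ℕ, derivNorm ℓ (F ξ) ≤ C ℓ * ∑ s ∈ Finset.range (ℓ + 1),
              ENNReal.ofReal (bracket k ^ s) *
                ENNReal.ofReal (1 + ((rate tN k ξ) ^ (s + 1))⁻¹) * derivNorm (ℓ - s) g) := by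
  refine ⟨kappaConst d m₀ β, boundConst d m₀ β, fun V hV κ hκ hK N tN α hN ht => ?_⟩
  have h : Params.Good ⟨β, V, κ, N, tN, α⟩ m₀ := good_of_le hβ hV hκ hK hN ht
  refine ⟨fun m _ hm k _ => h.isResolvent hm k, fun m hm k hk g hg => ?_,
    fun m h1 hm k _ ν hν _ g hg => ?_⟩
  · exact h.hat_bounds hd hm hk (fun ℓ => hatConst_le hm.le β ℓ) hg
  · rw [h.renormProp_eq hm]
    exact (h.propFam (m₀ - m) m (by omega)).deformed_bounds ht h1 hm k hν
      -- The summand 1 in `boundConst` covers the bound by λ(ξ)⁻¹, which holds with constant 1.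
      (le_add_of_nonneg_right zero_le) (fun ℓ => propConst_le hm β ℓ) hg
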